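/- Let $n=d+2\ge 2$, let $\mathbb P^n=\mathbb P^n_{\mathbb C}$ have homogeneous coordinates $(z_0:\dots:z_d:x:y)$, and let $Y\subset\mathbb P^n$ be a closed subscheme containing the line $\ell=\{z_0=\dots=z_d=0\}$; let $j:\ell\hookrightarrow Y$ be the inclusion. Put $H_Y=\langle z_0,\dots,z_d\rangle\subset H^0(\mathcal O_Y(1))$. The ADHM category $\mathfrak A(Y)$ has as objects the triples $(V,W,X)$ where $V,W$ are finite dimensional complex vector spaces and $X=(A,B,A',B',I,J)$ consists of linear maps $A,B,A',B':V\to V\otimes H_Y$, $I:W\to V\otimes H_Y$, $J:V\to W\otimes H_Y$ satisfying the ADHM equation $$AB'-BA'+IJ+(B'-B)\otimes x+(A-A')\otimes y=0\quad\text{in } \mathrm{End}(V)\otimes H^0(\mathcal O_Y(2)).$$ A morphism $(V_1,W_1,X_1)\to(V_2,W_2,X_2)$ is a pair of linear maps $f:V_1\to V_2$, $g:W_1\to W_2$ such that the maps $f\otimes 1$, $g\otimes 1$ and $f$, $g$ commute with each of the six components of $X_1$ and $X_2$. To $(V,W,X)$ one attaches the complex, in degrees $-1,0,1$, $$E_X^\bullet:\quad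 V\otimes\mathcal O_Y(-1)\xrightarrow{\ \alpha\ }(V\oplus V\oplus W)\otimes\mathcal O_Y\xrightarrow{\ \beta\ }V\otimes\mathcal O_Y(1),\qquad \alpha=\begin{pmatrix}A'+x\\ B'+y\\ J\end{pmatrix},\quad \beta=\begin{pmatrix}-B-y& A+x& I\end{pmatrix},$$ and to a morphism $(f,g)$ the morphism of complexes with components $f\otimes 1$, $(f\oplus f\oplus g)\otimes 1$, $f\otimes 1$. Let $\mathcal{PI}(Y)$ be the full subcategory of the derived category of $Y$ whose objects are the perverse instanton sheaves of trivial splitting type, that is, the objects $C^\bullet$ isomorphic in the derived category to a complex $\mathcal O_Y(-1)^{\oplus c}\to\mathcal O_Y^{\oplus a}\to\mathcal O_Y(1)^{\oplus c}$ in degrees $-1,0,1$ and such that $Lj^*C^\bullet$ is isomorphic to $\mathcal O_\ell^{\oplus r}$, placed in degree $0$, for some $r\ge 0$. **Theorem.** (i) The assignments $(V,W,X)\mapsto E_X^\bullet$ and $(f,g)\mapsto$ (the morphism in the derived category induced by the above morphism of complexes) define a functor $\mathcal F:\mathfrak A(Y)\to\mathcal{PI}(Y)$. (ii) If $\mathrm{Pic}(Y)\cong\mathbb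 Z$ and $Y$ is linearly normal, i.e. $H^0(\mathcal O_Y(1))$ is spanned by $z_0,\dots,z_d,x,y$, then $\mathcal F$ is essentially surjective. (iii) If $Y\cong\mathbb P^2$, or if $Y$ is arithmetically Cohen–Macaulay (its homogeneous coordinate ring $\mathbb C[z_0,\dots,z_d,x,y]/I_Y$, with $I_Y$ the saturated homogeneous ideal, is Cohen–Macaulay) and $\dim Y\ge 3$, then $\mathcal F$ is faithful. -/

import Mathlib

open CategoryTheory Limits AlgebraicGeometry TopologicalSpace TensorProduct
noncomputable section
namespace PerverseInstanton

instance (σ : Type) : GradedAlgebra (MvPolynomial.homogeneousSubmodule σ ℂ) :=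
  MvPolynomial.gradedAlgebra

/-- Projective space over `ℂ` with homogeneous coordinates indexed by `σ`. -/
abbrev PP (σ : Type) : Scheme.{0} := Proj (MvPolynomial.homogeneousSubmodule σ ℂ)

variable {σ : Type} {Y : Scheme.{0}}

/-- Restriction of functions. -/
abbrev res {U V : Y.Opens} (h : U ≤ V) : Γ(Y, V) →+* Γ(Y, U) := (Y.presheaf.map (homOfLE h).op).hom

lemma res_res {U V W : Y.Opens} (h : U ≤ V) (h' : V ≤ W) (s : Γ(Y, W)) :
    res h (res h' s) = res (h.trans h') s := by
  simp only [res, ← CommRingCat.comp_apply, ← Functor.map_comp]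
  rfl

lemma res_self {U : Y.Opens} (h : U ≤ U) (s : Γ(Y, U)) : res h s = s := by
  simp [res]

lemma X_mem (a : σ) : MvPolynomial.X a ∈ MvPolynomial.homogeneousSubmodule σ ℂ 1 :=
  MvPolynomial.isHomogeneous_X ℂ a

/-- The function `p / X_a ^ m` on `D₊(X_a)`, for `p` homogeneous of degree `m`. -/
def frac (a : σ) {m : ℕ} {p : MvPolynomial σ ℂ}
    (hp : p ∈ MvPolynomial.homogeneousSubmodule σ ℂ m) :
    Γ(PP σ, Proj.basicOpen (MvPolynomial.homogeneousSubmodule σ ℂ) (MvPolynomial.X a)) :=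
  Proj.awayToSection _ _
    (HomogeneousLocalization.Away.mk _ (X_mem a) m p (by simpa using hp))

lemma frac_aux (a b : σ) {m : ℕ} {p : MvPolynomial σ ℂ}
    (hp : p ∈ MvPolynomial.homogeneousSubmodule σ ℂ m) (S : Submonoid (MvPolynomial σ ℂ))
    (ha : Submonoid.powers (MvPolynomial.X a) ≤ S) (hb : Submonoid.powers (MvPolynomial.X b) ≤ S) :
    HomogeneousLocalization.mapId (MvPolynomial.homogeneousSubmodule σ ℂ) ha
      (HomogeneousLocalization.Away.mk _ (X_mem a) m p (by simpa using hp)) =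
    HomogeneousLocalization.mapId _ ha
      (HomogeneousLocalization.Away.mk _ (X_mem a) 1 (MvPolynomial.X b) (by simpa using X_mem b)) ^ m *
    HomogeneousLocalization.mapId _ hb
      (HomogeneousLocalization.Away.mk _ (X_mem b) m p (by simpa using hp)) := by
  refine HomogeneousLocalization.val_injective _ ?_
  rw [HomogeneousLocalization.val_mul, HomogeneousLocalization.val_pow]
  have key : ∀ (c : σ) (hc : Submonoid.powers (MvPolynomial.X c) ≤ S) (n : ℕ)
      (q : MvPolynomial σ ℂ) (hq : q ∈ MvPolynomial.homogeneousSubmodule σ ℂ (n • 1)),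
      (HomogeneousLocalization.mapId (MvPolynomial.homogeneousSubmodule σ ℂ) hc
        (HomogeneousLocalization.Away.mk _ (X_mem c) n q hq)).val =
      Localization.mk q (⟨MvPolynomial.X c ^ n, hc ⟨n, rfl⟩⟩ : S) := fun _ _ _ _ _ => rfl
  rw [key, key, key, Localization.mk_pow, Localization.mk_mul, Localization.mk_eq_mk_iff,
    Localization.r_iff_exists]
  refine ⟨1, ?_⟩
  simp only [Submonoid.coe_mul, SubmonoidClass.mk_pow]
  ring

lemma frac_X_self (a : σ) : frac a (X_mem a) = 1 := by
  unfold frac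
  refine Eq.trans ?_ (map_one (Proj.awayToSection _ _).hom)
  refine congrArg _ ?_
  refine HomogeneousLocalization.val_injective _ ?_
  rw [HomogeneousLocalization.Away.val_mk, HomogeneousLocalization.val_one, Localization.mk_eq_mk',
    IsLocalization.mk'_eq_iff_eq_mul]
  simp

lemma frac_eq (a b : σ) {m : ℕ} {p : MvPolynomial σ ℂ}
    (hp : p ∈ MvPolynomial.homogeneousSubmodule σ ℂ m) {U : (PP σ).Opens} 
    (ha : U ≤ Proj.basicOpen (MvPolynomial.homogeneousSubmodule σ ℂ) (MvPolynomial.X a))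
    (hb : U ≤ Proj.basicOpen (MvPolynomial.homogeneousSubmodule σ ℂ) (MvPolynomial.X b)) :
    res ha (frac a hp) = res ha (frac a (X_mem b)) ^ m * res hb (frac b hp) := by
  refine AlgebraicGeometry.Proj.ext _ _ _ (funext fun x => ?_)
  exact frac_aux a b hp _ (Submonoid.powers_le.mpr (ha x.2)) (Submonoid.powers_le.mpr (hb x.2))


/-- The scalars `ℂ → Γ(ℙ, 𝒪)`. -/
def cstP : ℂ →+* Γ(PP σ, ⊤) :=
  ((Scheme.ΓSpecIso _).inv ≫
    (Proj.toSpecZero (MvPolynomial.homogeneousSubmodule σ ℂ)).appTop).hom.comp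
    (algebraMap ℂ (MvPolynomial.homogeneousSubmodule σ ℂ 0))

variable (f : Y ⟶ PP σ)

/-- The scalars `ℂ → Γ(Y, 𝒪)`. -/
def cst : ℂ →+* Γ(Y, ⊤) := f.appTop.hom.comp cstP

/-- The open subset of `Y` where the homogeneous coordinate `X_a` does not vanish. -/
def chart (a : σ) : Y.Opens :=
  f ⁻¹ᵁ Proj.basicOpen (MvPolynomial.homogeneousSubmodule σ ℂ) (MvPolynomial.X a)

/-- The function `p / X_a ^ m` on the chart `X_a ≠ 0` of `Y`, for `p` homogeneous of degree `m`. -/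
def dehom (a : σ) {m : ℕ} {p : MvPolynomial σ ℂ}
    (hp : p ∈ MvPolynomial.homogeneousSubmodule σ ℂ m) : Γ(Y, chart f a) :=
  (f.app _).hom (frac a hp)

/-- The function `X_b / X_a` on the chart `X_a ≠ 0` of `Y`. -/
abbrev ratio (a b : σ) : Γ(Y, chart f a) := dehom f a (X_mem b)

lemma dehom_X_self (a : σ) : dehom f a (X_mem a) = 1 := by
  rw [dehom, frac_X_self, map_one]
  rfl

lemma dehom_eq (a b : σ) {m : ℕ} {p : MvPolynomial σ ℂ}
    (hp : p ∈ MvPolynomial.homogeneousSubmodule σ ℂ m) {U : Y.Opens}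
    (ha : U ≤ chart f a) (hb : U ≤ chart f b) :
    res ha (dehom f a hp) = res ha (ratio f a b) ^ m * res hb (dehom f b hp) := by
  have h := frac_eq a b hp (U := Proj.basicOpen _ (MvPolynomial.X a) ⊓
    Proj.basicOpen _ (MvPolynomial.X b)) inf_le_left inf_le_right
  have h' := congrArg (fun t => res (show U ≤ f ⁻¹ᵁ (Proj.basicOpen _ (MvPolynomial.X a) ⊓
    Proj.basicOpen _ (MvPolynomial.X b)) from le_inf ha hb) ((f.app _).hom t)) h
  have nat : ∀ {V W : (PP σ).Opens} (hVW : V ≤ W) (hU : U ≤ f ⁻¹ᵁ V) (t : Γ(PP σ, W)),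
      res hU ((f.app V).hom (res hVW t)) =
        res (hU.trans (f.preimage_mono hVW)) ((f.app W).hom t) := by
    intro V W hVW hU t
    have := congrArg (fun g => g.hom t) (f.naturality (homOfLE hVW).op)
    simp only [CommRingCat.hom_comp, RingHom.comp_apply] at this
    rw [res, this]
    exact res_res hU (f.preimage_mono hVW) _
  simp only [map_mul, map_pow] at h'
  rw [nat, nat, nat] at h'
  exact h'

/-- The transition function `X_b / X_a`, a unit on the overlap of the charts
`X_a ≠ 0` and `X_b ≠ 0`. -/
def trans (a b : σ) : Γ(Y, chart f a ⊓ chart f b)ˣ where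
  val := res inf_le_left (ratio f a b)
  inv := res inf_le_right (ratio f b a)
  val_inv := by
    have := dehom_eq f a b (X_mem a) (U := chart f a ⊓ chart f b) inf_le_left inf_le_right
    rw [pow_one, dehom_X_self, map_one] at this
    exact this.symm
  inv_val := by
    have := dehom_eq f b a (X_mem b) (U := chart f a ⊓ chart f b) inf_le_right inf_le_left
    rw [pow_one, dehom_X_self, map_one] at this
    exact this.symm

/-- Sections of `𝒪_Y(k)` over `U`: families `(s_a)` of functions on the sets
`U ∩ {X_a ≠ 0}`, to be thought of as `s = s_a X_a ^ k`, with
`s_a = (X_b / X_a) ^ k s_b` on the overlaps. -/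
def TwSec (k : ℤ) (U : Y.Opens) : AddSubgroup (∀ a : σ, Γ(Y, U ⊓ chart f a)) where
  carrier := {s | ∀ a b : σ,
    res (inf_le_inf_left U inf_le_left) (s a) =
      res (U := U ⊓ (chart f a ⊓ chart f b)) inf_le_right
          ((trans f a b ^ k : Γ(Y, chart f a ⊓ chart f b)ˣ) : Γ(Y, chart f a ⊓ chart f b)) *
        res (inf_le_inf_left U inf_le_right) (s b)}
  zero_mem' a b := by simp
  add_mem' hs ht a b := by
    simp only [Pi.add_apply, map_add, hs a b, ht a b, mul_add]
  neg_mem' hs a b := by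
    simp only [Pi.neg_apply, map_neg, hs a b, mul_neg]

variable {f}

instance (k : ℤ) (U : Y.Opens) : Module Γ(Y, U) (TwSec f k U) where
  smul r s := ⟨fun a => res inf_le_left r * s.1 a, fun a b => by
    simp only [map_mul, s.2 a b, res_res]
    ring⟩
  one_smul s := Subtype.ext (funext fun a => by
    change res _ 1 * s.1 a = _
    rw [map_one, one_mul])
  mul_smul r t s := Subtype.ext (funext fun a => by
    change res _ (r * t) * s.1 a = res _ r * (res _ t * s.1 a)
    rw [map_mul, mul_assoc])
  smul_zero r := Subtype.ext (funext fun a => mul_zero _)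
  smul_add r s t := Subtype.ext (funext fun a => mul_add _ _ _)
  add_smul r t s := Subtype.ext (funext fun a => by
    change res _ (r + t) * s.1 a = res _ r * s.1 a + res _ t * s.1 a
    rw [map_add, add_mul])
  zero_smul s := Subtype.ext (funext fun a => by
    change res _ 0 * s.1 a = 0
    rw [map_zero, zero_mul])

@[simp] lemma TwSec.smul_apply {k : ℤ} {U : Y.Opens} (r : Γ(Y, U)) (s : TwSec f k U) (a : σ) :
    (r • s).1 a = res inf_le_left r * s.1 a := rfl

/-- Restriction of sections of `𝒪_Y(k)`. -/
def TwSec.restr {k : ℤ} {U V : Y.Opens} (h : U ≤ V) : TwSec f k V →+ TwSec f k U where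
  toFun s := ⟨fun a => res (inf_le_inf_right _ h) (s.1 a), fun a b => by
    have := congrArg (res (show U ⊓ (chart f a ⊓ chart f b) ≤ V ⊓ (chart f a ⊓ chart f b) from
      inf_le_inf_right _ h)) (s.2 a b)
    simpa only [map_mul, res_res] using this⟩
  map_zero' := Subtype.ext (funext fun a => map_zero _)
  map_add' s t := Subtype.ext (funext fun a => map_add _ _ _)

@[simp] lemma TwSec.restr_apply {k : ℤ} {U V : Y.Opens} (h : U ≤ V) (s : TwSec f k V) (a : σ) :
    (TwSec.restr h s).1 a = res (inf_le_inf_right _ h) (s.1 a) := rfl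

lemma TwSec.restr_smul {k : ℤ} {U V : Y.Opens} (h : U ≤ V) (r : Γ(Y, V)) (s : TwSec f k V) :
    TwSec.restr h (r • s) = res h r • TwSec.restr h s :=
  Subtype.ext (funext fun a => by
    change res _ (res _ r * s.1 a) = res _ (res h r) * res _ (s.1 a)
    rw [map_mul, res_res, res_res])

variable (f) in
/-- The presheaf of abelian groups underlying `𝒪_Y(k)`. -/
def twPresheaf (k : ℤ) : TopCat.Presheaf Ab Y where
  obj U := .of (TwSec f k U.unop)
  map h := AddCommGrpCat.ofHom (TwSec.restr h.unop.le)
  map_id U := by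
    ext s a
    exact res_self _ (s.1 a)
  map_comp g h := by
    ext s a
    exact (res_res _ _ (s.1 a)).symm


lemma twPresheaf_isSheaf (k : ℤ) : TopCat.Presheaf.IsSheaf (twPresheaf f k) := by
  rw [TopCat.Presheaf.isSheaf_iff_isSheafUniqueGluing]
  intro ι U sf hsf
  replace hsf : ∀ i j, TwSec.restr (f := f) (k := k) inf_le_left (sf i) =
      TwSec.restr (U := U i ⊓ U j) inf_le_right (sf j) := hsf
  have cov : ∀ W : Y.Opens, iSup U ⊓ W ≤ ⨆ i, (U i ⊓ W) := fun W => (iSup_inf_eq U W).le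
  have key : ∀ a : σ, ∃! s : Γ(Y, iSup U ⊓ chart f a), ∀ i,
      res (inf_le_inf_right _ (le_iSup U i)) s = (sf i).1 a := by
    intro a
    refine Y.sheaf.existsUnique_gluing' (fun i => U i ⊓ chart f a) (iSup U ⊓ chart f a)
      (fun i => homOfLE (inf_le_inf_right _ (le_iSup U i))) (cov _) (fun i => (sf i).1 a) ?_
    intro i j
    have h1 := congrArg (fun t : TwSec f k (U i ⊓ U j) =>
      res (show U i ⊓ chart f a ⊓ (U j ⊓ chart f a) ≤ U i ⊓ U j ⊓ chart f a from
        le_inf (inf_le_inf inf_le_left inf_le_left) (inf_le_left.trans inf_le_right)) (t.1 a))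
      (hsf i j)
    exact (res_res _ _ ((sf i).1 a)).symm.trans (h1.trans (res_res _ _ ((sf j).1 a)))
  choose s hs hsu using key
  refine ⟨⟨s, fun a b => ?_⟩, fun i => ?_, fun t ht => ?_⟩
  · refine Y.sheaf.eq_of_locally_eq' (fun i => U i ⊓ (chart f a ⊓ chart f b)) _
      (fun i => homOfLE (inf_le_inf_right _ (le_iSup U i))) (cov _) _ _ fun i => ?_
    have h1 := (sf i).2 a b
    rw [← hs a i, ← hs b i, res_res, res_res] at h1
    change res _ (res _ (s a)) = res (inf_le_inf_right _ (le_iSup U i)) (res _ _ * res _ (s b))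
    rw [map_mul, res_res, res_res, res_res]
    exact h1
  · exact Subtype.ext (funext fun a => hs a i)
  · refine Subtype.ext (funext fun a => hsu a _ fun i => ?_)
    have := congrArg (fun t : TwSec f k (U i) => t.1 a) (ht i)
    exact this

variable (f) in
/-- The twisted sheaf `𝒪_Y(k)` on a scheme `Y` over projective space; for `k = 0` it is canonically
isomorphic to the structure sheaf, a section `s` corresponding to the family of its restrictions
to the charts. -/
def twist (k : ℤ) : Y.Modules where
  val :=
    letI : ∀ U : (Opens Y)ᵒᵖ, Module (Y.ringCatSheaf.obj.obj U) ((twPresheaf f k).obj U) :=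
      fun U => inferInstanceAs (Module Γ(Y, U.unop) (TwSec f k U.unop))
    PresheafOfModules.ofPresheaf (R := Y.ringCatSheaf.obj) (twPresheaf f k)
      (fun _ _ h r s => TwSec.restr_smul h.unop.le r s)
  isSheaf := twPresheaf_isSheaf k


/-- The `ℂ`-vector space structure on sections of `𝒪_Y(k)`. -/
instance (k : ℤ) (U : Y.Opens) : Module ℂ (TwSec f k U) :=
  Module.compHom (TwSec f k U) ((res (le_top : U ≤ ⊤)).comp (cst f))

lemma TwSec.csmul_apply {k : ℤ} {U : Y.Opens} (c : ℂ) (s : TwSec f k U) (a : σ) :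
    (c • s).1 a = res le_top (cst f c) * s.1 a := by
  change res _ (res _ (cst f c)) * s.1 a = _
  rw [res_res]

variable (f) in
/-- The space `H⁰(Y, 𝒪_Y(k))` of global sections. -/
abbrev H0 (k : ℤ) := TwSec f k (⊤ : Y.Opens)

/-- Product of a section of `𝒪_Y(k)` over `U` with a global section of `𝒪_Y(m)`. -/
def TwSec.mul {k m l : ℤ} (h : k + m = l) {U : Y.Opens} (s : TwSec f k U) (t : H0 f m) :
    TwSec f l U :=
  ⟨fun a => s.1 a * res (inf_le_inf_right _ le_top) (t.1 a), fun a b => by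
    have ht := congrArg (res (show U ⊓ (chart f a ⊓ chart f b) ≤
      ⊤ ⊓ (chart f a ⊓ chart f b) from inf_le_inf_right _ le_top)) (t.2 a b)
    simp only [map_mul, res_res] at ht
    simp only [map_mul, res_res, ht, s.2 a b, ← h, zpow_add, Units.val_mul]
    ring⟩

lemma TwSec.mul_apply {k m l : ℤ} (h : k + m = l) {U : Y.Opens} (s : TwSec f k U) (t : H0 f m)
    (a : σ) : (TwSec.mul h s t).1 a = s.1 a * res (inf_le_inf_right _ le_top) (t.1 a) := rfl

/-- Multiplication by a global section of `𝒪_Y(m)`, as a morphism `𝒪_Y(k) ⟶ 𝒪_Y(k + m)`. -/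
def mulHom {k m l : ℤ} (h : k + m = l) (t : H0 f m) : twist f k ⟶ twist f l :=
  (⟨PresheafOfModules.homMk
    { app := fun U => AddCommGrpCat.ofHom
        { toFun := fun s : TwSec f k U.unop => TwSec.mul h s t
          map_zero' := Subtype.ext (funext fun a => zero_mul _)
          map_add' := fun s s' => Subtype.ext (funext fun a => add_mul _ _ _) }
      naturality := fun U V g => by
        ext s
        refine Subtype.ext (funext fun a => ?_)
        change res _ (s.1 a) * res _ (t.1 a) = res _ (s.1 a * res _ (t.1 a))
        rw [map_mul, res_res] }
    (fun U r s => Subtype.ext (funext fun a => mul_assoc _ _ _))⟩ : SheafOfModules.Hom _ _)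

lemma mulHom_app {k m l : ℤ} (h : k + m = l) (t : H0 f m) (U : Y.Opens) (s : TwSec f k U) :
    (mulHom h t).app U s = TwSec.mul h s t := rfl

/-- The map on sections induced by a morphism `𝒪_Y(k) ⟶ 𝒪_Y(l)`. -/
def homApp {k l : ℤ} (p : twist f k ⟶ twist f l) (U : Y.Opens) (s : TwSec f k U) : TwSec f l U :=
  p.app U s

lemma mulHom_ext {k l : ℤ} {p q : twist f k ⟶ twist f l}
    (h : ∀ (U : Y.Opens) (s : TwSec f k U) (a : σ),
      (homApp p U s).1 a = (homApp q U s).1 a) : p = q := by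
  ext U s
  exact Subtype.ext (funext fun a => h U s a)

/-- The product `H⁰(𝒪(m)) × H⁰(𝒪(n)) → H⁰(𝒪(m + n))`. -/
def mulG {m n l : ℤ} (h : m + n = l) : H0 f m →ₗ[ℂ] H0 f n →ₗ[ℂ] H0 f l :=
  LinearMap.mk₂ ℂ (fun s t => TwSec.mul h s t)
    (fun s s' t => Subtype.ext (funext fun a => add_mul _ _ _))
    (fun c s t => Subtype.ext (funext fun a => by
      simp only [TwSec.mul_apply, TwSec.csmul_apply, mul_assoc]))
    (fun s t t' => Subtype.ext (funext fun a => by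
      change s.1 a * res _ (t.1 a + t'.1 a) = s.1 a * res _ (t.1 a) + s.1 a * res _ (t'.1 a)
      rw [map_add, mul_add]))
    (fun c s t => Subtype.ext (funext fun a => by
      simp only [TwSec.mul_apply, TwSec.csmul_apply, map_mul, res_res]
      ring))

lemma mulG_apply {m n l : ℤ} (h : m + n = l) (s : H0 f m) (t : H0 f n) (a : σ) :
    (mulG h s t).1 a = s.1 a * t.1 a := by
  change s.1 a * res _ (t.1 a) = _
  rw [res_self]

lemma mulG_comm {m n l : ℤ} (h : m + n = l) (h' : n + m = l) (s : H0 f m) (t : H0 f n) :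
    mulG h s t = mulG h' t s :=
  Subtype.ext (funext fun a => by rw [mulG_apply, mulG_apply, mul_comm])

lemma mulHom_comp {k m n k' l p : ℤ} (h : k + m = k') (h' : k' + n = l) (hp : n + m = p)
    (t : H0 f m) (s : H0 f n) :
    mulHom h t ≫ mulHom h' s = mulHom (k := k) (show k + p = l by omega) (mulG hp s t) := by
  refine mulHom_ext fun U r a => ?_
  change r.1 a * res _ (t.1 a) * res _ (s.1 a) = r.1 a * res _ ((mulG hp s t).1 a)
  rw [mulG_apply, map_mul]
  ring

lemma mulHom_add {k m l : ℤ} (h : k + m = l) (s t : H0 f m) :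
    mulHom h (s + t) = mulHom h s + mulHom h t := by
  refine mulHom_ext fun U r a => ?_
  change r.1 a * res _ (s.1 a + t.1 a) = r.1 a * res _ (s.1 a) + r.1 a * res _ (t.1 a)
  rw [map_add, mul_add]

lemma mulHom_zero {k m l : ℤ} (h : k + m = l) : mulHom (f := f) h (0 : H0 f m) = 0 := by
  have := mulHom_add h (0 : H0 f m) 0
  rwa [add_zero, left_eq_add] at this

variable (f) in
/-- The constant section `1` of `𝒪_Y(0)`. -/
def oneSec : H0 f 0 := ⟨fun _ => 1, fun a b => by simp⟩

lemma mulG_one_left {m : ℤ} (h : 0 + m = m) (t : H0 f m) : mulG h (oneSec f) t = t :=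
  Subtype.ext (funext fun a => by rw [mulG_apply]; exact one_mul _)

lemma mulHom_one {k : ℤ} (h : k + 0 = k) : mulHom h (oneSec f) = 𝟙 (twist f k) := by
  refine mulHom_ext fun U r a => ?_
  change r.1 a * res _ 1 = r.1 a
  rw [map_one, mul_one]

variable (f) in
/-- The global section of `𝒪_Y(m)` defined by a homogeneous polynomial of degree `m`. -/
def polySec {m : ℕ} {p : MvPolynomial σ ℂ}
    (hp : p ∈ MvPolynomial.homogeneousSubmodule σ ℂ m) : H0 f m :=
  ⟨fun a => res inf_le_right (dehom f a hp), fun a b => by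
    rw [res_res, res_res, dehom_eq f a b hp _ (inf_le_right.trans inf_le_right), zpow_natCast,
      Units.val_pow_eq_pow_val, map_pow]
    congr 2
    exact (res_res _ _ _).symm⟩

variable (f) in
/-- The homogeneous coordinate `X_a` as a section of `𝒪_Y(1)`. -/
def coord (a : σ) : H0 f 1 := polySec f (X_mem a)

/-! ### Coherent sheaves `V ⊗ 𝒪_Y(k)` and their morphisms -/

instance (Y : Scheme.{0}) : HasFiniteBiproducts Y.Modules := Abelian.hasFiniteBiproducts

section tensor

variable {V V' V'' : Type} [AddCommGroup V] [Module ℂ V] [FiniteDimensional ℂ V]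
  [AddCommGroup V'] [Module ℂ V'] [FiniteDimensional ℂ V']
  [AddCommGroup V''] [Module ℂ V''] [FiniteDimensional ℂ V'']

variable (f V) in
/-- The sheaf `V ⊗ 𝒪_Y(k)` for a finite dimensional vector space `V`, realised as the direct sum
of copies of `𝒪_Y(k)` indexed by a basis of `V`. -/
def tens (k : ℤ) : Y.Modules := ⨁ fun _ : Fin (Module.finrank ℂ V) => twist f k

/-- The matrix entries, with values in `H⁰(𝒪_Y(m))`, of a linear map `V → V' ⊗ H⁰(𝒪_Y(m))`. -/
def entry {m : ℤ} (T : V →ₗ[ℂ] V' ⊗[ℂ] H0 f m) (i : Fin (Module.finrank ℂ V'))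
    (j : Fin (Module.finrank ℂ V)) : H0 f m :=
  TensorProduct.lid ℂ _
    (LinearMap.rTensor _ ((Module.finBasis ℂ V').coord i) (T (Module.finBasis ℂ V j)))

/-- The morphism of sheaves `V ⊗ 𝒪_Y(k) ⟶ V' ⊗ 𝒪_Y(k + m)` induced by a linear map
`V → V' ⊗ H⁰(𝒪_Y(m))` and multiplication of sections. -/
def sheafMap {k m l : ℤ} (h : k + m = l) (T : V →ₗ[ℂ] V' ⊗[ℂ] H0 f m) :
    tens f V k ⟶ tens f V' l :=
  biproduct.matrix fun j i => mulHom h (entry T i j)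

/-- The composition
`V → V' ⊗ H⁰(𝒪(m)) → V'' ⊗ H⁰(𝒪(n)) ⊗ H⁰(𝒪(m)) → V'' ⊗ H⁰(𝒪(n + m))`. -/
def prodMap {n m l : ℤ} (h : n + m = l) (S : V' →ₗ[ℂ] V'' ⊗[ℂ] H0 f n)
    (T : V →ₗ[ℂ] V' ⊗[ℂ] H0 f m) : V →ₗ[ℂ] V'' ⊗[ℂ] H0 f l :=
  LinearMap.lTensor V'' (TensorProduct.lift (mulG h)) ∘ₗ
    (TensorProduct.assoc ℂ V'' (H0 f n) (H0 f m)).toLinearMap ∘ₗ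
      LinearMap.rTensor (H0 f m) S ∘ₗ T

/-- The map `g ⊗ t : v ↦ g v ⊗ t`. -/
def pureMap {m : ℤ} (g : V →ₗ[ℂ] V') (t : H0 f m) : V →ₗ[ℂ] V' ⊗[ℂ] H0 f m :=
  (TensorProduct.mk ℂ V' (H0 f m)).flip t ∘ₗ g

lemma expand {m : ℤ} (x : V' ⊗[ℂ] H0 f m) :
    x = ∑ j, Module.finBasis ℂ V' j ⊗ₜ[ℂ] TensorProduct.lid ℂ (H0 f m)
      (LinearMap.rTensor (H0 f m) ((Module.finBasis ℂ V').coord j) x) := by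
  induction x with
  | zero => simp
  | add x y hx hy =>
    simp only [map_add, TensorProduct.tmul_add, Finset.sum_add_distrib]
    rw [← hx, ← hy]
  | tmul v s =>
    conv_lhs => rw [← (Module.finBasis ℂ V').sum_repr v, TensorProduct.sum_tmul]
    simp only [LinearMap.rTensor_tmul, TensorProduct.lid_tmul, TensorProduct.tmul_smul,
      TensorProduct.smul_tmul', Module.Basis.coord_apply]

lemma entry_prodMap {n m l : ℤ} (h : n + m = l) (S : V' →ₗ[ℂ] V'' ⊗[ℂ] H0 f n)
    (T : V →ₗ[ℂ] V' ⊗[ℂ] H0 f m) (i j) :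
    entry (prodMap h S T) i j = ∑ a, mulG h (entry S i a) (entry T a j) := by
  have key : ∀ (y : V'' ⊗[ℂ] H0 f n) (t : H0 f m),
      TensorProduct.lid ℂ (H0 f l) (LinearMap.rTensor _ ((Module.finBasis ℂ V'').coord i)
        (LinearMap.lTensor V'' (TensorProduct.lift (mulG h))
          (TensorProduct.assoc ℂ V'' (H0 f n) (H0 f m) (y ⊗ₜ t)))) =
      mulG h (TensorProduct.lid ℂ _
        (LinearMap.rTensor _ ((Module.finBasis ℂ V'').coord i) y)) t := by
    intro y t
    induction y with
    | zero => simp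
    | add x y hx hy => simp only [TensorProduct.add_tmul, map_add, hx, hy, LinearMap.add_apply]
    | tmul v s => simp
  unfold entry prodMap
  simp only [LinearMap.comp_apply, LinearEquiv.coe_coe]
  conv_lhs => rw [expand (T (Module.finBasis ℂ V j))]
  simp only [map_sum, LinearMap.rTensor_tmul, key]

lemma entry_add {m : ℤ} (S T : V →ₗ[ℂ] V' ⊗[ℂ] H0 f m) (i j) :
    entry (S + T) i j = entry S i j + entry T i j := by
  simp [entry]

lemma entry_pureMap {m : ℤ} (g : V →ₗ[ℂ] V') (t : H0 f m) (i j) :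
    entry (pureMap g t) i j =
      (Module.finBasis ℂ V').repr (g (Module.finBasis ℂ V j)) i • t := by
  simp [entry, pureMap]

lemma sheafMap_comp {k m n k' l p : ℤ} (h : k + m = k') (h' : k' + n = l) (hp : n + m = p)
    (T : V →ₗ[ℂ] V' ⊗[ℂ] H0 f m) (S : V' →ₗ[ℂ] V'' ⊗[ℂ] H0 f n) :
    sheafMap h T ≫ sheafMap h' S =
      sheafMap (k := k) (show k + p = l by omega) (prodMap hp S T) := by
  have hsum : ∀ {ι : Type} (s : Finset ι) (t : ι → H0 f p),
      mulHom (show k + p = l by omega) (∑ a ∈ s, t a) =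
        ∑ a ∈ s, mulHom (show k + p = l by omega) (t a) := by
    intro ι s t
    exact map_sum (AddMonoidHom.mk' (mulHom (f := f) (show k + p = l by omega))
      (mulHom_add _)) t s
  unfold sheafMap tens
  refine biproduct.hom_ext _ _ fun i => biproduct.hom_ext' _ _ fun j => ?_
  simp only [entry_prodMap, hsum, biproduct.ι_matrix_assoc, Category.assoc, biproduct.matrix_π,
    biproduct.lift_desc, biproduct.ι_desc, mulHom_comp h h' hp]

lemma sheafMap_add {k m l : ℤ} (h : k + m = l) (S T : V →ₗ[ℂ] V' ⊗[ℂ] H0 f m) :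
    sheafMap h (S + T) = sheafMap h S + sheafMap h T := by
  unfold sheafMap tens
  refine biproduct.hom_ext _ _ fun i => biproduct.hom_ext' _ _ fun j => ?_
  simp [entry_add, mulHom_add]

lemma sheafMap_zero {k m l : ℤ} (h : k + m = l) :
    sheafMap h (0 : V →ₗ[ℂ] V' ⊗[ℂ] H0 f m) = 0 := by
  have := sheafMap_add h (0 : V →ₗ[ℂ] V' ⊗[ℂ] H0 f m) 0
  rwa [add_zero, left_eq_add] at this

lemma sheafMap_neg {k m l : ℤ} (h : k + m = l) (T : V →ₗ[ℂ] V' ⊗[ℂ] H0 f m) :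
    sheafMap h (-T) = - sheafMap h T := by
  rw [eq_neg_iff_add_eq_zero, ← sheafMap_add, neg_add_cancel, sheafMap_zero]

lemma prodMap_add_left {n m l : ℤ} (h : n + m = l) (S S' : V' →ₗ[ℂ] V'' ⊗[ℂ] H0 f n)
    (T : V →ₗ[ℂ] V' ⊗[ℂ] H0 f m) : prodMap h (S + S') T = prodMap h S T + prodMap h S' T := by
  simp only [prodMap, LinearMap.rTensor_add, LinearMap.add_comp, LinearMap.comp_add]

lemma prodMap_add_right {n m l : ℤ} (h : n + m = l) (S : V' →ₗ[ℂ] V'' ⊗[ℂ] H0 f n)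
    (T T' : V →ₗ[ℂ] V' ⊗[ℂ] H0 f m) : prodMap h S (T + T') = prodMap h S T + prodMap h S T' := by
  simp only [prodMap, LinearMap.comp_add]

lemma prodMap_neg_left {n m l : ℤ} (h : n + m = l) (S : V' →ₗ[ℂ] V'' ⊗[ℂ] H0 f n)
    (T : V →ₗ[ℂ] V' ⊗[ℂ] H0 f m) : prodMap h (-S) T = - prodMap h S T := by
  rw [eq_neg_iff_add_eq_zero, ← prodMap_add_left, neg_add_cancel]
  simp [prodMap]

lemma prodMap_pureMap_left {n m l : ℤ} (h : n + m = l) (g : V' →ₗ[ℂ] V'') (t : H0 f n)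
    (T : V →ₗ[ℂ] V' ⊗[ℂ] H0 f m) :
    prodMap h (pureMap g t) T =
      LinearMap.lTensor V'' (mulG h t) ∘ₗ LinearMap.rTensor (H0 f m) g ∘ₗ T := by
  have : LinearMap.lTensor V'' (TensorProduct.lift (mulG h)) ∘ₗ
      (TensorProduct.assoc ℂ V'' (H0 f n) (H0 f m)).toLinearMap ∘ₗ
      LinearMap.rTensor (H0 f m) (pureMap g t) =
    LinearMap.lTensor V'' (mulG h t) ∘ₗ LinearMap.rTensor (H0 f m) g := by
    ext v s
    simp [pureMap]
  simp only [prodMap, ← LinearMap.comp_assoc] at this ⊢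
  rw [this]

lemma prodMap_pureMap_right {n m l : ℤ} (h : n + m = l) (h' : m + n = l)
    (S : V' →ₗ[ℂ] V'' ⊗[ℂ] H0 f n) (g : V →ₗ[ℂ] V') (t : H0 f m) :
    prodMap h S (pureMap g t) = LinearMap.lTensor V'' (mulG h' t) ∘ₗ S ∘ₗ g := by
  have key : ∀ y : V'' ⊗[ℂ] H0 f n,
      LinearMap.lTensor V'' (TensorProduct.lift (mulG h))
        (TensorProduct.assoc ℂ V'' (H0 f n) (H0 f m) (y ⊗ₜ t)) =
      LinearMap.lTensor V'' (mulG h' t) y := by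
    intro y
    induction y with
    | zero => simp
    | add x y hx hy => simp only [TensorProduct.add_tmul, map_add, hx, hy]
    | tmul v s => simp [mulG_comm h h']
  ext v
  simp only [prodMap, pureMap, LinearMap.comp_apply, LinearMap.flip_apply,
    TensorProduct.mk_apply, LinearMap.rTensor_tmul, LinearEquiv.coe_coe, key]

lemma mulG_one : mulG (zero_add (0 : ℤ)) (oneSec f) = LinearMap.id :=
  LinearMap.ext fun t => mulG_one_left _ t

/-- The morphism `g ⊗ id : V ⊗ 𝒪_Y(k) ⟶ V' ⊗ 𝒪_Y(k)` induced by a linear map `g`. -/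
def linMap (k : ℤ) (g : V →ₗ[ℂ] V') : tens f V k ⟶ tens f V' k :=
  sheafMap (add_zero k) (pureMap g (oneSec f))

lemma linMap_id (k : ℤ) : linMap k (LinearMap.id : V →ₗ[ℂ] V) = 𝟙 (tens f V k) := by
  unfold linMap sheafMap tens
  refine biproduct.hom_ext _ _ fun i => biproduct.hom_ext' _ _ fun j => ?_
  simp only [entry_pureMap, biproduct.ι_matrix_assoc, biproduct.lift_π, biproduct.ι_matrix,
    Category.comp_id, LinearMap.id_apply, Module.Basis.repr_self, Category.assoc,
    biproduct.ι_π, Finsupp.single_apply, Category.id_comp]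
  split_ifs with h
  · subst h
    simp [mulHom_one]
  · simp [mulHom_zero]

lemma linMap_comp_sheafMap {k m l : ℤ} (h : k + m = l) (g : V →ₗ[ℂ] V')
    (S : V' →ₗ[ℂ] V'' ⊗[ℂ] H0 f m) :
    linMap k g ≫ sheafMap h S = sheafMap h (S ∘ₗ g) := by
  rw [linMap, sheafMap_comp (add_zero k) h (add_zero m),
    prodMap_pureMap_right _ (zero_add m)]
  congr 1
  have : mulG (zero_add m) (oneSec f) = LinearMap.id := LinearMap.ext fun t => mulG_one_left _ t
  rw [this, LinearMap.lTensor_id, LinearMap.id_comp]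

lemma sheafMap_comp_linMap {k m l : ℤ} (h : k + m = l) (T : V →ₗ[ℂ] V' ⊗[ℂ] H0 f m)
    (g : V' →ₗ[ℂ] V'') :
    sheafMap h T ≫ linMap l g = sheafMap h (LinearMap.rTensor (H0 f m) g ∘ₗ T) := by
  rw [linMap, sheafMap_comp h (add_zero l) (zero_add m), prodMap_pureMap_left]
  congr 1
  have : mulG (zero_add m) (oneSec f) = LinearMap.id := LinearMap.ext fun t => mulG_one_left _ t
  rw [this, LinearMap.lTensor_id, LinearMap.id_comp]

lemma linMap_comp (k : ℤ) (g : V →ₗ[ℂ] V') (g' : V' →ₗ[ℂ] V'') :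
    linMap (f := f) k g ≫ linMap k g' = linMap k (g' ∘ₗ g) := by
  rw [linMap, sheafMap_comp_linMap, linMap]
  rfl

lemma linMap_add (k : ℤ) (g g' : V →ₗ[ℂ] V') :
    linMap (f := f) k (g + g') = linMap k g + linMap k g' := by
  rw [linMap, linMap, linMap, ← sheafMap_add]
  congr 1
  simp [pureMap, LinearMap.comp_add]

end tensor

/-! ### Complexes concentrated in degrees `-1`, `0`, `1` -/

section threeTerm

open scoped ZeroObject

variable {C : Type*} [Category* C] [Abelian C]

/-- The terms of a three term complex. -/
def threeTerm.X (P Q R : C) : ℤ → C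
  | Int.negSucc 0 => P
  | Int.ofNat 0 => Q
  | Int.ofNat 1 => R
  | _ => 0

/-- The differentials of a three term complex. -/
def threeTerm.d {P Q R : C} (p : P ⟶ Q) (q : Q ⟶ R) :
    ∀ n : ℤ, threeTerm.X P Q R n ⟶ threeTerm.X P Q R (n + 1)
  | Int.negSucc 0 => p
  | Int.ofNat 0 => q
  | _ => 0

/-- The complex `P ⟶ Q ⟶ R` with `P`, `Q`, `R` placed in degrees `-1`, `0`, `1`. -/
def threeTerm {P Q R : C} (p : P ⟶ Q) (q : Q ⟶ R) (w : p ≫ q = 0) : CochainComplex C ℤ :=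
  CochainComplex.of (threeTerm.X P Q R) (threeTerm.d p q) (by
    intro n
    match n with
    | Int.negSucc 0 => exact w
    | Int.negSucc (k + 1) => exact zero_comp
    | Int.ofNat 0 => exact comp_zero
    | Int.ofNat (k + 1) => exact zero_comp)

/-- The components of a morphism of three term complexes. -/
def threeTerm.comps {P Q R P' Q' R' : C} (a : P ⟶ P') (b : Q ⟶ Q') (c : R ⟶ R') :
    ∀ n : ℤ, threeTerm.X P Q R n ⟶ threeTerm.X P' Q' R' n
  | Int.negSucc 0 => a
  | Int.ofNat 0 => b
  | Int.ofNat 1 => c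
  | _ => 0

/-- A morphism of three term complexes from its three components. -/
def threeTerm.map {P Q R P' Q' R' : C} {p : P ⟶ Q} {q : Q ⟶ R} {w : p ≫ q = 0}
    {p' : P' ⟶ Q'} {q' : Q' ⟶ R'} {w' : p' ≫ q' = 0}
    (a : P ⟶ P') (b : Q ⟶ Q') (c : R ⟶ R') (h : p ≫ b = a ≫ p') (h' : q ≫ c = b ≫ q') :
    threeTerm p q w ⟶ threeTerm p' q' w' :=
  CochainComplex.ofHom (X := threeTerm p q w) (Y := threeTerm p' q' w') (threeTerm.comps a b c) (by
    intro n
    have e : ∀ {P Q R : C} (p : P ⟶ Q) (q : Q ⟶ R) (w : p ≫ q = 0),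
      (threeTerm p q w).d n (n + 1) = threeTerm.d p q n := fun p q w =>
        CochainComplex.of_d _ _ n
    rw [e, e]
    match n with
    | Int.negSucc 0 => exact h.symm
    | Int.negSucc (k + 1) => exact comp_zero.trans zero_comp.symm
    | Int.ofNat 0 => exact h'.symm
    | Int.ofNat (k + 1) => exact comp_zero.trans zero_comp.symm)

lemma threeTerm.map_id {P Q R : C} {p : P ⟶ Q} {q : Q ⟶ R} {w : p ≫ q = 0}
    {a : P ⟶ P} {b : Q ⟶ Q} {c : R ⟶ R} (h : p ≫ b = a ≫ p) (h' : q ≫ c = b ≫ q)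
    (ha : a = 𝟙 P) (hb : b = 𝟙 Q) (hc : c = 𝟙 R) :
    threeTerm.map (w := w) (w' := w) a b c h h' = 𝟙 (threeTerm p q w) := by
  subst ha hb hc
  refine HomologicalComplex.hom_ext _ _ fun n => ?_
  match n with
  | Int.negSucc 0 => rfl
  | Int.negSucc (k + 1) => exact (isZero_zero C).eq_of_src _ _
  | Int.ofNat 0 => rfl
  | Int.ofNat 1 => rfl
  | Int.ofNat (k + 2) => exact (isZero_zero C).eq_of_src _ _

lemma threeTerm.map_comp {P Q R P' Q' R' P'' Q'' R'' : C}
    {p : P ⟶ Q} {q : Q ⟶ R} {w : p ≫ q = 0} {p' : P' ⟶ Q'} {q' : Q' ⟶ R'} {w' : p' ≫ q' = 0}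
    {p'' : P'' ⟶ Q''} {q'' : Q'' ⟶ R''} {w'' : p'' ≫ q'' = 0}
    {a : P ⟶ P'} {b : Q ⟶ Q'} {c : R ⟶ R'} (h : p ≫ b = a ≫ p') (h' : q ≫ c = b ≫ q')
    {a' : P' ⟶ P''} {b' : Q' ⟶ Q''} {c' : R' ⟶ R''}
    (k : p' ≫ b' = a' ≫ p'') (k' : q' ≫ c' = b' ≫ q'')
    {a'' : P ⟶ P''} {b'' : Q ⟶ Q''} {c'' : R ⟶ R''}
    (l : p ≫ b'' = a'' ≫ p'') (l' : q ≫ c'' = b'' ≫ q'')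
    (ha : a'' = a ≫ a') (hb : b'' = b ≫ b') (hc : c'' = c ≫ c') :
    threeTerm.map (w := w) (w' := w'') a'' b'' c'' l l' =
      threeTerm.map (w' := w') a b c h h' ≫ threeTerm.map a' b' c' k k' := by
  subst ha hb hc
  refine HomologicalComplex.hom_ext _ _ fun n => ?_
  match n with
  | Int.negSucc 0 => rfl
  | Int.negSucc (k + 1) => exact (isZero_zero C).eq_of_src _ _
  | Int.ofNat 0 => rfl
  | Int.ofNat 1 => rfl
  | Int.ofNat (k + 2) => exact (isZero_zero C).eq_of_src _ _

end threeTerm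

/-! ### ADHM data -/

variable {d : ℕ}

/-- The space `H_Y` of linear forms on `Y` spanned by the coordinates `z_0, …, z_d`. -/
def HY (i : Y ⟶ PP (Fin (d + 1) ⊕ Fin 2)) : Submodule ℂ (H0 i 1) :=
  Submodule.span ℂ (Set.range fun k : Fin (d + 1) => coord i (Sum.inl k))

/-- The coordinate `x` on `Y`. -/
def xSec (i : Y ⟶ PP (Fin (d + 1) ⊕ Fin 2)) : H0 i 1 := coord i (Sum.inr 0)

/-- The coordinate `y` on `Y`. -/
def ySec (i : Y ⟶ PP (Fin (d + 1) ⊕ Fin 2)) : H0 i 1 := coord i (Sum.inr 1)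

variable {i : Y ⟶ PP (Fin (d + 1) ⊕ Fin 2)}

section inc

variable {V V' V'' : Type} [AddCommGroup V] [Module ℂ V]
  [AddCommGroup V'] [Module ℂ V'] [AddCommGroup V''] [Module ℂ V'']

/-- A map `V → V' ⊗ H_Y` regarded as a map `V → V' ⊗ H⁰(𝒪_Y(1))`. -/
def inc (T : V →ₗ[ℂ] V' ⊗[ℂ] HY i) : V →ₗ[ℂ] V' ⊗[ℂ] H0 i 1 :=
  LinearMap.lTensor V' (HY i).subtype ∘ₗ T

lemma rTensor_inc (T : V →ₗ[ℂ] V' ⊗[ℂ] HY i) (g : V' →ₗ[ℂ] V'') :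
    LinearMap.rTensor (H0 i 1) g ∘ₗ inc T = inc (LinearMap.rTensor (HY i) g ∘ₗ T) := by
  simp only [inc, ← LinearMap.comp_assoc, LinearMap.rTensor_comp_lTensor,
    LinearMap.lTensor_comp_rTensor]

lemma inc_comp (T : V' →ₗ[ℂ] V'' ⊗[ℂ] HY i) (g : V →ₗ[ℂ] V') :
    inc T ∘ₗ g = inc (T ∘ₗ g) := rfl

end inc

lemma two_eq : (1 : ℤ) + 1 = 2 := rfl

variable (i) in
/-- An ADHM datum over `Y`: finite dimensional vector spaces `V`, `W`, linear maps
`A, B, A', B' : V → V ⊗ H_Y`, `I : W → V ⊗ H_Y`, `J : V → W ⊗ H_Y` satisfying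
`A B' - B A' + I J + (B' - B) ⊗ x + (A - A') ⊗ y = 0` in `Hom(V, V ⊗ H⁰(𝒪_Y(2)))`. -/
structure ADHM where
  V : Type
  W : Type
  [acgV : AddCommGroup V]
  [modV : Module ℂ V]
  [finV : FiniteDimensional ℂ V]
  [acgW : AddCommGroup W]
  [modW : Module ℂ W]
  [finW : FiniteDimensional ℂ W]
  A : V →ₗ[ℂ] V ⊗[ℂ] HY i
  B : V →ₗ[ℂ] V ⊗[ℂ] HY i
  A' : V →ₗ[ℂ] V ⊗[ℂ] HY i
  B' : V →ₗ[ℂ] V ⊗[ℂ] HY i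
  I : W →ₗ[ℂ] V ⊗[ℂ] HY i
  J : V →ₗ[ℂ] W ⊗[ℂ] HY i
  eq : prodMap two_eq (inc A) (inc B') - prodMap two_eq (inc B) (inc A') +
    prodMap two_eq (inc I) (inc J) +
    prodMap two_eq (inc B' - inc B) (pureMap LinearMap.id (xSec i)) +
    prodMap two_eq (inc A - inc A') (pureMap LinearMap.id (ySec i)) = 0

namespace ADHM

attribute [instance] acgV modV finV acgW modW finW

/-- A morphism of ADHM data: a pair of linear maps commuting with all the structure maps. -/
@[ext]
structure Hom (M N : ADHM i) where
  v : M.V →ₗ[ℂ] N.V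
  w : M.W →ₗ[ℂ] N.W
  hA : LinearMap.rTensor (HY i) v ∘ₗ M.A = N.A ∘ₗ v
  hB : LinearMap.rTensor (HY i) v ∘ₗ M.B = N.B ∘ₗ v
  hA' : LinearMap.rTensor (HY i) v ∘ₗ M.A' = N.A' ∘ₗ v
  hB' : LinearMap.rTensor (HY i) v ∘ₗ M.B' = N.B' ∘ₗ v
  hI : LinearMap.rTensor (HY i) v ∘ₗ M.I = N.I ∘ₗ w
  hJ : LinearMap.rTensor (HY i) w ∘ₗ M.J = N.J ∘ₗ v

lemma comp_aux {V₁ V₂ V₃ W₁ W₂ W₃ H : Type} [AddCommGroup V₁] [Module ℂ V₁]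
    [AddCommGroup V₂] [Module ℂ V₂] [AddCommGroup V₃] [Module ℂ V₃]
    [AddCommGroup W₁] [Module ℂ W₁] [AddCommGroup W₂] [Module ℂ W₂] [AddCommGroup W₃] [Module ℂ W₃]
    [AddCommGroup H] [Module ℂ H]
    {T₁ : V₁ →ₗ[ℂ] W₁ ⊗[ℂ] H} {T₂ : V₂ →ₗ[ℂ] W₂ ⊗[ℂ] H} {T₃ : V₃ →ₗ[ℂ] W₃ ⊗[ℂ] H}
    {a : V₁ →ₗ[ℂ] V₂} {a' : V₂ →ₗ[ℂ] V₃} {b : W₁ →ₗ[ℂ] W₂} {b' : W₂ →ₗ[ℂ] W₃}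
    (h : LinearMap.rTensor H b ∘ₗ T₁ = T₂ ∘ₗ a) (h' : LinearMap.rTensor H b' ∘ₗ T₂ = T₃ ∘ₗ a') :
    LinearMap.rTensor H (b' ∘ₗ b) ∘ₗ T₁ = T₃ ∘ₗ (a' ∘ₗ a) := by
  rw [LinearMap.rTensor_comp, LinearMap.comp_assoc, h, ← LinearMap.comp_assoc, h',
    LinearMap.comp_assoc]

instance : Category (ADHM i) where
  Hom := Hom
  id M := ⟨LinearMap.id, LinearMap.id, by simp, by simp, by simp, by simp, by simp, by simp⟩
  comp p q := ⟨q.v ∘ₗ p.v, q.w ∘ₗ p.w, comp_aux p.hA q.hA, comp_aux p.hB q.hB,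
    comp_aux p.hA' q.hA', comp_aux p.hB' q.hB', comp_aux p.hI q.hI, comp_aux p.hJ q.hJ⟩

variable (M : ADHM i)

/-- The map `α = (A' + x, B' + y, J) : V ⊗ 𝒪_Y(-1) ⟶ (V ⊕ V ⊕ W) ⊗ 𝒪_Y`. -/
def α : tens i M.V (-1) ⟶ tens i M.V 0 ⊞ (tens i M.V 0 ⊞ tens i M.W 0) :=
  biprod.lift (sheafMap (neg_add_cancel 1) (inc M.A' + pureMap LinearMap.id (xSec i)))
    (biprod.lift (sheafMap (neg_add_cancel 1) (inc M.B' + pureMap LinearMap.id (ySec i)))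
      (sheafMap (neg_add_cancel 1) (inc M.J)))

/-- The map `β = (-B - y, A + x, I) : (V ⊕ V ⊕ W) ⊗ 𝒪_Y ⟶ V ⊗ 𝒪_Y(1)`. -/
def β : tens i M.V 0 ⊞ (tens i M.V 0 ⊞ tens i M.W 0) ⟶ tens i M.V 1 :=
  biprod.desc (-sheafMap (zero_add 1) (inc M.B + pureMap LinearMap.id (ySec i)))
    (biprod.desc (sheafMap (zero_add 1) (inc M.A + pureMap LinearMap.id (xSec i)))
      (sheafMap (zero_add 1) (inc M.I)))

lemma prodMap_comm_pure {V V' : Type} [AddCommGroup V] [Module ℂ V]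
    [AddCommGroup V'] [Module ℂ V'] [FiniteDimensional ℂ V] [FiniteDimensional ℂ V']
    (T : V →ₗ[ℂ] V' ⊗[ℂ] H0 i 1) (t : H0 i 1) :
    prodMap two_eq (pureMap LinearMap.id t) T = prodMap two_eq T (pureMap LinearMap.id t) := by
  rw [prodMap_pureMap_left, prodMap_pureMap_right two_eq two_eq, LinearMap.rTensor_id]
  rfl

lemma α_comp_β : M.α ≫ M.β = 0 := by
  have h := M.eq
  simp only [sub_eq_add_neg, prodMap_add_left, prodMap_neg_left] at h
  simp only [α, β, biprod.lift_desc, sheafMap_comp _ _ two_eq, ← sheafMap_neg, ← sheafMap_add]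
  refine Eq.trans (congrArg (sheafMap _) (Eq.trans ?_ h)) (sheafMap_zero _)
  simp only [prodMap_add_left, prodMap_add_right, prodMap_neg_left]
  rw [prodMap_comm_pure (inc M.A') (ySec i), prodMap_comm_pure (inc M.B') (xSec i),
    prodMap_comm_pure (pureMap LinearMap.id (xSec i)) (ySec i)]
  abel

/-- The complex `V ⊗ 𝒪_Y(-1) ⟶ (V ⊕ V ⊕ W) ⊗ 𝒪_Y ⟶ V ⊗ 𝒪_Y(1)` in degrees `-1, 0, 1`
attached to an ADHM datum. -/
def cplx : CochainComplex Y.Modules ℤ := threeTerm M.α M.β M.α_comp_β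

end ADHM

lemma sheafMap_linMap_comm {V V' W W' : Type} [AddCommGroup V] [Module ℂ V] [FiniteDimensional ℂ V]
    [AddCommGroup V'] [Module ℂ V'] [FiniteDimensional ℂ V']
    [AddCommGroup W] [Module ℂ W] [FiniteDimensional ℂ W]
    [AddCommGroup W'] [Module ℂ W'] [FiniteDimensional ℂ W'] {k l : ℤ} (h : k + 1 = l)
    {T : V →ₗ[ℂ] W ⊗[ℂ] HY i} {T' : V' →ₗ[ℂ] W' ⊗[ℂ] HY i} {g : V →ₗ[ℂ] V'} {g' : W →ₗ[ℂ] W'}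
    (hT : LinearMap.rTensor (HY i) g' ∘ₗ T = T' ∘ₗ g) :
    sheafMap h (inc T) ≫ linMap l g' = linMap k g ≫ sheafMap h (inc T') := by
  rw [sheafMap_comp_linMap, linMap_comp_sheafMap, rTensor_inc, hT, inc_comp]

lemma sheafMap_linMap_comm' {V V' : Type} [AddCommGroup V] [Module ℂ V] [FiniteDimensional ℂ V]
    [AddCommGroup V'] [Module ℂ V'] [FiniteDimensional ℂ V'] {k l : ℤ} (h : k + 1 = l)
    {T : V →ₗ[ℂ] V ⊗[ℂ] HY i} {T' : V' →ₗ[ℂ] V' ⊗[ℂ] HY i} {g : V →ₗ[ℂ] V'} (t : H0 i 1)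
    (hT : LinearMap.rTensor (HY i) g ∘ₗ T = T' ∘ₗ g) :
    sheafMap h (inc T + pureMap LinearMap.id t) ≫ linMap l g =
      linMap k g ≫ sheafMap h (inc T' + pureMap LinearMap.id t) := by
  have e : sheafMap h (pureMap (f := i) LinearMap.id t) ≫ linMap l g =
      linMap k g ≫ sheafMap h (pureMap LinearMap.id t) := by
    rw [sheafMap_comp_linMap, linMap_comp_sheafMap]
    congr 1
  rw [sheafMap_add, sheafMap_add, Preadditive.add_comp, Preadditive.comp_add,
    sheafMap_linMap_comm h hT, e]

variable (i) in
/-- The functor sending an ADHM datum to its complex of sheaves, and a morphism `(f, g)` to the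
morphism of complexes with components `f`, `f ⊕ f ⊕ g`, `f`. -/
def complexFunctor : ADHM i ⥤ CochainComplex Y.Modules ℤ where
  obj M := M.cplx
  map {M N} p := threeTerm.map (linMap (-1) p.v)
    (biprod.map (linMap 0 p.v) (biprod.map (linMap 0 p.v) (linMap 0 p.w))) (linMap 1 p.v)
    (by
      refine biprod.hom_ext _ _ ?_ (biprod.hom_ext _ _ ?_ ?_)
      · simp [ADHM.α, sheafMap_linMap_comm' _ _ p.hA']
      · simp [ADHM.α, sheafMap_linMap_comm' _ _ p.hB']
      · simp [ADHM.α, sheafMap_linMap_comm _ p.hJ])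
    (by
      refine biprod.hom_ext' _ _ ?_ (biprod.hom_ext' _ _ ?_ ?_)
      · simp [ADHM.β, sheafMap_linMap_comm' _ _ p.hB]
      · simp [ADHM.β, sheafMap_linMap_comm' _ _ p.hA]
      · simp [ADHM.β, sheafMap_linMap_comm _ p.hI])
  map_id M := by
    refine threeTerm.map_id _ _ (linMap_id _) ?_ (linMap_id _)
    change biprod.map (linMap 0 LinearMap.id)
      (biprod.map (linMap 0 LinearMap.id) (linMap 0 LinearMap.id)) = _
    simp only [linMap_id]
    refine biprod.hom_ext _ _ ?_ (biprod.hom_ext _ _ ?_ ?_) <;> simp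
  map_comp p q := by
    refine threeTerm.map_comp _ _ _ _ _ _ (linMap_comp _ _ _).symm ?_ (linMap_comp _ _ _).symm
    change biprod.map (linMap 0 (q.v ∘ₗ p.v))
      (biprod.map (linMap 0 (q.v ∘ₗ p.v)) (linMap 0 (q.w ∘ₗ p.w))) = _
    simp only [← linMap_comp]
    refine biprod.hom_ext _ _ ?_ (biprod.hom_ext _ _ ?_ ?_) <;> simp

/-! ### The line -/

/-- The graded homomorphism `ℂ[z_0, …, z_d, x, y] → ℂ[x, y]` sending the `z_k` to `0`. -/
def killZ (d : ℕ) : MvPolynomial.homogeneousSubmodule (Fin (d + 1) ⊕ Fin 2) ℂ →+*ᵍ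
    MvPolynomial.homogeneousSubmodule (Fin 2) ℂ where
  toRingHom := (MvPolynomial.aeval (Sum.elim (fun _ => 0) MvPolynomial.X) :
    MvPolynomial (Fin (d + 1) ⊕ Fin 2) ℂ →ₐ[ℂ] MvPolynomial (Fin 2) ℂ).toRingHom
  map_mem {m p} hp := by
    have h := MvPolynomial.IsHomogeneous.aeval (n := 1) hp
      (Sum.elim (fun _ => 0) MvPolynomial.X : Fin (d + 1) ⊕ Fin 2 → MvPolynomial (Fin 2) ℂ)
      (fun a => by
        cases a with
        | inl k => exact MvPolynomial.isHomogeneous_zero _ _ _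
        | inr k => exact MvPolynomial.isHomogeneous_X ℂ k)
    rw [one_mul] at h
    exact h

lemma killZ_rename (d : ℕ) (p : MvPolynomial (Fin 2) ℂ) :
    killZ d (MvPolynomial.rename Sum.inr p) = p := by
  change MvPolynomial.aeval (Sum.elim (fun _ => 0) MvPolynomial.X) (MvPolynomial.rename Sum.inr p) = p
  rw [MvPolynomial.aeval_rename]
  exact MvPolynomial.aeval_X_left_apply p

open HomogeneousIdeal in
lemma killZ_irrelevant (d : ℕ) : irrelevant (MvPolynomial.homogeneousSubmodule (Fin 2) ℂ) ≤
    (irrelevant (MvPolynomial.homogeneousSubmodule (Fin (d + 1) ⊕ Fin 2) ℂ)).map (killZ d) := by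
  refine (toIdeal_irrelevant_le _).mpr fun n hn p hp => ?_
  have h : MvPolynomial.rename Sum.inr p ∈
      irrelevant (MvPolynomial.homogeneousSubmodule (Fin (d + 1) ⊕ Fin 2) ℂ) :=
    mem_irrelevant_of_mem _ hn (MvPolynomial.IsHomogeneous.rename_isHomogeneous hp)
  have := Ideal.mem_map_of_mem (killZ d) h
  rwa [killZ_rename] at this

/-- The inclusion `ℙ¹ ⟶ ℙⁿ`, `n = d + 2`, of the line `z_0 = … = z_d = 0`. -/
def lineIncl (d : ℕ) : PP (Fin 2) ⟶ PP (Fin (d + 1) ⊕ Fin 2) :=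
  Proj.map (killZ d) (killZ_irrelevant d)

/-! ### Perverse instanton sheaves of trivial splitting type -/

/-- The structure sheaf. -/
abbrev struct (Y : Scheme.{0}) : Y.Modules := SheafOfModules.unit Y.ringCatSheaf

/-- The cohomology of `K` is concentrated in degree `0`, where it is `𝒪^r` for some `r`. -/
def IsTrivialSheaf {Z : Scheme.{0}} (K : CochainComplex Z.Modules ℤ) : Prop :=
  (∀ n : ℤ, n ≠ 0 → K.ExactAt n) ∧
    ∃ r : ℕ, Nonempty (K.homology 0 ≅ ⨁ fun _ : Fin r => struct Z)

/-- The objects of the derived category of `Y` which are perverse instanton sheaves of trivial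
splitting type on the line `j : ℙ¹ ⟶ Y`: they are isomorphic to a complex
`𝒪_Y(-1)^c ⟶ 𝒪_Y^a ⟶ 𝒪_Y(1)^c` in degrees `-1, 0, 1` whose derived restriction to the line is
a trivial sheaf placed in degree `0`. As the terms are locally free,
the derived restriction is the termwise restriction. -/
def PI (i : Y ⟶ PP σ) (j : PP (Fin 2) ⟶ Y) [HasDerivedCategory Y.Modules] :
    ObjectProperty (DerivedCategory Y.Modules) := fun C =>
  ∃ (c a : ℕ) (p : (⨁ fun _ : Fin c => twist i (-1)) ⟶ ⨁ fun _ : Fin a => twist i 0)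
    (q : (⨁ fun _ : Fin a => twist i 0) ⟶ ⨁ fun _ : Fin c => twist i 1) (w : p ≫ q = 0),
    Nonempty (C ≅ DerivedCategory.Q.obj (threeTerm p q w)) ∧
      IsTrivialSheaf (((Scheme.Modules.pullback j).mapHomologicalComplex
        (ComplexShape.up ℤ)).obj (threeTerm p q w))

/-! ### The hypotheses on `Y` -/

/-- The tensor product of sheaves of modules: the sheaf associated to `U ↦ L(U) ⊗ M(U)`. -/
def tensorSheaf (L M : Y.Modules) : Y.Modules :=
  (PresheafOfModules.sheafification (𝟙 Y.ringCatSheaf.obj)).obj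
    (PresheafOfModules.Monoidal.tensorObj (R := Y.presheaf)
      ((Scheme.Modules.toPresheafOfModules Y).obj L) ((Scheme.Modules.toPresheafOfModules Y).obj M))

/-- Invertible sheaves. -/
def IsInvertible (L : Y.Modules) : Prop :=
  ∀ x : Y, ∃ U : Y.Opens, x ∈ U ∧ Nonempty (L.restrict U.ι ≅ struct U)

variable (Y) in
/-- The Picard group of `Y` is isomorphic to `ℤ`. -/
def PicIsZ : Prop :=
  ∃ φ : {L : Y.Modules // IsInvertible L} → ℤ, Function.Surjective φ ∧
    (∀ L M, φ L = φ M ↔ Nonempty (L.1 ≅ M.1)) ∧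
    ∀ L M N, Nonempty (N.1 ≅ tensorSheaf L.1 M.1) → φ N = φ L + φ M

/-- `Y` is linearly normal in projective space: every section of `𝒪_Y(1)` is a linear form in the
homogeneous coordinates. -/
def LinNormal (i : Y ⟶ PP σ) : Prop := Submodule.span ℂ (Set.range (coord i)) = ⊤

/-- The saturated homogeneous ideal of `Y`, generated by the homogeneous polynomials vanishing
on `Y`. -/
def idealOf (i : Y ⟶ PP σ) : Ideal (MvPolynomial σ ℂ) :=
  Ideal.span {p | ∃ (m : ℕ) (hp : p ∈ MvPolynomial.homogeneousSubmodule σ ℂ m), polySec i hp = 0}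

/-- Cohen–Macaulay rings: noetherian rings whose localizations at maximal ideals have a regular
sequence of length equal to the dimension. -/
def IsCM (R : Type) [CommRing R] : Prop :=
  IsNoetherianRing R ∧ ∀ (P : Ideal R) [P.IsMaximal], ∃ rs : List (Localization.AtPrime P),
    (∀ r ∈ rs, r ∈ IsLocalRing.maximalIdeal (Localization.AtPrime P)) ∧
    RingTheory.Sequence.IsRegular (Localization.AtPrime P) rs ∧
    ((rs.length : ℕ) : WithBot ℕ∞) = ringKrullDim (Localization.AtPrime P)

/-- `Y` is arithmetically Cohen–Macaulay: its homogeneous coordinate ring is Cohen–Macaulay. -/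
def IsACM (i : Y ⟶ PP σ) : Prop := IsCM (MvPolynomial σ ℂ ⧸ idealOf i)

end PerverseInstanton

end

open PerverseInstanton

universe w

/-!
The functor sends an ADHM datum to its complex, viewed in the derived category.

On the line `ℓ` the coordinates `z_k` vanish, so the restriction of the complex of an ADHM datum is
the sum of the Koszul complex of `x`, `y` tensored with `V` and of `W ⊗ 𝒪_ℓ` in degree zero. The
Koszul complex is exact, hence the restriction is a trivial sheaf (`koszul_homology`, `PI_cplx`).
As the terms of the complex are sums of twisted sheaves `𝒪_Y(k)`, the derived restriction is computed
by restricting the terms.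

Conversely, let `𝒪_Y(-1)^c → 𝒪_Y^a → 𝒪_Y(1)^c` be a complex with trivial restriction to `ℓ`. If `Y` is
linearly normal, its maps are matrices `P`, `Q` of linear forms in the `z_k`, `x` and `y`
(`exists_linear_forms`). The composite `Q P` vanishes on `ℓ`, so `Q_x P_x = Q_y P_y = 0` and
`Q_x P_y = -Q_y P_x`, and triviality of the cohomology on `ℓ` forces `Q_x P_y` to be invertible
(`line_monad`). Linear algebra then gives a decomposition of the middle space as `V ⊕ V ⊕ W` in which
the coefficients of `x` and `y` are those of the complex of an ADHM datum (`exists_splitting`), and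
the coefficients of the `z_k` define the datum (`exists_adhm`). Only objects represented by such
complexes have to be reached, so the Picard group plays no role.

For faithfulness, suppose that a morphism of complexes induced by `(f, g)` vanishes in the derived
category. It then factors through an acyclic complex, and a diagram chase shows that its components
in degrees `0` and `1` vanish if `Hom(𝒪_Y, 𝒪_Y(-1))`, `Hom(𝒪_Y(1), 𝒪_Y)` and
`Ext¹(𝒪_Y(1), 𝒪_Y(-1))` vanish (`threeTerm_map_eq_zero`); thus `f = 0` and `g = 0`. These groups are
`H⁰(𝒪_Y(-1))` and `H¹(𝒪_Y(-2))`. They vanish if the cone over `Y` in some projective embedding has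
depth at least three at its vertex: sections and Čech cocycles are fractions of homogeneous
polynomials, and a regular sequence of length three in the ideal of the vertex allows one to extend
sections and to split cocycles (`exists_of_mul_eq`, `exists_of_cocycle`). Extensions are handled
directly, without comparing `Ext¹` with Čech cohomology (`Model.extSplit`).

If `Y` is isomorphic to the projective plane, the embedding is that isomorphism, whose cone is affine
space. The given embedding of `Y` is then described by homogeneous polynomials of some degree `m`
(`exists_polynomials`), and `m > 0` because `Y` contains a line, so that `𝒪_Y(-1)` and `𝒪_Y(-2)` are
negative powers of the hyperplane sheaf of the plane as well. If `Y` is arithmetically Cohen–Macaulay, the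
depth of the local ring of the cone at the vertex is its dimension, which is at least `dim Y`, as the
homogeneous prime ideals of the points of `Y` are contained in the ideal of the vertex
(`topologicalKrullDim_le`).
-/

noncomputable section
namespace PerverseInstanton

/-! ### Three term complexes and split extensions in the derived category -/

section homological

variable {C : Type*} [Category* C] [Abelian C]

/-- Every extension of `R` by `P` splits. -/
def ExtSplit (R P : C) : Prop :=
  ∀ ⦃X : C⦄ (ι : P ⟶ X) (π : X ⟶ R) (w : ι ≫ π = 0),
    (ShortComplex.mk ι π w).ShortExact → ∃ s : R ⟶ X, s ≫ π = 𝟙 R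

/-- A morphism of complexes that vanishes in the derived category factors through an acyclic
complex. -/
lemma exists_acyclic_factorization [HasDerivedCategory.{w} C] {K L : CochainComplex C ℤ}
    (φ : K ⟶ L) (h : DerivedCategory.Q.map φ = 0) :
    ∃ (A : CochainComplex C ℤ) (u : K ⟶ A) (v : A ⟶ L), (∀ n, A.ExactAt n) ∧ u ≫ v = φ := by
  have h1 : DerivedCategory.Qh.map ((HomotopyCategory.quotient C (ComplexShape.up ℤ)).map φ) =
      DerivedCategory.Qh.map 0 := by
    rw [Functor.map_zero]
    exact h
  rw [MorphismProperty.map_eq_iff_precomp _ (HomotopyCategory.quasiIso C (ComplexShape.up ℤ))] at h1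
  obtain ⟨Z, s, hs, e⟩ := h1
  obtain ⟨Z, rfl⟩ := HomotopyCategory.quotient_obj_surjective Z
  obtain ⟨s, rfl⟩ := (HomotopyCategory.quotient _ _).map_surjective s
  rw [comp_zero, ← Functor.map_comp] at e
  have ho : Homotopy (s ≫ φ) 0 := HomotopyCategory.homotopyOfEq _ _ (by rw [e, Functor.map_zero])
  refine ⟨CochainComplex.mappingCone s, CochainComplex.mappingCone.inr s,
    CochainComplex.mappingCone.desc s (CochainComplex.HomComplex.Cochain.ofHomotopy ho) φ (by
      simp), ?_, by simp⟩
  rw [← HomotopyCategory.quotient_obj_mem_subcategoryAcyclic_iff_exactAt]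
  rw [HomotopyCategory.quasiIso_eq_trW_subcategoryAcyclic] at hs
  exact (ObjectProperty.trW_iff_of_distinguished _ _
    (HomotopyCategory.mappingCone_triangleh_distinguished s)).mp hs

/-- The projection of the pushout of an extension. -/
def pushoutProj (S : ShortComplex C) {P : C} (w : S.X₁ ⟶ P) : pushout S.f w ⟶ S.X₃ :=
  pushout.desc S.g 0 (by rw [S.zero, comp_zero])

lemma inl_pushoutProj (S : ShortComplex C) {P : C} (w : S.X₁ ⟶ P) :
    pushout.inl S.f w ≫ pushoutProj S w = S.g := pushout.inl_desc _ _ _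

lemma inr_pushoutProj (S : ShortComplex C) {P : C} (w : S.X₁ ⟶ P) :
    pushout.inr S.f w ≫ pushoutProj S w = 0 := pushout.inr_desc _ _ _

lemma pushoutProj_shortExact {S : ShortComplex C} (hS : S.ShortExact) {P : C} (w : S.X₁ ⟶ P) :
    (ShortComplex.mk (pushout.inr S.f w) (pushoutProj S w) (inr_pushoutProj S w)).ShortExact := by
  have := hS.mono_f
  have := hS.epi_g
  have hepi : Epi (pushoutProj S w) := epi_of_epi_fac (inl_pushoutProj S w)
  have hk : ∀ {Z : C} (k : pushout S.f w ⟶ Z) (hk : pushout.inr S.f w ≫ k = 0),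
      S.f ≫ pushout.inl S.f w ≫ k = 0 := fun k hk => by
    rw [pushout.condition_assoc, hk, comp_zero]
  refine { exact := ?_, mono_f := inferInstanceAs (Mono (pushout.inr S.f w)), epi_g := hepi }
  refine ShortComplex.exact_of_g_is_cokernel _ ?_
  refine CokernelCofork.IsColimit.ofπ' _ _ fun {Z} k hk' =>
    ⟨hS.exact.desc (pushout.inl S.f w ≫ k) (hk k hk'), ?_⟩
  refine pushout.hom_ext ?_ ?_
  · rw [reassoc_of% inl_pushoutProj S w]
    exact hS.exact.g_desc _ _
  · rw [reassoc_of% inr_pushoutProj S w, zero_comp]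
    exact hk'.symm

/-- If every extension of `R` by `P` splits, then morphisms from `R` to the quotient of an extension
lift to the pushout of the extension along a morphism to `P`. -/
lemma ExtSplit.lift {R P : C} (hs : ExtSplit R P) {S : ShortComplex C} (hS : S.ShortExact)
    (w : S.X₁ ⟶ P) (u : R ⟶ S.X₃) :
    ∃ s : R ⟶ pushout S.f w, s ≫ pushoutProj S w = u := by
  have ex := pushoutProj_shortExact hS w
  have hepi : Epi (pushoutProj S w) := ex.epi_g
  have hmono : Mono (pushout.inr S.f w) := ex.mono_f
  have e2 : pullback.lift (pushout.inr S.f w) (0 : P ⟶ R) (by rw [inr_pushoutProj, zero_comp]) ≫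
      pullback.snd (pushoutProj S w) u = 0 := pullback.lift_snd _ _ _
  obtain ⟨s, hs⟩ := hs _ _ e2
    { exact := by
        refine ShortComplex.exact_of_f_is_kernel _ ?_
        have hm : Mono (pullback.lift (pushout.inr S.f w) (0 : P ⟶ R)
          (by rw [inr_pushoutProj, zero_comp]) : P ⟶ pullback (pushoutProj S w) u) :=
            mono_of_mono_fac (pullback.lift_fst _ _ _)
        refine KernelFork.IsLimit.ofι' _ _ fun {Z} k hk =>
          ⟨ex.exact.lift (k ≫ pullback.fst _ _) ?_, ?_⟩
        · change _ ≫ pushoutProj S w = 0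
          rw [Category.assoc, pullback.condition]
          exact (Category.assoc _ _ _).symm.trans ((congrArg (· ≫ u) hk).trans zero_comp)
        · refine pullback.hom_ext ?_ ?_
          · rw [Category.assoc, pullback.lift_fst]
            exact ex.exact.lift_f _ _
          · rw [Category.assoc, pullback.lift_snd, comp_zero]
            exact hk.symm
      mono_f := mono_of_mono_fac (pullback.lift_fst _ _ _)
      epi_g := inferInstanceAs (Epi (pullback.snd (pushoutProj S w) u)) }
  exact ⟨s ≫ pullback.fst _ _, by
    rw [Category.assoc, pullback.condition, ← Category.assoc, hs, Category.id_comp]⟩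

/-- If every extension of `R` by the kernel of an extension splits, then morphisms from `R` to its
quotient lift. -/
lemma ExtSplit.lift_id {R P : C} (hs : ExtSplit R P) {S : ShortComplex C} (hS : S.ShortExact)
    (e : S.X₁ ≅ P) (u : R ⟶ S.X₃) : ∃ s : R ⟶ S.X₂, s ≫ S.g = u := by
  obtain ⟨s, hs⟩ := hs.lift hS e.hom u
  have h : pushout.desc (𝟙 S.X₂) (e.inv ≫ S.f) (by simp) ≫ S.g = pushoutProj S e.hom := by
    refine pushout.hom_ext ?_ ?_
    · rw [pushout.inl_desc_assoc, inl_pushoutProj, Category.id_comp]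
    · rw [pushout.inr_desc_assoc, inr_pushoutProj, Category.assoc, S.zero, comp_zero]
  exact ⟨s ≫ pushout.desc (𝟙 S.X₂) (e.inv ≫ S.f) (by simp), by rw [Category.assoc, h, hs]⟩

lemma ExtSplit.of_iso {R P P' : C} (hs : ExtSplit R P) (e : P' ≅ P) : ExtSplit R P' :=
  fun _ _ _ _ hS => hs.lift_id hS e (𝟙 R)

lemma ExtSplit.biprod {R P P' : C} (hs : ExtSplit R P) (hs' : ExtSplit R P') :
    ExtSplit R (P ⊞ P') := by
  intro X ι π w hS
  obtain ⟨s, hs'⟩ := hs'.lift hS biprod.snd (𝟙 R)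
  have hmono : Mono ι := hS.mono_f
  have e : (biprod.inl ≫ ι) ≫ pushout.inl ι (biprod.snd : P ⊞ P' ⟶ P') = 0 := by
    rw [Category.assoc, pushout.condition]
    simp
  have hc : IsColimit (CokernelCofork.ofπ (pushout.inl ι (biprod.snd : P ⊞ P' ⟶ P')) e) := by
    have : Epi (pushout.inl ι (biprod.snd : P ⊞ P' ⟶ P')) := inferInstance
    refine CokernelCofork.IsColimit.ofπ' _ _ fun {Z} k hk =>
      ⟨pushout.desc k (biprod.inr ≫ ι ≫ k) ?_, pushout.inl_desc _ _ _⟩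
    refine biprod.hom_ext' _ _ ?_ ?_
    · rw [← Category.assoc, hk]
      simp
    · simp
  obtain ⟨t, ht⟩ := hs.lift_id (S := ShortComplex.mk _ _ e)
    { exact := ShortComplex.exact_of_g_is_cokernel _ hc
      mono_f := inferInstanceAs (Mono (biprod.inl ≫ ι))
      epi_g := inferInstanceAs (Epi (pushout.inl ι (biprod.snd : P ⊞ P' ⟶ P'))) } (Iso.refl P) s
  refine ⟨t, ?_⟩
  have h := inl_pushoutProj (ShortComplex.mk ι π w) (biprod.snd : P ⊞ P' ⟶ P')
  change t ≫ (ShortComplex.mk ι π w).g = _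
  rw [← h, ← Category.assoc]
  exact (congrArg (· ≫ _) ht).trans hs'

section biproducts

variable [HasFiniteBiproducts C]

/-- A sum of `n + 1` copies of an object. -/
def biproductSuccIso (n : ℕ) (P : C) : (⨁ fun _ : Fin (n + 1) => P) ≅ P ⊞ ⨁ fun _ : Fin n => P where
  hom := biprod.lift (biproduct.π (fun _ : Fin (n + 1) => P) 0)
    (biproduct.lift fun i => biproduct.π (fun _ : Fin (n + 1) => P) i.succ)
  inv := biprod.desc (biproduct.ι (fun _ : Fin (n + 1) => P) 0)
    (biproduct.desc fun i => biproduct.ι (fun _ : Fin (n + 1) => P) i.succ)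
  hom_inv_id := by
    rw [biprod.lift_desc, biproduct.lift_desc, ← biproduct.total, Fin.sum_univ_succ]
  inv_hom_id := by
    refine biprod.hom_ext' _ _ (biprod.hom_ext _ _ ?_ (biproduct.hom_ext _ _ fun i => ?_))
      (biproduct.hom_ext' _ _ fun j => biprod.hom_ext _ _ ?_ (biproduct.hom_ext _ _ fun i => ?_))
    · simp
    · simp [biproduct.ι_π_ne _ (Fin.succ_ne_zero i).symm]
    · simp [biproduct.ι_π_ne _ (Fin.succ_ne_zero j)]
    · by_cases h : j = i
      · subst h
        simp
      · simp [biproduct.ι_π_ne _ h, biproduct.ι_π_ne _ (fun h' => h (Fin.succ_injective _ h'))]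

lemma ExtSplit.biproduct_left {R P : C} (hs : ExtSplit R P) (n : ℕ) :
    ExtSplit (⨁ fun _ : Fin n => R) P := by
  intro X ι π w hS
  choose s hs using fun i => hs.lift_id hS (Iso.refl _) (biproduct.ι (fun _ : Fin n => R) i)
  exact ⟨biproduct.desc s, biproduct.hom_ext' _ _ fun i => by simpa using hs i⟩

lemma ExtSplit.biproduct_right {R P : C} (hs : ExtSplit R P) (n : ℕ) :
    ExtSplit R (⨁ fun _ : Fin n => P) := by
  induction n with
  | zero =>
    intro X ι π w hS
    have hz : IsZero (⨁ fun _ : Fin 0 => P) := by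
      rw [IsZero.iff_id_eq_zero]
      exact biproduct.hom_ext _ _ fun i => i.elim0
    have : Epi π := hS.epi_g
    have : Mono ι := hS.mono_f
    have : Mono π := by
      rw [Preadditive.mono_iff_cancel_zero]
      intro Z k hk
      obtain ⟨l, hl⟩ := KernelFork.IsLimit.lift' hS.fIsKernel k hk
      rw [← hl, hz.eq_of_tgt l 0, zero_comp]
    have : IsIso π := isIso_of_mono_of_epi π
    exact ⟨inv π, IsIso.inv_hom_id π⟩
  | succ n ih => exact (hs.biprod ih).of_iso (biproductSuccIso n P)

end biproducts

lemma threeTerm_d_neg_one {P Q R : C} (p : P ⟶ Q) (q : Q ⟶ R) (w : p ≫ q = 0) :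
    (threeTerm p q w).d (-1) 0 = p := by
  exact CochainComplex.of_d (threeTerm.X P Q R) (threeTerm.d p q) (-1)

lemma threeTerm_d_zero {P Q R : C} (p : P ⟶ Q) (q : Q ⟶ R) (w : p ≫ q = 0) :
    (threeTerm p q w).d 0 1 = q := by
  exact CochainComplex.of_d (threeTerm.X P Q R) (threeTerm.d p q) 0

/-- A morphism of three term complexes that vanishes in the derived category has vanishing
components in degrees `0` and `1`, if `Hom(Q, P')`, `Hom(R, Q')` and `Ext¹(R, P')` vanish.
The morphism factors as `K ⟶ A ⟶ L` with `A` acyclic. In the pushout of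
`0 → A⁻¹ / im → A⁰ → Z¹ → 0` along the map to `P'`, the map `R ⟶ Z¹` lifts; the composite of the
lift with the map of the pushout to `Q'` is a morphism `R ⟶ Q'`, so it vanishes. -/
lemma threeTerm_map_eq_zero [HasDerivedCategory.{w} C] {P Q R P' Q' R' : C} {p : P ⟶ Q} {q : Q ⟶ R}
    {w : p ≫ q = 0} {p' : P' ⟶ Q'} {q' : Q' ⟶ R'} {w' : p' ≫ q' = 0}
    {a : P ⟶ P'} {b : Q ⟶ Q'} {c : R ⟶ R'} (h : p ≫ b = a ≫ p') (h' : q ≫ c = b ≫ q')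
    (hφ : DerivedCategory.Q.map (threeTerm.map (w := w) (w' := w') a b c h h') = 0)
    (hQP : ∀ f : Q ⟶ P', f = 0) (hRQ : ∀ f : R ⟶ Q', f = 0) (hs : ExtSplit R P') :
    b = 0 ∧ c = 0 := by
  obtain ⟨A, u, v, hA, huv⟩ := exists_acyclic_factorization _ hφ
  have ex : ∀ n m k : ℤ, n + 1 = m → m + 1 = k → (A.sc' n m k).Exact := fun n m k h h' =>
    (A.exactAt_iff' n m k (by simp; omega) (by simp; omega)).mp (hA m)
  -- the short exact sequence `0 → A⁻¹ / im → A⁰ → Z¹ → 0`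
  have exm := ex (-2) (-1) 0 rfl rfl
  have ex0 := ex (-1) 0 1 rfl rfl
  have ex1 := ex 0 1 2 rfl rfl
  let S : ShortComplex C := ShortComplex.mk
    (cokernel.desc (A.d (-2) (-1)) (A.d (-1) 0) (A.d_comp_d _ _ _))
    (kernel.lift (A.d 1 2) (A.d 0 1) (A.d_comp_d _ _ _))
    (by
      rw [← cancel_mono (kernel.ι _), ← cancel_epi (cokernel.π _)]
      simp)
  have hS : S.ShortExact :=
    { exact := by
        have hg : S.g ≫ kernel.ι _ = A.d 0 1 := kernel.lift_ι _ _ _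
        have hf : cokernel.π _ ≫ S.f = A.d (-1) 0 := cokernel.π_desc _ _ _
        rw [ShortComplex.exact_iff_exact_up_to_refinements] at ex0 ⊢
        intro T x hx
        obtain ⟨T', e, he, y, hy⟩ := ex0 x (by
          change x ≫ A.d 0 1 = 0
          rw [← hg, ← Category.assoc, hx, zero_comp])
        exact ⟨T', e, he, y ≫ cokernel.π (A.d (-2) (-1)),
          hy.trans ((congrArg (y ≫ ·) hf.symm).trans (Category.assoc _ _ _).symm)⟩
      mono_f := exm.mono_cokernelDesc
      epi_g := ex1.epi_kernelLift }
  -- components of `u` and `v`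
  have hv2 : A.d (-2) (-1) ≫ v.f (-1) = 0 := by
    have : (threeTerm p' q' w').d (-2) (-1) = 0 := (isZero_zero C).eq_of_src _ _
    rw [← v.comm (-2) (-1), this, comp_zero]
  have hu1 : u.f 1 ≫ A.d 1 2 = 0 := by
    rw [u.comm 1 2]
    have : (threeTerm p q w).d 1 2 = 0 := (isZero_zero C).eq_of_tgt _ _
    rw [this, zero_comp]
  let v' : A.X (-1) ⟶ P' := v.f (-1)
  let v0 : A.X 0 ⟶ Q' := v.f 0
  let v1 : A.X 1 ⟶ R' := v.f 1
  let u0 : Q ⟶ A.X 0 := u.f 0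
  let u1 : R ⟶ A.X 1 := u.f 1
  have c1 : v' ≫ p' = A.d (-1) 0 ≫ v0 := by
    have := v.comm (-1) 0
    rwa [threeTerm_d_neg_one] at this
  have c2 : v0 ≫ q' = A.d 0 1 ≫ v1 := by
    have := v.comm 0 1
    rwa [threeTerm_d_zero] at this
  have c3 : u0 ≫ A.d 0 1 = q ≫ u1 := by
    have := u.comm 0 1
    rwa [threeTerm_d_zero] at this
  have hb : u0 ≫ v0 = b := congrArg (fun t => t.f 0) huv
  have hc : u1 ≫ v1 = c := congrArg (fun t => t.f 1) huv
  let ω : S.X₁ ⟶ P' := cokernel.desc _ v' hv2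
  let u1' : R ⟶ S.X₃ := kernel.lift _ u1 hu1
  obtain ⟨s, hs'⟩ := hs.lift hS ω u1'
  have hu1' : u1' ≫ kernel.ι (A.d 1 2) = u1 := kernel.lift_ι _ _ _
  have hg : S.g ≫ kernel.ι (A.d 1 2) = A.d 0 1 := kernel.lift_ι _ _ _
  let ψ : pushout S.f ω ⟶ Q' := pushout.desc v0 p' (by
    rw [← cancel_epi (cokernel.π (A.d (-2) (-1))), ← Category.assoc, ← Category.assoc]
    refine Eq.trans ?_ (c1.symm.trans ?_)
    · exact congrArg (· ≫ v0) (cokernel.π_desc _ _ _)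
    · exact congrArg (· ≫ p') (cokernel.π_desc _ _ _).symm)
  have hψ : pushout.inl S.f ω ≫ ψ = v0 := pushout.inl_desc _ _ _
  have hψ' : pushout.inr S.f ω ≫ ψ = p' := pushout.inr_desc _ _ _
  have k1 : ψ ≫ q' = pushoutProj S ω ≫ kernel.ι _ ≫ v1 := by
    refine pushout.hom_ext ?_ ?_
    · rw [← Category.assoc, hψ, reassoc_of% inl_pushoutProj S ω, ← Category.assoc, hg]
      exact c2
    · rw [← Category.assoc, hψ', reassoc_of% inr_pushoutProj S ω, zero_comp]
      exact w'
  have hc0 : c = 0 := by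
    have : s ≫ ψ ≫ q' = c := by
      rw [k1, ← Category.assoc, hs', ← Category.assoc, hu1', hc]
    rw [← this, ← Category.assoc, hRQ (s ≫ ψ), zero_comp]
  refine ⟨?_, hc0⟩
  -- `u0` and `q ≫ s` agree in the pushout, as their difference factors through `P'`
  have hd : (u0 ≫ pushout.inl S.f ω - q ≫ s) ≫ pushoutProj S ω = 0 := by
    rw [Preadditive.sub_comp, Category.assoc, Category.assoc, hs', inl_pushoutProj, sub_eq_zero,
      ← cancel_mono (kernel.ι _), Category.assoc, Category.assoc, hg, hu1']
    exact c3
  have hex := (pushoutProj_shortExact hS ω)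
  have hmono := hex.mono_f
  have : u0 ≫ pushout.inl S.f ω = q ≫ s := by
    rw [← sub_eq_zero, ← hex.exact.lift_f _ hd]
    exact (congrArg (· ≫ _) (hQP _)).trans zero_comp
  rw [← hb, ← hψ, ← Category.assoc, this, Category.assoc, hRQ (s ≫ ψ), comp_zero]

end homological


/-! ### Sections of sheaves of modules -/

section modules

variable {Y : Scheme.{0}}

/-- Restriction of sections of a sheaf of modules. -/
def rm (M : Y.Modules) {U V : Y.Opens} (h : U ≤ V) : Γ(M, V) →+ Γ(M, U) :=
  (M.presheaf.map (homOfLE h).op).hom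

variable {M N : Y.Modules}

lemma rm_rm {U V W : Y.Opens} (h : U ≤ V) (h' : V ≤ W) (s : Γ(M, W)) :
    rm M h (rm M h' s) = rm M (h.trans h') s := by
  have : M.presheaf.map (homOfLE (h.trans h')).op =
      M.presheaf.map (homOfLE h').op ≫ M.presheaf.map (homOfLE h).op := by
    rw [← Functor.map_comp]
    rfl
  change _ = (M.presheaf.map (homOfLE (h.trans h')).op).hom s
  rw [this]
  rfl

lemma rm_self {U : Y.Opens} (h : U ≤ U) (s : Γ(M, U)) : rm M h s = s := by
  have : M.presheaf.map (homOfLE h).op = 𝟙 _ := M.presheaf.map_id _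
  change (M.presheaf.map (homOfLE h).op).hom s = s
  rw [this]
  rfl

lemma rm_smul {U V : Y.Opens} (h : U ≤ V) (r : Γ(Y, V)) (s : Γ(M, V)) :
    rm M h (r • s) = res h r • rm M h s := Scheme.Modules.map_smul M (homOfLE h) r s

lemma app_rm (p : M ⟶ N) {U V : Y.Opens} (h : U ≤ V) (s : Γ(M, V)) :
    p.app U (rm M h s) = rm N h (p.app V s) :=
  (ConcreteCategory.congr_hom (p.mapPresheaf.naturality (homOfLE h).op) s)

lemma sec_ext {ι : Type} {U : ι → Y.Opens} {V : Y.Opens} (hV : V ≤ iSup U) (hU : ∀ i, U i ≤ V)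
    {s t : Γ(M, V)} (h : ∀ i, rm M (hU i) s = rm M (hU i) t) : s = t :=
  TopCat.Sheaf.eq_of_locally_eq' ⟨M.presheaf, M.isSheaf⟩ U V (fun i => homOfLE (hU i)) hV s t h

lemma sec_glue {ι : Type} {U : ι → Y.Opens} {V : Y.Opens} (hV : V ≤ iSup U) (hU : ∀ i, U i ≤ V)
    (s : ∀ i, Γ(M, U i)) (h : ∀ i j, rm M (inf_le_left : U i ⊓ U j ≤ U i) (s i) =
      rm M (inf_le_right : U i ⊓ U j ≤ U j) (s j)) :
    ∃ t : Γ(M, V), ∀ i, rm M (hU i) t = s i :=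
  (TopCat.Sheaf.existsUnique_gluing' ⟨M.presheaf, M.isSheaf⟩ U V (fun i => homOfLE (hU i)) hV s
    h).exists

lemma fun_ext {ι : Type} {U : ι → Y.Opens} {V : Y.Opens} (hV : V ≤ iSup U) (hU : ∀ i, U i ≤ V)
    {s t : Γ(Y, V)} (h : ∀ i, res (hU i) s = res (hU i) t) : s = t :=
  TopCat.Sheaf.eq_of_locally_eq' Y.sheaf U V (fun i => homOfLE (hU i)) hV s t h

/-- A morphism of sheaves of modules from compatible linear maps on sections. -/
def homMk' (φ : ∀ U : Y.Opens, Γ(M, U) →+ Γ(N, U))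
    (hφ : ∀ {U V : Y.Opens} (h : U ≤ V) (s : Γ(M, V)), φ U (rm M h s) = rm N h (φ V s))
    (hs : ∀ (U : Y.Opens) (r : Γ(Y, U)) (s : Γ(M, U)), φ U (r • s) = r • φ U s) : M ⟶ N :=
  (⟨PresheafOfModules.homMk
    { app := fun U => AddCommGrpCat.ofHom (φ U.unop)
      naturality := fun U V g => by
        ext s
        exact hφ g.unop.le s }
    (fun U r s => hs U.unop r s)⟩ : SheafOfModules.Hom _ _)

lemma hom_ext_sec {p q : M ⟶ N} (h : ∀ (U : Y.Opens) (s : Γ(M, U)), p.app U s = q.app U s) :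
    p = q := by
  ext U s
  exact h U s

end modules

/-! ### Sections and morphisms of the twisted sheaves -/

section twist

variable {σ : Type} {Y : Scheme.{0}} {f : Y ⟶ PP σ}

variable (f) in
/-- The transition function `X_b / X_a` on an open set where both coordinates are invertible. -/
def tr (a b : σ) {U : Y.Opens} (ha : U ≤ chart f a) (hb : U ≤ chart f b) : Γ(Y, U)ˣ :=
  Units.map (res (le_inf ha hb)).toMonoidHom (trans f a b)

lemma tr_val (a b : σ) {U : Y.Opens} (ha : U ≤ chart f a) (hb : U ≤ chart f b) :
    (tr f a b ha hb : Γ(Y, U)) = res ha (ratio f a b) := res_res _ _ _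

lemma tr_self (a : σ) {U : Y.Opens} (ha : U ≤ chart f a) : tr f a a ha ha = 1 := by
  ext
  exact (tr_val _ _ _ _).trans ((congrArg _ (dehom_X_self f a)).trans (map_one _))

lemma tr_mul (a b c : σ) {U : Y.Opens} (ha : U ≤ chart f a) (hb : U ≤ chart f b)
    (hc : U ≤ chart f c) : tr f a b ha hb * tr f b c hb hc = tr f a c ha hc := by
  ext
  rw [Units.val_mul, tr_val, tr_val, tr_val, dehom_eq f a b (X_mem c) ha hb, pow_one]

lemma tr_inv (a b : σ) {U : Y.Opens} (ha : U ≤ chart f a) (hb : U ≤ chart f b) :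
    (tr f a b ha hb)⁻¹ = tr f b a hb ha := by
  rw [inv_eq_iff_mul_eq_one, tr_mul, tr_self]

lemma res_tr (a b : σ) {U V : Y.Opens} (h : U ≤ V) (ha : V ≤ chart f a) (hb : V ≤ chart f b)
    (k : ℤ) : res h ((tr f a b ha hb ^ k : Γ(Y, V)ˣ) : Γ(Y, V)) =
      ((tr f a b (h.trans ha) (h.trans hb) ^ k : Γ(Y, U)ˣ) : Γ(Y, U)) := by
  have : Units.map (res h).toMonoidHom (tr f a b ha hb) = tr f a b (h.trans ha) (h.trans hb) := by
    ext
    exact res_res _ _ _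
  rw [← this, ← map_zpow]
  rfl

/-- The coefficient of a section of `𝒪_Y(k)` with respect to the generator `X_a ^ k`. -/
def coef {k : ℤ} {U : Y.Opens} (s : TwSec f k U) (a : σ) {V : Y.Opens} (h : V ≤ U)
    (ha : V ≤ chart f a) : Γ(Y, V) := res (le_inf h ha) (s.1 a)

lemma coef_eq {k : ℤ} {U : Y.Opens} (s : TwSec f k U) (a b : σ) {V : Y.Opens} (h : V ≤ U)
    (ha : V ≤ chart f a) (hb : V ≤ chart f b) :
    coef s a h ha = ((tr f a b ha hb ^ k : Γ(Y, V)ˣ) : Γ(Y, V)) * coef s b h hb := by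
  have := congrArg (res (show V ≤ U ⊓ (chart f a ⊓ chart f b) from le_inf h (le_inf ha hb))) (s.2 a b)
  rw [map_mul, res_res, res_res, res_res] at this
  rw [coef, this, ← res_tr a b (le_inf ha hb) inf_le_left inf_le_right]
  congr 4
  ext
  exact (res_self _ _).symm

lemma coef_restr {k : ℤ} {U W : Y.Opens} (s : TwSec f k W) (a : σ) {V : Y.Opens} (h : V ≤ U)
    (hW : U ≤ W) (ha : V ≤ chart f a) : coef (TwSec.restr hW s) a h ha = coef s a (h.trans hW) ha :=
  res_res _ _ _

lemma res_coef {k : ℤ} {U : Y.Opens} (s : TwSec f k U) (a : σ) {V W : Y.Opens} (h : V ≤ U)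
    (ha : V ≤ chart f a) (hW : W ≤ V) :
    res hW (coef s a h ha) = coef s a (hW.trans h) (hW.trans ha) := res_res _ _ _

lemma coef_smul {k : ℤ} {U : Y.Opens} (r : Γ(Y, U)) (s : TwSec f k U) (a : σ) {V : Y.Opens}
    (h : V ≤ U) (ha : V ≤ chart f a) : coef (r • s) a h ha = res h r * coef s a h ha := by
  rw [coef, TwSec.smul_apply, map_mul, res_res]
  rfl

lemma coef_add {k : ℤ} {U : Y.Opens} (r s : TwSec f k U) (a : σ) {V : Y.Opens}
    (h : V ≤ U) (ha : V ≤ chart f a) : coef (r + s) a h ha = coef r a h ha + coef s a h ha :=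
  map_add _ _ _

lemma coef_csmul {k : ℤ} {U : Y.Opens} (c : ℂ) (s : TwSec f k U) (a : σ) {V : Y.Opens}
    (h : V ≤ U) (ha : V ≤ chart f a) :
    coef (c • s) a h ha = res le_top (cst f c) * coef s a h ha := by
  rw [coef, TwSec.csmul_apply, map_mul, res_res]
  rfl

lemma coef_mul {k m l : ℤ} (e : k + m = l) {U : Y.Opens} (s : TwSec f k U) (t : H0 f m)
    (a : σ) {V : Y.Opens} (h : V ≤ U) (ha : V ≤ chart f a) :
    coef (TwSec.mul e s t) a h ha = coef s a h ha * coef t a le_top ha := by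
  rw [coef, TwSec.mul_apply, map_mul, res_res]
  rfl

lemma TwSec.ext_chart {k : ℤ} {U : Y.Opens} {s t : TwSec f k U} (a : σ) (ha : U ≤ chart f a)
    (h : coef s a le_rfl ha = coef t a le_rfl ha) : s = t := by
  refine Subtype.ext (funext fun b => ?_)
  have key : ∀ s : TwSec f k U, s.1 b = ((tr f b a inf_le_right (inf_le_left.trans ha) ^ k :
      Γ(Y, U ⊓ chart f b)ˣ) : Γ(Y, U ⊓ chart f b)) * res inf_le_left (coef s a le_rfl ha) := by
    intro s
    rw [res_coef, ← coef_eq s b a inf_le_left inf_le_right (inf_le_left.trans ha)]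
    exact (res_self _ _).symm
  rw [key, key, h]

/-- The section `r X_a ^ k` of `𝒪_Y(k)` over an open subset of the chart `X_a ≠ 0`. -/
def TwSec.ofChart (k : ℤ) (a : σ) {U : Y.Opens} (ha : U ≤ chart f a) (r : Γ(Y, U)) : TwSec f k U :=
  ⟨fun b => ((tr f b a inf_le_right (inf_le_left.trans ha) ^ k :
      Γ(Y, U ⊓ chart f b)ˣ) : Γ(Y, U ⊓ chart f b)) * res inf_le_left r, fun b c => by
    have : ((trans f b c ^ k : Γ(Y, chart f b ⊓ chart f c)ˣ) : Γ(Y, chart f b ⊓ chart f c)) =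
        ((tr f b c inf_le_left inf_le_right ^ k : Γ(Y, chart f b ⊓ chart f c)ˣ) :
          Γ(Y, chart f b ⊓ chart f c)) := by
      congr 2
      ext
      exact (res_self _ _).symm
    rw [this, map_mul, map_mul, res_res, res_res, res_tr, res_tr, res_tr, ← mul_assoc,
      ← Units.val_mul, ← mul_zpow, tr_mul]⟩

lemma coef_ofChart (k : ℤ) (a : σ) {U : Y.Opens} (ha : U ≤ chart f a) (r : Γ(Y, U)) (b : σ)
    {V : Y.Opens} (h : V ≤ U) (hb : V ≤ chart f b) :
    coef (TwSec.ofChart k a ha r) b h hb =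
      ((tr f b a hb (h.trans ha) ^ k : Γ(Y, V)ˣ) : Γ(Y, V)) * res h r := by
  unfold coef TwSec.ofChart
  rw [map_mul, res_res, res_tr]

lemma coef_ofChart_self (k : ℤ) (a : σ) {U : Y.Opens} (ha : U ≤ chart f a) (r : Γ(Y, U))
    {V : Y.Opens} (h : V ≤ U) : coef (TwSec.ofChart k a ha r) a h (h.trans ha) = res h r := by
  rw [coef_ofChart, tr_self, one_zpow, Units.val_one, one_mul]

lemma TwSec.eq_ofChart {k : ℤ} (a : σ) {U : Y.Opens} (ha : U ≤ chart f a) (s : TwSec f k U) :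
    s = coef s a le_rfl ha • TwSec.ofChart k a ha 1 :=
  TwSec.ext_chart a ha (by
    rw [coef_smul, coef_ofChart_self, map_one, mul_one]
    exact (res_self _ _).symm)

/-- Functions on the charts that are compatible with the transition functions are the
coefficients of a section of `𝒪_Y(k)`. -/
lemma TwSec.exists_of_coef {k : ℤ} {U : Y.Opens} (t : ∀ a : σ, Γ(Y, U ⊓ chart f a))
    (h : ∀ a b, res (show U ⊓ (chart f a ⊓ chart f b) ≤ U ⊓ chart f a from
        inf_le_inf_left _ inf_le_left) (t a) =
      ((tr f a b (inf_le_right.trans inf_le_left) (inf_le_right.trans inf_le_right) ^ k :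
        Γ(Y, U ⊓ (chart f a ⊓ chart f b))ˣ) : Γ(Y, U ⊓ (chart f a ⊓ chart f b))) *
      res (inf_le_inf_left _ inf_le_right) (t b)) :
    ∃ s : TwSec f k U, ∀ a {V : Y.Opens} (hV : V ≤ U) (ha : V ≤ chart f a),
      coef s a hV ha = res (le_inf hV ha) (t a) := by
  refine ⟨⟨t, fun a b => ?_⟩, fun a V hV ha => rfl⟩
  rw [h, ← res_tr a b inf_le_right inf_le_left inf_le_right]
  congr 4
  ext
  exact res_self _ _

lemma iSup_chart (f : Y ⟶ PP σ) : (⨆ a, chart f a) = ⊤ := by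
  have h := Proj.iSup_basicOpen_eq_top' (MvPolynomial.homogeneousSubmodule σ ℂ) MvPolynomial.X
    (fun a => ⟨1, X_mem a⟩) (by
      rw [eq_top_iff]
      rintro p -
      induction p using MvPolynomial.induction_on with
      | C c =>
        exact Subalgebra.algebraMap_mem _
          (⟨MvPolynomial.C c, MvPolynomial.isHomogeneous_C σ c⟩ :
            MvPolynomial.homogeneousSubmodule σ ℂ 0)
      | add p q hp hq => exact add_mem hp hq
      | mul_X p a hp => exact mul_mem hp (Algebra.subset_adjoin ⟨a, rfl⟩))
  have h2 := congrArg (fun U => f ⁻¹ᵁ U) h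
  rw [Scheme.Hom.preimage_iSup] at h2
  exact h2

lemma TwSec.ext_coef {k : ℤ} {U : Y.Opens} {s t : TwSec f k U}
    (h : ∀ a {V : Y.Opens} (hV : V ≤ U) (ha : V ≤ chart f a), coef s a hV ha = coef t a hV ha) :
    s = t :=
  Subtype.ext (funext fun a => by
    have := h a (V := U ⊓ chart f a) inf_le_left inf_le_right
    rwa [coef, coef, res_self, res_self] at this)

/-- The action of a morphism from `𝒪_Y(k)` to a sheaf of modules on sections. -/
def twApp {k : ℤ} {M : Y.Modules} (p : twist f k ⟶ M) (U : Y.Opens) : TwSec f k U →+ Γ(M, U) :=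
  (p.app U).hom

lemma twApp_restr {k : ℤ} {M : Y.Modules} (p : twist f k ⟶ M) {U V : Y.Opens} (h : U ≤ V)
    (s : TwSec f k V) : twApp p U (TwSec.restr h s) = rm M h (twApp p V s) := app_rm p h _

lemma twApp_smul {k : ℤ} {M : Y.Modules} (p : twist f k ⟶ M) {U : Y.Opens} (r : Γ(Y, U))
    (s : TwSec f k U) : twApp p U (r • s) = r • twApp p U s := Scheme.Modules.Hom.app_smul p r _

lemma homApp_restr {k l : ℤ} (p : twist f k ⟶ twist f l) {U V : Y.Opens} (h : U ≤ V)
    (s : TwSec f k V) : homApp p U (TwSec.restr h s) = TwSec.restr h (homApp p V s) := app_rm p h _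

lemma homApp_smul {k l : ℤ} (p : twist f k ⟶ twist f l) {U : Y.Opens} (r : Γ(Y, U))
    (s : TwSec f k U) : homApp p U (r • s) = r • homApp p U s := Scheme.Modules.Hom.app_smul p r _

lemma homApp_mulHom {k m l : ℤ} (e : k + m = l) (t : H0 f m) {U : Y.Opens} (s : TwSec f k U) :
    homApp (mulHom e t) U s = TwSec.mul e s t := rfl

lemma TwSec.restr_ofChart {k : ℤ} (a : σ) {U V : Y.Opens} (h : U ≤ V) (ha : V ≤ chart f a)
    (r : Γ(Y, V)) :
    TwSec.restr h (TwSec.ofChart k a ha r) = TwSec.ofChart k a (h.trans ha) (res h r) :=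
  TwSec.ext_chart a (h.trans ha) (by
    rw [coef_restr, coef_ofChart_self, coef_ofChart_self, res_res])

/-- Two morphisms from `𝒪_Y(k)` that agree on the local generators are equal. -/
lemma twist_hom_ext {k : ℤ} {M : Y.Modules} {p q : twist f k ⟶ M}
    (h : ∀ (a : σ) (U : Y.Opens) (ha : U ≤ chart f a),
      twApp p U (TwSec.ofChart k a ha 1) = twApp q U (TwSec.ofChart k a ha 1)) : p = q := by
  refine hom_ext_sec fun U s => ?_
  refine sec_ext (U := fun a => U ⊓ chart f a) ?_ (fun a => inf_le_left) fun a => ?_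
  · rw [← inf_iSup_eq, iSup_chart, inf_top_eq]
  · have key : ∀ (p : twist f k ⟶ M) (s : TwSec f k U), rm M (inf_le_left : U ⊓ chart f a ≤ U)
        (twApp p U s) = coef s a inf_le_left inf_le_right •
          twApp p (U ⊓ chart f a) (TwSec.ofChart k a inf_le_right 1) := by
      intro p s
      rw [← twApp_restr, TwSec.eq_ofChart a inf_le_right (TwSec.restr _ s), twApp_smul, coef_restr]
    refine (key p s).trans (Eq.trans ?_ (key q s).symm)
    rw [h]

/-- A morphism from `𝒪_Y(k)` is defined by compatible images of the local generators. -/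
lemma exists_twist_hom {k : ℤ} {M : Y.Modules} {ι : Type} (a : ι → σ) (U : ι → Y.Opens)
    (hU : ⊤ ≤ iSup U) (ha : ∀ i, U i ≤ chart f (a i)) (t : ∀ i, Γ(M, U i))
    (ht : ∀ i j, rm M (inf_le_left : U i ⊓ U j ≤ U i) (t i) =
      ((tr f (a j) (a i) (inf_le_right.trans (ha j)) (inf_le_left.trans (ha i)) ^ k :
        Γ(Y, U i ⊓ U j)ˣ) : Γ(Y, U i ⊓ U j)) • rm M (inf_le_right : U i ⊓ U j ≤ U j) (t j)) :
    ∃ p : twist f k ⟶ M, ∀ i, twApp p (U i) (TwSec.ofChart k (a i) (ha i) 1) = t i := by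
  have cov : ∀ V : Y.Opens, V ≤ ⨆ i, V ⊓ U i := fun V => by
    rw [← inf_iSup_eq]
    exact le_inf le_rfl (le_top.trans hU)
  have key : ∀ (V : Y.Opens) (s : TwSec f k V), ∃ z : Γ(M, V), ∀ i {W : Y.Opens} (hV : W ≤ V)
      (hi : W ≤ U i), rm M hV z = coef s (a i) hV (hi.trans (ha i)) • rm M hi (t i) := by
    intro V s
    obtain ⟨z, hz⟩ := sec_glue (M := M) (U := fun i => V ⊓ U i) (cov V) (fun i => inf_le_left)
      (fun i => coef s (a i) inf_le_left (inf_le_right.trans (ha i)) • rm M inf_le_right (t i))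
      (by
        intro i j
        have := congrArg (rm M (show V ⊓ U i ⊓ (V ⊓ U j) ≤ U i ⊓ U j from
          inf_le_inf inf_le_right inf_le_right)) (ht i j)
        rw [rm_rm, rm_smul, rm_rm, res_tr] at this
        rw [rm_smul, rm_smul, res_coef, res_coef, rm_rm, rm_rm, this, smul_smul,
          coef_eq s (a j) (a i) _ (inf_le_right.trans (inf_le_right.trans (ha j)))
            (inf_le_left.trans (inf_le_right.trans (ha i))), mul_comm])
    refine ⟨z, fun i W hV hi => ?_⟩
    have := congrArg (rm M (le_inf hV hi)) (hz i)
    rwa [rm_rm, rm_smul, res_coef, rm_rm] at this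
  choose z hz using key
  have huniq : ∀ {V : Y.Opens} (x y : Γ(M, V)), (∀ i, rm M (inf_le_left : V ⊓ U i ≤ V) x =
      rm M (inf_le_left : V ⊓ U i ≤ V) y) → x = y := fun {V} x y h =>
    sec_ext (cov V) (fun i => inf_le_left) h
  refine ⟨homMk' (M := twist f k) (N := M)
    (fun V => AddMonoidHom.mk' (fun s : TwSec f k V => z V s) fun s s' => ?_) ?_ ?_, ?_⟩
  · refine huniq _ _ fun i => ?_
    rw [map_add]
    refine (hz V _ i inf_le_left inf_le_right).trans ?_
    refine (congrArg (· • _) (coef_add s s' (a i) _ _)).trans ?_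
    rw [add_smul]
    exact congrArg₂ _ (hz V s i inf_le_left inf_le_right).symm
      (hz V s' i inf_le_left inf_le_right).symm
  · intro V W h s
    refine huniq _ _ fun i => ?_
    rw [rm_rm]
    refine (hz V _ i inf_le_left inf_le_right).trans ?_
    refine Eq.trans ?_ (hz W _ i _ inf_le_right).symm
    exact congrArg (· • _) (coef_restr s (a i) _ h _)
  · intro V r s
    refine huniq _ _ fun i => ?_
    rw [rm_smul]
    refine (hz V _ i inf_le_left inf_le_right).trans ?_
    refine (congrArg (· • _) (coef_smul r s (a i) _ _)).trans ?_
    rw [mul_smul]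
    exact congrArg _ (hz V _ i inf_le_left inf_le_right).symm
  · intro i
    have := hz (U i) (TwSec.ofChart k (a i) (ha i) 1) i le_rfl le_rfl
    rw [rm_self, rm_self, coef_ofChart_self, map_one, one_smul] at this
    exact this

lemma homApp_mulHom_ofChart {k m l : ℤ} (e : k + m = l) (t : H0 f m) (a : σ) {U : Y.Opens}
    (ha : U ≤ chart f a) : homApp (mulHom e t) U (TwSec.ofChart k a ha 1) =
      coef t a le_top ha • TwSec.ofChart l a ha 1 :=
  TwSec.ext_chart a ha (by
    rw [homApp_mulHom, coef_mul, coef_smul, coef_ofChart_self,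
      coef_ofChart_self, map_one, one_mul, mul_one, res_self])

/-- Morphisms `𝒪_Y(k) ⟶ 𝒪_Y(l)` are multiplications by global sections of `𝒪_Y(l - k)`. -/
lemma mulHom_surjective {k m l : ℤ} (e : k + m = l) (p : twist f k ⟶ twist f l) :
    ∃ t : H0 f m, mulHom e t = p := by
  let c : ∀ (a : σ), Γ(Y, ⊤ ⊓ chart f a) := fun a =>
    coef (homApp p _ (TwSec.ofChart k a inf_le_right 1)) a le_rfl inf_le_right
  have hc : ∀ a {V : Y.Opens} (ha : V ≤ chart f a), res (le_inf le_top ha) (c a) =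
      coef (homApp p V (TwSec.ofChart k a ha 1)) a le_rfl ha := by
    intro a V ha
    have h1 := TwSec.restr_ofChart (k := k) a (le_inf le_top ha : V ≤ ⊤ ⊓ chart f a) inf_le_right 1
    rw [map_one] at h1
    rw [res_coef, ← h1, homApp_restr, coef_restr]
  obtain ⟨t, ht⟩ := TwSec.exists_of_coef (k := m) c (by
    intro a b
    have h1 : ⊤ ⊓ (chart f a ⊓ chart f b) ≤ chart f a := inf_le_right.trans inf_le_left
    have h2 : ⊤ ⊓ (chart f a ⊓ chart f b) ≤ chart f b := inf_le_right.trans inf_le_right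
    refine (hc a h1).trans (Eq.trans ?_ (congrArg _ (hc b h2)).symm)
    rw [TwSec.eq_ofChart b h2 (TwSec.ofChart k a h1 1), homApp_smul, coef_smul,
      res_self, coef_ofChart, map_one, mul_one, coef_eq _ a b le_rfl h1 h2,
      ← mul_assoc, ← Units.val_mul, ← tr_inv a b h1 h2, inv_zpow, ← zpow_neg, ← zpow_add]
    congr 3
    omega)
  refine ⟨t, mulHom_ext fun U s b => congrArg (fun s => s.1 b) (?_ : homApp _ U s = homApp p U s)⟩
  refine congrArg (fun p => homApp p U s) (twist_hom_ext fun a U ha => ?_)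
  refine (homApp_mulHom_ofChart e t a ha).trans ?_
  rw [ht, hc]
  refine TwSec.ext_chart a ha ?_
  rw [coef_smul, coef_ofChart_self, map_one, mul_one, res_self]
  rfl

lemma mulHom_injective {k m l : ℤ} (e : k + m = l) {s t : H0 f m}
    (h : mulHom (f := f) e s = mulHom e t) : s = t := by
  refine TwSec.ext_coef fun a V hV ha => ?_
  have h1 := homApp_mulHom_ofChart e s a ha
  rw [h, homApp_mulHom_ofChart] at h1
  have h2 := congrArg (fun s : TwSec f l V => coef s a le_rfl ha) h1
  simp only [coef_smul, coef_ofChart_self, map_one, mul_one, res_self] at h2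
  exact h2.symm

end twist


/-! ### Local exactness of sequences of sheaves of modules -/

section exactness

variable {Y : Scheme.{0}} {M N K : Y.Modules}

/-- Epimorphisms of sheaves of modules are surjective on sections, locally. -/
lemma exists_lift_of_epi (π : M ⟶ N) [Epi π] {U : Y.Opens} (s : Γ(N, U)) {x : Y} (hx : x ∈ U) :
    ∃ (V : Y.Opens) (hV : V ≤ U) (t : Γ(M, V)), x ∈ V ∧ π.app V t = rm N hV s := by
  let R := Y.ringCatSheaf
  let G : SheafOfModules R ⥤ PresheafOfModules R.obj :=
    SheafOfModules.forget R ⋙ PresheafOfModules.restrictScalars (𝟙 R.obj)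
  let adj := PresheafOfModules.sheafificationAdjunction (𝟙 R.obj)
  let M' : SheafOfModules R := M
  let N' : SheafOfModules R := N
  let π' : M' ⟶ N' := π
  have hπ' : Epi π' := ‹Epi π›
  let c : G.obj N' ⟶ cokernel (G.map π') := cokernel.π (G.map π')
  obtain ⟨k, hk⟩ := G.map_surjective (X := N')
    (Y := (PresheafOfModules.sheafification (𝟙 R.obj)).obj (cokernel (G.map π'))) (c ≫ adj.unit.app (cokernel (G.map π')))
  have hk0 : k = 0 := by
    rw [← cancel_epi π', comp_zero]
    apply G.map_injective
    rw [G.map_comp, hk, ← Category.assoc, cokernel.condition, zero_comp]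
    rfl
  have h0 : c ≫ adj.unit.app (cokernel (G.map π')) = 0 := by
    rw [← hk, hk0]
    rfl
  have h1 : (PresheafOfModules.toPresheaf R.obj).map c ≫
      CategoryTheory.toSheafify (Opens.grothendieckTopology Y) (cokernel (G.map π')).presheaf = 0 := by
    have := congrArg (PresheafOfModules.toPresheaf R.obj).map h0
    rw [Functor.map_comp] at this
    exact this
  let cs : ToType ((cokernel (G.map π')).presheaf.obj (.op U)) :=
    ((PresheafOfModules.toPresheaf R.obj).map c).app (.op U) s
  have h2 : (CategoryTheory.toSheafify (Opens.grothendieckTopology Y)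
      (cokernel (G.map π')).presheaf).app (.op U) cs = 
      (CategoryTheory.toSheafify (Opens.grothendieckTopology Y)
      (cokernel (G.map π')).presheaf).app (.op U) 0 := by
    rw [map_zero]
    exact ConcreteCategory.congr_hom (NatTrans.congr_app h1 (.op U)) s
  obtain ⟨V, i, hi, hxV⟩ := Presheaf.equalizerSieve_mem (Opens.grothendieckTopology Y)
    (CategoryTheory.toSheafify (Opens.grothendieckTopology Y) (cokernel (G.map π')).presheaf)
    cs 0 h2 x hx
  have h3 : (c.app (.op V)).hom (rm N i.le s) = 0 := by
    have : (cokernel (G.map π')).presheaf.map i.op cs = 0 := by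
      rw [Presheaf.equalizerSieve_apply] at hi
      rw [hi, map_zero]
    refine Eq.trans ?_ this
    exact ConcreteCategory.congr_hom
      (((PresheafOfModules.toPresheaf R.obj).map c).naturality i.op) s
  have ex : (ShortComplex.mk (G.map π') c (cokernel.condition _)).Exact :=
    ShortComplex.exact_cokernel _
  have ex' := ex.map (PresheafOfModules.evaluation R.obj (.op V))
  rw [ShortComplex.moduleCat_exact_iff] at ex'
  obtain ⟨t, ht⟩ := ex' (rm N i.le s) h3
  exact ⟨V, i.le, t, hxV, ht⟩

lemma app_injective_of_mono (π : M ⟶ N) [Mono π] (U : Y.Opens) : Function.Injective (π.app U) := by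
  have : Mono ((Scheme.Modules.toPresheafOfModules Y).map π) := inferInstance
  exact PresheafOfModules.injective_of_mono ((Scheme.Modules.toPresheafOfModules Y).map π) (.op U)

/-- Taking sections is left exact. -/
lemma exists_of_exact {S : ShortComplex Y.Modules} (hS : S.Exact) [Mono S.f] {U : Y.Opens}
    (s : Γ(S.X₂, U)) (hs : S.g.app U s = 0) : ∃ t : Γ(S.X₁, U), S.f.app U t = s := by
  have h := hS.fIsKernel
  have h' := isLimitForkMapOfIsLimit' (Scheme.Modules.toPresheafOfModules Y) S.zero h
  have ex : (S.map (Scheme.Modules.toPresheafOfModules Y)).Exact :=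
    ShortComplex.exact_of_f_is_kernel _ h'
  have ex' := ex.map (PresheafOfModules.evaluation Y.ringCatSheaf.obj (.op U))
  rw [ShortComplex.moduleCat_exact_iff] at ex'
  exact ex' s hs

end exactness


/-! ### Pullback of the twisted sheaves -/

section pullback

variable {σ : Type} {Y Z : Scheme.{0}} (j : Z ⟶ Y) (i : Y ⟶ PP σ)

lemma twist_hom_ext_chart {f : Y ⟶ PP σ} {k : ℤ} {M : Y.Modules} {p q : twist f k ⟶ M}
    (h : ∀ a, twApp p (chart f a) (TwSec.ofChart k a le_rfl 1) =
      twApp q (chart f a) (TwSec.ofChart k a le_rfl 1)) : p = q := by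
  refine twist_hom_ext fun a U ha => ?_
  have key : (TwSec.ofChart k a ha 1 : TwSec f k U) =
      TwSec.restr ha (TwSec.ofChart k a le_rfl 1) := by
    rw [TwSec.restr_ofChart, map_one]
  rw [key, twApp_restr, twApp_restr, h]

lemma app_res {U V : Y.Opens} (h : U ≤ V) (s : Γ(Y, V)) :
    (j.app U).hom (res h s) = res (j.preimage_mono h) ((j.app V).hom s) := by
  have := congrArg (fun g => g.hom s) (j.naturality (homOfLE h).op)
  exact this

lemma dehom_comp (a : σ) {m : ℕ} {p : MvPolynomial σ ℂ}
    (hp : p ∈ MvPolynomial.homogeneousSubmodule σ ℂ m) :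
    dehom (j ≫ i) a hp = (j.app (chart i a)).hom (dehom i a hp) := by
  unfold dehom
  rw [Scheme.Hom.comp_app]
  rfl

variable {i} in
lemma preimage_le_chart {a : σ} {U : Y.Opens} (h : U ≤ chart i a) :
    j ⁻¹ᵁ U ≤ chart (j ≫ i) a := j.preimage_mono h

lemma app_tr (a b : σ) {U : Y.Opens} (ha : U ≤ chart i a) (hb : U ≤ chart i b) (k : ℤ) :
    (j.app U).hom ((tr i a b ha hb ^ k : Γ(Y, U)ˣ) : Γ(Y, U)) =
      ((tr (j ≫ i) a b (preimage_le_chart j ha) (preimage_le_chart j hb) ^ k : Γ(Z, j ⁻¹ᵁ U)ˣ) :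
        Γ(Z, j ⁻¹ᵁ U)) := by
  have : Units.map (j.app U).hom.toMonoidHom (tr i a b ha hb) =
      tr (j ≫ i) a b (preimage_le_chart j ha) (preimage_le_chart j hb) := by
    ext
    refine Eq.trans (congrArg (j.app U).hom (tr_val a b ha hb)) ?_
    refine Eq.trans ?_ (tr_val a b _ _).symm
    refine (app_res j ha _).trans ?_
    exact congrArg (res (preimage_le_chart j ha)) (dehom_comp j i a (X_mem b)).symm
  rw [← this, ← map_zpow]
  rfl

/-- The pullback of sections of `𝒪_Y(k)` along `j : Z ⟶ Y`. -/
def pullTw {k : ℤ} {U : Y.Opens} : TwSec i k U →+ TwSec (j ≫ i) k (j ⁻¹ᵁ U) where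
  toFun s := ⟨fun a => (j.app (U ⊓ chart i a)).hom (s.1 a), fun a b => by
    have h := congrArg (j.app _).hom (s.2 a b)
    rw [map_mul, app_res, app_res, app_res] at h
    refine h.trans ?_
    congr 2
    have h1 := app_tr j i a b (U := chart i a ⊓ chart i b) inf_le_left inf_le_right k
    have h2 : ∀ (X : Scheme.{0}) (f : X ⟶ PP σ), tr f a b (U := chart f a ⊓ chart f b) inf_le_left inf_le_right
        = trans f a b := fun X f => by
      ext
      exact res_self _ _
    rw [h2] at h1
    refine h1.trans ?_
    exact congrArg (fun u => Units.val (u ^ k)) (h2 Z (j ≫ i))⟩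
  map_zero' := Subtype.ext (funext fun a => map_zero _)
  map_add' s t := Subtype.ext (funext fun a => map_add _ _ _)

lemma coef_pullTw {k : ℤ} {U : Y.Opens} (s : TwSec i k U) (a : σ) {V : Y.Opens} (h : V ≤ U)
    (ha : V ≤ chart i a) : coef (pullTw j i s) a (j.preimage_mono h) (preimage_le_chart j ha) =
      (j.app V).hom (coef s a h ha) := by
  exact (app_res j (le_inf h ha) (s.1 a)).symm

lemma pullTw_ofChart {k : ℤ} {U : Y.Opens} (a : σ) (ha : U ≤ chart i a) (r : Γ(Y, U)) :
    pullTw j i (TwSec.ofChart k a ha r) =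
      TwSec.ofChart k a (preimage_le_chart j ha) ((j.app U).hom r) := by
  refine TwSec.ext_chart a (preimage_le_chart j ha) ?_
  refine (coef_pullTw j i (TwSec.ofChart k a ha r) a le_rfl ha).trans ?_
  rw [coef_ofChart_self k a ha r le_rfl, coef_ofChart_self k a _ _ le_rfl]
  exact app_res j le_rfl r

lemma pullTw_mul {k m l : ℤ} (e : k + m = l) {U : Y.Opens} (s : TwSec i k U) (t : H0 i m) :
    pullTw j i (TwSec.mul e s t) =
      TwSec.mul e (pullTw j i s) (pullTw j i t : TwSec (j ≫ i) m (j ⁻¹ᵁ ⊤)) := by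
  refine Subtype.ext (funext fun a => ?_)
  refine (map_mul (j.app (U ⊓ chart i a)).hom (s.1 a) _).trans ?_
  rw [app_res]
  rfl

/-- Pullback of sections as a morphism `𝒪_Y(k) ⟶ j_* 𝒪_Z(k)`. -/
def pullHom (k : ℤ) : twist i k ⟶ (Scheme.Modules.pushforward j).obj (twist (j ≫ i) k) :=
  homMk' (M := twist i k) (N := (Scheme.Modules.pushforward j).obj (twist (j ≫ i) k))
    (fun U => (pullTw j i : TwSec i k U →+ TwSec (j ≫ i) k (j ⁻¹ᵁ U)))
    (fun {U V} h s => Subtype.ext (funext fun a => app_res j _ _))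
    (fun U r s => Subtype.ext (funext fun a => by
      refine (map_mul (j.app (U ⊓ chart i a)).hom _ _).trans ?_
      rw [app_res]
      rfl))

/-- The comparison morphism `j^* 𝒪_Y(k) ⟶ 𝒪_Z(k)`. -/
def pullTwistHom (k : ℤ) : (Scheme.Modules.pullback j).obj (twist i k) ⟶ twist (j ≫ i) k :=
  ((Scheme.Modules.pullbackPushforwardAdjunction j).homEquiv _ _).symm (pullHom j i k)

lemma unit_pullTwistHom (k : ℤ) :
    (Scheme.Modules.pullbackPushforwardAdjunction j).unit.app (twist i k) ≫
      (Scheme.Modules.pushforward j).map (pullTwistHom j i k) = pullHom j i k := by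
  exact (Adjunction.homEquiv_unit _ _ _ _).symm.trans (Equiv.apply_symm_apply _ _)

/-- The canonical isomorphism `j^* 𝒪_Y(k) ≅ 𝒪_Z(k)`. The inverse sends the local
generator `X_a ^ k` to the pullback of `X_a ^ k`. -/
lemma exists_pullTwist_inv (k : ℤ) : ∃ ρ : twist (j ≫ i) k ⟶ (Scheme.Modules.pullback j).obj (twist i k),
    pullTwistHom j i k ≫ ρ = 𝟙 _ ∧ ρ ≫ pullTwistHom j i k = 𝟙 _ := by
  let L := (Scheme.Modules.pullback j).obj (twist i k)
  let η : twist i k ⟶ (Scheme.Modules.pushforward j).obj L :=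
    (Scheme.Modules.pullbackPushforwardAdjunction j).unit.app (twist i k)
  have hη : ∀ U (s : TwSec i k U), Scheme.Modules.Hom.app (M := L) (pullTwistHom j i k) (j ⁻¹ᵁ U) (twApp η U s) =
      (pullTw j i s : TwSec (j ≫ i) k (j ⁻¹ᵁ U)) := fun U s =>
    ConcreteCategory.congr_hom (congrArg (fun p => Scheme.Modules.Hom.app p U)
      (unit_pullTwistHom j i k)) s
  obtain ⟨ρ, hρ⟩ := exists_twist_hom (f := j ≫ i) (k := k) (M := L) (fun a : σ => a) (chart (j ≫ i))
    (iSup_chart _).ge (fun a => le_rfl) (fun a => twApp η (chart i a) (TwSec.ofChart k a le_rfl 1))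
    (by
      intro a b
      have h1 := twApp_restr η (inf_le_left : chart i a ⊓ chart i b ≤ chart i a)
        (TwSec.ofChart k a le_rfl 1)
      have h2 := twApp_restr η (inf_le_right : chart i a ⊓ chart i b ≤ chart i b)
        (TwSec.ofChart k b le_rfl 1)
      rw [TwSec.restr_ofChart, map_one] at h1 h2
      refine h1.symm.trans ?_
      rw [TwSec.eq_ofChart b inf_le_right (TwSec.ofChart k a _ 1), twApp_smul, h2,
        coef_ofChart, map_one, mul_one]
      refine (congrArg (fun r : Γ(Z, chart (j ≫ i) a ⊓ chart (j ≫ i) b) => r • (rm L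
        (inf_le_right : chart (j ≫ i) a ⊓ chart (j ≫ i) b ≤ chart (j ≫ i) b)
          (twApp η (chart i b) (TwSec.ofChart k b le_rfl 1)))) (app_tr j i b a inf_le_right inf_le_left k)))
  refine ⟨ρ, ?_, ?_⟩
  · apply ((Scheme.Modules.pullbackPushforwardAdjunction j).homEquiv _ _).injective
    rw [Adjunction.homEquiv_unit, Adjunction.homEquiv_unit, Functor.map_comp, ← Category.assoc,
      unit_pullTwistHom, CategoryTheory.Functor.map_id]
    refine Eq.trans ?_ (Category.comp_id η).symm
    refine twist_hom_ext_chart fun a => ?_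
    refine Eq.trans ?_ (hρ a)
    refine congrArg (twApp ρ (chart (j ≫ i) a)) ?_
    exact (pullTw_ofChart j i a le_rfl 1).trans (congrArg _ (map_one (j.app (chart i a)).hom))
  · refine twist_hom_ext_chart fun a => ?_
    have h1 : Scheme.Modules.Hom.app (M := L) (pullTwistHom j i k) (chart (j ≫ i) a)
      (twApp ρ (chart (j ≫ i) a) (TwSec.ofChart k a le_rfl 1)) =
      (pullTw j i (TwSec.ofChart k a le_rfl 1 : TwSec i k (chart i a)) : TwSec (j ≫ i) k _) := by
      rw [hρ a]
      exact hη (chart i a) (TwSec.ofChart k a le_rfl 1)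
    refine h1.trans ?_
    exact (pullTw_ofChart j i a le_rfl 1).trans (congrArg _ (map_one (j.app (chart i a)).hom))

/-- The canonical isomorphism `j^* 𝒪_Y(k) ≅ 𝒪_Z(k)`. -/
def pullTwistIso (k : ℤ) : (Scheme.Modules.pullback j).obj (twist i k) ≅ twist (j ≫ i) k where
  hom := pullTwistHom j i k
  inv := (exists_pullTwist_inv j i k).choose
  hom_inv_id := (exists_pullTwist_inv j i k).choose_spec.1
  inv_hom_id := (exists_pullTwist_inv j i k).choose_spec.2

lemma pullTwistIso_naturality {k m l : ℤ} (e : k + m = l) (t : H0 i m) :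
    (Scheme.Modules.pullback j).map (mulHom e t) ≫ (pullTwistIso j i l).hom =
      (pullTwistIso j i k).hom ≫ mulHom e (pullTw j i t : TwSec (j ≫ i) m (j ⁻¹ᵁ ⊤)) := by
  apply ((Scheme.Modules.pullbackPushforwardAdjunction j).homEquiv _ _).injective
  rw [Adjunction.homEquiv_naturality_left, Adjunction.homEquiv_naturality_right]
  have h : ∀ k, ((Scheme.Modules.pullbackPushforwardAdjunction j).homEquiv _ _)
    (pullTwistIso j i k).hom = pullHom j i k := fun k => Equiv.apply_symm_apply _ _
  rw [h, h]
  refine hom_ext_sec fun U s => ?_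
  exact pullTw_mul j i e s t

lemma pullTw_polySec {m : ℕ} {p : MvPolynomial σ ℂ}
    (hp : p ∈ MvPolynomial.homogeneousSubmodule σ ℂ m) :
    (pullTw j i (polySec i hp) : TwSec (j ≫ i) m (j ⁻¹ᵁ ⊤)) = polySec (j ≫ i) hp := by
  refine Subtype.ext (funext fun a => ?_)
  refine (app_res j _ _).trans ?_
  rw [← dehom_comp]
  rfl

/-- The canonical isomorphism `𝒪_Y(0) ≅ 𝒪_Y`. -/
lemma exists_twist_zero_iso : Nonempty (twist i 0 ≅ struct Y) := by
  obtain ⟨p, hp⟩ := exists_twist_hom (f := i) (k := 0) (M := struct Y) (fun a : σ => a) (chart i)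
    (iSup_chart _).ge (fun a => le_rfl) (fun a => (1 : Γ(Y, chart i a))) (by
      intro a b
      rw [zpow_zero, Units.val_one, one_smul]
      exact (map_one (res _)).trans (map_one (res _)).symm)
  let q : struct Y ⟶ twist i 0 := homMk' (M := struct Y) (N := twist i 0)
    (fun U => AddMonoidHom.mk' (fun r : Γ(Y, U) => r • TwSec.restr le_top (oneSec i))
      fun r s => add_smul _ _ _)
    (fun {U V} h s => by
      refine Eq.trans ?_ (TwSec.restr_smul h s (TwSec.restr le_top (oneSec i))).symm
      exact (congrArg
        (fun t : TwSec i 0 U => (res h s) • t)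
        (Subtype.ext (funext fun a => (res_res _ _ _).symm))))
    (fun U r s => mul_smul r s _)
  have hq : ∀ U (r : Γ(Y, U)), q.app U r = (r • TwSec.restr le_top (oneSec i) : TwSec i 0 U) :=
    fun U r => rfl
  have h1 : ∀ (a : σ) (U : Y.Opens) (ha : U ≤ chart i a), TwSec.restr le_top (oneSec i) =
      TwSec.ofChart (f := i) 0 a ha 1 := fun a U ha => TwSec.ext_chart a ha (by
    rw [coef_restr, coef_ofChart_self, map_one]
    exact map_one _)
  refine ⟨⟨p, q, ?_, ?_⟩⟩
  · refine twist_hom_ext_chart fun a => ?_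
    refine (congrArg (q.app (chart i a)) (hp a)).trans ?_
    refine (hq _ _).trans ?_
    rw [h1 a _ le_rfl]
    exact one_smul _ _
  · refine hom_ext_sec fun U s => ?_
    refine sec_ext (M := struct Y) (U := fun a => U ⊓ chart i a) ?_ (fun a => inf_le_left) fun a => ?_
    · rw [← inf_iSup_eq, iSup_chart, inf_top_eq]
    · rw [← app_rm]
      have h2 : p.app (U ⊓ chart i a) (q.app (U ⊓ chart i a) (rm (struct Y) inf_le_left s)) =
          rm (struct Y) inf_le_left s := by
        refine (congrArg (p.app (U ⊓ chart i a)) (hq _ _)).trans ?_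
        refine (twApp_smul p _ _).trans ?_
        have h3 : TwSec.restr le_top (oneSec i) =
          TwSec.restr (U := U ⊓ chart i a) inf_le_right (TwSec.ofChart (f := i) 0 a le_rfl 1) := by
            rw [TwSec.restr_ofChart, map_one, h1]
        have h4 : twApp p (U ⊓ chart i a) (TwSec.restr le_top (oneSec i)) =
            (1 : Γ(Y, U ⊓ chart i a)) := by
          rw [h3, twApp_restr, hp]
          exact map_one (res _)
        rw [h4]
        exact mul_one (M := Γ(Y, U ⊓ chart i a)) (rm (struct Y) inf_le_left s)
      exact h2

end pullback


/-! ### Fractions of homogeneous polynomials as functions -/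

section fractions

variable {τ : Type}

/-- The homogeneous polynomials of degree `n`. -/
abbrev Hom' (τ : Type) (n : ℕ) : Submodule ℂ (MvPolynomial τ ℂ) :=
  MvPolynomial.homogeneousSubmodule τ ℂ n

/-- The open subset `D₊(h)` of projective space. -/
abbrev DP (h : MvPolynomial τ ℂ) : (PP τ).Opens :=
  Proj.basicOpen (MvPolynomial.homogeneousSubmodule τ ℂ) h

/-- The function `p / q` on `D₊(q)`. -/
def pfrac {n : ℕ} {p q : MvPolynomial τ ℂ} (hp : p ∈ Hom' τ n) (hq : q ∈ Hom' τ n) :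
    Γ(PP τ, DP q) :=
  Proj.awayToSection _ _ (HomogeneousLocalization.Away.mk _ hq 1 p (by simpa using hp))

lemma pfrac_val {n : ℕ} {p q : MvPolynomial τ ℂ} (hp : p ∈ Hom' τ n) (hq : q ∈ Hom' τ n)
    (x : DP q) : ((pfrac hp hq).1 x).val = Localization.mk p ⟨q, x.2⟩ := by
  refine Eq.trans (b := Localization.mk p ⟨q ^ 1, _⟩) rfl ?_
  congr 2
  exact pow_one q

lemma res_pfrac_val {n : ℕ} {p q : MvPolynomial τ ℂ} (hp : p ∈ Hom' τ n) (hq : q ∈ Hom' τ n)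
    {U : (PP τ).Opens} (hU : U ≤ DP q) (x : U) :
    ((res hU (pfrac hp hq)).1 x).val = Localization.mk p ⟨q, hU x.2⟩ := pfrac_val hp hq ⟨x.1, hU x.2⟩

lemma sec_ext_val {U : (PP τ).Opens} {s t : Γ(PP τ, U)} (h : ∀ x : U, (s.1 x).val = (t.1 x).val) :
    s = t :=
  AlgebraicGeometry.Proj.ext _ _ _ (funext fun x => HomogeneousLocalization.val_injective _ (h x))

variable {Y : Scheme.{0}} (g : Y ⟶ PP τ)

/-- The function `p / q` on an open subset of `Y` where `q` does not vanish. -/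
def fr {n : ℕ} {p q : MvPolynomial τ ℂ} (hp : p ∈ Hom' τ n) (hq : q ∈ Hom' τ n) {U : Y.Opens}
    (hU : U ≤ g ⁻¹ᵁ DP q) : Γ(Y, U) := res hU ((g.app _).hom (pfrac hp hq))

variable {g}

lemma res_fr {n : ℕ} {p q : MvPolynomial τ ℂ} (hp : p ∈ Hom' τ n) (hq : q ∈ Hom' τ n)
    {U V : Y.Opens} (h : U ≤ V) (hV : V ≤ g ⁻¹ᵁ DP q) :
    res h (fr g hp hq hV) = fr g hp hq (h.trans hV) := res_res _ _ _

lemma fr_of_res {n : ℕ} {p q : MvPolynomial τ ℂ} (hp : p ∈ Hom' τ n) (hq : q ∈ Hom' τ n)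
    {U : Y.Opens} {V : (PP τ).Opens} (h : U ≤ g ⁻¹ᵁ V) (hV : V ≤ DP q) :
    fr g hp hq (h.trans (g.preimage_mono hV)) = res h ((g.app V).hom (res hV (pfrac hp hq))) := by
  rw [app_res, res_res]
  rfl

lemma fr_eq {n m : ℕ} {p q p' q' : MvPolynomial τ ℂ} (hp : p ∈ Hom' τ n) (hq : q ∈ Hom' τ n)
    (hp' : p' ∈ Hom' τ m) (hq' : q' ∈ Hom' τ m) {U : Y.Opens} (hU : U ≤ g ⁻¹ᵁ DP q)
    (hU' : U ≤ g ⁻¹ᵁ DP q') (h : p * q' = p' * q) : fr g hp hq hU = fr g hp' hq' hU' := by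
  rw [fr_of_res hp hq (V := DP q ⊓ DP q') (le_inf hU hU') inf_le_left,
    fr_of_res hp' hq' (V := DP q ⊓ DP q') (le_inf hU hU') inf_le_right]
  congr 2
  refine sec_ext_val fun x => ?_
  rw [res_pfrac_val, res_pfrac_val, Localization.mk_eq_mk_iff, Localization.r_iff_exists]
  refine ⟨1, ?_⟩
  simp only [OneMemClass.coe_one, one_mul]
  rw [mul_comm, h, mul_comm]

lemma fr_self {n : ℕ} {q : MvPolynomial τ ℂ} (hq : q ∈ Hom' τ n) {U : Y.Opens}
    (hU : U ≤ g ⁻¹ᵁ DP q) : fr g hq hq hU = 1 := by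
  have : pfrac hq hq = 1 := sec_ext_val fun x => by
    rw [pfrac_val]
    exact (Localization.mk_self ⟨q, x.2⟩).trans HomogeneousLocalization.val_one.symm
  rw [fr, this, map_one, map_one]

lemma fr_add {n : ℕ} {p p' q : MvPolynomial τ ℂ} (hp : p ∈ Hom' τ n) (hp' : p' ∈ Hom' τ n)
    (hq : q ∈ Hom' τ n) {U : Y.Opens} (hU : U ≤ g ⁻¹ᵁ DP q) :
    fr g (add_mem hp hp') hq hU = fr g hp hq hU + fr g hp' hq hU := by
  have : pfrac (add_mem hp hp') hq = pfrac hp hq + pfrac hp' hq := sec_ext_val fun x => by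
    refine Eq.trans ?_ (HomogeneousLocalization.val_add _ _).symm
    rw [pfrac_val, pfrac_val, pfrac_val, Localization.add_mk_self]
  rw [fr, this, map_add, map_add]
  rfl

lemma fr_zero {n : ℕ} {q : MvPolynomial τ ℂ} (hq : q ∈ Hom' τ n) {U : Y.Opens}
    (hU : U ≤ g ⁻¹ᵁ DP q) : fr g (zero_mem (Hom' τ n)) hq hU = 0 := by
  have h := fr_add (zero_mem (Hom' τ n)) (zero_mem (Hom' τ n)) hq hU
  have h2 : fr g (add_mem (zero_mem (Hom' τ n)) (zero_mem (Hom' τ n))) hq hU =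
    fr g (zero_mem (Hom' τ n)) hq hU := fr_eq _ _ _ _ _ _ (by ring)
  rw [h2, left_eq_add] at h
  exact h

lemma fr_neg {n : ℕ} {p q : MvPolynomial τ ℂ} (hp : p ∈ Hom' τ n)
    (hq : q ∈ Hom' τ n) {U : Y.Opens} (hU : U ≤ g ⁻¹ᵁ DP q) :
    fr g (neg_mem hp) hq hU = - fr g hp hq hU := by
  rw [eq_neg_iff_add_eq_zero, ← fr_add, ← fr_zero hq hU]
  exact fr_eq _ _ _ _ _ _ (by ring)

lemma fr_sub {n : ℕ} {p p' q : MvPolynomial τ ℂ} (hp : p ∈ Hom' τ n) (hp' : p' ∈ Hom' τ n)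
    (hq : q ∈ Hom' τ n) {U : Y.Opens} (hU : U ≤ g ⁻¹ᵁ DP q) :
    fr g (sub_mem hp hp') hq hU = fr g hp hq hU - fr g hp' hq hU := by
  refine Eq.trans ?_ ((fr_add hp (neg_mem hp') hq hU).trans (by rw [fr_neg, sub_eq_add_neg]))
  exact fr_eq _ _ _ _ _ _ (by ring)

lemma le_DP_mul {q q' : MvPolynomial τ ℂ} {U : Y.Opens} (hU : U ≤ g ⁻¹ᵁ DP q)
    (hU' : U ≤ g ⁻¹ᵁ DP q') : U ≤ g ⁻¹ᵁ DP (q * q') := by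
  rw [DP, Proj.basicOpen_mul]
  exact le_inf hU hU'

lemma le_DP_pow {q : MvPolynomial τ ℂ} {U : Y.Opens} (hU : U ≤ g ⁻¹ᵁ DP q) (n : ℕ) :
    U ≤ g ⁻¹ᵁ DP (q ^ n) := by
  induction n with
  | zero =>
    rw [pow_zero, DP, Proj.basicOpen_one]
    exact le_top
  | succ n ih =>
    rw [pow_succ]
    exact le_DP_mul ih hU

lemma fr_mul {n m : ℕ} {p q p' q' : MvPolynomial τ ℂ} (hp : p ∈ Hom' τ n) (hq : q ∈ Hom' τ n)
    (hp' : p' ∈ Hom' τ m) (hq' : q' ∈ Hom' τ m) {U : Y.Opens} (hU : U ≤ g ⁻¹ᵁ DP q)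
    (hU' : U ≤ g ⁻¹ᵁ DP q') :
    fr g (SetLike.mul_mem_graded hp hp' : p * p' ∈ Hom' τ (n + m))
      (SetLike.mul_mem_graded hq hq' : q * q' ∈ Hom' τ (n + m)) (le_DP_mul hU hU') =
      fr g hp hq hU * fr g hp' hq' hU' := by
  have e1 : DP (q * q') ≤ DP q := Proj.basicOpen_mono _ _ _ ⟨q', rfl⟩
  have e2 : DP (q * q') ≤ DP q' := Proj.basicOpen_mono _ _ _ ⟨q, mul_comm _ _⟩
  have : pfrac (SetLike.mul_mem_graded hp hp' : p * p' ∈ Hom' τ (n + m))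
      (SetLike.mul_mem_graded hq hq' : q * q' ∈ Hom' τ (n + m)) =
      res e1 (pfrac hp hq) * res e2 (pfrac hp' hq') := sec_ext_val fun x => by
    refine Eq.trans ?_ (HomogeneousLocalization.val_mul _ _).symm
    rw [pfrac_val]
    refine Eq.trans ?_ (congrArg₂ (· * ·) (res_pfrac_val hp hq e1 x) (res_pfrac_val hp' hq' e2 x)).symm
    rw [Localization.mk_mul]
    rfl
  rw [fr, this, map_mul, map_mul, fr_of_res hp hq (le_DP_mul hU hU') e1,
    fr_of_res hp' hq' (le_DP_mul hU hU') e2]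

lemma le_chart_pow {a : τ} {U : Y.Opens} (hU : U ≤ chart g a) (m : ℕ) :
    U ≤ g ⁻¹ᵁ DP (MvPolynomial.X a ^ m : MvPolynomial τ ℂ) := le_DP_pow hU m

lemma DP_le_pow (h : MvPolynomial τ ℂ) (m : ℕ) : DP h ≤ DP (h ^ m) := by
  have := le_DP_pow (g := 𝟙 (PP τ)) (U := 𝟙 (PP τ) ⁻¹ᵁ DP h) (q := h) le_rfl m
  exact this

lemma mem_mul {p q : MvPolynomial τ ℂ} {m n : ℕ} (hp : p ∈ Hom' τ m) (hq : q ∈ Hom' τ n) :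
    p * q ∈ Hom' τ (m + n) := SetLike.mul_mem_graded hp hq

lemma mem_pow {p : MvPolynomial τ ℂ} {m : ℕ} (hp : p ∈ Hom' τ m) (n : ℕ) :
    p ^ n ∈ Hom' τ (n * m) := by simpa using SetLike.pow_mem_graded n hp

lemma X_pow_mem (a : τ) (m : ℕ) : (MvPolynomial.X a ^ m : MvPolynomial τ ℂ) ∈ Hom' τ m := by
  simpa using mem_pow (X_mem a) m

lemma fr_X (a : τ) {m : ℕ} {p : MvPolynomial τ ℂ} (hp : p ∈ Hom' τ m) {U : Y.Opens}
    (hU : U ≤ chart g a) : res hU (dehom g a hp) = fr g hp (X_pow_mem a m) (le_chart_pow hU m) := by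
  have : frac a hp = res (DP_le_pow _ m) (pfrac hp (X_pow_mem a m)) :=
    sec_ext_val fun x => (res_pfrac_val _ _ (DP_le_pow _ m) x).symm
  rw [dehom, this]
  exact (fr_of_res hp _ hU (DP_le_pow _ m)).symm

lemma dehom_eq_fr (a : τ) {m : ℕ} {p : MvPolynomial τ ℂ} (hp : p ∈ Hom' τ m) :
    dehom g a hp = fr g hp (X_pow_mem a m) (le_chart_pow le_rfl m) := by
  rw [← fr_X a hp le_rfl, res_self]

lemma dehom_mul {m n : ℕ} {p p' : MvPolynomial τ ℂ} (hp : p ∈ Hom' τ m)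
    (hp' : p' ∈ Hom' τ n) (a : τ) :
    dehom g a (mem_mul hp hp') = dehom g a hp * dehom g a hp' := by
  rw [dehom_eq_fr, dehom_eq_fr, dehom_eq_fr, ← fr_mul]
  exact fr_eq _ _ _ _ _ _ (by ring)

lemma dehom_congr {m n : ℕ} {p p' : MvPolynomial τ ℂ} (hp : p ∈ Hom' τ m)
    (hp' : p' ∈ Hom' τ n) (a : τ) (h : p = p') (hmn : m = n) : dehom g a hp = dehom g a hp' := by
  subst h hmn
  rfl

lemma pfrac_surjective {n : ℕ} (hn : 0 < n) {h : MvPolynomial τ ℂ} (hh : h ∈ Hom' τ n)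
    (s : Γ(PP τ, DP h)) : ∃ (k : ℕ) (p : MvPolynomial τ ℂ) (hp : p ∈ Hom' τ (k * n)),
      s = res (DP_le_pow h k) (pfrac hp (mem_pow hh k)) := by
  obtain ⟨z, rfl⟩ : ∃ z, Proj.awayToSection _ h z = s :=
    ⟨(Proj.basicOpenIsoAway _ h hh hn).inv s, by
      have := ConcreteCategory.congr_hom (Proj.basicOpenIsoAway _ h hh hn).inv_hom_id s
      exact this⟩
  obtain ⟨k, p, hp, rfl⟩ := HomogeneousLocalization.Away.mk_surjective _ hh z
  have hp' : p ∈ Hom' τ (k * n) := by simpa using hp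
  exact ⟨k, p, hp', sec_ext_val fun x => (res_pfrac_val hp' (mem_pow hh k) (DP_le_pow h k) x).symm⟩

/-- Functions on `Y ∩ D₊(h)` are fractions with denominator a power of `h`. -/
lemma fr_surjective [IsClosedImmersion g] {n : ℕ} (hn : 0 < n) {h : MvPolynomial τ ℂ}
    (hh : h ∈ Hom' τ n) (s : Γ(Y, g ⁻¹ᵁ DP h)) :
    ∃ (k : ℕ) (p : MvPolynomial τ ℂ) (hp : p ∈ Hom' τ (k * n)),
      s = fr g hp (mem_pow hh k) (le_DP_pow le_rfl k) := by
  obtain ⟨t, rfl⟩ := g.app_surjective _ (Proj.isAffineOpen_basicOpen _ h hh hn) s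
  obtain ⟨k, p, hp, rfl⟩ := pfrac_surjective hn hh t
  refine ⟨k, p, hp, ?_⟩
  exact app_res g (DP_le_pow h k) _

lemma basicOpen_pfrac_le {n : ℕ} {p q : MvPolynomial τ ℂ} (hp : p ∈ Hom' τ n) (hq : q ∈ Hom' τ n) :
    (PP τ).basicOpen (pfrac hp hq) ≤ DP p := by
  intro x hx
  have hxq : x ∈ DP q := (PP τ).basicOpen_le _ hx
  have h1 := (Scheme.mem_basicOpen (PP τ) (pfrac hp hq) x hxq).mp hx
  have h2 : IsUnit ((pfrac hp hq).1 ⟨x, hxq⟩) := by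
    have := h1.map (AlgebraicGeometry.stalkToFiberRingHom
      (MvPolynomial.homogeneousSubmodule τ ℂ) x).hom
    exact (congrArg IsUnit (AlgebraicGeometry.stalkToFiberRingHom_germ
      (MvPolynomial.homogeneousSubmodule τ ℂ) (DP q) x hxq (pfrac hp hq))).mp this
  have := x.isPrime
  have h3 := h2.map (algebraMap _ (Localization x.asHomogeneousIdeal.toIdeal.primeCompl))
  rw [HomogeneousLocalization.algebraMap_apply] at h3
  have h4 := (congrArg IsUnit (pfrac_val hp hq ⟨x, hxq⟩)).mp h3
  rw [Localization.mk_eq_mk'] at h4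
  exact (IsLocalization.AtPrime.isUnit_mk'_iff _ x.asHomogeneousIdeal.toIdeal _ _).mp h4

lemma polySec_eq_zero_iff {m : ℕ} {p : MvPolynomial τ ℂ} (hp : p ∈ Hom' τ m) :
    polySec g hp = 0 ↔ ∀ a, dehom g a hp = 0 := by
  constructor
  · intro h a
    have h1 := congrArg (fun s => res (show chart g a ≤ ⊤ ⊓ chart g a from le_inf le_top le_rfl)
      (s.1 a)) h
    refine Eq.trans ?_ (h1.trans (map_zero (res _)))
    exact ((res_res _ _ _).trans (res_self _ _)).symm
  · intro h
    refine Subtype.ext (funext fun a => ?_)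
    exact (congrArg _ (h a)).trans (map_zero (res _))

/-- A fraction `p / q` vanishes on `Y ∩ D₊(h)` only if `p` multiplied by a power of `h`
vanishes on `Y`. -/
lemma exists_pow_mul_polySec_eq_zero [Finite τ] [IsClosedImmersion g] {n N : ℕ}
    {h p q : MvPolynomial τ ℂ}
    (hh : h ∈ Hom' τ n) (hp : p ∈ Hom' τ N) (hq : q ∈ Hom' τ N) (hU : g ⁻¹ᵁ DP h ≤ g ⁻¹ᵁ DP q)
    (h0 : fr g hp hq hU = 0) : ∃ K, polySec g (mem_mul (mem_pow hh K) hp) = 0 := by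
  have key : ∀ b : τ, ∃ K, ∀ K' ≥ K, dehom g b (mem_mul (mem_pow hh K') hp) = 0 := by
    intro b
    have hV : IsAffineOpen (chart g b) :=
      (Proj.isAffineOpen_basicOpen _ _ (X_mem b) one_pos).preimage g
    let t : Γ(Y, chart g b) := dehom g b hh
    let s : Γ(Y, chart g b) := dehom g b hp
    have ht : Y.basicOpen t ≤ g ⁻¹ᵁ DP h := by
      have h1 : t = res (V := g ⁻¹ᵁ DP (MvPolynomial.X b ^ n : MvPolynomial τ ℂ)) (le_chart_pow le_rfl n)
          ((g.app _).hom (pfrac hh (X_pow_mem b n))) := dehom_eq_fr b hh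
      rw [h1]
      refine (Scheme.basicOpen_res Y _ _).trans_le (inf_le_right.trans ?_)
      refine (Scheme.preimage_basicOpen g (pfrac hh (X_pow_mem b n))).ge.trans ?_
      exact g.preimage_mono (basicOpen_pfrac_le hh _)
    have hle : Y.basicOpen t ≤ chart g b := Y.basicOpen_le t
    have hs : res hle s = 0 := by
      have e1 : fr g hp (X_pow_mem b N) (le_chart_pow hle N) = fr g hp hq (ht.trans hU) *
          fr g hq (X_pow_mem b N) (le_chart_pow hle N) := by
        rw [← fr_mul]
        exact fr_eq _ _ _ _ _ _ (by ring)
      rw [fr_X b hp hle, e1, ← res_fr hp hq ht hU, h0, map_zero, zero_mul]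
    obtain ⟨K, hK⟩ := exists_pow_mul_eq_zero_of_res_basicOpen_eq_zero_of_isAffineOpen Y hV s t hs
    refine ⟨K, fun K' hK' => ?_⟩
    have e2 : ∀ K', dehom g b (mem_mul (mem_pow hh K') hp) = t ^ K' * s := by
      intro K'
      induction K' with
      | zero =>
        exact (dehom_congr _ hp b (by ring) (by ring)).trans (by rw [pow_zero, one_mul])
      | succ K' ih =>
        have e3 : t ^ (K' + 1) * s = t * dehom g b (mem_mul (mem_pow hh K') hp) := by
          rw [ih, pow_succ', mul_assoc]
        rw [e3, ← dehom_mul]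
        exact dehom_congr _ _ b (by ring) (by ring)
    obtain ⟨c, rfl⟩ := Nat.exists_eq_add_of_le hK'
    rw [e2, pow_add, mul_right_comm, hK, zero_mul]
  choose K hK using key
  cases nonempty_fintype τ
  refine ⟨∑ b, K b, (polySec_eq_zero_iff _).mpr fun b => hK b _ ?_⟩
  exact Finset.single_le_sum (fun _ _ => Nat.zero_le _) (Finset.mem_univ b)

lemma polySec_add {m : ℕ} {p p' : MvPolynomial τ ℂ} (hp : p ∈ Hom' τ m) (hp' : p' ∈ Hom' τ m) :
    polySec g (add_mem hp hp') = polySec g hp + polySec g hp' := by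
  refine Subtype.ext (funext fun a => ?_)
  have h1 : dehom g a (add_mem hp hp') = dehom g a hp + dehom g a hp' := by
    rw [dehom_eq_fr, dehom_eq_fr, dehom_eq_fr, fr_add]
  exact (congrArg _ h1).trans (map_add (res _) _ _)

end fractions


/-! ### The homogeneous ideal of a closed subscheme -/

section constants

variable {τ : Type}

lemma C_mem (c : ℂ) : (MvPolynomial.C c : MvPolynomial τ ℂ) ∈ Hom' τ 0 := MvPolynomial.isHomogeneous_C _ _
lemma one_mem' : (1 : MvPolynomial τ ℂ) ∈ Hom' τ 0 := MvPolynomial.isHomogeneous_one _ _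

lemma toSpecZero_appTop : ((Scheme.ΓSpecIso _).inv ≫
    (Proj.toSpecZero (MvPolynomial.homogeneousSubmodule τ ℂ)).appTop) =
    CommRingCat.ofHom (HomogeneousLocalization.fromZeroRingHom (MvPolynomial.homogeneousSubmodule τ ℂ) (.powers 1)) ≫
     Proj.awayToSection _ 1 ≫ (PP τ).presheaf.map (homOfLE (show (⊤ : (PP τ).Opens) ≤ DP 1 by rw [DP, Proj.basicOpen_one])).op := by
  have h : (Proj.basicOpenToSpec (MvPolynomial.homogeneousSubmodule τ ℂ) 1).appTop = _ := Proj.basicOpenToSpec_app_top _ _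
  have h1 : ∀ (U : (PP τ).Opens) (hU : U = ⊤), U.topIso.inv ≫
      ((PP τ).topIso.inv ≫ ((PP τ).isoOfEq hU).inv).appTop = (PP τ).presheaf.map (homOfLE hU.ge).op := by
    intro U hU
    have e : ((PP τ).topIso.inv ≫ ((PP τ).isoOfEq hU).inv) ≫ U.ι = 𝟙 _ := by
      rw [Category.assoc, Scheme.isoOfEq_inv_ι, ← Scheme.topIso_hom, Iso.inv_hom_id]
    have e2 : U.topIso.inv = U.ι.appLE U ⊤ (by simp) := by
      simp only [Scheme.Hom.appLE, Scheme.Opens.ι_app]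
      rfl
    have e3 : ∀ (k : PP τ ⟶ PP τ) (hk : k = 𝟙 _) (e : (⊤ : (PP τ).Opens) ≤ k ⁻¹ᵁ U),
        k.appLE U ⊤ e = (PP τ).presheaf.map (homOfLE hU.ge).op := by
      intro k hk e
      subst hk
      exact Category.id_comp _
    have e4 : ∀ k : PP τ ⟶ U, k.appTop = k.appLE ⊤ ⊤ le_top := fun k => by
      rw [Scheme.Hom.appTop, Scheme.Hom.app_eq_appLE]
      rfl
    rw [e2, e4]
    refine (Scheme.Hom.appLE_comp_appLE _ U.ι U ⊤ ⊤ _ _).trans ?_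
    exact e3 _ e _
  unfold Proj.toSpecZero
  rw [← Category.assoc, ← Category.assoc, Scheme.Hom.comp_appTop, Scheme.Hom.comp_appTop]
  rw [h, ← Scheme.ΓSpecIso_inv_naturality_assoc]
  simp only [Category.assoc, Iso.inv_hom_id_assoc]
  rw [h1]

variable {Y : Scheme.{0}} {g : Y ⟶ PP τ}

lemma top_le_DP_one : (⊤ : (PP τ).Opens) ≤ DP 1 := by rw [DP, Proj.basicOpen_one]

lemma cstP_eq (c : ℂ) : cstP c = res top_le_DP_one (pfrac (C_mem c) (one_mem' (τ := τ))) := by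
  have h := congrArg (fun t => t.hom (algebraMap ℂ (MvPolynomial.homogeneousSubmodule τ ℂ 0) c))
    (toSpecZero_appTop (τ := τ))
  refine Eq.trans h ?_
  refine congrArg (res top_le_DP_one) ?_
  refine congrArg (Proj.awayToSection (MvPolynomial.homogeneousSubmodule τ ℂ) 1).hom ?_
  refine HomogeneousLocalization.val_injective _ ?_
  rw [HomogeneousLocalization.Away.val_mk]
  refine Eq.trans (b := Localization.mk (MvPolynomial.C c) 1) rfl ?_
  congr 1
  ext
  simp

lemma cst_eq (c : ℂ) {n : ℕ} {q : MvPolynomial τ ℂ} (hq : q ∈ Hom' τ n) {U : Y.Opens}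
    (hU : U ≤ g ⁻¹ᵁ DP q) : res le_top (cst g c) =
      fr g ((Submodule.smul_mem _ c hq : c • q ∈ Hom' τ n)) hq hU := by
  have h1 : res le_top (cst g c) = fr g (C_mem c) one_mem' (U := U) (by
      rw [DP, Proj.basicOpen_one]; exact le_top) := by
    rw [cst, RingHom.comp_apply, cstP_eq]
    have := app_res g (top_le_DP_one (τ := τ)) (pfrac (C_mem c) one_mem')
    refine (congrArg (res (le_top : U ≤ ⊤)) this).trans ?_
    exact res_res _ _ _
  rw [h1]
  exact fr_eq _ _ _ _ _ _ (by rw [mul_one, MvPolynomial.smul_eq_C_mul])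

lemma basicOpen_dehom (a : τ) {n : ℕ} {h : MvPolynomial τ ℂ} (hh : h ∈ Hom' τ n) :
    Y.basicOpen (dehom g a hh) = chart g a ⊓ g ⁻¹ᵁ DP h := by
  refine le_antisymm (le_inf (Y.basicOpen_le _) ?_) ?_
  · have h1 : dehom g a hh = res (V := g ⁻¹ᵁ DP (MvPolynomial.X a ^ n : MvPolynomial τ ℂ))
        (le_chart_pow le_rfl n) ((g.app _).hom (pfrac hh (X_pow_mem a n))) := dehom_eq_fr a hh
    rw [h1]
    refine (Scheme.basicOpen_res Y _ _).trans_le (inf_le_right.trans ?_)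
    refine (Scheme.preimage_basicOpen g (pfrac hh (X_pow_mem a n))).ge.trans ?_
    exact g.preimage_mono (basicOpen_pfrac_le hh _)
  · have h1 : IsUnit (res (inf_le_left : chart g a ⊓ g ⁻¹ᵁ DP h ≤ chart g a) (dehom g a hh)) := by
      rw [fr_X a hh inf_le_left]
      refine IsUnit.of_mul_eq_one (fr g (X_pow_mem a n) hh inf_le_right) ?_
      rw [← fr_mul]
      refine (fr_eq _ _ _ _ _ (le_DP_mul inf_le_right (le_chart_pow inf_le_left n)) (by ring)).trans (fr_self
        (mem_mul hh (X_pow_mem a n)) _)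
    have h2 := Scheme.basicOpen_of_isUnit Y h1
    rw [res, Scheme.basicOpen_res] at h2
    rw [← h2]
    exact inf_le_right

lemma dehom_add (a : τ) {m : ℕ} {p p' : MvPolynomial τ ℂ} (hp : p ∈ Hom' τ m) (hp' : p' ∈ Hom' τ m) :
    dehom g a (add_mem hp hp') = dehom g a hp + dehom g a hp' := by
  rw [dehom_eq_fr, dehom_eq_fr, dehom_eq_fr, fr_add]

lemma dehom_zero (a : τ) {m : ℕ} : dehom g a (zero_mem (Hom' τ m)) = 0 := by
  rw [dehom_eq_fr, fr_zero]

lemma component_mul {n : ℕ} {r p : MvPolynomial τ ℂ} (hr : r ∈ Hom' τ n) (m : ℕ) :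
    MvPolynomial.homogeneousComponent m (r * p) =
      if n ≤ m then r * MvPolynomial.homogeneousComponent (m - n) p else 0 := by
  have key : ∀ (φ : MvPolynomial τ ℂ) (i : ℕ),
      (DirectSum.decompose (MvPolynomial.homogeneousSubmodule τ ℂ) φ i : MvPolynomial τ ℂ) =
      MvPolynomial.homogeneousComponent i φ := fun φ i =>
    MvPolynomial.decomposition.decompose'_apply φ i
  rw [← key, ← key]
  split_ifs with h
  · exact DirectSum.coe_decompose_mul_of_left_mem_of_le (MvPolynomial.homogeneousSubmodule τ ℂ) hr h
  · exact DirectSum.coe_decompose_mul_of_left_mem_of_not_le (MvPolynomial.homogeneousSubmodule τ ℂ) hr h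

lemma dehom_component_of_mem_idealOf {p : MvPolynomial τ ℂ} (hp : p ∈ idealOf g) (m : ℕ) (a : τ) :
    dehom g a (MvPolynomial.homogeneousComponent_mem m p) = 0 := by
  have hadd : ∀ {p q : MvPolynomial τ ℂ},
      (∀ m, dehom g a (MvPolynomial.homogeneousComponent_mem m p) = 0) →
      (∀ m, dehom g a (MvPolynomial.homogeneousComponent_mem m q) = 0) →
      ∀ m, dehom g a (MvPolynomial.homogeneousComponent_mem m (p + q)) = 0 := by
    intro p q hp hq m
    refine (dehom_congr _ (add_mem (MvPolynomial.homogeneousComponent_mem m p)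
      (MvPolynomial.homogeneousComponent_mem m q)) a (map_add _ _ _) rfl).trans ?_
    rw [dehom_add a (MvPolynomial.homogeneousComponent_mem m p)
      (MvPolynomial.homogeneousComponent_mem m q), hp, hq, add_zero]
  have hzero : ∀ m, dehom g a (MvPolynomial.homogeneousComponent_mem m 0) = 0 := fun m =>
    (dehom_congr _ (zero_mem _) a (map_zero _) rfl).trans (dehom_zero a (m := m))
  revert m
  induction hp using Submodule.span_induction with
  | mem p h =>
    intro m
    obtain ⟨n, hp, h0⟩ := h
    by_cases hmn : m = n
    · subst hmn
      refine (dehom_congr _ hp a (MvPolynomial.homogeneousComponent_eq_self hp) rfl).trans ?_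
      exact (polySec_eq_zero_iff hp).mp h0 a
    · refine (dehom_congr _ (zero_mem _) a ?_ rfl).trans (dehom_zero a (m := m))
      rw [MvPolynomial.homogeneousComponent_of_mem hp, if_neg hmn]
  | zero => exact hzero
  | add p q _ _ hp hq => exact hadd hp hq
  | smul r p _ hp =>
    rw [smul_eq_mul, ← MvPolynomial.sum_homogeneousComponent r, Finset.sum_mul]
    refine Finset.sum_induction _ (fun p => ∀ m, dehom g a
      (MvPolynomial.homogeneousComponent_mem m p) = 0) (fun _ _ => hadd) hzero fun n _ m => ?_
    have hr := MvPolynomial.homogeneousComponent_mem n r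
    by_cases h : n ≤ m
    · refine (dehom_congr _ (mem_mul hr (MvPolynomial.homogeneousComponent_mem (m - n) p)) a
        ?_ (by omega)).trans ?_
      · rw [component_mul hr, if_pos h]
      · rw [dehom_mul hr (MvPolynomial.homogeneousComponent_mem (m - n) p), hp, mul_zero]
    · refine (dehom_congr _ (zero_mem _) a ?_ rfl).trans (dehom_zero a (m := m))
      rw [component_mul hr, if_neg h]

/-- A homogeneous polynomial lies in the ideal of `Y` iff it vanishes on `Y`. -/
lemma mem_idealOf_iff {m : ℕ} {p : MvPolynomial τ ℂ} (hp : p ∈ Hom' τ m) :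
    p ∈ idealOf g ↔ polySec g hp = 0 := by
  refine ⟨fun h => (polySec_eq_zero_iff hp).mpr fun a => ?_, fun h => Ideal.subset_span ⟨m, hp, h⟩⟩
  refine Eq.trans ?_ (dehom_component_of_mem_idealOf h m a)
  exact dehom_congr _ _ a (MvPolynomial.homogeneousComponent_eq_self hp).symm rfl

/-- The ideal of `Y` is homogeneous. -/
lemma component_mem_idealOf {p : MvPolynomial τ ℂ} (hp : p ∈ idealOf g) (m : ℕ) :
    MvPolynomial.homogeneousComponent m p ∈ idealOf g := by
  rw [mem_idealOf_iff (MvPolynomial.homogeneousComponent_mem m p), polySec_eq_zero_iff]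
  exact dehom_component_of_mem_idealOf hp m

lemma fr_eq_zero_of_mem {n : ℕ} {p q : MvPolynomial τ ℂ} (hp : p ∈ Hom' τ n) (hq : q ∈ Hom' τ n)
    (h : p ∈ idealOf g) {U : Y.Opens} (hU : U ≤ g ⁻¹ᵁ DP q) : fr g hp hq hU = 0 := by
  rw [mem_idealOf_iff hp, polySec_eq_zero_iff] at h
  refine fun_ext (U := fun a => U ⊓ chart g a) ?_ (fun a => inf_le_left) fun a => ?_
  · rw [← inf_iSup_eq, iSup_chart, inf_top_eq]
  · have h1 : fr g hp hq (inf_le_left.trans hU : U ⊓ chart g a ≤ _) =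
        fr g hp (X_pow_mem a n) (le_chart_pow inf_le_right n) *
        fr g (X_pow_mem a n) hq (inf_le_left.trans hU) := by
      rw [← fr_mul]
      exact fr_eq _ _ _ _ _ _ (by ring)
    rw [res_fr, h1, ← fr_X a hp inf_le_right, h, map_zero, map_zero, zero_mul]

/-- A fraction `p / q` vanishes on `Y ∩ D₊(h)` only if a power of `h` multiplies `p` into the ideal
of `Y`. -/
lemma exists_pow_mul_mem_idealOf [Finite τ] [IsClosedImmersion g] {n N : ℕ}
    {h p q : MvPolynomial τ ℂ}
    (hh : h ∈ Hom' τ n) (hp : p ∈ Hom' τ N) (hq : q ∈ Hom' τ N) (hU : g ⁻¹ᵁ DP h ≤ g ⁻¹ᵁ DP q)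
    (h0 : fr g hp hq hU = 0) : ∃ K, h ^ K * p ∈ idealOf g := by
  obtain ⟨K, hK⟩ := exists_pow_mul_polySec_eq_zero hh hp hq hU h0
  exact ⟨K, (mem_idealOf_iff _).mpr hK⟩

/-- Homogeneous polynomials without common zero on `Y` generate, together with the ideal of `Y`,
a power of each coordinate. -/
lemma exists_X_pow_mem [Finite τ] [IsClosedImmersion g] {ι : Type} [Finite ι] {e : ι → ℕ}
    {H : ι → MvPolynomial τ ℂ} (hH : ∀ i, H i ∈ Hom' τ (e i)) (hcov : (⨆ i, g ⁻¹ᵁ DP (H i)) = ⊤)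
    (a : τ) : ∃ N, (MvPolynomial.X a ^ N : MvPolynomial τ ℂ) ∈
      Ideal.span (Set.range H) ⊔ idealOf g := by
  cases nonempty_fintype ι
  have hV : IsAffineOpen (chart g a) :=
    (Proj.isAffineOpen_basicOpen _ _ (X_mem a) one_pos).preimage g
  have h1 : Ideal.span (Set.range fun i => dehom g a (hH i)) = ⊤ := by
    rw [← hV.iSup_basicOpen_eq_self_iff]
    refine le_antisymm (iSup_le fun f => Y.basicOpen_le _) ?_
    calc chart g a = chart g a ⊓ ⨆ i, g ⁻¹ᵁ DP (H i) := by rw [hcov, inf_top_eq]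
      _ = ⨆ i, chart g a ⊓ g ⁻¹ᵁ DP (H i) := inf_iSup_eq _ _
      _ ≤ _ := iSup_le fun i => by
        rw [← basicOpen_dehom a (hH i)]
        exact le_iSup (fun f : Set.range fun i => dehom g a (hH i) => Y.basicOpen f.1) ⟨_, i, rfl⟩
  have h2 : (1 : Γ(Y, chart g a)) ∈ Ideal.span (Set.range fun i => dehom g a (hH i)) := by
    rw [h1]
    trivial
  obtain ⟨c, hc⟩ := Ideal.mem_span_range_iff_exists_fun.mp h2
  have h3 : ∀ i, ∃ (k : ℕ) (p : MvPolynomial τ ℂ) (hp : p ∈ Hom' τ k), c i = dehom g a hp := by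
    intro i
    obtain ⟨k, p, hp, hpc⟩ := fr_surjective (g := g) one_pos (X_mem a) (c i)
    refine ⟨k, p, by simpa using hp, hpc.trans ?_⟩
    rw [dehom_eq_fr]
    exact fr_eq _ _ _ _ _ _ rfl
  choose k p hp hpc using h3
  let M := ∑ i, (k i + e i)
  have hle : ∀ i, k i + e i ≤ M := fun i =>
    Finset.single_le_sum (f := fun i => k i + e i) (fun _ _ => Nat.zero_le _) (Finset.mem_univ i)
  have hX : ∀ i, dehom g a (mem_mul (mem_mul (hp i) (hH i)) (X_pow_mem a (M - (k i + e i)))) =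
      c i * dehom g a (hH i) := by
    intro i
    rw [dehom_mul (mem_mul (hp i) (hH i)) (X_pow_mem a (M - (k i + e i))), dehom_mul (hp i) (hH i),
      ← hpc, dehom_eq_fr a (X_pow_mem a _), fr_self, mul_one]
  let q : MvPolynomial τ ℂ := ∑ i, p i * H i * MvPolynomial.X a ^ (M - (k i + e i))
  have hterm : ∀ i, p i * H i * MvPolynomial.X a ^ (M - (k i + e i)) ∈ Hom' τ M := fun i => by
    have := mem_mul (mem_mul (hp i) (hH i)) (X_pow_mem a (M - (k i + e i)))
    rwa [Nat.add_sub_cancel' (hle i)] at this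
  have hq : q ∈ Hom' τ M := sum_mem fun i _ => hterm i
  have hq1 : dehom g a hq = 1 := by
    have key : ∀ s : Finset ι, ∀ hs : (∑ i ∈ s, p i * H i * MvPolynomial.X a ^ (M - (k i + e i))) ∈
        Hom' τ M, dehom g a hs = ∑ i ∈ s, c i * dehom g a (hH i) := by
      classical
      intro s
      induction s using Finset.induction_on with
      | empty =>
        intro hs
        exact (dehom_congr _ (zero_mem _) a Finset.sum_empty rfl).trans (dehom_zero a)
      | insert i s his ih =>
        intro hs
        have h' : (∑ i ∈ s, p i * H i * MvPolynomial.X a ^ (M - (k i + e i))) ∈ Hom' τ M :=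
          sum_mem fun i _ => hterm i
        refine Eq.trans ?_ (Finset.sum_insert his).symm
        rw [← ih h', ← hX i]
        refine (dehom_congr _ (add_mem (hterm i) h') a (Finset.sum_insert his) rfl).trans ?_
        rw [dehom_add a (hterm i) h']
        congr 1
        exact dehom_congr _ _ a rfl (Nat.add_sub_cancel' (hle i)).symm
    rw [key, hc]
  have h4 : fr g (sub_mem hq (X_pow_mem a M)) (X_pow_mem a M) (le_chart_pow (a := a) le_rfl M) = 0 := by
    rw [fr_sub hq (X_pow_mem a M), fr_self, ← dehom_eq_fr, hq1, sub_self]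
  obtain ⟨K, hK⟩ := exists_pow_mul_mem_idealOf (X_mem a)
    (sub_mem hq (X_pow_mem a M)) (X_pow_mem a M) (le_chart_pow (g := g) (a := a) le_rfl M) h4
  refine ⟨K + M, ?_⟩
  have h5 : (MvPolynomial.X a ^ (K + M) : MvPolynomial τ ℂ) = MvPolynomial.X a ^ K * q -
      MvPolynomial.X a ^ K * (q - MvPolynomial.X a ^ M) := by ring
  rw [h5]
  refine sub_mem (Ideal.mul_mem_left _ _ (Ideal.mem_sup_left ?_)) (Ideal.mem_sup_right hK)
  refine sum_mem fun i _ => Ideal.mul_mem_right _ _ (Ideal.mul_mem_left _ _ ?_)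
  exact Ideal.subset_span ⟨i, rfl⟩

end constants


/-! ### Regular sequences and the Čech complex -/

section regular

variable {R : Type*} [CommRing R]

/-- `a`, `b` is a (weakly) regular sequence. -/
def Reg2 (a b : R) : Prop := (∀ u, a * u = 0 → u = 0) ∧ ∀ u v, b * u = a * v → ∃ w, u = a * w

/-- `a`, `b`, `c` is a (weakly) regular sequence. -/
def Reg3 (a b c : R) : Prop :=
  Reg2 a b ∧ ∀ u v w, c * u = a * v + b * w → ∃ v' w', u = a * v' + b * w'

lemma Reg2.pow_left {a b : R} (h : Reg2 a b) (K : ℕ) : Reg2 (a ^ K) b := by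
  induction K with
  | zero =>
    refine ⟨fun u hu => by simpa using hu, fun u v _ => ⟨u, by simp⟩⟩
  | succ K ih =>
    refine ⟨fun u hu => h.1 u (ih.1 _ (by rw [← hu]; ring)), fun u v huv => ?_⟩
    obtain ⟨w, rfl⟩ := h.2 u (a ^ K * v) (by rw [huv]; ring)
    obtain ⟨w', rfl⟩ := ih.2 w v (by
      have : a * (b * w - a ^ K * v) = 0 := by linear_combination huv
      exact sub_eq_zero.mp (h.1 _ this))
    exact ⟨w', by ring⟩

lemma Reg2.pow {a b : R} (h : Reg2 a b) (K L : ℕ) : Reg2 (a ^ K) (b ^ L) := by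
  have h' := h.pow_left K
  refine ⟨h'.1, ?_⟩
  induction L with
  | zero => exact fun u v huv => ⟨v, by simpa using huv⟩
  | succ L ih =>
    intro u v huv
    obtain ⟨w, hw⟩ := ih (b * u) v (by rw [← huv]; ring)
    exact h'.2 u w hw

/-- After replacing `a` by a power and passing to the quotient by it, the remaining two elements
still form a regular sequence. -/
lemma Reg3.quotient {a b c : R} (h : Reg3 a b c) (K : ℕ) :
    Reg2 (Ideal.Quotient.mk (Ideal.span {a ^ K}) b) (Ideal.Quotient.mk (Ideal.span {a ^ K}) c) := by
  have mk_eq : ∀ x y : R, Ideal.Quotient.mk (Ideal.span {a ^ K}) x = Ideal.Quotient.mk _ y ↔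
      ∃ z, x = y + a ^ K * z := by
    intro x y
    rw [Ideal.Quotient.eq, Ideal.mem_span_singleton]
    exact ⟨fun ⟨z, hz⟩ => ⟨z, by linear_combination hz⟩, fun ⟨z, hz⟩ => ⟨z, by linear_combination hz⟩⟩
  have hb := h.1.pow_left K
  have key : ∀ K (u v w : R), c * u = a ^ K * v + b * w → ∃ v' w', u = a ^ K * v' + b * w' := by
    intro K
    induction K with
    | zero => exact fun u v w _ => ⟨u, 0, by simp⟩
    | succ K ih =>
      intro u v w huvw
      obtain ⟨v', w', rfl⟩ := ih u (a * v) w (by rw [huvw]; ring)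
      have hbK := h.1.pow_left K
      obtain ⟨x, hx⟩ := hbK.2 (c * w' - w) (a * v - c * v') (by linear_combination huvw)
      have h2 : c * v' = a * v + b * (-x) := by
        have : a ^ K * (c * v' - (a * v + b * (-x))) = 0 := by linear_combination huvw - b * hx
        exact sub_eq_zero.mp (hbK.1 _ this)
      obtain ⟨v'', w'', rfl⟩ := h.2 v' v (-x) h2
      exact ⟨v'', a ^ K * w'' + w', by ring⟩
  constructor
  · intro u hu
    obtain ⟨u, rfl⟩ := Ideal.Quotient.mk_surjective u
    rw [← map_mul, ← map_zero (Ideal.Quotient.mk _), mk_eq] at hu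
    obtain ⟨z, hz⟩ := hu
    obtain ⟨w, rfl⟩ := hb.2 u z (by rw [hz]; ring)
    rw [← map_zero (Ideal.Quotient.mk _), mk_eq]
    exact ⟨w, by ring⟩
  · intro u v huv
    obtain ⟨u, rfl⟩ := Ideal.Quotient.mk_surjective u
    obtain ⟨v, rfl⟩ := Ideal.Quotient.mk_surjective v
    rw [← map_mul, ← map_mul, mk_eq] at huv
    obtain ⟨z, hz⟩ := huv
    obtain ⟨v', w', rfl⟩ := key K u z v (by rw [hz]; ring)
    refine ⟨Ideal.Quotient.mk _ w', ?_⟩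
    rw [← map_mul, mk_eq]
    exact ⟨v', by ring⟩

variable {ι : Type*} [Fintype ι]

/-- Functions `b_i / g_i` that agree on overlaps extend over a locus of depth at least two. -/
lemma exists_of_mul_eq {a b : R} (h : Reg2 a b) {g : ι → R}
    (ha : ∃ K, a ^ K ∈ Ideal.span (Set.range g)) (hb : ∃ L, b ^ L ∈ Ideal.span (Set.range g))
    (p : ι → R) (hp : ∀ i j, p i * g j = p j * g i) : ∃ m, ∀ i, p i = g i * m := by
  obtain ⟨K, hK⟩ := ha
  obtain ⟨L, hL⟩ := hb
  obtain ⟨c, hc⟩ := Ideal.mem_span_range_iff_exists_fun.mp hK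
  obtain ⟨d, hd⟩ := Ideal.mem_span_range_iff_exists_fun.mp hL
  have hr := h.pow K L
  have e : ∀ (c : ι → R) j, g j * ∑ i, c i * p i = (∑ i, c i * g i) * p j := by
    intro c j
    rw [Finset.mul_sum, Finset.sum_mul]
    exact Finset.sum_congr rfl fun i _ => by linear_combination c i * hp i j
  obtain ⟨m, hm⟩ := hr.2 (∑ i, c i * p i) (∑ j, d j * p j) (by
    rw [← hd, ← hc, Finset.sum_mul, Finset.sum_mul]
    refine Eq.trans (Finset.sum_congr rfl fun j _ => (mul_assoc _ _ _).trans (congrArg (d j * ·) (e c j))) ?_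
    rw [← Finset.sum_mul, Finset.mul_sum]
    exact Finset.sum_congr rfl fun j _ => by ring)
  refine ⟨m, fun j => ?_⟩
  have h1 := e c j
  rw [hc, hm] at h1
  have : a ^ K * (p j - g j * m) = 0 := by linear_combination -h1
  exact sub_eq_zero.mp (hr.1 _ this)

/-- A Čech one-cocycle `q_ij / (g_i g_j)` on the complement of a locus of depth at least three is
a coboundary. -/
lemma exists_of_cocycle {a b c : R} (h : Reg3 a b c) {g : ι → R}
    (ha : ∃ K, a ^ K ∈ Ideal.span (Set.range g)) (hb : ∃ L, b ^ L ∈ Ideal.span (Set.range g))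
    (hc : ∃ L, c ^ L ∈ Ideal.span (Set.range g))
    (q : ι → ι → R) (hq : ∀ i j, q i j + q j i = 0)
    (hcoc : ∀ i j k, q i k * g j = q i j * g k + q j k * g i) :
    ∃ p : ι → R, ∀ i j, q i j = p i * g j - p j * g i := by
  obtain ⟨K, hK⟩ := ha
  obtain ⟨d, hd⟩ := Ideal.mem_span_range_iff_exists_fun.mp hK
  let B : ι → R := fun i => ∑ l, d l * q i l
  have hB : ∀ i j, a ^ K * q i j = B i * g j - B j * g i := by
    intro i j
    rw [← hd, Finset.sum_mul, Finset.sum_mul, Finset.sum_mul, ← Finset.sum_sub_distrib]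
    exact Finset.sum_congr rfl fun l _ => by linear_combination d l * hcoc i l j + d l * g i * hq l j
  let f := Ideal.Quotient.mk (Ideal.span {a ^ K})
  have hmap : ∀ x : R, x ∈ Ideal.span (Set.range g) →
      f x ∈ Ideal.span (Set.range fun i => f (g i)) := by
    intro x hx
    have := Ideal.mem_map_of_mem f hx
    rw [Ideal.map_span, ← Set.range_comp] at this
    exact this
  obtain ⟨m, hm⟩ := exists_of_mul_eq (h.quotient K) (g := fun i => f (g i))
    (hb.imp fun L hL => by rw [← map_pow]; exact hmap _ hL)
    (hc.imp fun L hL => by rw [← map_pow]; exact hmap _ hL) (fun i => f (B i)) (by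
      intro i j
      rw [← map_mul, ← map_mul]
      refine Ideal.Quotient.eq.mpr ?_
      rw [← hB]
      exact Ideal.mul_mem_right _ _ (Ideal.mem_span_singleton_self _))
  obtain ⟨m, rfl⟩ := Ideal.Quotient.mk_surjective m
  have hm' : ∀ i, ∃ z, B i - g i * m = a ^ K * z := by
    intro i
    have h1 := hm i
    rw [← map_mul, Ideal.Quotient.eq, Ideal.mem_span_singleton] at h1
    exact h1
  choose p hp using hm'
  refine ⟨p, fun i j => ?_⟩
  have : a ^ K * (q i j - (p i * g j - p j * g i)) = 0 := by
    linear_combination hB i j + g j * hp i - g i * hp j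
  exact sub_eq_zero.mp ((h.1.pow_left K).1 _ this)

end regular

/-! ### Depth at the vertex of a cone -/

section graded

variable {τ : Type}

/-- The cone over the closed subscheme defined by `I` has depth at least two at the vertex: as in
`DepthThree`, with a regular sequence of length two. -/
def DepthTwo (I : Ideal (MvPolynomial τ ℂ)) : Prop :=
  ∃ (R : Type) (_ : CommRing R) (φ : MvPolynomial τ ℂ →+* R), (∀ p, φ p = 0 ↔ p ∈ I) ∧
    (∀ z, ∃ s u : MvPolynomial τ ℂ, s.coeff 0 ≠ 0 ∧ φ s * z = φ u) ∧
    ∃ a b, a ∈ Ideal.span (Set.range fun c => φ (MvPolynomial.X c)) ∧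
      b ∈ Ideal.span (Set.range fun c => φ (MvPolynomial.X c)) ∧ Reg2 a b

/-- The cone over the closed subscheme defined by `I` has depth at least three at the vertex: after
passing to a ring of fractions `R` of `ℂ[X] / I` whose denominators do not vanish at the vertex,
there is a regular sequence of length three in the ideal of the vertex. -/
def DepthThree (I : Ideal (MvPolynomial τ ℂ)) : Prop :=
  ∃ (R : Type) (_ : CommRing R) (φ : MvPolynomial τ ℂ →+* R), (∀ p, φ p = 0 ↔ p ∈ I) ∧
    (∀ z, ∃ s u : MvPolynomial τ ℂ, s.coeff 0 ≠ 0 ∧ φ s * z = φ u) ∧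
    ∃ a b c, a ∈ Ideal.span (Set.range fun c => φ (MvPolynomial.X c)) ∧
      b ∈ Ideal.span (Set.range fun c => φ (MvPolynomial.X c)) ∧
      c ∈ Ideal.span (Set.range fun c => φ (MvPolynomial.X c)) ∧ Reg3 a b c

lemma DepthThree.depthTwo {I : Ideal (MvPolynomial τ ℂ)} (h : DepthThree I) : DepthTwo I := by
  obtain ⟨R, _, φ, h1, h2, a, b, c, ha, hb, -, h3⟩ := h
  exact ⟨R, _, φ, h1, h2, a, b, ha, hb, h3.1⟩

variable {I : Ideal (MvPolynomial τ ℂ)}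

lemma exists_pow_mem_span {R : Type} [CommRing R] {φ : MvPolynomial τ ℂ →+* R}
    (hφ : ∀ p ∈ I, φ p = 0) {ι : Type*} {g : ι → MvPolynomial τ ℂ}
    (hg : ∀ c, ∃ N, (MvPolynomial.X c ^ N : MvPolynomial τ ℂ) ∈ Ideal.span (Set.range g) ⊔ I)
    {a : R} (ha : a ∈ Ideal.span (Set.range fun c => φ (MvPolynomial.X c))) :
    ∃ K, a ^ K ∈ Ideal.span (Set.range fun i => φ (g i)) := by
  have h : Ideal.span (Set.range fun c => φ (MvPolynomial.X c)) ≤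
      (Ideal.span (Set.range fun i => φ (g i))).radical := by
    rw [Ideal.span_le]
    rintro _ ⟨c, rfl⟩
    obtain ⟨N, hN⟩ := hg c
    refine ⟨N, ?_⟩
    rw [← map_pow]
    obtain ⟨x, hx, y, hy, hxy⟩ := Submodule.mem_sup.mp hN
    rw [← hxy, map_add, hφ y hy, add_zero]
    have := Ideal.mem_map_of_mem φ hx
    rwa [Ideal.map_span, ← Set.range_comp] at this
  exact h ha

variable (hI : ∀ p ∈ I, ∀ m, MvPolynomial.homogeneousComponent m p ∈ I)
  {ι : Type*} [Fintype ι] {g : ι → MvPolynomial τ ℂ}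
  (hg : ∀ c, ∃ N, (MvPolynomial.X c ^ N : MvPolynomial τ ℂ) ∈ Ideal.span (Set.range g) ⊔ I)

lemma component_mul_right {n m : ℕ} {r p : MvPolynomial τ ℂ} (hr : r ∈ Hom' τ n) :
    MvPolynomial.homogeneousComponent (m + n) (p * r) =
      MvPolynomial.homogeneousComponent m p * r := by
  rw [mul_comm, component_mul hr, if_pos (Nat.le_add_left _ _), Nat.add_sub_cancel, mul_comm]

include hI hg in
/-- Polynomials `p_i` of degree `D i = deg g_i - δ` such that the fractions `p_i / g_i` agree on
overlaps are, modulo `I`, a constant multiple of the `g_i`. The fractions extend over the vertex,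
and comparing the homogeneous components of degree `D i` gives the constant, which vanishes if
`δ ≠ 0`. -/
lemma DepthTwo.exists_const (h : DepthTwo I) {D E : ι → ℕ} {δ : ℕ} (hDE : ∀ i, D i + δ = E i)
    (hgE : ∀ i, g i ∈ Hom' τ (E i)) {p : ι → MvPolynomial τ ℂ} (hpD : ∀ i, p i ∈ Hom' τ (D i))
    (hp : ∀ i j, p i * g j - p j * g i ∈ I) :
    ∃ c : ℂ, (δ ≠ 0 → c = 0) ∧ ∀ i, p i - MvPolynomial.C c * g i ∈ I := by
  obtain ⟨R, _, φ, h1, h2, a, b, ha, hb, hab⟩ := h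
  have h0 : ∀ p ∈ I, φ p = 0 := fun p hp => (h1 p).mpr hp
  obtain ⟨m, hm⟩ := exists_of_mul_eq hab (exists_pow_mem_span h0 hg ha)
    (exists_pow_mem_span h0 hg hb) (fun i => φ (p i)) (by
      intro i j
      rw [← map_mul, ← map_mul, ← sub_eq_zero, ← map_sub]
      exact h0 _ (hp i j))
  obtain ⟨s, u, hs, hsu⟩ := h2 m
  have h3 : ∀ i, s * p i - u * g i ∈ I := by
    intro i
    rw [← h1, map_sub, map_mul, map_mul, hm, ← hsu]
    ring
  have h4 : ∀ i, MvPolynomial.C (s.coeff 0) * p i -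
      MvPolynomial.C (if δ = 0 then u.coeff 0 else 0) * g i ∈ I := by
    intro i
    have := hI _ (h3 i) (0 + D i)
    rw [map_sub, component_mul_right (hpD i), MvPolynomial.homogeneousComponent_zero] at this
    split_ifs with hδ
    · subst hδ
      have e : D i = E i := by simpa using hDE i
      rwa [e, component_mul_right (hgE i), MvPolynomial.homogeneousComponent_zero] at this
    · rw [mul_comm u, component_mul (hgE i), if_neg (by have := hDE i; omega)] at this
      simpa using this
  refine ⟨(s.coeff 0)⁻¹ * (if δ = 0 then u.coeff 0 else 0), fun hδ => by rw [if_neg hδ, mul_zero],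
    fun i => ?_⟩
  have := Ideal.mul_mem_left _ (MvPolynomial.C (s.coeff 0)⁻¹) (h4 i)
  rwa [mul_sub, ← mul_assoc, ← mul_assoc, ← MvPolynomial.C_mul, ← MvPolynomial.C_mul,
    inv_mul_cancel₀ hs, MvPolynomial.C_1, one_mul] at this

include hI hg in
/-- A homogeneous Čech `1`-cocycle `q_ij / (g_i g_j)` on the complement of the vertex is the
coboundary of homogeneous fractions: it is the coboundary of fractions in the ring of the
definition of depth, and the homogeneous components of their numerators do as well. -/
lemma DepthThree.exists_coboundary (h : DepthThree I) {D E : ι → ℕ} {δ : ℕ}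
    (hDE : ∀ i, D i + δ = E i)
    (hgE : ∀ i, g i ∈ Hom' τ (E i)) {q : ι → ι → MvPolynomial τ ℂ}
    (hqD : ∀ i j, q i j ∈ Hom' τ (D i + E j)) (hq : ∀ i j, q i j + q j i ∈ I)
    (hcoc : ∀ i j k, q i k * g j - (q i j * g k + q j k * g i) ∈ I) :
    ∃ p : ι → MvPolynomial τ ℂ, (∀ i, p i ∈ Hom' τ (D i)) ∧
      ∀ i j, q i j - (p i * g j - p j * g i) ∈ I := by
  obtain ⟨R, _, φ, h1, h2, a, b, c, ha, hb, hc, habc⟩ := h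
  have h0 : ∀ p ∈ I, φ p = 0 := fun p hp => (h1 p).mpr hp
  obtain ⟨β, hβ⟩ := exists_of_cocycle habc (exists_pow_mem_span h0 hg ha)
    (exists_pow_mem_span h0 hg hb) (exists_pow_mem_span h0 hg hc) (fun i j => φ (q i j))
    (fun i j => by rw [← map_add]; exact h0 _ (hq i j)) (by
      intro i j k
      rw [← map_mul, ← map_mul, ← map_mul, ← map_add, ← sub_eq_zero, ← map_sub]
      exact h0 _ (hcoc i j k))
  choose s u hs hsu using fun i => h2 (β i)
  classical
  let S := ∏ i, s i
  let v : ι → MvPolynomial τ ℂ := fun i => (∏ j ∈ Finset.univ.erase i, s j) * u i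
  have hS : S.coeff 0 ≠ 0 := by
    have : MvPolynomial.constantCoeff S = ∏ i, MvPolynomial.constantCoeff (s i) := map_prod _ _ _
    rw [MvPolynomial.constantCoeff_eq] at this
    rw [this]
    exact Finset.prod_ne_zero_iff.mpr fun i _ => hs i
  have hv : ∀ i, φ S * β i = φ (v i) := by
    intro i
    have e : S = (∏ j ∈ Finset.univ.erase i, s j) * s i :=
      (Finset.prod_erase_mul _ _ (Finset.mem_univ i)).symm
    rw [e, map_mul, mul_assoc, hsu, map_mul]
  have h3 : ∀ i j, S * q i j - (v i * g j - v j * g i) ∈ I := by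
    intro i j
    rw [← h1, map_sub, map_mul, map_sub, map_mul (f := φ) (v i), map_mul (f := φ) (v j), hβ, ← hv, ← hv]
    ring
  refine ⟨fun i => MvPolynomial.C (S.coeff 0)⁻¹ * MvPolynomial.homogeneousComponent (D i) (v i),
    fun i => ?_, fun i j => ?_⟩
  · refine (congrArg (· ∈ Hom' τ (D i)) (MvPolynomial.smul_eq_C_mul _ _)).mp ?_
    exact Submodule.smul_mem _ _ (MvPolynomial.homogeneousComponent_mem _ _)
  · have h4 := hI _ (h3 i j) (0 + (D i + E j))
    rw [map_sub, component_mul_right (hqD i j), MvPolynomial.homogeneousComponent_zero, map_sub,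
      zero_add, component_mul_right (hgE j), show D i + E j = D j + E i by
        have := hDE i
        have := hDE j
        omega, component_mul_right (hgE i)] at h4
    have h5 := Ideal.mul_mem_left _ (MvPolynomial.C (S.coeff 0)⁻¹) h4
    have e : MvPolynomial.C (S.coeff 0)⁻¹ * MvPolynomial.C (S.coeff 0) = (1 : MvPolynomial τ ℂ) := by
      rw [← MvPolynomial.C_mul, inv_mul_cancel₀ hS, MvPolynomial.C_1]
    refine (congrArg (· ∈ I) ?_).mp h5
    linear_combination q i j * e

end graded


/-! ### Maps to projective space given by homogeneous polynomials -/

section model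

variable {σ τ : Type} {Y : Scheme.{0}}

/-- The coordinates of `f : Y ⟶ ℙ(σ)` are given, in terms of another morphism
`g : Y ⟶ ℙ(τ)`, by the homogeneous polynomials `G a` of degree `m`; in other words
`f^* 𝒪(1) = g^* 𝒪(m)`, compatibly with the coordinates. -/
structure Model (f : Y ⟶ PP σ) (g : Y ⟶ PP τ) (m : ℕ) (G : σ → MvPolynomial τ ℂ) : Prop where
  pos : 0 < m
  mem : ∀ a, G a ∈ Hom' τ m
  chart_eq : ∀ a, chart f a = g ⁻¹ᵁ DP (G a)
  ratio_eq : ∀ a b, ratio f a b = fr g (mem b) (mem a) (chart_eq a).le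

variable {f : Y ⟶ PP σ} {g : Y ⟶ PP τ}

lemma mem_cast {p : MvPolynomial τ ℂ} {m n : ℕ} (h : p ∈ Hom' τ m) (e : m = n) : p ∈ Hom' τ n :=
  e ▸ h

/-- Functions on `Y ∩ D₊(h)` are fractions with denominator any large power of `h`. -/
lemma exists_fr_of_large [IsClosedImmersion g] {n : ℕ} (hn : 0 < n) {h : MvPolynomial τ ℂ}
    (hh : h ∈ Hom' τ n) {U : Y.Opens} (hU : U = g ⁻¹ᵁ DP h) (s : Γ(Y, U)) :
    ∃ k₀, ∀ k ≥ k₀, ∃ (p : MvPolynomial τ ℂ) (hp : p ∈ Hom' τ (k * n)),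
      s = fr g hp (mem_pow hh k) (le_DP_pow hU.le k) := by
  subst hU
  obtain ⟨k₀, p, hp, rfl⟩ := fr_surjective hn hh s
  refine ⟨k₀, fun k hk => ?_⟩
  obtain ⟨c, rfl⟩ := Nat.exists_eq_add_of_le hk
  exact ⟨p * h ^ c, mem_cast (mem_mul hp (mem_pow hh c)) (by ring), fr_eq _ _ _ _ _ _ (by ring)⟩

/-- A variant of `exists_pow_mul_mem_idealOf` for all large powers. -/
lemma exists_pow_mul_mem_of_large [Finite τ] [IsClosedImmersion g] {n N : ℕ}
    {h p q : MvPolynomial τ ℂ} (hh : h ∈ Hom' τ n) (hp : p ∈ Hom' τ N) (hq : q ∈ Hom' τ N)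
    {U : Y.Opens} (hU : g ⁻¹ᵁ DP h = U) (hUq : U ≤ g ⁻¹ᵁ DP q) (h0 : fr g hp hq hUq = 0) :
    ∃ K₀, ∀ K ≥ K₀, h ^ K * p ∈ idealOf g := by
  subst hU
  obtain ⟨K₀, hK⟩ := exists_pow_mul_mem_idealOf hh hp hq hUq h0
  refine ⟨K₀, fun K hk => ?_⟩
  obtain ⟨c, rfl⟩ := Nat.exists_eq_add_of_le hk
  rw [add_comm, pow_add, mul_assoc]
  exact Ideal.mul_mem_left _ _ hK

/-- Finitely many conditions that hold eventually hold simultaneously. -/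
lemma exists_uniform {ι : Type*} [Finite ι] {P : ι → ℕ → Prop} (h : ∀ i, ∃ k₀, ∀ k ≥ k₀, P i k) :
    ∃ k₀, ∀ k ≥ k₀, ∀ i, P i k := by
  cases nonempty_fintype ι
  choose k₀ hk using h
  exact ⟨∑ i, k₀ i, fun k hk' i => hk i k ((Finset.single_le_sum (fun _ _ => Nat.zero_le _)
    (Finset.mem_univ i)).trans hk')⟩

namespace Model

variable {m : ℕ} {G : σ → MvPolynomial τ ℂ} (M : Model f g m G)

include M

lemma tr_eq (a b : σ) {U : Y.Opens} (ha : U ≤ chart f a) (hb : U ≤ chart f b) :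
    (tr f a b ha hb : Γ(Y, U)) = fr g (M.mem b) (M.mem a) (ha.trans (M.chart_eq a).le) := by
  rw [tr_val, M.ratio_eq, res_fr]

lemma tr_pow_eq (a b : σ) {U : Y.Opens} (ha : U ≤ chart f a) (hb : U ≤ chart f b) (k : ℕ) :
    (tr f a b ha hb : Γ(Y, U)) ^ k = fr g (mem_pow (M.mem b) k) (mem_pow (M.mem a) k)
      (le_DP_pow (ha.trans (M.chart_eq a).le) k) := by
  induction k with
  | zero =>
    rw [pow_zero, ← fr_self (mem_pow (M.mem a) 0) (le_DP_pow (ha.trans (M.chart_eq a).le) 0)]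
    exact fr_eq _ _ _ _ _ _ (by ring)
  | succ k ih =>
    rw [pow_succ, ih, M.tr_eq, ← fr_mul]
    exact fr_eq _ _ _ _ _ _ (by ring)

lemma iSup_DP : (⨆ a, g ⁻¹ᵁ DP (G a)) = ⊤ := by
  rw [← iSup_chart f]
  exact iSup_congr fun a => (M.chart_eq a).symm

/-- Sections of `𝒪_Y(-k)`, `k ≥ 0`, are constants, and vanish if `k > 0`. -/
lemma exists_const [Finite σ] [Finite τ] [IsClosedImmersion g] (h2 : DepthTwo (idealOf g)) (k : ℕ)
    (s : H0 f (-(k : ℤ))) : ∃ c : ℂ, (k ≠ 0 → c = 0) ∧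
      ∀ a, coef s a le_top le_rfl = res le_top (cst g c) := by
  cases nonempty_fintype σ
  obtain ⟨n, hn⟩ := exists_uniform fun a =>
    exists_fr_of_large M.pos (M.mem a) (M.chart_eq a) (coef s a le_top le_rfl)
  choose p hp hps using hn n le_rfl
  have hinf : ∀ a b, g ⁻¹ᵁ DP (G a * G b) = chart f a ⊓ chart f b := fun a b => by
    rw [M.chart_eq, M.chart_eq, DP, Proj.basicOpen_mul]
    rfl
  have h1 : ∀ ab : σ × σ, ∃ K₀, ∀ K ≥ K₀, (G ab.1 * G ab.2) ^ K *
      (p ab.1 * G ab.2 ^ (n + k) - p ab.2 * G ab.1 ^ (n + k)) ∈ idealOf g := by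
    rintro ⟨a, b⟩
    have ha : chart f a ⊓ chart f b ≤ g ⁻¹ᵁ DP (G a) := inf_le_left.trans (M.chart_eq a).le
    have hb : chart f a ⊓ chart f b ≤ g ⁻¹ᵁ DP (G b) := inf_le_right.trans (M.chart_eq b).le
    have e := coef_eq s b a (V := chart f a ⊓ chart f b) le_top inf_le_right inf_le_left
    rw [← tr_inv, inv_zpow, ← zpow_neg, neg_neg, zpow_natCast, Units.val_pow_eq_pow_val,
      M.tr_pow_eq] at e
    have ea : coef s a le_top inf_le_left = res (inf_le_left : chart f a ⊓ chart f b ≤ chart f a)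
      (coef s a le_top le_rfl) := (res_coef _ _ _ _ _).symm
    have eb : coef s b le_top inf_le_right = res (inf_le_right : chart f a ⊓ chart f b ≤ chart f b)
      (coef s b le_top le_rfl) := (res_coef _ _ _ _ _).symm
    rw [ea, eb, hps a, hps b, res_fr, res_fr, ← fr_mul] at e
    have hq : G a ^ (n + k) * G b ^ n ∈ Hom' τ ((n + (n + k)) * m) :=
      mem_cast (mem_mul (mem_pow (M.mem a) _) (mem_pow (M.mem b) _)) (by ring)
    have hle : chart f a ⊓ chart f b ≤ g ⁻¹ᵁ DP (G a ^ (n + k) * G b ^ n) :=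
      le_DP_mul (le_DP_pow ha _) (le_DP_pow hb _)
    have h1 : p a * G b ^ (n + k) ∈ Hom' τ ((n + (n + k)) * m) :=
      mem_cast (mem_mul (hp a) (mem_pow (M.mem b) (n + k))) (by ring)
    have h2 : p b * G a ^ (n + k) ∈ Hom' τ ((n + (n + k)) * m) :=
      mem_cast (mem_mul (hp b) (mem_pow (M.mem a) (n + k))) (by ring)
    refine exists_pow_mul_mem_of_large (mem_mul (M.mem a) (M.mem b)) (sub_mem h1 h2) hq
      (hinf a b) hle ?_
    rw [fr_sub h1 h2, sub_eq_zero]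
    refine (Eq.trans ?_ e.symm).trans ?_
    · exact fr_eq _ _ _ _ _ _ (by ring)
    · exact fr_eq _ _ _ _ _ _ (by ring)
  obtain ⟨K, hK⟩ := exists_uniform h1
  obtain ⟨c, hc0, hc⟩ := h2.exists_const (fun p hp => component_mem_idealOf hp)
    (g := fun a => G a ^ (n + K + k)) (D := fun _ => (n + K) * m) (E := fun _ => (n + K + k) * m)
    (δ := k * m) (exists_X_pow_mem (fun a => mem_pow (M.mem a) _) (by
      rw [eq_top_iff, ← M.iSup_DP]
      exact iSup_mono fun a => le_DP_pow le_rfl _)) (fun _ => by ring)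
    (fun a => mem_pow (M.mem a) _) (p := fun a => p a * G a ^ K)
    (fun a => mem_cast (mem_mul (hp a) (mem_pow (M.mem a) K)) (by ring)) (fun a b => by
      have := hK K le_rfl (a, b)
      refine (congrArg (· ∈ idealOf g) ?_).mp this
      ring)
  refine ⟨c, fun hk => hc0 (Nat.mul_ne_zero hk M.pos.ne'), fun a => ?_⟩
  have ha : chart f a ≤ g ⁻¹ᵁ DP (G a) := (M.chart_eq a).le
  by_cases hk : k = 0
  · subst hk
    rw [hps, cst_eq c (mem_pow (M.mem a) (n + K)) (le_DP_pow ha _), ← sub_eq_zero]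
    have h3 : p a * G a ^ K - c • G a ^ (n + K) ∈ Hom' τ ((n + K) * m) :=
      sub_mem (mem_cast (mem_mul (hp a) (mem_pow (M.mem a) K)) (by ring))
        (Submodule.smul_mem _ _ (mem_pow (M.mem a) _))
    refine Eq.trans ?_ (fr_eq_zero_of_mem h3 (mem_pow (M.mem a) (n + K)) (by
      rw [MvPolynomial.smul_eq_C_mul]
      exact hc a) (le_DP_pow ha _))
    rw [fr_sub (mem_cast (mem_mul (hp a) (mem_pow (M.mem a) K)) (by ring))
        (Submodule.smul_mem _ _ (mem_pow (M.mem a) _))]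
    congr 1
    exact fr_eq _ _ _ _ _ _ (by ring)
  · rw [hc0 (Nat.mul_ne_zero hk M.pos.ne'), map_zero, map_zero, hps]
    have h3 : p a * G a ^ K ∈ Hom' τ ((n + K) * m) :=
      mem_cast (mem_mul (hp a) (mem_pow (M.mem a) K)) (by ring)
    refine Eq.trans ?_ (fr_eq_zero_of_mem h3 (mem_pow (M.mem a) (n + K)) (by
      have := hc a
      rwa [hc0 (Nat.mul_ne_zero hk M.pos.ne'), map_zero, zero_mul, sub_zero] at this) (le_DP_pow ha _))
    exact fr_eq _ _ _ _ _ _ (by ring)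

/-- The sheaf `𝒪_Y(-1)` has no sections if the cone over `Y` has depth at least two. -/
lemma H0_neg_one_eq_zero [Finite σ] [Finite τ] [IsClosedImmersion g] (h2 : DepthTwo (idealOf g))
    (s : H0 f (-1)) : s = 0 := by
  obtain ⟨c, h0, hc⟩ := M.exists_const h2 1 s
  refine TwSec.ext_coef fun a V hV ha => ?_
  have h1 := congrArg (res ha) (hc a)
  rw [res_coef, res_res, h0 one_ne_zero, map_zero, map_zero] at h1
  exact h1.trans (map_zero (res _)).symm

end Model

end model


/-! ### Vanishing of the Čech cohomology of the sheaf `𝒪_Y(-2)` -/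

section model

variable {σ τ : Type} {Y : Scheme.{0}} {f : Y ⟶ PP σ} {g : Y ⟶ PP τ}

namespace Model

variable {m : ℕ} {G : σ → MvPolynomial τ ℂ} (M : Model f g m G)

include M

/-- Every Čech `1`-cocycle with values in `𝒪_Y(-2)` is a coboundary. On the open set `U i`, which
is contained in the chart of `a i`, sections of `𝒪_Y(-2)` are written as `c X_{a i} ^ {-2}`. -/
lemma exists_coboundary [Finite τ] [IsClosedImmersion g] (h3 : DepthThree (idealOf g))
    {ι : Type} [Finite ι] (a : ι → σ) {n : ι → ℕ} {h' : ι → MvPolynomial τ ℂ}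
    (hh' : ∀ i, h' i ∈ Hom' τ (n i)) (U : ι → Y.Opens) (hU : ∀ i, U i = g ⁻¹ᵁ DP (h' i * G (a i)))
    (hcov : ⊤ ≤ iSup U) (ha : ∀ i, U i ≤ chart f (a i)) (c : ∀ i j, Γ(Y, U i ⊓ U j))
    (hanti : ∀ i j, c i j + (tr f (a j) (a i) (inf_le_right.trans (ha j)) (inf_le_left.trans (ha i)) :
      Γ(Y, U i ⊓ U j)) ^ 2 * res (le_inf inf_le_right inf_le_left) (c j i) = 0)
    (hcoc : ∀ i j k, ∀ {W : Y.Opens} (hi : W ≤ U i) (hj : W ≤ U j) (hk : W ≤ U k),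
      res (le_inf hi hk) (c i k) = res (le_inf hi hj) (c i j) +
        (tr f (a j) (a i) (hj.trans (ha j)) (hi.trans (ha i)) : Γ(Y, W)) ^ 2 *
          res (le_inf hj hk) (c j k)) :
    ∃ r : ∀ i, Γ(Y, U i), ∀ i j, c i j = res inf_le_left (r i) -
      (tr f (a j) (a i) (inf_le_right.trans (ha j)) (inf_le_left.trans (ha i)) :
        Γ(Y, U i ⊓ U j)) ^ 2 * res inf_le_right (r j) := by
  cases nonempty_fintype ι
  let h : ι → MvPolynomial τ ℂ := fun i => h' i * G (a i)
  have hdef : ∀ i, h i = h' i * G (a i) := fun i => rfl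
  have hh : ∀ i, h i ∈ Hom' τ (n i + m) := fun i => mem_mul (hh' i) (M.mem _)
  have leh : ∀ i {W : Y.Opens}, W ≤ U i → W ≤ g ⁻¹ᵁ DP (h i) := fun i W hW => hW.trans (hU i).le
  have leh' : ∀ i {W : Y.Opens}, W ≤ U i → W ≤ g ⁻¹ᵁ DP (h' i) := fun i W hW =>
    (leh i hW).trans (g.preimage_mono (Proj.basicOpen_mono _ _ _ ⟨G (a i), rfl⟩))
  have leG : ∀ i {W : Y.Opens}, W ≤ U i → W ≤ g ⁻¹ᵁ DP (G (a i)) := fun i W hW =>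
    (hW.trans (ha i)).trans (M.chart_eq _).le
  have hinf : ∀ {p q : MvPolynomial τ ℂ} {V W : Y.Opens}, V = g ⁻¹ᵁ DP p → W = g ⁻¹ᵁ DP q →
      V ⊓ W = g ⁻¹ᵁ DP (p * q) := by
    intro p q V W hV hW
    rw [hV, hW, DP, DP, DP, Proj.basicOpen_mul]
    rfl
  -- a uniform denominator for the cocycle
  obtain ⟨k, hk⟩ := exists_uniform fun ij : ι × ι =>
    exists_fr_of_large (by have := M.pos; omega) (mem_mul (hh ij.1) (hh ij.2))
      (hinf (hU ij.1) (hU ij.2)) (c ij.1 ij.2)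
  replace hk := hk k le_rfl
  choose p hp hpc using fun i j => hk (i, j)
  dsimp only at hp hpc
  -- the cocycle in terms of the generators `G ^ {-2}`, with denominators `(h i) ^ (k + 2)`
  let Q : ι → ι → MvPolynomial τ ℂ := fun i j => p i j * h' i ^ 2 * h j ^ 2
  have hQ : ∀ i j, Q i j ∈ Hom' τ (k * (n i + m) + 2 * n i + (k + 2) * (n j + m)) := fun i j =>
    mem_cast (mem_mul (mem_mul (hp i j) (mem_pow (hh' i) 2)) (mem_pow (hh j) 2)) (by ring)
  have h1 : ∀ ij : ι × ι, ∃ K₀, ∀ K ≥ K₀,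
      (h ij.1 * h ij.2) ^ K * (Q ij.1 ij.2 + Q ij.2 ij.1) ∈ idealOf g := by
    rintro ⟨i, j⟩
    have hQ' : Q j i ∈ Hom' τ (k * (n i + m) + 2 * n i + (k + 2) * (n j + m)) :=
      mem_cast (hQ j i) (by ring)
    have hq : (h i * h j) ^ k * (h' i * h j) ^ 2 ∈
        Hom' τ (k * (n i + m) + 2 * n i + (k + 2) * (n j + m)) :=
      mem_cast (mem_mul (mem_pow (mem_mul (hh i) (hh j)) k)
        (mem_pow (mem_mul (hh' i) (hh j)) 2)) (by ring)
    have hle : U i ⊓ U j ≤ g ⁻¹ᵁ DP ((h i * h j) ^ k * (h' i * h j) ^ 2) :=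
      le_DP_mul (le_DP_pow (le_DP_mul (leh i inf_le_left) (leh j inf_le_right)) _)
        (le_DP_pow (le_DP_mul (leh' i inf_le_left) (leh j inf_le_right)) _)
    refine exists_pow_mul_mem_of_large (mem_mul (hh i) (hh j)) (add_mem (hQ i j) hQ') hq
      (hinf (hU i) (hU j)).symm hle ?_
    rw [fr_add (hQ i j) hQ' hq hle]
    refine Eq.trans ?_ (hanti i j)
    rw [hpc i j, hpc j i, res_fr, M.tr_pow_eq, ← fr_mul]
    congr 1
    · exact fr_eq _ _ _ _ _ _ (by simp only [Q]; ring)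
    · exact fr_eq _ _ _ _ _ _ (by simp only [Q, hdef]; ring)
  have h2 : ∀ ijk : ι × ι × ι, ∃ K₀, ∀ K ≥ K₀, (h ijk.1 * h ijk.2.1 * h ijk.2.2) ^ K *
      (Q ijk.1 ijk.2.2 * h ijk.2.1 ^ (k + 2) - (Q ijk.1 ijk.2.1 * h ijk.2.2 ^ (k + 2) +
        Q ijk.2.1 ijk.2.2 * h ijk.1 ^ (k + 2))) ∈ idealOf g := by
    rintro ⟨i, j, l⟩
    have m1 : Q i l * h j ^ (k + 2) ∈
        Hom' τ (k * (n i + m) + 2 * n i + (k + 2) * (n j + m) + (k + 2) * (n l + m)) :=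
      mem_cast (mem_mul (hQ i l) (mem_pow (hh j) (k + 2))) (by ring)
    have m2 : Q i j * h l ^ (k + 2) ∈
        Hom' τ (k * (n i + m) + 2 * n i + (k + 2) * (n j + m) + (k + 2) * (n l + m)) :=
      mem_cast (mem_mul (hQ i j) (mem_pow (hh l) (k + 2))) (by ring)
    have m3 : Q j l * h i ^ (k + 2) ∈
        Hom' τ (k * (n i + m) + 2 * n i + (k + 2) * (n j + m) + (k + 2) * (n l + m)) :=
      mem_cast (mem_mul (hQ j l) (mem_pow (hh i) (k + 2))) (by ring)
    have hq : (h i * h j * h l) ^ k * (h' i * h j * h l) ^ 2 ∈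
        Hom' τ (k * (n i + m) + 2 * n i + (k + 2) * (n j + m) + (k + 2) * (n l + m)) :=
      mem_cast (mem_mul (mem_pow (mem_mul (mem_mul (hh i) (hh j)) (hh l)) k)
        (mem_pow (mem_mul (mem_mul (hh' i) (hh j)) (hh l)) 2)) (by ring)
    have hi : U i ⊓ U j ⊓ U l ≤ U i := inf_le_left.trans inf_le_left
    have hj : U i ⊓ U j ⊓ U l ≤ U j := inf_le_left.trans inf_le_right
    have hl : U i ⊓ U j ⊓ U l ≤ U l := inf_le_right
    have hle : U i ⊓ U j ⊓ U l ≤ g ⁻¹ᵁ DP ((h i * h j * h l) ^ k * (h' i * h j * h l) ^ 2) :=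
      le_DP_mul (le_DP_pow (le_DP_mul (le_DP_mul (leh i hi) (leh j hj)) (leh l hl)) _)
        (le_DP_pow (le_DP_mul (le_DP_mul (leh' i hi) (leh j hj)) (leh l hl)) _)
    refine exists_pow_mul_mem_of_large (mem_mul (mem_mul (hh i) (hh j)) (hh l))
      (sub_mem m1 (add_mem m2 m3)) hq (hinf (hinf (hU i) (hU j)) (hU l)).symm hle ?_
    rw [fr_sub m1 (add_mem m2 m3) hq hle, fr_add m2 m3 hq hle, sub_eq_zero]
    have e := hcoc i j l hi hj hl
    rw [hpc i j, hpc j l, hpc i l, res_fr, res_fr, res_fr, M.tr_pow_eq, ← fr_mul] at e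
    refine (Eq.trans ?_ e).trans ?_
    · exact fr_eq _ _ _ _ _ _ (by simp only [Q]; ring)
    · congr 1
      · exact fr_eq _ _ _ _ _ _ (by simp only [Q]; ring)
      · exact fr_eq _ _ _ _ _ _ (by simp only [Q, hdef]; ring)
  -- a power `K` of the denominators makes the cocycle relations hold modulo the ideal of `Y`
  obtain ⟨K₁, hK₁⟩ := exists_uniform h1
  obtain ⟨K₂, hK₂⟩ := exists_uniform h2
  obtain ⟨K, hK1, hK2⟩ : ∃ K, K₁ ≤ K ∧ K₂ ≤ K := ⟨max K₁ K₂, le_max_left _ _, le_max_right _ _⟩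
  obtain ⟨b, hb, hbq⟩ := h3.exists_coboundary (fun p hp => component_mem_idealOf hp)
    (g := fun i => h i ^ (k + 2 + K)) (D := fun i => (k + K) * (n i + m) + 2 * n i)
    (E := fun i => (k + 2 + K) * (n i + m)) (δ := 2 * m)
    (exists_X_pow_mem (fun i => mem_pow (hh i) _) (by
      rw [eq_top_iff]
      exact hcov.trans (iSup_mono fun i => le_DP_pow (leh i le_rfl) _)))
    (fun i => by ring) (fun i => mem_pow (hh i) _)
    (q := fun i j => Q i j * (h i * h j) ^ K)
    (fun i j => mem_cast (mem_mul (hQ i j) (mem_pow (mem_mul (hh i) (hh j)) K)) (by ring))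
    (fun i j => by
      refine (congrArg (· ∈ idealOf g) ?_).mp (hK₁ K hK1 (i, j))
      dsimp only
      ring)
    (fun i j l => by
      refine (congrArg (· ∈ idealOf g) ?_).mp (hK₂ K hK2 (i, j, l))
      dsimp only
      ring)
  have hGb : ∀ i, G (a i) ^ 2 * b i ∈ Hom' τ ((k + 2 + K) * (n i + m)) := fun i =>
    mem_cast (mem_mul (mem_pow (M.mem (a i)) 2) (hb i)) (by ring)
  refine ⟨fun i => fr g (hGb i) (mem_pow (hh i) (k + 2 + K)) (le_DP_pow (leh i le_rfl) _),
    fun i j => ?_⟩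
  have hle : U i ⊓ U j ≤ g ⁻¹ᵁ DP ((h i * h j) ^ (k + 2 + K)) :=
    le_DP_pow (le_DP_mul (leh i inf_le_left) (leh j inf_le_right)) _
  have hq := mem_pow (mem_mul (hh i) (hh j)) (k + 2 + K)
  have m0 : G (a i) ^ 2 * (Q i j * (h i * h j) ^ K) ∈
      Hom' τ ((k + 2 + K) * (n i + m + (n j + m))) :=
    mem_cast (mem_mul (mem_pow (M.mem (a i)) 2)
      (mem_mul (hQ i j) (mem_pow (mem_mul (hh i) (hh j)) K))) (by ring)
  have m1 : G (a i) ^ 2 * (b i * h j ^ (k + 2 + K)) ∈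
      Hom' τ ((k + 2 + K) * (n i + m + (n j + m))) :=
    mem_cast (mem_mul (mem_pow (M.mem (a i)) 2) (mem_mul (hb i) (mem_pow (hh j) _))) (by ring)
  have m2 : G (a i) ^ 2 * (b j * h i ^ (k + 2 + K)) ∈
      Hom' τ ((k + 2 + K) * (n i + m + (n j + m))) :=
    mem_cast (mem_mul (mem_pow (M.mem (a i)) 2) (mem_mul (hb j) (mem_pow (hh i) _))) (by ring)
  have e0 := fr_eq_zero_of_mem (sub_mem m0 (sub_mem m1 m2)) hq (by
    have := Ideal.mul_mem_left _ (G (a i) ^ 2) (hbq i j)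
    refine (congrArg (· ∈ idealOf g) ?_).mp this
    ring) hle
  rw [fr_sub m0 (sub_mem m1 m2) hq hle, fr_sub m1 m2 hq hle, sub_eq_zero] at e0
  rw [res_fr, res_fr, M.tr_pow_eq, ← fr_mul, hpc i j]
  refine (Eq.trans ?_ e0).trans ?_
  · exact fr_eq _ _ _ _ _ _ (by simp only [Q, hdef]; ring)
  · congr 1
    · exact fr_eq _ _ _ _ _ _ (by ring)
    · exact fr_eq _ _ _ _ _ _ (by ring)

end Model

end model


/-! ### Splitting of extensions of `𝒪_Y(1)` by `𝒪_Y(-1)` -/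

section model

variable {σ τ : Type} {Y : Scheme.{0}} {f : Y ⟶ PP σ} {g : Y ⟶ PP τ}

lemma exists_mem_chart (f : Y ⟶ PP σ) (x : Y) : ∃ a, x ∈ chart f a := by
  have h : x ∈ ⨆ a, chart f a := by
    rw [iSup_chart]
    trivial
  exact Opens.mem_iSup.mp h

lemma isAffineOpen_chart [IsClosedImmersion g] (a : τ) : IsAffineOpen (chart g a) :=
  (Proj.isAffineOpen_basicOpen _ _ (X_mem a) one_pos).preimage g

variable (g) in
lemma compactSpace_of_isClosedImmersion [Finite τ] [IsClosedImmersion g] : CompactSpace Y := by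
  refine ⟨?_⟩
  have h : (Set.univ : Set Y) = ⋃ a, (chart g a : Set Y) := by
    refine (Set.eq_univ_of_forall fun x => ?_).symm
    exact Set.mem_iUnion.mpr (exists_mem_chart g x)
  rw [h]
  exact isCompact_iUnion fun a => (isAffineOpen_chart a).isCompact

/-- The sets `Y ∩ D₊(h)`, `h` homogeneous, form a basis of the topology of `Y`. -/
lemma exists_preimage_DP_le [IsClosedImmersion g] {V : Y.Opens} {x : Y} (hx : x ∈ V) :
    ∃ (n : ℕ) (h : MvPolynomial τ ℂ), h ∈ Hom' τ n ∧ x ∈ g ⁻¹ᵁ DP h ∧ g ⁻¹ᵁ DP h ≤ V := by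
  obtain ⟨W, hW, hWV⟩ := g.isClosedEmbedding.isInducing.isOpen_iff.mp V.isOpen
  have hxW : g x ∈ W := by
    have : x ∈ g ⁻¹' W := hWV ▸ hx
    exact this
  obtain ⟨_, ⟨p, rfl⟩, hxp, hpW⟩ := Opens.isBasis_iff_nbhd.mp
    (Proj.isBasis_basicOpen (MvPolynomial.homogeneousSubmodule τ ℂ)) (U := ⟨W, hW⟩) hxW
  rw [Proj.basicOpen_eq_iSup_proj] at hxp hpW
  obtain ⟨n, hn⟩ := Opens.mem_iSup.mp hxp
  refine ⟨n, _, SetLike.coe_mem (DirectSum.decompose (MvPolynomial.homogeneousSubmodule τ ℂ) p n),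
    hn, fun y hy => ?_⟩
  have h1 : g y ∈ W := hpW (Opens.mem_iSup.mpr ⟨n, hy⟩)
  have h2 : y ∈ g ⁻¹' W := h1
  rw [hWV] at h2
  exact h2

lemma twist_hom_ext_cover {k : ℤ} {M : Y.Modules} {ι : Type} (a : ι → σ) (U : ι → Y.Opens)
    (hU : ⊤ ≤ iSup U) (ha : ∀ i, U i ≤ chart f (a i)) {p q : twist f k ⟶ M}
    (h : ∀ i, twApp p (U i) (TwSec.ofChart k (a i) (ha i) 1) =
      twApp q (U i) (TwSec.ofChart k (a i) (ha i) 1)) : p = q := by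
  refine hom_ext_sec fun V s => ?_
  refine sec_ext (U := fun i => V ⊓ U i) ?_ (fun i => inf_le_left) fun i => ?_
  · rw [← inf_iSup_eq]
    exact le_inf le_rfl (le_top.trans hU)
  · have key : ∀ (p : twist f k ⟶ M) (s : TwSec f k V), rm M (inf_le_left : V ⊓ U i ≤ V)
        (twApp p V s) = coef s (a i) inf_le_left (inf_le_right.trans (ha i)) •
          rm M inf_le_right (twApp p (U i) (TwSec.ofChart k (a i) (ha i) 1)) := by
      intro p s
      rw [← twApp_restr, TwSec.eq_ofChart (a i) (inf_le_right.trans (ha i)) (TwSec.restr _ s),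
        twApp_smul, coef_restr, ← twApp_restr, TwSec.restr_ofChart, map_one]
    refine (key p s).trans (Eq.trans ?_ (key q s).symm)
    rw [h]

lemma TwSec.ofChart_add {k : ℤ} (a : σ) {U : Y.Opens} (ha : U ≤ chart f a) (r s : Γ(Y, U)) :
    TwSec.ofChart k a ha (r + s) = TwSec.ofChart k a ha r + TwSec.ofChart k a ha s :=
  TwSec.ext_chart a ha (by
    rw [coef_add, coef_ofChart_self, coef_ofChart_self, coef_ofChart_self, map_add])

lemma TwSec.ofChart_zero {k : ℤ} (a : σ) {U : Y.Opens} (ha : U ≤ chart f a) :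
    TwSec.ofChart k a ha 0 = 0 := by
  have h := TwSec.ofChart_add (k := k) a ha 0 0
  rwa [add_zero, left_eq_add] at h

lemma TwSec.ofChart_mul {k : ℤ} (a : σ) {U : Y.Opens} (ha : U ≤ chart f a) (r s : Γ(Y, U)) :
    TwSec.ofChart k a ha (r * s) = r • TwSec.ofChart k a ha s :=
  TwSec.ext_chart a ha (by
    rw [coef_smul, coef_ofChart_self, coef_ofChart_self, map_mul])

lemma TwSec.ofChart_one_eq (a b : σ) {U : Y.Opens} (ha : U ≤ chart f a) (hb : U ≤ chart f b) :
    TwSec.ofChart 1 a ha 1 = (tr f b a hb ha : Γ(Y, U)) • TwSec.ofChart 1 b hb 1 := by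
  refine TwSec.ext_chart b hb ?_
  rw [coef_smul, coef_ofChart_self, coef_ofChart, res_self, res_self, mul_one, mul_one, zpow_one]

lemma TwSec.ofChart_neg_one_eq (a b : σ) {U : Y.Opens} (ha : U ≤ chart f a) (hb : U ≤ chart f b)
    (r : Γ(Y, U)) :
    TwSec.ofChart (-1) a ha ((tr f b a hb ha : Γ(Y, U)) * r) = TwSec.ofChart (-1) b hb r := by
  refine TwSec.ext_chart b hb ?_
  rw [coef_ofChart_self, coef_ofChart, res_self, res_self, ← mul_assoc,
    ← Units.val_mul, zpow_neg_one, inv_mul_cancel, Units.val_one, one_mul]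

namespace Model

variable {m : ℕ} {G : σ → MvPolynomial τ ℂ} (M : Model f g m G)

include M

/-- If the generators of `𝒪_Y(1)` can be lifted on a finite cover by sets `Y ∩ D₊(h)`, then the
extension splits. -/
lemma exists_section [Finite τ] [IsClosedImmersion g] (h3 : DepthThree (idealOf g))
    {E : Y.Modules} (ι : twist f (-1) ⟶ E) (π : E ⟶ twist f 1) (w : ι ≫ π = 0)
    (hS : (ShortComplex.mk ι π w).ShortExact)
    {T : Type} [Finite T] (a : T → σ) {n : T → ℕ} {h' : T → MvPolynomial τ ℂ}
    (hh' : ∀ i, h' i ∈ Hom' τ (n i)) (U : T → Y.Opens) (hU : ∀ i, U i = g ⁻¹ᵁ DP (h' i * G (a i)))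
    (hcov : ⊤ ≤ iSup U) (ha : ∀ i, U i ≤ chart f (a i)) (t : ∀ i, Γ(E, U i))
    (ht : ∀ i, π.app (U i) (t i) = TwSec.ofChart 1 (a i) (ha i) 1) :
    ∃ s : twist f 1 ⟶ E, s ≫ π = 𝟙 _ := by
  have : Mono ι := hS.mono_f
  have hι : ∀ (b : σ) {W : Y.Opens} (hb : W ≤ chart f b) (r s : Γ(Y, W)),
      twApp ι W (TwSec.ofChart (-1) b hb r) = twApp ι W (TwSec.ofChart (-1) b hb s) → r = s := by
    intro b W hb r s h
    have h1 : TwSec.ofChart (-1) b hb r = TwSec.ofChart (-1) b hb s := app_injective_of_mono ι W h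
    have h2 := congrArg (fun s : TwSec f (-1) W => coef s b le_rfl hb) h1
    simpa only [coef_ofChart_self, res_self] using h2
  have hπt : ∀ i {W : Y.Opens} (hi : W ≤ U i),
      π.app W (rm E hi (t i)) = TwSec.ofChart 1 (a i) (hi.trans (ha i)) 1 := by
    intro i W hi
    rw [app_rm, ht]
    refine (TwSec.restr_ofChart (a i) hi (ha i) 1).trans ?_
    rw [map_one]
  -- the cocycle of the extension
  have hc : ∀ i j, ∃ c : Γ(Y, U i ⊓ U j),
      twApp ι (U i ⊓ U j) (TwSec.ofChart (-1) (a i) (inf_le_left.trans (ha i)) c) =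
        rm E inf_le_left (t i) - (tr f (a j) (a i) (inf_le_right.trans (ha j))
          (inf_le_left.trans (ha i)) : Γ(Y, U i ⊓ U j)) • rm E inf_le_right (t j) := by
    intro i j
    obtain ⟨z, hz⟩ : ∃ z : TwSec f (-1) (U i ⊓ U j), twApp ι (U i ⊓ U j) z =
        rm E inf_le_left (t i) - (tr f (a j) (a i) (inf_le_right.trans (ha j))
          (inf_le_left.trans (ha i)) : Γ(Y, U i ⊓ U j)) • rm E inf_le_right (t j) :=
      exists_of_exact hS.exact (U := U i ⊓ U j) (rm E inf_le_left (t i) - (tr f (a j) (a i) (inf_le_right.trans (ha j))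
        (inf_le_left.trans (ha i)) : Γ(Y, U i ⊓ U j)) • rm E inf_le_right (t j)) (by
        change π.app _ _ = 0
        rw [map_sub, Scheme.Modules.Hom.app_smul, hπt, hπt]
        exact sub_eq_zero.mpr (TwSec.ofChart_one_eq _ _ _ _))
    refine ⟨coef z (a i) le_rfl (inf_le_left.trans (ha i)), ?_⟩
    rw [← hz]
    refine congrArg (twApp ι (U i ⊓ U j)) ?_
    refine TwSec.ext_chart (a i) (inf_le_left.trans (ha i)) ?_
    rw [coef_ofChart_self, res_coef]
  choose c hc using hc
  have hcW : ∀ i j {W : Y.Opens} (hi : W ≤ U i) (hj : W ≤ U j),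
      twApp ι W (TwSec.ofChart (-1) (a i) (hi.trans (ha i)) (res (le_inf hi hj) (c i j))) =
        rm E hi (t i) - (tr f (a j) (a i) (hj.trans (ha j)) (hi.trans (ha i)) : Γ(Y, W)) •
          rm E hj (t j) := by
    intro i j W hi hj
    have h1 := congrArg (rm E (le_inf hi hj)) (hc i j)
    rw [← twApp_restr, TwSec.restr_ofChart, map_sub, rm_smul, rm_rm, rm_rm] at h1
    have h2 := res_tr (f := f) (a j) (a i) (le_inf hi hj) (inf_le_right.trans (ha j))
      (inf_le_left.trans (ha i)) 1
    rw [zpow_one, zpow_one] at h2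
    rw [h2] at h1
    exact h1
  have hτ : ∀ i j {W : Y.Opens} (hi : W ≤ chart f (a i)) (hj : W ≤ chart f (a j)) (r : Γ(Y, W)),
      twApp ι W (TwSec.ofChart (-1) (a i) hi ((tr f (a j) (a i) hj hi : Γ(Y, W)) ^ 2 * r)) =
        (tr f (a j) (a i) hj hi : Γ(Y, W)) • twApp ι W (TwSec.ofChart (-1) (a j) hj r) := by
    intro i j W hi hj r
    rw [pow_two, mul_assoc, TwSec.ofChart_mul, twApp_smul, TwSec.ofChart_neg_one_eq]
  obtain ⟨r, hr⟩ := M.exists_coboundary h3 a hh' U hU hcov ha c (by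
    intro i j
    refine hι (a i) (inf_le_left.trans (ha i)) _ _ ?_
    rw [TwSec.ofChart_add, map_add, hτ i j (inf_le_left.trans (ha i)) (inf_le_right.trans (ha j)),
      hcW j i inf_le_right inf_le_left, hc, smul_sub,
      smul_smul, ← Units.val_mul, tr_mul, tr_self, Units.val_one, one_smul,
      sub_add_sub_cancel', sub_self, TwSec.ofChart_zero, map_zero]) (by
    intro i j k W hi hj hk
    refine hι (a i) (hi.trans (ha i)) _ _ ?_
    rw [TwSec.ofChart_add, map_add, hτ i j (hi.trans (ha i)) (hj.trans (ha j)), hcW i k hi hk, hcW i j hi hj,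
      hcW j k hj hk, smul_sub, smul_smul,
      ← Units.val_mul, mul_comm, tr_mul, sub_add_sub_cancel])
  -- the lifts corrected by the cochain are compatible
  obtain ⟨s, hs⟩ := exists_twist_hom (k := 1) a U hcov ha
    (fun i => t i - twApp ι (U i) (TwSec.ofChart (-1) (a i) (ha i) (r i))) (by
      intro i j
      rw [map_sub, map_sub, ← twApp_restr, ← twApp_restr, TwSec.restr_ofChart,
        TwSec.restr_ofChart, zpow_one, smul_sub,
        ← hτ i j (inf_le_left.trans (ha i)) (inf_le_right.trans (ha j))]
      have h1 := hc i j
      have h2 : res inf_le_left (r i) = c i j + (tr f (a j) (a i) (inf_le_right.trans (ha j))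
          (inf_le_left.trans (ha i)) : Γ(Y, U i ⊓ U j)) ^ 2 * res inf_le_right (r j) := by
        rw [hr i j, sub_add_cancel]
      rw [h2, TwSec.ofChart_add, map_add, h1]
      abel)
  refine ⟨s, twist_hom_ext_cover a U hcov ha fun i => ?_⟩
  have h1 : twApp (s ≫ π) (U i) (TwSec.ofChart 1 (a i) (ha i) 1) =
      π.app (U i) (twApp s (U i) (TwSec.ofChart 1 (a i) (ha i) 1)) := rfl
  have h2 : π.app (U i) (twApp ι (U i) (TwSec.ofChart (-1) (a i) (ha i) (r i))) = 0 := by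
    have := congrArg (fun p => twApp p (U i) (TwSec.ofChart (-1) (a i) (ha i) (r i))) w
    exact this
  rw [h1, hs, map_sub, h2, sub_zero, ht]
  rfl

/-- Extensions of `𝒪_Y(1)` by `𝒪_Y(-1)` split, as their classes lie in `H¹(𝒪_Y(-2)) = 0`. -/
lemma extSplit [Finite τ] [IsClosedImmersion g] (h3 : DepthThree (idealOf g)) :
    ExtSplit (twist f 1) (twist f (-1)) := by
  intro E ι π w hS
  have : Epi π := hS.epi_g
  have : Mono ι := hS.mono_f
  have : CompactSpace Y := compactSpace_of_isClosedImmersion g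
  -- local lifts of the generators
  have h1 : ∀ x : Y, ∃ (a : σ) (n : ℕ) (h' : MvPolynomial τ ℂ) (_ : h' ∈ Hom' τ n)
      (_ : x ∈ g ⁻¹ᵁ DP (h' * G a)) (ha : g ⁻¹ᵁ DP (h' * G a) ≤ chart f a)
      (t : Γ(E, g ⁻¹ᵁ DP (h' * G a))),
      π.app _ t = TwSec.ofChart 1 a ha 1 := by
    intro x
    obtain ⟨a, ha⟩ := exists_mem_chart f x
    obtain ⟨V, hV, t, hxV, ht⟩ := exists_lift_of_epi π
      (TwSec.ofChart 1 a le_rfl 1 : TwSec f 1 (chart f a)) ha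
    obtain ⟨n, h', hh', hxh, hle⟩ := exists_preimage_DP_le (g := g) hxV
    have e : g ⁻¹ᵁ DP (h' * G a) = g ⁻¹ᵁ DP h' ⊓ chart f a := by
      rw [M.chart_eq, DP, Proj.basicOpen_mul]
      rfl
    have le : g ⁻¹ᵁ DP (h' * G a) ≤ V := (e.le.trans inf_le_left).trans hle
    refine ⟨a, n, h', hh', e ▸ ⟨hxh, ha⟩, e.le.trans inf_le_right, rm E le t, ?_⟩
    rw [app_rm, ht]
    refine (congrArg (TwSec.restr le) (TwSec.restr_ofChart a hV le_rfl 1)).trans ?_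
    refine (TwSec.restr_ofChart a le hV _).trans ?_
    rw [map_one, map_one]
  choose a n h' hh' hx ha t ht using h1
  obtain ⟨T, hT⟩ := isCompact_univ.elim_finite_subcover
    (fun x => ((g ⁻¹ᵁ DP (h' x * G (a x)) : Y.Opens) : Set Y)) (fun x => Opens.isOpen _)
    (fun x _ => Set.mem_iUnion.mpr ⟨x, hx x⟩)
  let U : T → Y.Opens := fun i => g ⁻¹ᵁ DP (h' i * G (a i))
  have hcov : ⊤ ≤ iSup U := by
    intro x _
    obtain ⟨i, hi, hxi⟩ := Set.mem_iUnion₂.mp (hT (Set.mem_univ x))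
    exact Opens.mem_iSup.mpr ⟨⟨i, hi⟩, hxi⟩
  exact M.exists_section h3 ι π w hS (fun i : T => a i) (fun i => hh' i) U (fun _ => rfl) hcov
    (fun i => ha i) (fun i => t i) fun i => ht i

end Model

end model


/-! ### Morphisms between the sheaves `V ⊗ 𝒪_Y(k)` -/

section sheafMap

variable {σ : Type} {Y : Scheme.{0}} {f : Y ⟶ PP σ}
  {V V' V'' : Type} [AddCommGroup V] [Module ℂ V] [FiniteDimensional ℂ V]
  [AddCommGroup V'] [Module ℂ V'] [FiniteDimensional ℂ V']
  [AddCommGroup V''] [Module ℂ V''] [FiniteDimensional ℂ V'']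

lemma entry_injective {m : ℤ} {S T : V →ₗ[ℂ] V' ⊗[ℂ] H0 f m}
    (h : ∀ i j, entry S i j = entry T i j) : S = T := by
  refine (Module.finBasis ℂ V).ext fun j => ?_
  rw [expand (S _), expand (T _)]
  exact Finset.sum_congr rfl fun i _ => congrArg _ (h i j)

lemma exists_entry_eq {m : ℤ} (t : Fin (Module.finrank ℂ V') → Fin (Module.finrank ℂ V) → H0 f m) :
    ∃ T : V →ₗ[ℂ] V' ⊗[ℂ] H0 f m, ∀ i j, entry T i j = t i j := by
  refine ⟨(Module.finBasis ℂ V).constr ℂ fun j => ∑ i, Module.finBasis ℂ V' i ⊗ₜ t i j,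
    fun i j => ?_⟩
  rw [entry, Module.Basis.constr_basis]
  simp [Finsupp.single_apply, ite_smul]

variable (f V) in
/-- The inclusion of the summand of `V ⊗ 𝒪_Y(k)` spanned by a basis vector. -/
def tensι (k : ℤ) (a : Fin (Module.finrank ℂ V)) : twist f k ⟶ tens f V k :=
  biproduct.ι (fun _ : Fin (Module.finrank ℂ V) => twist f k) a

variable (f V) in
/-- A coordinate of `V ⊗ 𝒪_Y(k)`. -/
def tensπ (k : ℤ) (a : Fin (Module.finrank ℂ V)) : tens f V k ⟶ twist f k :=
  biproduct.π (fun _ : Fin (Module.finrank ℂ V) => twist f k) a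

omit [FiniteDimensional ℂ V] in
lemma tens_hom_ext {k : ℤ} {M : Y.Modules} {p q : M ⟶ tens f V k}
    (h : ∀ a, p ≫ tensπ f V k a = q ≫ tensπ f V k a) : p = q := biproduct.hom_ext _ _ h

omit [FiniteDimensional ℂ V] in
lemma tens_hom_ext' {k : ℤ} {M : Y.Modules} {p q : tens f V k ⟶ M}
    (h : ∀ a, tensι f V k a ≫ p = tensι f V k a ≫ q) : p = q := biproduct.hom_ext' _ _ h

omit [FiniteDimensional ℂ V] in
lemma tensι_π_self (k : ℤ) (a : Fin (Module.finrank ℂ V)) :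
    tensι f V k a ≫ tensπ f V k a = 𝟙 _ := biproduct.ι_π_self _ _

omit [FiniteDimensional ℂ V] in
lemma tensι_π_ne (k : ℤ) {a b : Fin (Module.finrank ℂ V)} (h : a ≠ b) :
    tensι f V k a ≫ tensπ f V k b = 0 := biproduct.ι_π_ne _ h

omit [FiniteDimensional ℂ V] in
lemma tens_total (k : ℤ) : ∑ a, tensπ f V k a ≫ tensι f V k a = 𝟙 _ := biproduct.total

lemma sheafMap_π {k m l : ℤ} (h : k + m = l) (T : V →ₗ[ℂ] V' ⊗[ℂ] H0 f m) (b) :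
    sheafMap h T ≫ tensπ f V' l b = ∑ a, tensπ f V k a ≫ mulHom h (entry T b a) :=
  by
  refine (biproduct.matrix_π _ _).trans ?_
  exact biproduct.desc_eq

lemma ι_sheafMap_π {k m l : ℤ} (h : k + m = l) (T : V →ₗ[ℂ] V' ⊗[ℂ] H0 f m) (a b) :
    tensι f V k a ≫ sheafMap h T ≫ tensπ f V' l b = mulHom h (entry T b a) := by
  rw [sheafMap_π, Preadditive.comp_sum, Finset.sum_eq_single a]
  · rw [← Category.assoc, tensι_π_self, Category.id_comp]
  · intro c _ hc
    rw [← Category.assoc, tensι_π_ne k hc.symm, zero_comp]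
  · exact fun h => (h (Finset.mem_univ a)).elim

/-- Morphisms `V ⊗ 𝒪_Y(k) ⟶ V' ⊗ 𝒪_Y(l)` are matrices of sections of `𝒪_Y(l - k)`. -/
lemma sheafMap_surjective {k m l : ℤ} (h : k + m = l) (p : tens f V k ⟶ tens f V' l) :
    ∃ T : V →ₗ[ℂ] V' ⊗[ℂ] H0 f m, sheafMap h T = p := by
  choose t ht using fun b a => mulHom_surjective h (tensι f V k a ≫ p ≫ tensπ f V' l b)
  obtain ⟨T, hT⟩ := exists_entry_eq t
  refine ⟨T, tens_hom_ext fun b => tens_hom_ext' fun a => ?_⟩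
  exact (ι_sheafMap_π h T a b).trans ((congrArg _ (hT b a)).trans (ht b a))

lemma sheafMap_injective {k m l : ℤ} (h : k + m = l) {S T : V →ₗ[ℂ] V' ⊗[ℂ] H0 f m}
    (e : sheafMap h S = sheafMap h T) : S = T :=
  entry_injective fun b a => mulHom_injective h (by
    rw [← ι_sheafMap_π h S a b, ← ι_sheafMap_π h T a b, e])

variable (f V V') in
/-- The decomposition of `(V × V') ⊗ 𝒪_Y(k)`. -/
def tensProd (k : ℤ) : tens f (V × V') k ≅ tens f V k ⊞ tens f V' k where
  hom := biprod.lift (linMap k (LinearMap.fst ℂ V V')) (linMap k (LinearMap.snd ℂ V V'))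
  inv := biprod.desc (linMap k (LinearMap.inl ℂ V V')) (linMap k (LinearMap.inr ℂ V V'))
  hom_inv_id := by
    rw [biprod.lift_desc, linMap_comp, linMap_comp, ← linMap_add, ← linMap_id]
    congr 1
    ext <;> simp
  inv_hom_id := by
    have hz : linMap (f := f) k (0 : V →ₗ[ℂ] V') = 0 := by
      have := linMap_add (f := f) k (0 : V →ₗ[ℂ] V') 0
      rwa [add_zero, left_eq_add] at this
    have hz' : linMap (f := f) k (0 : V' →ₗ[ℂ] V) = 0 := by
      have := linMap_add (f := f) k (0 : V' →ₗ[ℂ] V) 0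
      rwa [add_zero, left_eq_add] at this
    refine biprod.hom_ext' _ _ (biprod.hom_ext _ _ ?_ ?_) (biprod.hom_ext _ _ ?_ ?_) <;>
      simp [linMap_comp, hz, hz', linMap_id]

/-- An isomorphism of vector spaces induces isomorphisms of sheaves. -/
def linIso (k : ℤ) (e : V ≃ₗ[ℂ] V') : tens f V k ≅ tens f V' k where
  hom := linMap k e.toLinearMap
  inv := linMap k e.symm.toLinearMap
  hom_inv_id := by
    rw [linMap_comp, ← linMap_id]
    congr 1
    ext
    simp
  inv_hom_id := by
    rw [linMap_comp, ← linMap_id]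
    congr 1
    ext
    simp

end sheafMap

/-- Isomorphic terms give isomorphic three term complexes. -/
def threeTermIso {C : Type*} [Category* C] [Abelian C] {P Q R P' Q' R' : C}
    {p : P ⟶ Q} {q : Q ⟶ R} {w : p ≫ q = 0} {p' : P' ⟶ Q'} {q' : Q' ⟶ R'} {w' : p' ≫ q' = 0}
    (a : P ≅ P') (b : Q ≅ Q') (c : R ≅ R') (h : p ≫ b.hom = a.hom ≫ p')
    (h' : q ≫ c.hom = b.hom ≫ q') : threeTerm p q w ≅ threeTerm p' q' w' where
  hom := threeTerm.map a.hom b.hom c.hom h h'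
  inv := threeTerm.map a.inv b.inv c.inv (by rw [Iso.eq_inv_comp, ← reassoc_of% h]; simp)
    (by rw [Iso.eq_inv_comp, ← reassoc_of% h']; simp)
  hom_inv_id := by
    rw [← threeTerm.map_comp (a'' := 𝟙 _) (b'' := 𝟙 _) (c'' := 𝟙 _) _ _ _ _ (by simp) (by simp)
      (by simp) (by simp) (by simp)]
    exact threeTerm.map_id _ _ rfl rfl rfl
  inv_hom_id := by
    rw [← threeTerm.map_comp (a'' := 𝟙 _) (b'' := 𝟙 _) (c'' := 𝟙 _) _ _ _ _ (by simp) (by simp)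
      (by simp) (by simp) (by simp)]
    exact threeTerm.map_id _ _ rfl rfl rfl

lemma mapBiproduct_mapIso_hom_π {C D : Type*} [Category* C] [Category* D] [Preadditive C]
    [Preadditive D] [HasFiniteBiproducts C] [HasFiniteBiproducts D] (F : C ⥤ D) [F.Additive]
    {n : ℕ} {X : Fin n → C} {X' : Fin n → D} (e : ∀ a, F.obj (X a) ≅ X' a) (a : Fin n) :
    (F.mapBiproduct X ≪≫ biproduct.mapIso e).hom ≫ biproduct.π X' a =
      F.map (biproduct.π X a) ≫ (e a).hom := by
  simp only [Iso.trans_hom, biproduct.mapIso_hom, Functor.mapBiproduct_hom, Category.assoc,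
    biproduct.map_π]
  exact (Category.assoc _ _ _).symm.trans (congrArg (· ≫ _) (biproduct.lift_π _ _))

/-! ### Pullback of the sheaves `V ⊗ 𝒪_Y(k)` -/

section pullTens

variable {σ : Type} {Y Z : Scheme.{0}} (j : Z ⟶ Y) (i : Y ⟶ PP σ)
  (V : Type) [AddCommGroup V] [Module ℂ V] [FiniteDimensional ℂ V]
  (V' : Type) [AddCommGroup V'] [Module ℂ V'] [FiniteDimensional ℂ V']

lemma pullTw_csmul {k : ℤ} (c : ℂ) (s : H0 i k) :
    (pullTw j i (c • s) : H0 (j ≫ i) k) = c • (pullTw j i s : H0 (j ≫ i) k) := by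
  refine Subtype.ext (funext fun a => ?_)
  rw [TwSec.csmul_apply]
  refine (congrArg (j.app (⊤ ⊓ chart i a)).hom (TwSec.csmul_apply c s a)).trans ?_
  rw [map_mul, app_res]
  congr 1

/-- The restriction of global sections. -/
def pullH0 (k : ℤ) : H0 i k →ₗ[ℂ] H0 (j ≫ i) k where
  toFun s := (pullTw j i s : H0 (j ≫ i) k)
  map_add' := map_add (pullTw j i)
  map_smul' := pullTw_csmul j i

lemma pullH0_polySec {m : ℕ} {p : MvPolynomial σ ℂ} (hp : p ∈ Hom' σ m) :
    pullH0 j i m (polySec i hp) = polySec (j ≫ i) hp := pullTw_polySec j i hp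

variable {i V V'} in
lemma entry_lTensor {m : ℤ} {f : Z ⟶ PP σ} (φ : H0 i m →ₗ[ℂ] H0 f m) (T : V →ₗ[ℂ] V' ⊗[ℂ] H0 i m)
    (a b) :
    entry (LinearMap.lTensor V' φ ∘ₗ T) a b = φ (entry T a b) := by
  unfold entry
  rw [LinearMap.comp_apply]
  generalize T _ = z
  induction z with
  | zero => simp
  | add x y hx hy => simp only [map_add, hx, hy]
  | tmul v s => simp

/-- The pullback of `V ⊗ 𝒪_Y(k)`. -/
def pullTens (k : ℤ) : (Scheme.Modules.pullback j).obj (tens i V k) ≅ tens (j ≫ i) V k :=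
  (Scheme.Modules.pullback j).mapBiproduct _ ≪≫ biproduct.mapIso fun _ => pullTwistIso j i k

omit [FiniteDimensional ℂ V] in
lemma pullTens_hom_π (k : ℤ) (a) : (pullTens j i V k).hom ≫ tensπ (j ≫ i) V k a =
    (Scheme.Modules.pullback j).map (tensπ i V k a) ≫ (pullTwistIso j i k).hom := by
  exact mapBiproduct_mapIso_hom_π (Scheme.Modules.pullback j)
    (fun _ : Fin (Module.finrank ℂ V) => pullTwistIso j i k) a

/-- The pullback of a matrix of sections is the matrix of the restricted sections. -/
lemma pullTens_naturality {k m l : ℤ} (h : k + m = l) (T : V →ₗ[ℂ] V' ⊗[ℂ] H0 i m) :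
    (Scheme.Modules.pullback j).map (sheafMap h T) ≫ (pullTens j i V' l).hom =
      (pullTens j i V k).hom ≫ sheafMap h (LinearMap.lTensor V' (pullH0 j i m) ∘ₗ T) := by
  refine tens_hom_ext fun b => ?_
  rw [Category.assoc, Category.assoc, pullTens_hom_π, sheafMap_π, ← Functor.map_comp_assoc,
    sheafMap_π, Functor.map_sum, Preadditive.sum_comp, Preadditive.comp_sum]
  refine Finset.sum_congr rfl fun a _ => ?_
  rw [Functor.map_comp, Category.assoc, pullTwistIso_naturality, entry_lTensor,
    ← Category.assoc, ← pullTens_hom_π, Category.assoc]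
  rfl

end pullTens


/-! ### Projective space and the line -/

section isoProj

variable {τ : Type} {Y : Scheme.{0}} {g : Y ⟶ PP τ}

/-- On projective space itself, only the zero polynomial defines the zero section. -/
lemma eq_zero_of_polySec_eq_zero [IsIso g] [Nonempty τ] {m : ℕ} {p : MvPolynomial τ ℂ}
    (hp : p ∈ Hom' τ m) (h : polySec g hp = 0) : p = 0 := by
  let a : τ := Classical.arbitrary τ
  have h1 : (g.app _).hom (frac a hp) = 0 := (polySec_eq_zero_iff hp).mp h a
  have h2 : frac a hp = 0 := by
    have hinj : Function.Injective (g.app (DP (MvPolynomial.X a))).hom :=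
      ((ConcreteCategory.isIso_iff_bijective (g.app (DP (MvPolynomial.X a)))).mp inferInstance).1
    exact hinj (h1.trans (map_zero _).symm)
  have h3 : HomogeneousLocalization.Away.mk (MvPolynomial.homogeneousSubmodule τ ℂ) (X_mem a) m p
      (by simpa using hp) = 0 := by
    have hinj : Function.Injective (Proj.awayToSection (MvPolynomial.homogeneousSubmodule τ ℂ)
        (MvPolynomial.X a)).hom := by
      have e := (Proj.basicOpenIsoAway (MvPolynomial.homogeneousSubmodule τ ℂ) _ (X_mem a)
        one_pos).hom_inv_id
      exact Function.LeftInverse.injective fun z => ConcreteCategory.congr_hom e z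
    exact hinj (h2.trans (map_zero _).symm)
  have h4 := congrArg HomogeneousLocalization.val h3
  rw [HomogeneousLocalization.Away.val_mk, HomogeneousLocalization.val_zero, Localization.mk_eq_mk',
    IsLocalization.mk'_eq_zero_iff] at h4
  obtain ⟨⟨_, n, rfl⟩, hn⟩ := h4
  exact (mul_eq_zero.mp hn).resolve_left (pow_ne_zero _ (MvPolynomial.X_ne_zero a))

lemma idealOf_eq_bot [IsIso g] [Nonempty τ] : idealOf g = ⊥ := by
  rw [idealOf, Ideal.span_eq_bot]
  rintro p ⟨m, hp, h⟩
  exact eq_zero_of_polySec_eq_zero hp h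

lemma reg2_X {a b : τ} (hab : a ≠ b) :
    Reg2 (MvPolynomial.X a : MvPolynomial τ ℂ) (MvPolynomial.X b) := by
  refine ⟨fun u hu => (mul_eq_zero.mp hu).resolve_left (MvPolynomial.X_ne_zero a),
    fun u v h => ?_⟩
  have h1 : (MvPolynomial.X a : MvPolynomial τ ℂ) ∣ MvPolynomial.X b * u := ⟨v, h⟩
  rcases (MvPolynomial.X_prime (R := ℂ) (i := a)).dvd_or_dvd h1 with h2 | h2
  · exact absurd (by simpa using h2) hab
  · exact h2

lemma depthTwo_bot {a b : τ} (hab : a ≠ b) : DepthTwo (⊥ : Ideal (MvPolynomial τ ℂ)) :=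
  ⟨MvPolynomial τ ℂ, inferInstance, RingHom.id _, fun p => by simp,
    fun z => ⟨1, z, by simp, by simp⟩, MvPolynomial.X a, MvPolynomial.X b,
    Ideal.subset_span ⟨a, rfl⟩, Ideal.subset_span ⟨b, rfl⟩, reg2_X hab⟩

end isoProj

section line

variable {d : ℕ}

lemma killZ_mem {m : ℕ} {p : MvPolynomial (Fin (d + 1) ⊕ Fin 2) ℂ}
    (hp : p ∈ Hom' (Fin (d + 1) ⊕ Fin 2) m) : (killZ d p : MvPolynomial (Fin 2) ℂ) ∈ Hom' (Fin 2) m :=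
  (killZ d).map_mem hp

lemma killZ_X_inl (k : Fin (d + 1)) :
    (killZ d (MvPolynomial.X (Sum.inl k)) : MvPolynomial (Fin 2) ℂ) = 0 :=
  MvPolynomial.aeval_X (R := ℂ) _ _

lemma killZ_X_inr (k : Fin 2) :
    (killZ d (MvPolynomial.X (Sum.inr k)) : MvPolynomial (Fin 2) ℂ) = MvPolynomial.X k :=
  MvPolynomial.aeval_X (R := ℂ) _ _

lemma killZ_C (c : ℂ) :
    (killZ d (MvPolynomial.C c) : MvPolynomial (Fin 2) ℂ) = MvPolynomial.C c :=
  MvPolynomial.aeval_C (R := ℂ) _ _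

/-- A fraction restricts to the line by setting the coordinates `z_k` to zero. -/
lemma fr_lineIncl {n : ℕ} {p q : MvPolynomial (Fin (d + 1) ⊕ Fin 2) ℂ}
    (hp : p ∈ Hom' (Fin (d + 1) ⊕ Fin 2) n) (hq : q ∈ Hom' (Fin (d + 1) ⊕ Fin 2) n)
    {U : (PP (Fin 2)).Opens} (hU : U ≤ lineIncl d ⁻¹ᵁ DP q)
    (hU' : U ≤ 𝟙 (PP (Fin 2)) ⁻¹ᵁ DP (killZ d q)) :
    fr (lineIncl d) hp hq hU = fr (𝟙 _) (killZ_mem hp) (killZ_mem hq) hU' := by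
  have h := ConcreteCategory.congr_hom (Proj.awayToSection_comp_appLE (killZ d) (killZ_irrelevant d) hq)
    (HomogeneousLocalization.Away.mk _ hq 1 p (by simpa using hp))
  have h1 : (CommRingCat.ofHom (HomogeneousLocalization.Away.map (killZ d) q) ≫
      Proj.awayToSection (MvPolynomial.homogeneousSubmodule (Fin 2) ℂ) (killZ d q)).hom
      (HomogeneousLocalization.Away.mk _ hq 1 p (by simpa using hp)) =
      pfrac (killZ_mem hp) (killZ_mem hq) := by
    refine congrArg (Proj.awayToSection (MvPolynomial.homogeneousSubmodule (Fin 2) ℂ) (killZ d q)).hom ?_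
    exact HomogeneousLocalization.Away.map_mk (killZ d) q hq 1 p (by simpa using hp)
  have h2 := h.trans h1
  have h3 : ((lineIncl d).app (DP q)).hom (pfrac hp hq) = pfrac (killZ_mem hp) (killZ_mem hq) := by
    refine Eq.trans ?_ h2
    exact (res_self le_rfl _).symm
  exact congrArg (res hU) h3

/-- The restrictions of the coordinates to the line. -/
def lineCoord (d : ℕ) (a : Fin (d + 1) ⊕ Fin 2) : MvPolynomial (Fin 2) ℂ :=
  killZ d (MvPolynomial.X a)

lemma model_lineIncl (d : ℕ) : Model (lineIncl d) (𝟙 (PP (Fin 2))) 1 (lineCoord d) where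
  pos := one_pos
  mem a := killZ_mem (X_mem a)
  chart_eq a := rfl
  ratio_eq a b := by
    have hle : chart (lineIncl d) a ≤ 𝟙 (PP (Fin 2)) ⁻¹ᵁ DP (killZ d (MvPolynomial.X a ^ 1)) := by
      rw [pow_one]
      exact le_rfl
    have h1 := fr_lineIncl (X_mem b) (X_pow_mem a 1) (le_chart_pow le_rfl 1) hle
    refine ((dehom_eq_fr a (X_mem b)).trans h1).trans ?_
    refine fr_eq (killZ_mem (X_mem b)) (killZ_mem (X_pow_mem a 1)) (killZ_mem (X_mem b))
      (killZ_mem (X_mem a)) hle _ ?_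
    rw [pow_one]

lemma cst_lineIncl (d : ℕ) (c : ℂ) : cst (lineIncl d) c = cst (𝟙 _) c := by
  have hle : (⊤ : (PP (Fin 2)).Opens) ≤ lineIncl d ⁻¹ᵁ DP 1 := by
    rw [DP, Proj.basicOpen_one]
    exact le_top
  have hle' : (⊤ : (PP (Fin 2)).Opens) ≤ 𝟙 (PP (Fin 2)) ⁻¹ᵁ DP 1 := top_le_DP_one
  have hle2 : (⊤ : (PP (Fin 2)).Opens) ≤ 𝟙 (PP (Fin 2)) ⁻¹ᵁ DP (killZ d 1) := by
    rw [map_one]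
    exact hle'
  have h1 := cst_eq (g := lineIncl d) c one_mem' hle
  have h2 := cst_eq (g := 𝟙 (PP (Fin 2))) c one_mem' hle'
  rw [res_self] at h1 h2
  rw [h1, h2, fr_lineIncl _ _ hle hle2]
  refine fr_eq _ _ _ _ _ _ ?_
  rw [map_one, MvPolynomial.smul_eq_C_mul, mul_one, mul_one, mul_one, killZ_C,
    MvPolynomial.smul_eq_C_mul, mul_one]

lemma chart_lineIncl_inl (k : Fin (d + 1)) : chart (lineIncl d) (Sum.inl k) = ⊥ := by
  rw [(model_lineIncl d).chart_eq, lineCoord, killZ_X_inl, DP, Proj.basicOpen_zero]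
  rfl

lemma iSup_chart_lineIncl : ⊤ ≤ ⨆ c : Fin 2, chart (lineIncl d) (Sum.inr c) := by
  rw [← iSup_chart (lineIncl d)]
  refine iSup_le fun a => ?_
  cases a with
  | inl k => exact (chart_lineIncl_inl k).le.trans bot_le
  | inr c => exact le_iSup (fun c => chart (lineIncl d) (Sum.inr c)) c

lemma coord_lineIncl_inl (k : Fin (d + 1)) : coord (lineIncl d) (Sum.inl k) = 0 := by
  refine (polySec_eq_zero_iff (X_mem (Sum.inl k))).mpr fun a => ?_
  refine ((model_lineIncl d).ratio_eq a (Sum.inl k)).trans ?_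
  refine Eq.trans ?_ (fr_zero (killZ_mem (X_mem a)) ((model_lineIncl d).chart_eq a).le)
  exact fr_eq _ _ _ _ _ _ (by rw [lineCoord, killZ_X_inl]; rfl)

lemma depthTwo_line : DepthTwo (idealOf (𝟙 (PP (Fin 2)))) := by
  rw [idealOf_eq_bot]
  exact depthTwo_bot (a := 0) (b := 1) (by decide)

/-- Global functions on the line are constant. -/
lemma exists_eq_smul_oneSec (s : H0 (lineIncl d) 0) : ∃ c : ℂ, s = c • oneSec (lineIncl d) := by
  obtain ⟨c, -, hc⟩ := (model_lineIncl d).exists_const depthTwo_line 0 s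
  refine ⟨c, TwSec.ext_coef fun a V hV ha => ?_⟩
  have h1 := congrArg (res ha) (hc a)
  rw [res_coef, res_res] at h1
  refine h1.trans ?_
  rw [coef_csmul, cst_lineIncl]
  have : coef (oneSec (lineIncl d)) a hV ha = 1 := map_one (res _)
  rw [this, mul_one]

lemma H0_neg_one_eq_zero (s : H0 (lineIncl d) (-1)) : s = 0 :=
  (model_lineIncl d).H0_neg_one_eq_zero depthTwo_line s

/-- A homogeneous polynomial that vanishes on the line is zero once the coordinates `z_k` are set
to zero. -/
lemma killZ_eq_zero {m : ℕ} {p : MvPolynomial (Fin (d + 1) ⊕ Fin 2) ℂ}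
    (hp : p ∈ Hom' (Fin (d + 1) ⊕ Fin 2) m) (h : polySec (lineIncl d) hp = 0) :
    (killZ d p : MvPolynomial (Fin 2) ℂ) = 0 := by
  refine eq_zero_of_polySec_eq_zero (g := 𝟙 (PP (Fin 2))) (killZ_mem hp)
    ((polySec_eq_zero_iff _).mpr fun a => ?_)
  have h1 := (polySec_eq_zero_iff hp).mp h (Sum.inr a)
  have hle : chart (𝟙 (PP (Fin 2))) a ≤ lineIncl d ⁻¹ᵁ DP (MvPolynomial.X (Sum.inr a) ^ m) :=
    le_DP_pow (g := lineIncl d) (((congrArg DP (killZ_X_inr (d := d) a)).ge :)) m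
  have hle' : chart (𝟙 (PP (Fin 2))) a ≤
      𝟙 (PP (Fin 2)) ⁻¹ᵁ DP (killZ d (MvPolynomial.X (Sum.inr a) ^ m)) := hle
  have h2 := fr_lineIncl hp (X_pow_mem (Sum.inr a) m) hle hle'
  rw [dehom_eq_fr] at h1 ⊢
  refine (fr_eq _ _ _ _ _ hle' ?_).trans (h2.symm.trans ?_)
  · rw [map_pow, killZ_X_inr]
  · have h3 := congrArg (res (show chart (𝟙 (PP (Fin 2))) a ≤ chart (lineIncl d) (Sum.inr a) from
      (congrArg DP (killZ_X_inr (d := d) a)).ge)) h1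
    rw [res_fr, map_zero] at h3
    exact h3

lemma csmul_polySec {σ : Type} {Y : Scheme.{0}} {f : Y ⟶ PP σ} {m : ℕ} {p : MvPolynomial σ ℂ}
    (hp : p ∈ Hom' σ m) (c : ℂ) :
    c • polySec f hp = polySec f (Submodule.smul_mem _ c hp : c • p ∈ Hom' σ m) := by
  refine Subtype.ext (funext fun a => ?_)
  rw [TwSec.csmul_apply]
  have h1 : dehom f a (Submodule.smul_mem _ c hp : c • p ∈ Hom' σ m) =
      res le_top (cst f c) * dehom f a hp := by
    rw [dehom_eq_fr, dehom_eq_fr, cst_eq c (X_pow_mem a m) (le_chart_pow le_rfl m), ← fr_mul]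
    exact fr_eq _ _ _ _ _ _ (by simp only [MvPolynomial.smul_eq_C_mul]; ring)
  refine Eq.trans ?_ (congrArg (res inf_le_right) h1).symm
  rw [map_mul, res_res]
  rfl

lemma mulG_polySec {σ : Type} {Y : Scheme.{0}} {f : Y ⟶ PP σ} {m n : ℕ} {l : ℤ}
    (h : (m : ℤ) + n = l) (h' : ((m + n : ℕ) : ℤ) = l) {p q : MvPolynomial σ ℂ}
    (hp : p ∈ Hom' σ m) (hq : q ∈ Hom' σ n) :
    mulG h (polySec f hp) (polySec f hq) = h' ▸ polySec f (mem_mul hp hq) := by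
  subst h'
  refine Subtype.ext (funext fun a => ?_)
  rw [mulG_apply]
  exact ((congrArg (res inf_le_right) (dehom_mul hp hq a)).trans (map_mul (res _) _ _)).symm

/-- The coordinates `x`, `y` are linearly independent on the line. -/
lemma linear_independent_xy {c₁ c₂ : ℂ}
    (h : c₁ • coord (lineIncl d) (Sum.inr 0) + c₂ • coord (lineIncl d) (Sum.inr 1) = 0) :
    c₁ = 0 ∧ c₂ = 0 := by
  rw [coord, coord, csmul_polySec, csmul_polySec] at h
  have h1 := (polySec_add (g := lineIncl d) (Submodule.smul_mem _ c₁ (X_mem (Sum.inr 0)))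
    (Submodule.smul_mem _ c₂ (X_mem (Sum.inr 1)))).trans h
  have h2 := killZ_eq_zero _ h1
  simp only [map_add, MvPolynomial.smul_eq_C_mul, map_mul, killZ_X_inr, killZ_C] at h2
  constructor
  · simpa using congrArg (MvPolynomial.eval ![1, 0]) h2
  · simpa using congrArg (MvPolynomial.eval ![0, 1]) h2

/-- The monomials `x²`, `xy`, `y²` are linearly independent on the line. -/
lemma linear_independent_sq {c₀ c₁ c₂ : ℂ}
    (h : c₀ • mulG two_eq (coord (lineIncl d) (Sum.inr 0)) (coord (lineIncl d) (Sum.inr 0)) +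
      c₁ • mulG two_eq (coord (lineIncl d) (Sum.inr 0)) (coord (lineIncl d) (Sum.inr 1)) +
      c₂ • mulG two_eq (coord (lineIncl d) (Sum.inr 1)) (coord (lineIncl d) (Sum.inr 1)) = 0) :
    c₀ = 0 ∧ c₁ = 0 ∧ c₂ = 0 := by
  have e : ∀ a b : Fin 2, mulG two_eq (coord (lineIncl d) (Sum.inr a)) (coord (lineIncl d) (Sum.inr b)) =
      polySec (lineIncl d) (mem_mul (X_mem (Sum.inr a)) (X_mem (Sum.inr b))) := fun a b =>
    mulG_polySec (m := 1) (n := 1) two_eq rfl _ _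
  rw [e, e, e, csmul_polySec, csmul_polySec, csmul_polySec] at h
  have m0 := Submodule.smul_mem (Hom' _ _) c₀ (mem_mul (X_mem (Sum.inr 0 : Fin (d + 1) ⊕ Fin 2))
    (X_mem (Sum.inr 0)))
  have m1 := Submodule.smul_mem (Hom' _ _) c₁ (mem_mul (X_mem (Sum.inr 0 : Fin (d + 1) ⊕ Fin 2))
    (X_mem (Sum.inr 1)))
  have m2 := Submodule.smul_mem (Hom' _ _) c₂ (mem_mul (X_mem (Sum.inr 1 : Fin (d + 1) ⊕ Fin 2))
    (X_mem (Sum.inr 1)))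
  have h1 := ((polySec_add (g := lineIncl d) (add_mem m0 m1) m2).trans
    (congrArg (· + _) (polySec_add (g := lineIncl d) m0 m1))).trans h
  have h2 := killZ_eq_zero _ h1
  simp only [map_add, MvPolynomial.smul_eq_C_mul, map_mul, killZ_X_inr, killZ_C] at h2
  have e0 : c₀ = 0 := by simpa using congrArg (MvPolynomial.eval ![1, 0]) h2
  have e2 : c₂ = 0 := by simpa using congrArg (MvPolynomial.eval ![0, 1]) h2
  have e1 := congrArg (MvPolynomial.eval ![1, 1]) h2
  simp [e0, e2] at e1
  exact ⟨e0, e1, e2⟩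

end line


/-! ### Multiplication by the coordinates of the line -/

section sections

variable {σ : Type} {Y : Scheme.{0}} {f : Y ⟶ PP σ}

lemma coef_coord_self (a : σ) {U : Y.Opens} (h : U ≤ ⊤) (ha : U ≤ chart f a) :
    coef (coord f a) a h ha = 1 := by
  have h1 : coef (coord f a) a h ha = res ha (ratio f a a) := res_res _ _ _
  rw [h1, ratio, dehom_X_self, map_one]

lemma mul_coord_injective {k l : ℤ} (e : k + 1 = l) {a : σ} {U : Y.Opens} (ha : U ≤ chart f a)
    {s t : TwSec f k U} (h : TwSec.mul e s (coord f a) = TwSec.mul e t (coord f a)) : s = t := by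
  refine TwSec.ext_chart a ha ?_
  have h1 := congrArg (fun s => coef s a le_rfl ha) h
  simpa only [coef_mul, coef_coord_self, mul_one] using h1

lemma mul_coord_surjective {k l : ℤ} (e : k + 1 = l) {a : σ} {U : Y.Opens} (ha : U ≤ chart f a)
    (s : TwSec f l U) : ∃ t : TwSec f k U, TwSec.mul e t (coord f a) = s := by
  refine ⟨TwSec.ofChart k a ha (coef s a le_rfl ha), TwSec.ext_chart a ha ?_⟩
  rw [coef_mul, coef_coord_self, mul_one, coef_ofChart_self, res_self]

lemma TwSec.mul_right_comm {k l n : ℤ} (e : k + 1 = l) (e' : l + 1 = n) {U : Y.Opens}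
    (s : TwSec f k U) (x y : H0 f 1) :
    TwSec.mul e' (TwSec.mul e s x) y = TwSec.mul e' (TwSec.mul e s y) x := by
  refine TwSec.ext_coef fun a V hV ha => ?_
  simp only [coef_mul]
  ring

lemma TwSec.restr_mul {k l : ℤ} (e : k + 1 = l) {U V : Y.Opens} (h : U ≤ V) (s : TwSec f k V)
    (x : H0 f 1) : TwSec.restr h (TwSec.mul e s x) = TwSec.mul e (TwSec.restr h s) x := by
  refine TwSec.ext_coef fun a W hW ha => ?_
  simp only [coef_mul, coef_restr]

variable {V : Type} [AddCommGroup V] [Module ℂ V] [FiniteDimensional ℂ V]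

/-- The coordinates of a section of `V ⊗ 𝒪_Y(k)`. -/
def tensCoef {k : ℤ} {U : Y.Opens} (s : Γ(tens f V k, U)) (a : Fin (Module.finrank ℂ V)) :
    TwSec f k U := (tensπ f V k a).app U s

omit [FiniteDimensional ℂ V] in
lemma tensCoef_ext {k : ℤ} {U : Y.Opens} {s t : Γ(tens f V k, U)}
    (h : ∀ a, tensCoef s a = tensCoef t a) : s = t := by
  have key : ∀ s : Γ(tens f V k, U), s = ∑ a, twApp (tensι f V k a) U (tensCoef s a) := by
    intro s
    have h1 := congrArg (fun p => Scheme.Modules.Hom.app p U s) (tens_total (f := f) (V := V) k)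
    refine Eq.trans ?_ (h1.symm.trans (map_sum (AddMonoidHom.mk'
      (fun p : tens f V k ⟶ tens f V k => p.app U s) fun _ _ => rfl) _ _))
    rfl
  rw [key s, key t]
  exact Finset.sum_congr rfl fun a _ => by rw [h]

omit [FiniteDimensional ℂ V] in
lemma exists_tensCoef_eq {k : ℤ} {U : Y.Opens} (t : Fin (Module.finrank ℂ V) → TwSec f k U) :
    ∃ s : Γ(tens f V k, U), ∀ a, tensCoef s a = t a := by
  refine ⟨∑ a, twApp (tensι f V k a) U (t a), fun b => ?_⟩
  have h1 : ∀ a, (tensπ f V k b).app U (twApp (tensι f V k a) U (t a)) =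
      if a = b then t a else (0 : TwSec f k U) := by
    intro a
    split_ifs with h
    · subst h
      exact congrArg (fun p => twApp p U (t a)) (tensι_π_self (f := f) (V := V) k a)
    · exact congrArg (fun p => twApp p U (t a)) (tensι_π_ne (f := f) (V := V) k h)
  refine (map_sum ((tensπ f V k b).app U).hom _ _).trans ?_
  refine (Finset.sum_congr rfl fun a _ => h1 a).trans ?_
  exact (Finset.sum_ite_eq' Finset.univ b t).trans (if_pos (Finset.mem_univ b))

variable (V) in
/-- Multiplication by a section of `𝒪_Y(1)`, as a morphism `V ⊗ 𝒪_Y(k) ⟶ V ⊗ 𝒪_Y(k + 1)`. -/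
def mulT {k l : ℤ} (e : k + 1 = l) (x : H0 f 1) : tens f V k ⟶ tens f V l :=
  sheafMap e (pureMap LinearMap.id x)

lemma mulT_π {k l : ℤ} (e : k + 1 = l) (x : H0 f 1) (a) :
    mulT V e x ≫ tensπ f V l a = tensπ f V k a ≫ mulHom e x := by
  rw [mulT, sheafMap_π, Finset.sum_eq_single a]
  · rw [entry_pureMap]
    simp
  · intro b _ hb
    rw [entry_pureMap]
    simp [hb, mulHom_zero]
  · exact fun h => (h (Finset.mem_univ a)).elim

lemma tensCoef_mulT {k l : ℤ} (e : k + 1 = l) (x : H0 f 1) {U : Y.Opens} (s : Γ(tens f V k, U)) (a) :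
    tensCoef ((mulT V e x).app U s) a = TwSec.mul e (tensCoef s a) x :=
  congrArg (fun p => Scheme.Modules.Hom.app p U s) (mulT_π e x a)

lemma mulT_comm {k l n : ℤ} (e : k + 1 = l) (e' : l + 1 = n) (x y : H0 f 1) :
    mulT V e x ≫ mulT V e' y = mulT V e y ≫ mulT V e' x := by
  refine hom_ext_sec fun U s => tensCoef_ext fun a => ?_
  have h : ∀ x y : H0 f 1, tensCoef ((mulT V e x ≫ mulT V e' y).app U s) a =
      TwSec.mul e' (TwSec.mul e (tensCoef s a) x) y := fun x y =>
    (tensCoef_mulT e' y _ a).trans (congrArg (TwSec.mul e' · y) (tensCoef_mulT e x s a))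
  rw [h, h, TwSec.mul_right_comm]

end sections

section koszul

variable {d : ℕ}

/-- The exactness of the Koszul complex on sections: sections `s`, `t` over the line with
`s y = t x` are of the form `u x`, `u y`. -/
lemma exists_of_mul_y_eq_mul_x {k l n : ℤ} (e : k + 1 = l) (e' : l + 1 = n) {U : (PP (Fin 2)).Opens}
    {s t : TwSec (lineIncl d) l U}
    (h : TwSec.mul e' s (coord (lineIncl d) (Sum.inr 1)) =
      TwSec.mul e' t (coord (lineIncl d) (Sum.inr 0))) :
    ∃ u : TwSec (lineIncl d) k U, TwSec.mul e u (coord (lineIncl d) (Sum.inr 0)) = s ∧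
      TwSec.mul e u (coord (lineIncl d) (Sum.inr 1)) = t := by
  let p : Fin 2 → TwSec (lineIncl d) l U := ![s, t]
  have hloc : ∀ c : Fin 2, ∃ u : TwSec (lineIncl d) k (U ⊓ chart (lineIncl d) (Sum.inr c)),
      ∀ b : Fin 2, TwSec.mul e u (coord (lineIncl d) (Sum.inr b)) =
        TwSec.restr inf_le_left (p b) := by
    intro c
    have h' := congrArg (TwSec.restr (inf_le_left : U ⊓ chart (lineIncl d) (Sum.inr c) ≤ U)) h
    rw [TwSec.restr_mul, TwSec.restr_mul] at h'
    obtain ⟨u, hu⟩ := mul_coord_surjective e (inf_le_right : U ⊓ chart (lineIncl d) (Sum.inr c) ≤ _)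
      (TwSec.restr inf_le_left (p c))
    have hc : c = 0 ∨ c = 1 := by omega
    refine ⟨u, fun b => ?_⟩
    by_cases hb : b = c
    · rw [hb, hu]
    refine mul_coord_injective e' (inf_le_right : U ⊓ chart (lineIncl d) (Sum.inr c) ≤ _) ?_
    rw [TwSec.mul_right_comm, hu]
    rcases hc with rfl | rfl
    · obtain rfl : b = 1 := by omega
      exact h'
    · obtain rfl : b = 0 := by omega
      exact h'.symm
  choose u hu using hloc
  have cov : U ≤ ⨆ c : Fin 2, U ⊓ chart (lineIncl d) (Sum.inr c) := by
    rw [← inf_iSup_eq]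
    exact le_inf le_rfl (le_top.trans iSup_chart_lineIncl)
  obtain ⟨v, hv⟩ : ∃ v : TwSec (lineIncl d) k U, ∀ c, TwSec.restr inf_le_left v = u c :=
    sec_glue (M := twist (lineIncl d) k) cov (fun c => inf_le_left) u (by
      intro c c'
      have hW : U ⊓ chart (lineIncl d) (Sum.inr c) ⊓ (U ⊓ chart (lineIncl d) (Sum.inr c')) ≤
        chart (lineIncl d) (Sum.inr c) := inf_le_left.trans inf_le_right
      refine mul_coord_injective e hW (s := TwSec.restr inf_le_left (u c))
        (t := TwSec.restr inf_le_right (u c')) ?_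
      rw [← TwSec.restr_mul, ← TwSec.restr_mul, hu, hu]
      refine TwSec.ext_coef fun a W hW ha => ?_
      rw [coef_restr, coef_restr, coef_restr, coef_restr])
  have hvb : ∀ b, TwSec.mul e v (coord (lineIncl d) (Sum.inr b)) = p b := fun b =>
    sec_ext (M := twist (lineIncl d) l) cov (fun c => inf_le_left) fun c =>
      (TwSec.restr_mul e inf_le_left v _).trans (by rw [hv]; exact hu c b)
  exact ⟨v, hvb 0, hvb 1⟩

lemma eq_zero_of_mul_x_eq_zero {k l : ℤ} (e : k + 1 = l) {U : (PP (Fin 2)).Opens}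
    {u : TwSec (lineIncl d) k U} (hx : TwSec.mul e u (coord (lineIncl d) (Sum.inr 0)) = 0)
    (hy : TwSec.mul e u (coord (lineIncl d) (Sum.inr 1)) = 0) : u = 0 := by
  have cov : U ≤ ⨆ c : Fin 2, U ⊓ chart (lineIncl d) (Sum.inr c) := by
    rw [← inf_iSup_eq]
    exact le_inf le_rfl (le_top.trans iSup_chart_lineIncl)
  refine sec_ext (M := twist (lineIncl d) k) cov (fun c => inf_le_left) fun c => ?_
  refine mul_coord_injective e (inf_le_right : U ⊓ chart (lineIncl d) (Sum.inr c) ≤ _)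
    (s := TwSec.restr inf_le_left u) (t := TwSec.restr inf_le_left 0) ?_
  rw [← TwSec.restr_mul, ← TwSec.restr_mul]
  have h0 : TwSec.mul e (0 : TwSec (lineIncl d) k U) (coord (lineIncl d) (Sum.inr c)) = 0 :=
    Subtype.ext (funext fun a => zero_mul _)
  rw [h0]
  have hc : c = 0 ∨ c = 1 := by omega
  rcases hc with rfl | rfl
  · rw [hx]
  · rw [hy]

end koszul


/-! ### The Koszul complex on the line -/

section koszul

variable (d : ℕ) {V : Type} [AddCommGroup V] [Module ℂ V] [FiniteDimensional ℂ V]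

/-- Multiplication by the coordinate `x` (for `c = 0`) or `y` (for `c = 1`) on the line. -/
abbrev mulXY (V : Type) [AddCommGroup V] [Module ℂ V] [FiniteDimensional ℂ V] (c : Fin 2)
    {k l : ℤ} (e : k + 1 = l) : tens (lineIncl d) V k ⟶ tens (lineIncl d) V l :=
  mulT V e (coord (lineIncl d) (Sum.inr c))

variable {d}

lemma mulXY_app_injective {k l : ℤ} (e : k + 1 = l) {U : (PP (Fin 2)).Opens}
    {s t : Γ(tens (lineIncl d) V k, U)} (h : ∀ c, (mulXY d V c e).app U s = (mulXY d V c e).app U t) :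
    s = t := by
  rw [← sub_eq_zero]
  refine tensCoef_ext fun a => ?_
  have h0 : tensCoef (0 : Γ(tens (lineIncl d) V k, U)) a = 0 := map_zero ((tensπ _ V k a).app U).hom
  rw [h0]
  have key : ∀ c, TwSec.mul e (tensCoef (s - t) a) (coord (lineIncl d) (Sum.inr c)) = 0 := by
    intro c
    rw [← tensCoef_mulT, map_sub, h c, sub_self]
    exact map_zero ((tensπ _ V l a).app U).hom
  exact eq_zero_of_mul_x_eq_zero e (key 0) (key 1)

lemma mulXY_cancel {k l : ℤ} (e : k + 1 = l) {M : (PP (Fin 2)).Modules}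
    {u v : M ⟶ tens (lineIncl d) V k} (h : ∀ c, u ≫ mulXY d V c e = v ≫ mulXY d V c e) : u = v :=
  hom_ext_sec fun U s => mulXY_app_injective e fun c =>
    congrArg (fun p => Scheme.Modules.Hom.app p U s) (h c)

/-- Morphisms `p`, `q` with `p y = q x` factor through multiplication by `x` and `y`. -/
lemma exists_of_mulXY {k l n : ℤ} (e : k + 1 = l) (e' : l + 1 = n) {M : (PP (Fin 2)).Modules}
    (a b : M ⟶ tens (lineIncl d) V l) (h : a ≫ mulXY d V 1 e' = b ≫ mulXY d V 0 e') :
    ∃ u : M ⟶ tens (lineIncl d) V k, u ≫ mulXY d V 0 e = a ∧ u ≫ mulXY d V 1 e = b := by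
  let p : Fin 2 → (M ⟶ tens (lineIncl d) V l) := ![a, b]
  have key : ∀ (U : (PP (Fin 2)).Opens) (m : Γ(M, U)), ∃ u : Γ(tens (lineIncl d) V k, U),
      ∀ c, (mulXY d V c e).app U u = (p c).app U m := by
    intro U m
    have hm := congrArg (fun p => Scheme.Modules.Hom.app p U m) h
    choose u hu0 hu1 using fun i => exists_of_mul_y_eq_mul_x (d := d) e e'
      (s := tensCoef (a.app U m) i) (t := tensCoef (b.app U m) i) (by
        rw [← tensCoef_mulT, ← tensCoef_mulT]
        exact congrArg (fun s => tensCoef (V := V) (f := lineIncl d) s i) hm)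
    obtain ⟨s, hs⟩ := exists_tensCoef_eq u
    refine ⟨s, fun c => tensCoef_ext fun i => ?_⟩
    rw [tensCoef_mulT, hs]
    have hc : c = 0 ∨ c = 1 := by omega
    rcases hc with rfl | rfl
    · exact hu0 i
    · exact hu1 i
  choose φ hφ using key
  refine ⟨homMk' (fun U => AddMonoidHom.mk' (φ U) fun m m' => ?_) ?_ ?_, ?_, ?_⟩
  · refine mulXY_app_injective e fun c => ?_
    rw [map_add, hφ, hφ, hφ, map_add]
  · intro U U' hU m
    refine mulXY_app_injective e fun c => ?_
    refine (hφ U _ c).trans ?_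
    rw [app_rm]
    refine Eq.trans ?_ (app_rm _ hU _).symm
    exact congrArg _ (hφ U' m c).symm
  · intro U r m
    refine mulXY_app_injective e fun c => ?_
    refine (hφ U _ c).trans ?_
    rw [Scheme.Modules.Hom.app_smul, Scheme.Modules.Hom.app_smul]
    exact congrArg _ (hφ U m c).symm
  · exact hom_ext_sec fun U m => hφ U m 0
  · exact hom_ext_sec fun U m => hφ U m 1

lemma mulXY_jointly_epi {k l : ℤ} (e : k + 1 = l) {M : (PP (Fin 2)).Modules}
    {u v : tens (lineIncl d) V l ⟶ M} (h : ∀ c, mulXY d V c e ≫ u = mulXY d V c e ≫ v) : u = v := by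
  refine hom_ext_sec fun U s => ?_
  have cov : U ≤ ⨆ c : Fin 2, U ⊓ chart (lineIncl d) (Sum.inr c) := by
    rw [← inf_iSup_eq]
    exact le_inf le_rfl (le_top.trans iSup_chart_lineIncl)
  refine sec_ext cov (fun c => inf_le_left) fun c => ?_
  rw [← app_rm, ← app_rm]
  choose t ht using fun i => mul_coord_surjective e
    (inf_le_right : U ⊓ chart (lineIncl d) (Sum.inr c) ≤ _)
    (tensCoef (rm _ (inf_le_left : U ⊓ chart (lineIncl d) (Sum.inr c) ≤ U) s) i)
  obtain ⟨t', ht'⟩ := exists_tensCoef_eq t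
  have h1 : (mulXY d V c e).app _ t' =
      rm _ (inf_le_left : U ⊓ chart (lineIncl d) (Sum.inr c) ≤ U) s :=
    tensCoef_ext fun i => by rw [tensCoef_mulT, ht', ht]
  rw [← h1]
  exact congrArg (fun p => Scheme.Modules.Hom.app p _ t') (h c)

variable (d V) (W : Type) [AddCommGroup W] [Module ℂ W] [FiniteDimensional ℂ W]

/-- The first map of the sum of the Koszul complex and the trivial sheaf with fibre `W`. -/
def koszulα : tens (lineIncl d) V (-1) ⟶
    tens (lineIncl d) V 0 ⊞ (tens (lineIncl d) V 0 ⊞ tens (lineIncl d) W 0) :=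
  biprod.lift (mulXY d V 0 (neg_add_cancel 1)) (biprod.lift (mulXY d V 1 (neg_add_cancel 1)) 0)

/-- The second map of the sum of the Koszul complex and the trivial sheaf with fibre `W`. -/
def koszulβ : tens (lineIncl d) V 0 ⊞ (tens (lineIncl d) V 0 ⊞ tens (lineIncl d) W 0) ⟶
    tens (lineIncl d) V 1 :=
  biprod.desc (-mulXY d V 1 (zero_add 1)) (biprod.desc (mulXY d V 0 (zero_add 1)) 0)

omit [FiniteDimensional ℂ W] in
lemma koszul_comp : koszulα d V W ≫ koszulβ d V W = 0 := by
  simp only [koszulα, koszulβ, biprod.lift_desc, comp_zero, add_zero, Preadditive.comp_neg]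
  rw [mulT_comm, neg_add_cancel]

instance : Mono (koszulα d V W) := by
  refine ⟨fun u v h => mulXY_cancel (neg_add_cancel 1) fun c => ?_⟩
  have hc : c = 0 ∨ c = 1 := by omega
  rcases hc with rfl | rfl
  · simpa [koszulα] using congrArg (· ≫ biprod.fst) h
  · simpa [koszulα] using congrArg (· ≫ biprod.snd ≫ biprod.fst) h

instance : Epi (koszulβ d V W) := by
  refine ⟨fun u v h => mulXY_jointly_epi (zero_add 1) fun c => ?_⟩
  have hc : c = 0 ∨ c = 1 := by omega
  rcases hc with rfl | rfl
  · simpa [koszulβ] using congrArg (biprod.inl ≫ biprod.inr ≫ ·) h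
  · simpa [koszulβ] using congrArg (biprod.inl ≫ ·) h

omit [FiniteDimensional ℂ W] in
/-- The Koszul complex is exact, so that the homology is the trivial sheaf with fibre `W`. -/
lemma koszul_homology : Nonempty ((ShortComplex.mk (koszulα d V W) (koszulβ d V W)
    (koszul_comp d V W)).homology ≅ tens (lineIncl d) W 0) := by
  let ι : tens (lineIncl d) V (-1) ⊞ tens (lineIncl d) W 0 ⟶
      tens (lineIncl d) V 0 ⊞ (tens (lineIncl d) V 0 ⊞ tens (lineIncl d) W 0) :=
    biprod.desc (koszulα d V W) (biprod.inr ≫ biprod.inr)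
  have hι : ι ≫ koszulβ d V W = 0 := by
    refine biprod.hom_ext' _ _ ?_ ?_
    · simp [ι, koszul_comp]
    · simp [ι, koszulβ]
  have e0 : ι ≫ biprod.fst = biprod.fst ≫ mulXY d V 0 (neg_add_cancel 1) := by
    refine biprod.hom_ext' _ _ ?_ ?_ <;> simp [ι, koszulα]
  have e1 : ι ≫ biprod.snd ≫ biprod.fst = biprod.fst ≫ mulXY d V 1 (neg_add_cancel 1) := by
    refine biprod.hom_ext' _ _ ?_ ?_ <;> simp [ι, koszulα]
  have e2 : ι ≫ biprod.snd ≫ biprod.snd = biprod.snd := by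
    refine biprod.hom_ext' _ _ ?_ ?_ <;> simp [ι, koszulα]
  have hmono : Mono ι := by
    rw [Preadditive.mono_iff_cancel_zero]
    intro P g hg
    refine biprod.hom_ext _ _ ((mulXY_cancel (neg_add_cancel 1) fun c => ?_).trans zero_comp.symm) ?_
    · have hc : c = 0 ∨ c = 1 := by omega
      rw [zero_comp, Category.assoc]
      rcases hc with rfl | rfl
      · rw [← e0, reassoc_of% hg, zero_comp]
      · rw [← e1, reassoc_of% hg, zero_comp]
    · rw [← e2, reassoc_of% hg, zero_comp, zero_comp]
  have hex : ∀ {M : (PP (Fin 2)).Modules}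
      (k : M ⟶ tens (lineIncl d) V 0 ⊞ (tens (lineIncl d) V 0 ⊞ tens (lineIncl d) W 0)),
      k ≫ koszulβ d V W = 0 → ∃ l, l ≫ ι = k := by
    intro M k hk
    have e3 : koszulβ d V W = -(biprod.fst ≫ mulXY d V 1 (zero_add 1)) +
        biprod.snd ≫ biprod.fst ≫ mulXY d V 0 (zero_add 1) := by
      refine biprod.hom_ext' _ _ ?_ (biprod.hom_ext' _ _ ?_ ?_) <;> simp [koszulβ]
    rw [e3, Preadditive.comp_add, Preadditive.comp_neg, neg_add_eq_zero] at hk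
    obtain ⟨u, hu0, hu1⟩ := exists_of_mulXY (neg_add_cancel 1) (zero_add 1) (k ≫ biprod.fst)
      (k ≫ biprod.snd ≫ biprod.fst) (by simpa using hk)
    refine ⟨biprod.lift u (k ≫ biprod.snd ≫ biprod.snd), biprod.hom_ext _ _ ?_
      (biprod.hom_ext _ _ ?_ ?_)⟩
    · rw [Category.assoc, e0, biprod.lift_fst_assoc, hu0]
    · rw [Category.assoc, Category.assoc, e1, biprod.lift_fst_assoc, hu1, Category.assoc]
    · rw [Category.assoc, Category.assoc, e2, biprod.lift_snd, Category.assoc]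
  let hi : IsLimit (KernelFork.ofι ι hι) := KernelFork.IsLimit.ofι ι hι
    (fun k hk => (hex k hk).choose) (fun k hk => (hex k hk).choose_spec)
    (fun k hk m hm => by rw [← cancel_mono ι, hm, (hex k hk).choose_spec])
  have hl : hi.lift (KernelFork.ofι (koszulα d V W) (koszul_comp d V W)) = biprod.inl := by
    rw [← cancel_mono ι]
    refine (hi.fac _ WalkingParallelPair.zero).trans ?_
    simp [ι]
  let D : (ShortComplex.mk (koszulα d V W) (koszulβ d V W) (koszul_comp d V W)).LeftHomologyData :=
    { K := tens (lineIncl d) V (-1) ⊞ tens (lineIncl d) W 0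
      H := tens (lineIncl d) W 0
      i := ι
      π := biprod.snd
      wi := hι
      hi := hi
      wπ := by
        rw [hl]
        exact biprod.inl_snd
      hπ := CokernelCofork.IsColimit.ofπ _ _ (fun k _ => biprod.inr ≫ k) (fun k hk => by
          refine biprod.hom_ext' _ _ ?_ ?_
          · rw [hl] at hk
            refine Eq.trans ?_ hk.symm
            simp
          · simp)
        (fun k hk m hm => by
          rw [← hm]
          simp) }
  exact ⟨D.homologyIso⟩

end koszul


/-! ### Restriction of three term complexes to the line -/

section restriction

variable {Y Z : Scheme.{0}} (F : Y.Modules ⥤ Z.Modules) [F.Additive] {P Q R : Y.Modules}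
  (p : P ⟶ Q) (q : Q ⟶ R) (w : p ≫ q = 0)

lemma mapThreeTerm_d_neg_one :
    ((F.mapHomologicalComplex (ComplexShape.up ℤ)).obj (threeTerm p q w)).d (-1) 0 = F.map p :=
  congrArg F.map (threeTerm_d_neg_one p q w)

lemma mapThreeTerm_d_zero :
    ((F.mapHomologicalComplex (ComplexShape.up ℤ)).obj (threeTerm p q w)).d 0 1 = F.map q :=
  congrArg F.map (threeTerm_d_zero p q w)

lemma mapThreeTerm_isZero (n : ℤ) (h : n ≠ -1) (h0 : n ≠ 0) (h1 : n ≠ 1) :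
    IsZero (((F.mapHomologicalComplex (ComplexShape.up ℤ)).obj (threeTerm p q w)).X n) := by
  have h2 : IsZero ((threeTerm p q w).X n) := by
    match n, h, h0, h1 with
    | Int.negSucc 0, h, _, _ => exact (h rfl).elim
    | Int.negSucc (k + 1), _, _, _ => exact isZero_zero _
    | Int.ofNat 0, _, h, _ => exact (h rfl).elim
    | Int.ofNat 1, _, _, h => exact (h rfl).elim
    | Int.ofNat (k + 2), _, _, _ => exact isZero_zero _
  exact F.map_isZero h2

/-- The restriction of a three term complex is a trivial sheaf in degree `0` precisely when the
first restricted map is injective, the last one is surjective, and the cohomology in the middle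
is trivial. -/
lemma isTrivialSheaf_iff :
    IsTrivialSheaf ((F.mapHomologicalComplex (ComplexShape.up ℤ)).obj (threeTerm p q w)) ↔
      Mono (F.map p) ∧ Epi (F.map q) ∧ ∃ r : ℕ, Nonempty ((ShortComplex.mk (F.map p) (F.map q)
        (by rw [← F.map_comp, w, F.map_zero])).homology ≅ ⨁ fun _ : Fin r => struct Z) := by
  set K := (F.mapHomologicalComplex (ComplexShape.up ℤ)).obj (threeTerm p q w) with hK
  have hz := mapThreeTerm_isZero F p q w
  have ex : ∀ n m k : ℤ, n + 1 = m → m + 1 = k → (K.ExactAt m ↔ (K.sc' n m k).Exact) :=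
    fun n m k h h' => K.exactAt_iff' n m k (by simp; omega) (by simp; omega)
  have hm : K.ExactAt (-1) ↔ Mono (F.map p) := by
    rw [ex (-2) (-1) 0 rfl rfl, ShortComplex.exact_iff_mono _
      ((hz (-2) (by decide) (by decide) (by decide)).eq_of_src _ _)]
    change Mono (K.d (-1) 0) ↔ _
    rw [hK, mapThreeTerm_d_neg_one]
    rfl
  have he : K.ExactAt 1 ↔ Epi (F.map q) := by
    rw [ex 0 1 2 rfl rfl, ShortComplex.exact_iff_epi _
      ((hz 2 (by decide) (by decide) (by decide)).eq_of_tgt _ _)]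
    change Epi (K.d 0 1) ↔ _
    rw [hK, mapThreeTerm_d_zero]
    rfl
  have hn : ∀ n : ℤ, n ≠ 0 → n ≠ -1 → n ≠ 1 → K.ExactAt n := fun n h0 h h1 => by
    rw [ex (n - 1) n (n + 1) (by omega) rfl]
    exact ShortComplex.exact_of_isZero_X₂ _ (hz n h h0 h1)
  let e : K.sc' (-1) 0 1 ≅ ShortComplex.mk (F.map p) (F.map q)
      (by rw [← F.map_comp, w, F.map_zero]) :=
    ShortComplex.isoMk (Iso.refl (F.obj P)) (Iso.refl (F.obj Q)) (Iso.refl (F.obj R))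
      ((Category.id_comp _).trans ((mapThreeTerm_d_neg_one F p q w).symm.trans
        (Category.comp_id _).symm))
      ((Category.id_comp _).trans ((mapThreeTerm_d_zero F p q w).symm.trans
        (Category.comp_id _).symm))
  let e' : K.homology 0 ≅ (ShortComplex.mk (F.map p) (F.map q)
      (by rw [← F.map_comp, w, F.map_zero])).homology :=
    ShortComplex.homologyMapIso (K.isoSc' (-1) 0 1 (by simp) (by simp) ≪≫ e)
  constructor
  · rintro ⟨h, r, ⟨φ⟩⟩
    exact ⟨hm.mp (h _ (by decide)), he.mp (h _ (by decide)), r, ⟨e'.symm ≪≫ φ⟩⟩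
  · rintro ⟨h, h', r, ⟨φ⟩⟩
    refine ⟨fun n h0 => ?_, r, ⟨e' ≪≫ φ⟩⟩
    by_cases hn1 : n = -1
    · rw [hn1]
      exact hm.mpr h
    by_cases hn2 : n = 1
    · rw [hn2]
      exact he.mpr h'
    exact hn n h0 hn1 hn2

end restriction

/-! ### The functor from ADHM data to perverse instanton sheaves -/

section adhm

variable {d : ℕ} {Y : Scheme.{0}} {i : Y ⟶ PP (Fin (d + 1) ⊕ Fin 2)} (M : ADHM i)

variable (i) in
/-- The decomposition of `(V ⊕ V ⊕ W) ⊗ 𝒪_Y(k)`. -/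
def tensProd₃ (V W : Type) [AddCommGroup V] [Module ℂ V] [FiniteDimensional ℂ V]
    [AddCommGroup W] [Module ℂ W] [FiniteDimensional ℂ W] (k : ℤ) :
    tens i (V × (V × W)) k ≅ tens i V k ⊞ (tens i V k ⊞ tens i W k) :=
  tensProd i V (V × W) k ≪≫ biprod.mapIso (Iso.refl _) (tensProd i V W k)

/-- The complex of an ADHM datum, its middle term being written as `(V ⊕ V ⊕ W) ⊗ 𝒪_Y`. -/
lemma cplx_comp : (M.α ≫ (tensProd₃ i M.V M.W 0).inv) ≫ (tensProd₃ i M.V M.W 0).hom ≫ M.β = 0 := by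
  rw [Category.assoc, Iso.inv_hom_id_assoc, M.α_comp_β]

variable (j : PP (Fin 2) ⟶ Y) {f : PP (Fin 2) ⟶ PP (Fin (d + 1) ⊕ Fin 2)} (hf : j ≫ i = f)

/-- The restriction of `V ⊗ 𝒪_Y(k)` along `j`, for a given name `f` of the composite `j ≫ i`. -/
def restrTens (V : Type) [AddCommGroup V] [Module ℂ V] [FiniteDimensional ℂ V] (k : ℤ) :
    (Scheme.Modules.pullback j).obj (tens i V k) ≅ tens f V k :=
  pullTens j i V k ≪≫ eqToIso (by rw [hf])

/-- The restriction of global sections along `j`, for a given name `f` of the composite `j ≫ i`. -/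
def restrH0 (m : ℤ) : H0 i m →ₗ[ℂ] H0 f m := hf ▸ pullH0 j i m

lemma restrH0_coord (a) : restrH0 j hf 1 (coord i a) = coord f a := by
  subst hf
  exact pullH0_polySec j i _

/-- The coordinates `z_k` vanish on the line. -/
lemma restrH0_HY (hl : f = lineIncl d) (z : HY i) : restrH0 j hf 1 z = 0 := by
  obtain ⟨z, hz⟩ := z
  refine Submodule.span_induction (p := fun z _ => restrH0 j hf 1 z = 0) ?_ (map_zero _) ?_ ?_ hz
  · rintro _ ⟨k, rfl⟩
    rw [restrH0_coord, hl]
    exact coord_lineIncl_inl k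
  · intro x y _ _ hx hy
    rw [map_add, hx, hy, add_zero]
  · intro c x _ hx
    rw [map_smul, hx, smul_zero]

section linear

variable {V V' : Type} [AddCommGroup V] [Module ℂ V] [AddCommGroup V'] [Module ℂ V']

lemma restr_inc (hl : f = lineIncl d) (T : V →ₗ[ℂ] V' ⊗[ℂ] HY i) :
    LinearMap.lTensor V' (restrH0 j hf 1) ∘ₗ inc T = 0 := by
  have h : restrH0 j hf 1 ∘ₗ (HY i).subtype = 0 := LinearMap.ext (restrH0_HY j hf hl)
  rw [inc, ← LinearMap.comp_assoc, ← LinearMap.lTensor_comp, h, LinearMap.lTensor_zero,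
    LinearMap.zero_comp]

lemma restr_pureMap (g : V →ₗ[ℂ] V') (a) :
    LinearMap.lTensor V' (restrH0 j hf 1) ∘ₗ pureMap g (coord i a) = pureMap g (coord f a) := by
  refine LinearMap.ext fun v => ?_
  refine (LinearMap.lTensor_tmul _ _ _ _).trans ?_
  exact congrArg _ (restrH0_coord j hf _)

variable [FiniteDimensional ℂ V] [FiniteDimensional ℂ V']

lemma restrTens_naturality {k m l : ℤ} (h : k + m = l) (T : V →ₗ[ℂ] V' ⊗[ℂ] H0 i m) :
    (Scheme.Modules.pullback j).map (sheafMap h T) ≫ (restrTens j hf V' l).hom =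
      (restrTens j hf V k).hom ≫ sheafMap h (LinearMap.lTensor V' (restrH0 j hf m) ∘ₗ T) := by
  subst hf
  simp only [restrTens, eqToIso_refl, Iso.trans_refl]
  exact pullTens_naturality j i V V' h T

lemma restr_sheafMap_inc (hl : f = lineIncl d) {k l : ℤ} (h : k + 1 = l)
    (T : V →ₗ[ℂ] V' ⊗[ℂ] HY i) :
    (Scheme.Modules.pullback j).map (sheafMap h (inc T)) ≫ (restrTens j hf V' l).hom = 0 := by
  rw [restrTens_naturality, restr_inc j hf hl, sheafMap_zero, comp_zero]

lemma restr_sheafMap_add (hl : f = lineIncl d) {k l : ℤ} (h : k + 1 = l)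
    (T : V →ₗ[ℂ] V' ⊗[ℂ] HY i) (g : V →ₗ[ℂ] V') (a) :
    (Scheme.Modules.pullback j).map (sheafMap h (inc T + pureMap g (coord i a))) ≫
        (restrTens j hf V' l).hom =
      (restrTens j hf V k).hom ≫ sheafMap h (pureMap g (coord f a)) := by
  rw [restrTens_naturality, LinearMap.comp_add, restr_inc j hf hl, restr_pureMap, zero_add]

end linear

instance : PreservesBinaryBiproducts (Scheme.Modules.pullback j) :=
  preservesBinaryBiproducts_of_preservesBiproducts _

/-- The restriction of the middle term of the monad of an ADHM datum. -/
def restrMid (V W : Type) [AddCommGroup V] [Module ℂ V] [FiniteDimensional ℂ V]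
    [AddCommGroup W] [Module ℂ W] [FiniteDimensional ℂ W] (k : ℤ) :
    (Scheme.Modules.pullback j).obj (tens i V k ⊞ (tens i V k ⊞ tens i W k)) ≅
      tens f V k ⊞ (tens f V k ⊞ tens f W k) :=
  (Scheme.Modules.pullback j).mapBiprod _ _ ≪≫ biprod.mapIso (restrTens j hf V k)
    ((Scheme.Modules.pullback j).mapBiprod _ _ ≪≫
      biprod.mapIso (restrTens j hf V k) (restrTens j hf W k))

variable (hj : j ≫ i = lineIncl d)

/-- The restriction of the first map of the monad of an ADHM datum is that of the Koszul complex. -/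
lemma restr_α : (Scheme.Modules.pullback j).map M.α ≫ (restrMid j hj M.V M.W 0).hom =
    (restrTens j hj M.V (-1)).hom ≫ koszulα d M.V M.W := by
  refine biprod.hom_ext _ _ ?_ (biprod.hom_ext _ _ ?_ ?_)
  · simp only [restrMid, ADHM.α, koszulα, Iso.trans_hom, Functor.mapBiprod_hom, biprod.mapIso_hom,
      Category.assoc, biprod.map_fst, biprod.lift_fst_assoc, biprod.lift_fst, ← Functor.map_comp_assoc]
    exact restr_sheafMap_add j hj rfl _ _ _ _
  · simp only [restrMid, ADHM.α, koszulα, Iso.trans_hom, Functor.mapBiprod_hom, biprod.mapIso_hom,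
      Category.assoc, biprod.map_fst, biprod.map_snd_assoc, biprod.lift_snd_assoc, biprod.lift_snd,
      biprod.lift_fst_assoc, biprod.lift_fst, ← Functor.map_comp_assoc]
    exact restr_sheafMap_add j hj rfl _ _ _ _
  · simp only [restrMid, ADHM.α, koszulα, Iso.trans_hom, Functor.mapBiprod_hom, biprod.mapIso_hom,
      Category.assoc, biprod.map_snd, biprod.lift_snd_assoc, biprod.lift_snd,
      ← Functor.map_comp_assoc, comp_zero]
    exact restr_sheafMap_inc j hj rfl _ _

/-- The restriction of the second map of the monad of an ADHM datum is that of the Koszul complex. -/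
lemma restr_β : (Scheme.Modules.pullback j).map M.β ≫ (restrTens j hj M.V 1).hom =
    (restrMid j hj M.V M.W 0).hom ≫ koszulβ d M.V M.W := by
  rw [← Iso.inv_comp_eq]
  refine biprod.hom_ext' _ _ ?_ (biprod.hom_ext' _ _ ?_ ?_)
  · simp only [restrMid, ADHM.β, koszulβ, Iso.trans_inv, Functor.mapBiprod_inv, biprod.mapIso_inv,
      Category.assoc, biprod.inl_map_assoc, biprod.inl_desc_assoc, biprod.inl_desc,
      ← Functor.map_comp_assoc, Functor.map_neg, Preadditive.neg_comp, Iso.inv_comp_eq,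
      Preadditive.comp_neg, neg_inj]
    exact restr_sheafMap_add j hj rfl _ _ _ _
  · simp only [restrMid, ADHM.β, koszulβ, Iso.trans_inv, Functor.mapBiprod_inv, biprod.mapIso_inv,
      Category.assoc, biprod.inl_map_assoc, biprod.inr_map_assoc, biprod.inl_desc_assoc,
      biprod.inr_desc_assoc, biprod.inl_desc, biprod.inr_desc,
      ← Functor.map_comp_assoc, Iso.inv_comp_eq]
    exact restr_sheafMap_add j hj rfl _ _ _ _
  · simp only [restrMid, ADHM.β, koszulβ, Iso.trans_inv, Functor.mapBiprod_inv, biprod.mapIso_inv,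
      Category.assoc, biprod.inr_map_assoc, 
      biprod.inr_desc_assoc, biprod.inr_desc,
      ← Functor.map_comp_assoc, Iso.inv_comp_eq, comp_zero]
    exact restr_sheafMap_inc j hj rfl _ _

/-- A three term complex isomorphic to that of an ADHM datum restricts to a trivial sheaf on the
line, since the Koszul complex is exact. -/
lemma isTrivialSheaf_of_iso (hj : j ≫ i = lineIncl d) {P Q R : Y.Modules} {p : P ⟶ Q} {q : Q ⟶ R} (w : p ≫ q = 0)
    (a : P ≅ tens i M.V (-1)) (b : Q ≅ tens i M.V 0 ⊞ (tens i M.V 0 ⊞ tens i M.W 0))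
    (c : R ≅ tens i M.V 1) (hp : p ≫ b.hom = a.hom ≫ M.α) (hq : q ≫ c.hom = b.hom ≫ M.β) :
    IsTrivialSheaf (((Scheme.Modules.pullback j).mapHomologicalComplex
        (ComplexShape.up ℤ)).obj (threeTerm p q w)) := by
  let F := Scheme.Modules.pullback j
  let a' := F.mapIso a ≪≫ restrTens j hj M.V (-1)
  let b' := F.mapIso b ≪≫ restrMid j hj M.V M.W 0
  let c' := F.mapIso c ≪≫ restrTens j hj M.V 1
  have hp' : F.map p ≫ b'.hom = a'.hom ≫ koszulα d M.V M.W := by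
    simp only [a', b', Iso.trans_hom, Functor.mapIso_hom, Category.assoc, ← restr_α,
      ← Functor.map_comp_assoc, hp, F]
  have hq' : F.map q ≫ c'.hom = b'.hom ≫ koszulβ d M.V M.W := by
    simp only [c', b', Iso.trans_hom, Functor.mapIso_hom, Category.assoc, ← restr_β,
      ← Functor.map_comp_assoc, hq, F]
  refine (isTrivialSheaf_iff F p q w).mpr ⟨?_, ?_, ?_⟩
  · rw [← Iso.eq_comp_inv] at hp'
    rw [hp']
    infer_instance
  · rw [← Iso.eq_comp_inv] at hq'
    rw [hq']
    infer_instance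
  · obtain ⟨φ⟩ := koszul_homology d M.V M.W
    obtain ⟨ψ⟩ := exists_twist_zero_iso (lineIncl d)
    let e : ShortComplex.mk (F.map p) (F.map q) (by rw [← F.map_comp, w, F.map_zero]) ≅
      ShortComplex.mk (koszulα d M.V M.W) (koszulβ d M.V M.W) (koszul_comp d M.V M.W) :=
      ShortComplex.isoMk a' b' c' hp'.symm hq'.symm
    exact ⟨Module.finrank ℂ M.W, ⟨ShortComplex.homologyMapIso e ≪≫ φ ≪≫
      biproduct.mapIso fun _ => ψ⟩⟩

/-- The complex of an ADHM datum is a perverse instanton sheaf of trivial splitting type. -/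
lemma PI_cplx (hj : j ≫ i = lineIncl d) [HasDerivedCategory.{w} Y.Modules] :
    PI i j (DerivedCategory.Q.obj M.cplx) := by
  refine ⟨Module.finrank ℂ M.V, Module.finrank ℂ (M.V × (M.V × M.W)),
    M.α ≫ (tensProd₃ i M.V M.W 0).inv, (tensProd₃ i M.V M.W 0).hom ≫ M.β, cplx_comp M, ⟨?_⟩, ?_⟩
  · exact DerivedCategory.Q.mapIso (threeTermIso (Iso.refl _) (tensProd₃ i M.V M.W 0).symm
      (Iso.refl _) (Category.id_comp _).symm ((Category.comp_id _).trans
        (Iso.inv_hom_id_assoc _ _).symm))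
  · exact isTrivialSheaf_of_iso M j hj (cplx_comp M) (Iso.refl _) (tensProd₃ i M.V M.W 0)
      (Iso.refl _) ((Category.assoc _ _ _).trans ((congrArg _ (Iso.inv_hom_id _)).trans
        ((Category.comp_id _).trans (Category.id_comp _).symm))) (Category.comp_id _)

/-- The functor from ADHM data to perverse instanton sheaves. -/
def instantonFunctor (hj : j ≫ i = lineIncl d) [HasDerivedCategory.{w} Y.Modules] : ADHM i ⥤ (PI i j).FullSubcategory :=
  (PI i j).lift (complexFunctor i ⋙ DerivedCategory.Q) fun M => PI_cplx M j hj

lemma instantonFunctor_comp_ι (hj : j ≫ i = lineIncl d) [HasDerivedCategory.{w} Y.Modules] :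
    instantonFunctor j hj ⋙ (PI i j).ι = complexFunctor i ⋙ DerivedCategory.Q := rfl

end adhm


/-! ### Monads on the line with trivial cohomology -/

section linear

variable {V A : Type} [AddCommGroup V] [Module ℂ V] [FiniteDimensional ℂ V]
  [AddCommGroup A] [Module ℂ A] [FiniteDimensional ℂ A]

/-- The normal form of the matrices `P = P_x x + P_y y`, `Q = Q_x x + Q_y y` of a monad on the line
with trivial cohomology: if `Q P = 0` and `Q_x P_y` is injective, hence invertible, then
`A = P_x V ⊕ P_y V ⊕ (ker Q_x ∩ ker Q_y)`. -/
lemma exists_splitting {Px Py : V →ₗ[ℂ] A} {Qx Qy : A →ₗ[ℂ] V} (hxx : Qx ∘ₗ Px = 0)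
    (hyy : Qy ∘ₗ Py = 0) (hxy : Qx ∘ₗ Py + Qy ∘ₗ Px = 0)
    (hD : Function.Injective (Qx ∘ₗ Py)) :
    ∃ (W : Type) (_ : AddCommGroup W) (_ : Module ℂ W) (_ : FiniteDimensional ℂ W)
      (Φ : (V × (V × W)) ≃ₗ[ℂ] A) (D : V ≃ₗ[ℂ] V),
      (∀ v, Φ (v, 0, 0) = Px v) ∧ (∀ v, Φ (0, v, 0) = Py v) ∧
      (∀ v v' w, D (Qx (Φ (v, v', w))) = v') ∧ ∀ v v' w, D (Qy (Φ (v, v', w))) = -v := by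
  let D := LinearEquiv.ofInjectiveEndo (Qx ∘ₗ Py) hD
  have hDa : ∀ v, D.symm (Qx (Py v)) = v := fun v => D.symm_apply_apply v
  have hyx : ∀ v, Qy (Px v) = - Qx (Py v) := fun v => by
    have := LinearMap.congr_fun hxy v
    exact eq_neg_of_add_eq_zero_right this
  have hxx' : ∀ v, Qx (Px v) = 0 := fun v => LinearMap.congr_fun hxx v
  have hyy' : ∀ v, Qy (Py v) = 0 := fun v => LinearMap.congr_fun hyy v
  let W := (LinearMap.ker Qx ⊓ LinearMap.ker Qy : Submodule ℂ A)
  have hW : ∀ w : W, Qx w = 0 ∧ Qy w = 0 := fun w => ⟨w.2.1, w.2.2⟩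
  let φ : (V × (V × W)) →ₗ[ℂ] A := Px.coprod (Py.coprod W.subtype)
  have hφ : ∀ v v' w, φ (v, v', w) = Px v + (Py v' + w) := fun v v' w => rfl
  have hx : ∀ v v' w, D.symm (Qx (φ (v, v', w))) = v' := fun v v' w => by
    rw [hφ, map_add Qx, map_add Qx, hxx', (hW w).1, zero_add, add_zero, hDa]
  have hy : ∀ v v' w, D.symm (Qy (φ (v, v', w))) = -v := fun v v' w => by
    rw [hφ, map_add Qy, map_add Qy, hyy', (hW w).2, zero_add, add_zero, hyx, map_neg, hDa]
  have hinj : Function.Injective φ := by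
    rw [← LinearMap.ker_eq_bot, LinearMap.ker_eq_bot']
    rintro ⟨v, v', w⟩ h
    have h1 := hx v v' w
    have h2 := hy v v' w
    rw [h, map_zero, map_zero] at h1 h2
    have h2' : v = 0 := neg_eq_zero.mp h2.symm
    rw [hφ, h2', ← h1, map_zero, map_zero, zero_add, zero_add] at h
    have hw0 : w = 0 := Subtype.ext h
    rw [h2', ← h1, hw0]
    rfl
  have hsurj : Function.Surjective φ := by
    intro a
    have hDs : ∀ v, Qx (Py (D.symm v)) = v := fun v => D.apply_symm_apply v
    refine ⟨(-D.symm (Qy a), D.symm (Qx a), ⟨a + Px (D.symm (Qy a)) - Py (D.symm (Qx a)), ?_, ?_⟩), ?_⟩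
    · change Qx _ = 0
      rw [map_sub, map_add, hxx', hDs, add_zero, sub_self]
    · change Qy _ = 0
      rw [map_sub, map_add, hyx, hyy', hDs, sub_zero, add_neg_cancel]
    · rw [hφ, map_neg]
      change -_ + (_ + (a + _ - _)) = a
      abel
  refine ⟨W, inferInstance, inferInstance, inferInstance,
    LinearEquiv.ofBijective φ ⟨hinj, hsurj⟩, D.symm, fun v => ?_, fun v => ?_, hx, hy⟩
  · exact (hφ v 0 0).trans (by simp)
  · exact (hφ 0 v 0).trans (by simp)

end linear

section line

variable {d : ℕ} {V A : Type} [AddCommGroup V] [Module ℂ V] [FiniteDimensional ℂ V]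
  [AddCommGroup A] [Module ℂ A] [FiniteDimensional ℂ A]

/-- The coefficients of a matrix of linear forms on the line are unique. -/
lemma pureMap_xy_eq_zero {g g' : V →ₗ[ℂ] A}
    (h : pureMap g (coord (lineIncl d) (Sum.inr 0)) + pureMap g' (coord (lineIncl d) (Sum.inr 1)) = 0) :
    g = 0 ∧ g' = 0 := by
  have key : ∀ a b, (Module.finBasis ℂ A).repr (g (Module.finBasis ℂ V b)) a = 0 ∧
      (Module.finBasis ℂ A).repr (g' (Module.finBasis ℂ V b)) a = 0 := by
    intro a b
    have h1 := congrArg (fun T => entry T a b) h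
    simp only [entry_add, entry_pureMap] at h1
    exact linear_independent_xy (h1.trans (by simp [entry]))
  constructor <;> refine (Module.finBasis ℂ V).ext fun b => ?_ <;>
    refine (Module.finBasis ℂ A).repr.injective (Finsupp.ext fun a => ?_)
  · simpa using (key a b).1
  · simpa using (key a b).2

/-- The coefficients of a matrix of quadratic forms on the line are unique. -/
lemma pureMap_sq_eq_zero {g g' g'' : V →ₗ[ℂ] A}
    (h : pureMap g (mulG two_eq (coord (lineIncl d) (Sum.inr 0)) (coord (lineIncl d) (Sum.inr 0))) +
      pureMap g' (mulG two_eq (coord (lineIncl d) (Sum.inr 0)) (coord (lineIncl d) (Sum.inr 1))) +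
      pureMap g'' (mulG two_eq (coord (lineIncl d) (Sum.inr 1)) (coord (lineIncl d) (Sum.inr 1))) = 0) :
    g = 0 ∧ g' = 0 ∧ g'' = 0 := by
  have key : ∀ a b, (Module.finBasis ℂ A).repr (g (Module.finBasis ℂ V b)) a = 0 ∧
      (Module.finBasis ℂ A).repr (g' (Module.finBasis ℂ V b)) a = 0 ∧
      (Module.finBasis ℂ A).repr (g'' (Module.finBasis ℂ V b)) a = 0 := by
    intro a b
    have h1 := congrArg (fun T => entry T a b) h
    simp only [entry_add, entry_pureMap] at h1
    exact linear_independent_sq (h1.trans (by simp [entry]))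
  refine ⟨?_, ?_, ?_⟩ <;> refine (Module.finBasis ℂ V).ext fun b => ?_ <;>
    refine (Module.finBasis ℂ A).repr.injective (Finsupp.ext fun a => ?_)
  · simpa using (key a b).1
  · simpa using (key a b).2.1
  · simpa using (key a b).2.2

lemma prodMap_pureMap_pureMap {σ : Type} {Y : Scheme.{0}} {f : Y ⟶ PP σ} {V₁ V₂ V₃ : Type}
    [AddCommGroup V₁] [Module ℂ V₁] [FiniteDimensional ℂ V₁]
    [AddCommGroup V₂] [Module ℂ V₂] [FiniteDimensional ℂ V₂]
    [AddCommGroup V₃] [Module ℂ V₃] [FiniteDimensional ℂ V₃] {m n l : ℤ} (h : n + m = l)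
    (g : V₂ →ₗ[ℂ] V₃) (g' : V₁ →ₗ[ℂ] V₂) (s : H0 f n) (t : H0 f m) :
    prodMap h (pureMap g s) (pureMap g' t) = pureMap (g ∘ₗ g') (mulG h s t) := by
  rw [prodMap_pureMap_left]
  refine LinearMap.ext fun v => ?_
  simp [pureMap]

lemma linMap_line_injective {k : ℤ} {g : V →ₗ[ℂ] A} (h : linMap (f := lineIncl d) k g = 0) : g = 0 := by
  have h1 : pureMap g (oneSec (lineIncl d)) = 0 :=
    sheafMap_injective _ (h.trans (sheafMap_zero _).symm)
  refine (pureMap_xy_eq_zero (d := d) (g := g) (g' := 0) ?_).1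
  refine LinearMap.ext fun v => ?_
  have h2 := congrArg (LinearMap.lTensor A (mulG (add_zero (1 : ℤ))
    (coord (lineIncl d) (Sum.inr 0)))) (LinearMap.congr_fun h1 v)
  have h3 : mulG (add_zero (1 : ℤ)) (coord (lineIncl d) (Sum.inr 0)) (oneSec (lineIncl d)) =
      coord (lineIncl d) (Sum.inr 0) := by
    rw [mulG_comm _ (zero_add 1), mulG_one_left]
  simp only [pureMap, LinearMap.comp_apply, LinearMap.flip_apply, TensorProduct.mk_apply,
    LinearMap.lTensor_tmul, h3] at h2
  simp [pureMap, h2]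

/-- Morphisms between trivial sheaves on the line are constant matrices. -/
lemma exists_linMap_line (u : tens (lineIncl d) V 0 ⟶ tens (lineIncl d) A 0) :
    ∃ g : V →ₗ[ℂ] A, u = linMap 0 g := by
  obtain ⟨T, rfl⟩ := sheafMap_surjective (zero_add 0) u
  have key : ∀ z : A ⊗[ℂ] H0 (lineIncl d) 0, ∃ a : A, z = a ⊗ₜ oneSec _ := by
    intro z
    induction z with
    | zero => exact ⟨0, by simp⟩
    | add z z' hz hz' =>
      obtain ⟨a, rfl⟩ := hz
      obtain ⟨a', rfl⟩ := hz'
      exact ⟨a + a', by rw [TensorProduct.add_tmul]⟩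
    | tmul a s =>
      obtain ⟨c, rfl⟩ := exists_eq_smul_oneSec s
      exact ⟨c • a, by rw [TensorProduct.smul_tmul]⟩
  choose a ha using fun b => key (T (Module.finBasis ℂ V b))
  refine ⟨(Module.finBasis ℂ V).constr ℂ a, ?_⟩
  have : T = pureMap ((Module.finBasis ℂ V).constr ℂ a) (oneSec _) :=
    (Module.finBasis ℂ V).ext fun b => by
      rw [ha]
      simp [pureMap]
  rw [this]
  rfl

lemma hom_line_neg_one_eq_zero (u : tens (lineIncl d) V 0 ⟶ tens (lineIncl d) A (-1)) : u = 0 := by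
  obtain ⟨T, rfl⟩ := sheafMap_surjective (zero_add (-1)) u
  have : T = 0 := entry_injective fun a b =>
    (H0_neg_one_eq_zero _).trans (H0_neg_one_eq_zero _).symm
  rw [this, sheafMap_zero]

/-- The matrices of a monad on the line whose first map is injective and whose cohomology is
trivial satisfy the hypotheses of `exists_splitting`. If `Q_x P_y v = 0`, then `P_x v` and `P_y v`
are cocycles; their classes `e_x`, `e_y`, being constants with `e_x x + e_y y = 0`, vanish, and so do
`P_x v` and `P_y v`, as there are no morphisms `𝒪 ⟶ 𝒪(-1)`. By injectivity, `v = 0`. -/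
lemma line_monad {Px Py : V →ₗ[ℂ] A} {Qx Qy : A →ₗ[ℂ] V}
    {p : tens (lineIncl d) V (-1) ⟶ tens (lineIncl d) A 0}
    {q : tens (lineIncl d) A 0 ⟶ tens (lineIncl d) V 1} (w : p ≫ q = 0) [Mono p]
    (hp : p = sheafMap (neg_add_cancel 1) (pureMap Px (coord (lineIncl d) (Sum.inr 0)) +
      pureMap Py (coord (lineIncl d) (Sum.inr 1))))
    (hq : q = sheafMap (zero_add 1) (pureMap Qx (coord (lineIncl d) (Sum.inr 0)) +
      pureMap Qy (coord (lineIncl d) (Sum.inr 1))))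
    {W : Type} [AddCommGroup W] [Module ℂ W] [FiniteDimensional ℂ W]
    (φ : (ShortComplex.mk p q w).homology ≅ tens (lineIncl d) W 0) :
    Qx ∘ₗ Px = 0 ∧ Qy ∘ₗ Py = 0 ∧ Qx ∘ₗ Py + Qy ∘ₗ Px = 0 ∧ Function.Injective (Qx ∘ₗ Py) := by
  have hw := w
  rw [hp, hq, sheafMap_comp _ _ two_eq] at hw
  have hw1 := sheafMap_injective _ (hw.trans (sheafMap_zero _).symm)
  rw [prodMap_add_left, prodMap_add_right, prodMap_add_right, prodMap_pureMap_pureMap,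
    prodMap_pureMap_pureMap, prodMap_pureMap_pureMap, prodMap_pureMap_pureMap,
    mulG_comm two_eq two_eq (coord (lineIncl d) (Sum.inr 1)) (coord (lineIncl d) (Sum.inr 0))] at hw1
  obtain ⟨h0, h1, h2⟩ := pureMap_sq_eq_zero (d := d) (g := Qx ∘ₗ Px) (g' := Qx ∘ₗ Py + Qy ∘ₗ Px)
    (g'' := Qy ∘ₗ Py) (by
      refine Eq.trans ?_ hw1
      simp only [pureMap, LinearMap.comp_add]
      abel)
  refine ⟨h0, h2, h1, ?_⟩
  rw [← LinearMap.ker_eq_bot, LinearMap.ker_eq_bot']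
  intro v hv
  have hv' : Qy (Px v) = 0 := by
    have := LinearMap.congr_fun h1 v
    rw [LinearMap.add_apply, hv, zero_add] at this
    exact this
  let S := ShortComplex.mk p q w
  let gv : ℂ →ₗ[ℂ] V := LinearMap.toSpanSingleton ℂ V v
  have hgv : ∀ g : V →ₗ[ℂ] V, g v = 0 → g ∘ₗ gv = 0 := fun g hg => by
    ext
    simp [gv, hg]
  -- the vectors `Px v` and `Py v` define maps to the middle term killed by `q`
  have hu : ∀ g : V →ₗ[ℂ] A, Qx (g v) = 0 → Qy (g v) = 0 →
      linMap 0 (g ∘ₗ gv) ≫ q = 0 := by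
    intro g hx hy
    rw [hq, linMap_comp_sheafMap, LinearMap.add_comp]
    have : ∀ (Q : A →ₗ[ℂ] V) (t : H0 (lineIncl d) 1), Q (g v) = 0 → pureMap Q t ∘ₗ g ∘ₗ gv = 0 := by
      intro Q t hQ
      ext
      simp [pureMap, gv, hQ]
    rw [this _ _ hx, this _ _ hy, add_zero, sheafMap_zero]
  have hux := hu Px (LinearMap.congr_fun h0 v) hv'
  have huy := hu Py hv (LinearMap.congr_fun h2 v)
  obtain ⟨ex, hex⟩ := exists_linMap_line (S.liftCycles _ hux ≫ S.homologyπ ≫ φ.hom)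
  obtain ⟨ey, hey⟩ := exists_linMap_line (S.liftCycles _ huy ≫ S.homologyπ ≫ φ.hom)
  have hpv : mulT ℂ (neg_add_cancel 1) (coord (lineIncl d) (Sum.inr 0)) ≫ linMap 0 (Px ∘ₗ gv) +
      mulT ℂ (neg_add_cancel 1) (coord (lineIncl d) (Sum.inr 1)) ≫ linMap 0 (Py ∘ₗ gv) =
      linMap (-1) gv ≫ p := by
    rw [hp, linMap_comp_sheafMap, mulT, mulT, sheafMap_comp_linMap, sheafMap_comp_linMap,
      ← sheafMap_add]
    congr 1
  have hexy : pureMap ex (coord (lineIncl d) (Sum.inr 0)) +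
      pureMap ey (coord (lineIncl d) (Sum.inr 1)) = 0 := by
    refine sheafMap_injective (neg_add_cancel 1) ?_
    rw [sheafMap_zero, sheafMap_add]
    have e : ∀ (g : ℂ →ₗ[ℂ] W) (t : H0 (lineIncl d) 1), sheafMap (neg_add_cancel 1) (pureMap g t) =
        mulT ℂ (neg_add_cancel 1) t ≫ linMap 0 g := by
      intro g t
      rw [mulT, sheafMap_comp_linMap]
      congr 1
    rw [e, e, ← hex, ← hey, ← Category.assoc, ← Category.assoc, ← Category.assoc, ← Category.assoc,
      ← Preadditive.add_comp, ← Preadditive.add_comp]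
    have : mulT ℂ (neg_add_cancel 1) (coord (lineIncl d) (Sum.inr 0)) ≫ S.liftCycles _ hux +
        mulT ℂ (neg_add_cancel 1) (coord (lineIncl d) (Sum.inr 1)) ≫ S.liftCycles _ huy =
        linMap (-1) gv ≫ S.toCycles := by
      rw [← cancel_mono S.iCycles, Preadditive.add_comp, Category.assoc, Category.assoc,
        Category.assoc, S.liftCycles_i, S.liftCycles_i, S.toCycles_i]
      exact hpv
    rw [this, Category.assoc, Category.assoc, S.toCycles_comp_homologyπ_assoc, zero_comp, comp_zero]
  obtain ⟨hx0, hy0⟩ := pureMap_xy_eq_zero hexy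
  have hzero : ∀ (g : V →ₗ[ℂ] A) (hg : linMap 0 (g ∘ₗ gv) ≫ q = 0),
      S.liftCycles _ hg ≫ S.homologyπ ≫ φ.hom = 0 → linMap (f := lineIncl d) 0 (g ∘ₗ gv) = 0 := by
    intro g hg h
    have h' : S.liftCycles _ hg ≫ S.homologyπ = 0 := by
      rw [← cancel_mono φ.hom, Category.assoc, h, zero_comp]
    have hm : Mono S.toCycles := by
      have : Mono (S.toCycles ≫ S.iCycles) := by
        rw [S.toCycles_i]
        infer_instance
      exact mono_of_mono _ S.iCycles
    have hE : (ShortComplex.mk S.toCycles S.homologyπ S.toCycles_comp_homologyπ).Exact :=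
      ShortComplex.exact_of_g_is_cokernel _ S.homologyIsCokernel
    have := hE.lift_f _ h'
    have h0 : hE.lift _ h' = 0 := hom_line_neg_one_eq_zero _
    rw [h0, zero_comp] at this
    have h2 := congrArg (· ≫ S.iCycles) this
    simpa using h2.symm
  have hz : ∀ (e : ℂ →ₗ[ℂ] W), e = 0 → linMap (f := lineIncl d) 0 e = 0 := fun e he => by
    rw [he, linMap, show pureMap (0 : ℂ →ₗ[ℂ] W) (oneSec (lineIncl d)) = 0 from LinearMap.comp_zero _,
      sheafMap_zero]
  rw [hzero Px hux (hex.trans (hz _ hx0)), hzero Py huy (hey.trans (hz _ hy0)), comp_zero, comp_zero,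
    add_zero] at hpv
  have h3 : linMap (f := lineIncl d) (-1) gv = 0 := by
    rw [← cancel_mono p, ← hpv, zero_comp]
  simpa [gv] using LinearMap.congr_fun (linMap_line_injective h3) 1

end line

/-! ### Essential surjectivity -/

section essSurj

variable {d : ℕ} {Y : Scheme.{0}} {i : Y ⟶ PP (Fin (d + 1) ⊕ Fin 2)}
  {V V' V'' : Type} [AddCommGroup V] [Module ℂ V] [FiniteDimensional ℂ V]
  [AddCommGroup V'] [Module ℂ V'] [AddCommGroup V''] [Module ℂ V'']

/-- Over a linearly normal `Y`, a matrix of sections of `𝒪_Y(1)` is a matrix of linear forms in the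
coordinates `z_k`, `x` and `y`. -/
lemma exists_linear_forms (hL : LinNormal i) (P : V →ₗ[ℂ] V' ⊗[ℂ] H0 i 1) :
    ∃ (S : V →ₗ[ℂ] V' ⊗[ℂ] HY i) (Px Py : V →ₗ[ℂ] V'),
      P = inc S + (pureMap Px (coord i (Sum.inr 0)) + pureMap Py (coord i (Sum.inr 1))) := by
  let good : V' ⊗[ℂ] H0 i 1 → Prop := fun z => ∃ (s : V' ⊗[ℂ] HY i) (a b : V'),
    z = LinearMap.lTensor V' (HY i).subtype s +
      (a ⊗ₜ coord i (Sum.inr 0) + b ⊗ₜ coord i (Sum.inr 1))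
  have hz : good 0 := ⟨0, 0, 0, by simp⟩
  have ha : ∀ z z', good z → good z' → good (z + z') := by
    rintro _ _ ⟨s, a, b, rfl⟩ ⟨s', a', b', rfl⟩
    refine ⟨s + s', a + a', b + b', ?_⟩
    rw [map_add, TensorProduct.add_tmul, TensorProduct.add_tmul]
    abel
  have key : ∀ z, good z := by
    intro z
    induction z with
    | zero => exact hz
    | add z z' h h' => exact ha z z' h h'
    | tmul v t =>
      have ht : t ∈ Submodule.span ℂ (Set.range (coord i)) := by
        rw [show Submodule.span ℂ (Set.range (coord i)) = ⊤ from hL]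
        trivial
      induction ht using Submodule.span_induction generalizing v with
      | mem t ht =>
        obtain ⟨c, rfl⟩ := ht
        rcases c with k | c
        · exact ⟨v ⊗ₜ ⟨coord i (Sum.inl k), Submodule.subset_span ⟨k, rfl⟩⟩, 0, 0, by simp⟩
        · have hc : c = 0 ∨ c = 1 := by omega
          rcases hc with rfl | rfl
          · exact ⟨0, v, 0, by simp⟩
          · exact ⟨0, 0, v, by simp⟩
      | zero => rw [TensorProduct.tmul_zero]; exact hz
      | add t t' _ _ h h' => rw [TensorProduct.tmul_add]; exact ha _ _ (h v) (h' v)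
      | smul c t _ h => rw [← TensorProduct.smul_tmul]; exact h (c • v)
  choose s a b h using fun n => key (P (Module.finBasis ℂ V n))
  refine ⟨(Module.finBasis ℂ V).constr ℂ s, (Module.finBasis ℂ V).constr ℂ a,
    (Module.finBasis ℂ V).constr ℂ b, (Module.finBasis ℂ V).ext fun n => ?_⟩
  rw [h]
  simp [inc, pureMap]

omit [FiniteDimensional ℂ V] in
lemma rTensor_linear_forms (S : V →ₗ[ℂ] V' ⊗[ℂ] HY i) (Px Py : V →ₗ[ℂ] V') (s t : H0 i 1)
    (g : V' →ₗ[ℂ] V'') :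
    LinearMap.rTensor (H0 i 1) g ∘ₗ (inc S + (pureMap Px s + pureMap Py t)) =
      inc (LinearMap.rTensor (HY i) g ∘ₗ S) + (pureMap (g ∘ₗ Px) s + pureMap (g ∘ₗ Py) t) := by
  rw [LinearMap.comp_add, rTensor_inc, LinearMap.comp_add]
  rfl

omit [FiniteDimensional ℂ V] in
lemma linear_forms_comp (S : V' →ₗ[ℂ] V'' ⊗[ℂ] HY i) (Px Py : V' →ₗ[ℂ] V'') (s t : H0 i 1)
    (g : V →ₗ[ℂ] V') :
    (inc S + (pureMap Px s + pureMap Py t)) ∘ₗ g =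
      inc (S ∘ₗ g) + (pureMap (Px ∘ₗ g) s + pureMap (Py ∘ₗ g) t) := by
  rw [LinearMap.add_comp, inc_comp, LinearMap.add_comp]
  rfl

/-- The ADHM equation follows from the vanishing of the composition of the maps of the monad. -/
lemma adhm_eq_of_comp {W : Type} [AddCommGroup W] [Module ℂ W] [FiniteDimensional ℂ W]
    {A B A' B' : V →ₗ[ℂ] V ⊗[ℂ] HY i} {I : W →ₗ[ℂ] V ⊗[ℂ] HY i} {J : V →ₗ[ℂ] W ⊗[ℂ] HY i}
    (h : biprod.lift (sheafMap (neg_add_cancel 1) (inc A' + pureMap LinearMap.id (xSec i)))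
      (biprod.lift (sheafMap (neg_add_cancel 1) (inc B' + pureMap LinearMap.id (ySec i)))
        (sheafMap (neg_add_cancel 1) (inc J))) ≫
      biprod.desc (-sheafMap (zero_add 1) (inc B + pureMap LinearMap.id (ySec i)))
        (biprod.desc (sheafMap (zero_add 1) (inc A + pureMap LinearMap.id (xSec i)))
          (sheafMap (zero_add 1) (inc I))) = 0) :
    prodMap two_eq (inc A) (inc B') - prodMap two_eq (inc B) (inc A') +
      prodMap two_eq (inc I) (inc J) +
      prodMap two_eq (inc B' - inc B) (pureMap LinearMap.id (xSec i)) +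
      prodMap two_eq (inc A - inc A') (pureMap LinearMap.id (ySec i)) = 0 := by
  simp only [biprod.lift_desc, sheafMap_comp _ _ two_eq, ← sheafMap_neg, ← sheafMap_add] at h
  have h' := sheafMap_injective _ (h.trans (sheafMap_zero _).symm)
  simp only [prodMap_add_left, prodMap_add_right, prodMap_neg_left] at h'
  rw [ADHM.prodMap_comm_pure (inc A') (ySec i), ADHM.prodMap_comm_pure (inc B') (xSec i),
    ADHM.prodMap_comm_pure (pureMap LinearMap.id (xSec i)) (ySec i)] at h'
  simp only [sub_eq_add_neg, prodMap_add_left, prodMap_neg_left]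
  refine Eq.trans ?_ h'
  abel

variable {W : Type} [AddCommGroup W] [Module ℂ W] [FiniteDimensional ℂ W]
  {A : Type} [AddCommGroup A] [Module ℂ A] [FiniteDimensional ℂ A]

variable (i) in
/-- A decomposition `A = V ⊕ V ⊕ W` induces a decomposition of `A ⊗ 𝒪_Y`. -/
lemma exists_decomposition (Φ : (V × (V × W)) ≃ₗ[ℂ] A) :
    ∃ (π₁ π₂ : A →ₗ[ℂ] V) (π₃ : A →ₗ[ℂ] W) (ι₁ ι₂ : V →ₗ[ℂ] A) (ι₃ : W →ₗ[ℂ] A)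
      (m : tens i A 0 ≅ tens i V 0 ⊞ (tens i V 0 ⊞ tens i W 0)),
      (∀ v v' w, π₁ (Φ (v, v', w)) = v) ∧ (∀ v v' w, π₂ (Φ (v, v', w)) = v') ∧
      (∀ v v' w, π₃ (Φ (v, v', w)) = w) ∧ (∀ v, ι₁ v = Φ (v, 0, 0)) ∧ (∀ v, ι₂ v = Φ (0, v, 0)) ∧
      (∀ w, ι₃ w = Φ (0, 0, w)) ∧
      m.hom = biprod.lift (linMap 0 π₁) (biprod.lift (linMap 0 π₂) (linMap 0 π₃)) ∧
      m.inv = biprod.desc (linMap 0 ι₁) (biprod.desc (linMap 0 ι₂) (linMap 0 ι₃)) := by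
  refine ⟨LinearMap.fst ℂ _ _ ∘ₗ Φ.symm.toLinearMap,
    LinearMap.fst ℂ _ _ ∘ₗ LinearMap.snd ℂ _ _ ∘ₗ Φ.symm.toLinearMap,
    LinearMap.snd ℂ _ _ ∘ₗ LinearMap.snd ℂ _ _ ∘ₗ Φ.symm.toLinearMap,
    Φ.toLinearMap ∘ₗ LinearMap.inl ℂ _ _, Φ.toLinearMap ∘ₗ LinearMap.inr ℂ _ _ ∘ₗ LinearMap.inl ℂ _ _,
    Φ.toLinearMap ∘ₗ LinearMap.inr ℂ _ _ ∘ₗ LinearMap.inr ℂ _ _,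
    linIso 0 Φ.symm ≪≫ tensProd₃ i V W 0, fun _ _ _ => by simp, fun _ _ _ => by simp,
    fun _ _ _ => by simp, fun _ => rfl, fun _ => rfl, fun _ => rfl, ?_, ?_⟩
  · refine biprod.hom_ext _ _ ?_ (biprod.hom_ext _ _ ?_ ?_) <;>
      simp [tensProd₃, linIso, tensProd, linMap_comp, LinearMap.comp_assoc]
  · refine biprod.hom_ext' _ _ ?_ (biprod.hom_ext' _ _ ?_ ?_) <;>
      simp [tensProd₃, linIso, tensProd, linMap_comp, LinearMap.comp_assoc]

omit [FiniteDimensional ℂ V] in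
lemma pureMap_zero (t : H0 i 1) : pureMap (0 : V →ₗ[ℂ] V') t = 0 := LinearMap.comp_zero _

lemma linear_forms_comp_linMap {U : Type} [AddCommGroup U] [Module ℂ U] [FiniteDimensional ℂ U]
    (S : V →ₗ[ℂ] A ⊗[ℂ] HY i) {Px Py : V →ₗ[ℂ] A} {g : A →ₗ[ℂ] U} {gx gy : V →ₗ[ℂ] U}
    (hx : ∀ v, g (Px v) = gx v) (hy : ∀ v, g (Py v) = gy v) :
    sheafMap (neg_add_cancel 1)
      (inc S + (pureMap Px (coord i (Sum.inr 0)) + pureMap Py (coord i (Sum.inr 1)))) ≫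
      linMap 0 g = sheafMap (neg_add_cancel 1) (inc (LinearMap.rTensor (HY i) g ∘ₗ S) +
        (pureMap gx (xSec i) + pureMap gy (ySec i))) := by
  have hx' : g ∘ₗ Px = gx := LinearMap.ext hx
  have hy' : g ∘ₗ Py = gy := LinearMap.ext hy
  rw [sheafMap_comp_linMap, rTensor_linear_forms, hx', hy', xSec, ySec]

lemma linMap_comp_linear_forms {U : Type} [AddCommGroup U] [Module ℂ U] [FiniteDimensional ℂ U]
    (T : A →ₗ[ℂ] V ⊗[ℂ] HY i) {Qx Qy : A →ₗ[ℂ] V} (D : V ≃ₗ[ℂ] V) {g : U →ₗ[ℂ] A}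
    {gx gy : U →ₗ[ℂ] V} (hx : ∀ u, D (Qx (g u)) = gx u) (hy : ∀ u, D (Qy (g u)) = gy u) :
    linMap 0 g ≫ sheafMap (zero_add 1)
      (inc T + (pureMap Qx (coord i (Sum.inr 0)) + pureMap Qy (coord i (Sum.inr 1)))) ≫
      linMap 1 D.toLinearMap = sheafMap (zero_add 1)
        (inc (LinearMap.rTensor (HY i) D.toLinearMap ∘ₗ T ∘ₗ g) +
        (pureMap gx (xSec i) + pureMap gy (ySec i))) := by
  have hx' : (D.toLinearMap ∘ₗ Qx) ∘ₗ g = gx := LinearMap.ext hx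
  have hy' : (D.toLinearMap ∘ₗ Qy) ∘ₗ g = gy := LinearMap.ext hy
  rw [sheafMap_comp_linMap, rTensor_linear_forms, linMap_comp_sheafMap, linear_forms_comp, hx', hy',
    xSec, ySec, LinearMap.comp_assoc]

set_option maxHeartbeats 800000 in
/-- The ADHM datum of a monad whose `x` and `y` parts are in normal form. -/
lemma exists_adhm_of_splitting {S : V →ₗ[ℂ] A ⊗[ℂ] HY i} {Px Py : V →ₗ[ℂ] A}
    {T : A →ₗ[ℂ] V ⊗[ℂ] HY i} {Qx Qy : A →ₗ[ℂ] V}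
    {p : tens i V (-1) ⟶ tens i A 0} {q : tens i A 0 ⟶ tens i V 1} (w : p ≫ q = 0)
    (hP : sheafMap (neg_add_cancel 1)
      (inc S + (pureMap Px (coord i (Sum.inr 0)) + pureMap Py (coord i (Sum.inr 1)))) = p)
    (hQ : sheafMap (zero_add 1)
      (inc T + (pureMap Qx (coord i (Sum.inr 0)) + pureMap Qy (coord i (Sum.inr 1)))) = q)
    (Φ : (V × (V × W)) ≃ₗ[ℂ] A) (D : V ≃ₗ[ℂ] V)
    (hΦx : ∀ v, Φ (v, 0, 0) = Px v) (hΦy : ∀ v, Φ (0, v, 0) = Py v)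
    (hDx : ∀ v v' w, D (Qx (Φ (v, v', w))) = v') (hDy : ∀ v v' w, D (Qy (Φ (v, v', w))) = -v) :
    ∃ M : ADHM i, Nonempty (M.cplx ≅ threeTerm p q w) := by
  obtain ⟨π₁, π₂, π₃, ι₁, ι₂, ι₃, m, h₁, h₂, h₃, k₁, k₂, k₃, hm, hm'⟩ := exists_decomposition i Φ
  have hα : p ≫ m.hom = biprod.lift
      (sheafMap (neg_add_cancel 1) (inc (LinearMap.rTensor (HY i) π₁ ∘ₗ S) +
        pureMap LinearMap.id (xSec i)))
      (biprod.lift (sheafMap (neg_add_cancel 1) (inc (LinearMap.rTensor (HY i) π₂ ∘ₗ S) +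
          pureMap LinearMap.id (ySec i)))
        (sheafMap (neg_add_cancel 1) (inc (LinearMap.rTensor (HY i) π₃ ∘ₗ S)))) := by
    have e₁ := linear_forms_comp_linMap S (g := π₁) (gx := LinearMap.id) (gy := 0)
      (fun v => by rw [← hΦx, h₁]; rfl) (fun v => by rw [← hΦy, h₁]; rfl)
    have e₂ := linear_forms_comp_linMap S (g := π₂) (gx := 0) (gy := LinearMap.id)
      (fun v => by rw [← hΦx, h₂]; rfl) (fun v => by rw [← hΦy, h₂]; rfl)
    have e₃ := linear_forms_comp_linMap S (g := π₃) (gx := 0) (gy := 0)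
      (fun v => by rw [← hΦx, h₃]; rfl) (fun v => by rw [← hΦy, h₃]; rfl)
    rw [hP, pureMap_zero, add_zero] at e₁
    rw [hP, pureMap_zero, zero_add] at e₂
    rw [hP, pureMap_zero, pureMap_zero, add_zero, add_zero] at e₃
    rw [hm, ← e₁, ← e₂, ← e₃]
    refine biprod.hom_ext _ _ ?_ (biprod.hom_ext _ _ ?_ ?_) <;> simp
  have hβ : m.inv ≫ q ≫ linMap 1 D.toLinearMap = biprod.desc
      (-sheafMap (zero_add 1) (inc (-(LinearMap.rTensor (HY i) D.toLinearMap ∘ₗ T ∘ₗ ι₁)) +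
        pureMap LinearMap.id (ySec i)))
      (biprod.desc (sheafMap (zero_add 1) (inc (LinearMap.rTensor (HY i) D.toLinearMap ∘ₗ T ∘ₗ ι₂) +
          pureMap LinearMap.id (xSec i)))
        (sheafMap (zero_add 1) (inc (LinearMap.rTensor (HY i) D.toLinearMap ∘ₗ T ∘ₗ ι₃)))) := by
    have e₁ := linMap_comp_linear_forms T D (g := ι₁) (gx := 0) (gy := -LinearMap.id)
      (fun v => by rw [k₁, hDx]; rfl) (fun v => by rw [k₁, hDy]; rfl)
    have e₂ := linMap_comp_linear_forms T D (g := ι₂) (gx := LinearMap.id) (gy := 0)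
      (fun v => by rw [k₂, hDx]; rfl) (fun v => by rw [k₂, hDy, neg_zero]; rfl)
    have e₃ := linMap_comp_linear_forms T D (g := ι₃) (gx := 0) (gy := 0)
      (fun v => by rw [k₃, hDx]; rfl) (fun v => by rw [k₃, hDy, neg_zero]; rfl)
    rw [hQ, pureMap_zero, zero_add] at e₁
    rw [hQ, pureMap_zero, add_zero] at e₂
    rw [hQ, pureMap_zero, pureMap_zero, add_zero, add_zero] at e₃
    have e₄ : ∀ R : V →ₗ[ℂ] V ⊗[ℂ] HY i, inc R + pureMap (-LinearMap.id) (ySec i) =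
        -(inc (-R) + pureMap LinearMap.id (ySec i)) := fun R => by
      simp only [inc, pureMap, LinearMap.comp_neg]
      abel
    rw [e₄, sheafMap_neg] at e₁
    rw [hm', ← e₁, ← e₂, ← e₃]
    refine biprod.hom_ext' _ _ ?_ (biprod.hom_ext' _ _ ?_ ?_) <;> simp
  let M : ADHM i :=
    { V := V, W := W
      A := LinearMap.rTensor (HY i) D.toLinearMap ∘ₗ T ∘ₗ ι₂
      B := -(LinearMap.rTensor (HY i) D.toLinearMap ∘ₗ T ∘ₗ ι₁)
      A' := LinearMap.rTensor (HY i) π₁ ∘ₗ S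
      B' := LinearMap.rTensor (HY i) π₂ ∘ₗ S
      I := LinearMap.rTensor (HY i) D.toLinearMap ∘ₗ T ∘ₗ ι₃
      J := LinearMap.rTensor (HY i) π₃ ∘ₗ S
      eq := adhm_eq_of_comp (by
        rw [← hα, ← hβ, Category.assoc, Iso.hom_inv_id_assoc, reassoc_of% w, zero_comp]) }
  have hβ' := (Iso.inv_comp_eq _).mp hβ
  exact ⟨M, ⟨(threeTermIso (w := w) (w' := M.α_comp_β) (Iso.refl _) m (linIso 1 D)
    (hα.trans (Category.id_comp _).symm) hβ').symm⟩⟩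

/-- Over a linearly normal `Y`, a monad with trivial restriction to the line is isomorphic to
the monad of an ADHM datum. -/
lemma exists_adhm (hL : LinNormal i) {j : PP (Fin 2) ⟶ Y} (hj : j ≫ i = lineIncl d)
    {p : tens i V (-1) ⟶ tens i A 0} {q : tens i A 0 ⟶ tens i V 1} (w : p ≫ q = 0)
    (ht : IsTrivialSheaf (((Scheme.Modules.pullback j).mapHomologicalComplex
        (ComplexShape.up ℤ)).obj (threeTerm p q w))) :
    ∃ M : ADHM i, Nonempty (M.cplx ≅ threeTerm p q w) := by
  obtain ⟨P, hP⟩ := sheafMap_surjective (neg_add_cancel 1) p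
  obtain ⟨Q, hQ⟩ := sheafMap_surjective (zero_add 1) q
  obtain ⟨S, Px, Py, rfl⟩ := exists_linear_forms hL P
  obtain ⟨T, Qx, Qy, rfl⟩ := exists_linear_forms hL Q
  let F := Scheme.Modules.pullback j
  obtain ⟨hm, -, r, ⟨φ⟩⟩ := (isTrivialSheaf_iff F p q w).mp ht
  -- the restriction of the monad to the line
  let a := restrTens j hj V (-1)
  let b := restrTens j hj A 0
  let c := restrTens j hj V 1
  have hp : F.map p ≫ b.hom = a.hom ≫ sheafMap (neg_add_cancel 1)
      (pureMap Px (coord (lineIncl d) (Sum.inr 0)) + pureMap Py (coord (lineIncl d) (Sum.inr 1))) := by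
    rw [← hP, restrTens_naturality j hj, LinearMap.comp_add, restr_inc j hj rfl, zero_add,
      LinearMap.comp_add, restr_pureMap j hj, restr_pureMap j hj]
  have hq : F.map q ≫ c.hom = b.hom ≫ sheafMap (zero_add 1)
      (pureMap Qx (coord (lineIncl d) (Sum.inr 0)) + pureMap Qy (coord (lineIncl d) (Sum.inr 1))) := by
    rw [← hQ, restrTens_naturality j hj, LinearMap.comp_add, restr_inc j hj rfl, zero_add,
      LinearMap.comp_add, restr_pureMap j hj, restr_pureMap j hj]
  have hp' := (Iso.inv_comp_eq a).mpr hp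
  have hq' := (Iso.inv_comp_eq b).mpr hq
  have hw : (a.inv ≫ F.map p ≫ b.hom) ≫ b.inv ≫ F.map q ≫ c.hom = 0 := by
    simp only [Category.assoc, Iso.hom_inv_id_assoc]
    rw [← Functor.map_comp_assoc, w, F.map_zero, zero_comp, comp_zero]
  obtain ⟨W₀, _, _, _, rfl⟩ : ∃ (W₀ : Type) (_ : AddCommGroup W₀) (_ : Module ℂ W₀)
      (_ : FiniteDimensional ℂ W₀), Module.finrank ℂ W₀ = r :=
    ⟨Fin r → ℂ, inferInstance, inferInstance, inferInstance, by simp⟩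
  obtain ⟨ψ⟩ := exists_twist_zero_iso (lineIncl d)
  have hmono : Mono (a.inv ≫ F.map p ≫ b.hom) := inferInstance
  let e : ShortComplex.mk _ _ hw ≅
      ShortComplex.mk (F.map p) (F.map q) (by rw [← F.map_comp, w, F.map_zero]) :=
    ShortComplex.isoMk a.symm b.symm c.symm (by simp) (by simp)
  obtain ⟨hxx, hyy, hxy, hD⟩ := line_monad hw hp' hq' (W := W₀)
    (ShortComplex.homologyMapIso e ≪≫ φ ≪≫ (biproduct.mapIso fun _ => ψ).symm)
  obtain ⟨W, _, _, _, Φ, D, hΦx, hΦy, hDx, hDy⟩ := exists_splitting hxx hyy hxy hD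
  exact exists_adhm_of_splitting w hP hQ Φ D hΦx hΦy hDx hDy

/-- Over a linearly normal `Y`, every perverse instanton sheaf of trivial splitting type comes
from an ADHM datum. -/
lemma instantonFunctor_essSurj [HasDerivedCategory.{w} Y.Modules] (hL : LinNormal i)
    {j : PP (Fin 2) ⟶ Y} (hj : j ≫ i = lineIncl d) : (instantonFunctor j hj).EssSurj := by
  refine ⟨fun C => ?_⟩
  obtain ⟨c, a, p, q, w, ⟨e⟩, ht⟩ := C.property
  obtain ⟨V, _, _, _, rfl⟩ : ∃ (V : Type) (_ : AddCommGroup V) (_ : Module ℂ V)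
      (_ : FiniteDimensional ℂ V), Module.finrank ℂ V = c :=
    ⟨Fin c → ℂ, inferInstance, inferInstance, inferInstance, by simp⟩
  obtain ⟨A, _, _, _, rfl⟩ : ∃ (A : Type) (_ : AddCommGroup A) (_ : Module ℂ A)
      (_ : FiniteDimensional ℂ A), Module.finrank ℂ A = a :=
    ⟨Fin a → ℂ, inferInstance, inferInstance, inferInstance, by simp⟩
  obtain ⟨M, ⟨φ⟩⟩ := exists_adhm (V := V) (A := A) hL hj w ht
  exact ⟨M, ⟨(PI i j).isoMk (DerivedCategory.Q.mapIso φ ≪≫ e.symm)⟩⟩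

end essSurj


/-! ### Faithfulness and the vanishing of cohomology -/

lemma threeTerm_comm {C : Type*} [Category* C] [Abelian C] {P Q R P' Q' R' : C}
    {p : P ⟶ Q} {q : Q ⟶ R} {w : p ≫ q = 0} {p' : P' ⟶ Q'} {q' : Q' ⟶ R'} {w' : p' ≫ q' = 0}
    (φ : threeTerm p q w ⟶ threeTerm p' q' w') :
    p ≫ (φ.f 0 : Q ⟶ Q') = (φ.f (Int.negSucc 0) : P ⟶ P') ≫ p' ∧
      q ≫ (φ.f 1 : R ⟶ R') = (φ.f 0 : Q ⟶ Q') ≫ q' := by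
  have h := φ.comm (-1) 0
  have h' := φ.comm 0 1
  rw [threeTerm_d_neg_one, threeTerm_d_neg_one] at h
  rw [threeTerm_d_zero, threeTerm_d_zero] at h'
  exact ⟨h.symm, h'.symm⟩

/-- A morphism of three term complexes is given by its components. -/
lemma threeTerm_eta {C : Type*} [Category* C] [Abelian C] {P Q R P' Q' R' : C}
    {p : P ⟶ Q} {q : Q ⟶ R} {w : p ≫ q = 0} {p' : P' ⟶ Q'} {q' : Q' ⟶ R'} {w' : p' ≫ q' = 0}
    (φ : threeTerm p q w ⟶ threeTerm p' q' w') :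
    φ = threeTerm.map (φ.f (Int.negSucc 0) : P ⟶ P') (φ.f 0 : Q ⟶ Q') (φ.f 1 : R ⟶ R')
      (threeTerm_comm φ).1 (threeTerm_comm φ).2 := by
  refine HomologicalComplex.hom_ext _ _ fun n => ?_
  match n with
  | Int.negSucc 0 => rfl
  | Int.negSucc (k + 1) => exact (isZero_zero C).eq_of_src _ _
  | Int.ofNat 0 => rfl
  | Int.ofNat 1 => rfl
  | Int.ofNat (k + 2) => exact (isZero_zero C).eq_of_src _ _

/-- The version of `threeTerm_map_eq_zero` for the equality of two morphisms. -/
lemma threeTerm_eq_of_map_eq {C : Type*} [Category* C] [Abelian C] [HasDerivedCategory.{w} C]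
    {P Q R P' Q' R' : C} {p : P ⟶ Q} {q : Q ⟶ R} {w : p ≫ q = 0} {p' : P' ⟶ Q'} {q' : Q' ⟶ R'}
    {w' : p' ≫ q' = 0} {φ φ' : threeTerm p q w ⟶ threeTerm p' q' w'}
    (hQ : DerivedCategory.Q.map φ = DerivedCategory.Q.map φ')
    (hQP : ∀ f : Q ⟶ P', f = 0) (hRQ : ∀ f : R ⟶ Q', f = 0) (hs : ExtSplit R P') :
    φ.f 0 = φ'.f 0 ∧ φ.f 1 = φ'.f 1 := by
  have h : DerivedCategory.Q.map (φ - φ') = 0 := by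
    rw [Functor.map_sub, hQ, sub_self]
  rw [threeTerm_eta (φ - φ')] at h
  obtain ⟨hb, hc⟩ := threeTerm_map_eq_zero _ _ h hQP hRQ hs
  exact ⟨sub_eq_zero.mp hb, sub_eq_zero.mp hc⟩

section faithful

variable {d : ℕ} {Y : Scheme.{0}} {i : Y ⟶ PP (Fin (d + 1) ⊕ Fin 2)}
  {V A : Type} [AddCommGroup V] [Module ℂ V] [FiniteDimensional ℂ V]
  [AddCommGroup A] [Module ℂ A] [FiniteDimensional ℂ A]

/-- A constant matrix is determined by the morphism of sheaves it induces, as it can be recovered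
on the line. -/
lemma linMap_injective {j : PP (Fin 2) ⟶ Y} (hj : j ≫ i = lineIncl d) {k : ℤ} {g g' : V →ₗ[ℂ] A}
    (h : linMap (f := i) k g = linMap k g') : g = g' := by
  have h1 := sheafMap_injective _ h
  refine (Module.finBasis ℂ V).ext fun b => (Module.finBasis ℂ A).repr.injective
    (Finsupp.ext fun a => ?_)
  have h2 := congrArg (fun T => entry T a b) h1
  simp only [entry_pureMap] at h2
  have h3 := congrArg (fun s => restrH0 j hj 1 (mulG (zero_add (1 : ℤ)) s (coord i (Sum.inr 0)))) h2
  simp only [map_smul, LinearMap.smul_apply, mulG_one_left, restrH0_coord] at h3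
  rw [← sub_eq_zero, ← sub_smul] at h3
  exact sub_eq_zero.mp (linear_independent_xy (d := d) (c₂ := 0) (by rw [h3, zero_smul, add_zero])).1

lemma tens_hom_eq_zero (h : ∀ s : H0 i (-1), s = 0) {k l : ℤ} (e : k + -1 = l) (u : tens i V k ⟶ tens i A l) : u = 0 := by
  obtain ⟨T, rfl⟩ := sheafMap_surjective e u
  have : T = 0 := entry_injective fun a b => (h _).trans (h _).symm
  rw [this, sheafMap_zero]

/-- Faithfulness follows from the vanishing of `Hom(𝒪(1), 𝒪)`, `Hom(𝒪, 𝒪(-1))` and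
`Ext¹(𝒪(1), 𝒪(-1))`. -/
lemma instantonFunctor_faithful (h : ∀ s : H0 i (-1), s = 0) [HasDerivedCategory.{w} Y.Modules]
    {j : PP (Fin 2) ⟶ Y} (hj : j ≫ i = lineIncl d) (hs : ExtSplit (twist i 1) (twist i (-1))) :
    (instantonFunctor j hj).Faithful := by
  refine ⟨fun {M N} p q hpq => ?_⟩
  have h1 : DerivedCategory.Q.map ((complexFunctor i).map p) =
      DerivedCategory.Q.map ((complexFunctor i).map q) := congrArg (PI i j).ι.map hpq
  have hQP : ∀ f : tens i M.V 0 ⊞ (tens i M.V 0 ⊞ tens i M.W 0) ⟶ tens i N.V (-1), f = 0 :=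
    fun f => by
      refine biprod.hom_ext' _ _ ?_ (biprod.hom_ext' _ _ ?_ ?_) <;>
        exact (tens_hom_eq_zero h (zero_add _) _).trans (tens_hom_eq_zero h (zero_add _) _).symm
  have hRQ : ∀ f : tens i M.V 1 ⟶ tens i N.V 0 ⊞ (tens i N.V 0 ⊞ tens i N.W 0), f = 0 :=
    fun f => by
      refine biprod.hom_ext _ _ ?_ (biprod.hom_ext _ _ ?_ ?_) <;>
        exact (tens_hom_eq_zero h (add_neg_cancel _) _).trans
          (tens_hom_eq_zero h (add_neg_cancel _) _).symm
  obtain ⟨hb, hc⟩ := threeTerm_eq_of_map_eq (w := M.α_comp_β) (w' := N.α_comp_β) h1 hQP hRQ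
    ((hs.biproduct_left _).biproduct_right _)
  have hv : p.v = q.v := linMap_injective hj hc
  have hw : p.w = q.w := by
    refine linMap_injective (i := i) hj (k := 0) ?_
    replace hb : biprod.map (linMap 0 p.v) (biprod.map (linMap 0 p.v) (linMap 0 p.w)) =
      biprod.map (linMap 0 q.v) (biprod.map (linMap 0 q.v) (linMap 0 q.w)) := hb
    have := congrArg (fun t => biprod.inr ≫ biprod.inr ≫ t ≫ biprod.snd ≫ biprod.snd) hb
    simpa using this
  exact ADHM.Hom.ext hv hw

end faithful


/-! ### Divisors of homogeneous polynomials -/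

section homogeneousDivisors

variable {τ : Type}

/-- The homomorphism `p ↦ p(TX)` to polynomials in `T`, whose coefficients are the homogeneous
components. -/
def dilate (τ : Type) : MvPolynomial τ ℂ →ₐ[ℂ] Polynomial (MvPolynomial τ ℂ) :=
  MvPolynomial.aeval fun a => Polynomial.C (MvPolynomial.X a) * Polynomial.X

lemma dilate_monomial (s : τ →₀ ℕ) (c : ℂ) : dilate τ (MvPolynomial.monomial s c) =
    Polynomial.monomial s.degree (MvPolynomial.monomial s c) := by
  rw [dilate, MvPolynomial.aeval_monomial, MvPolynomial.monomial_eq, Finsupp.prod, Finsupp.prod,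
    ← Polynomial.C_mul_X_pow_eq_monomial]
  simp only [mul_pow, Finset.prod_mul_distrib, map_mul, map_prod, map_pow]
  rw [Finset.prod_pow_eq_pow_sum, mul_assoc]
  rfl

lemma coeff_dilate (p : MvPolynomial τ ℂ) (m : ℕ) :
    (dilate τ p).coeff m = MvPolynomial.homogeneousComponent m p := by
  induction p using MvPolynomial.induction_on' with
  | monomial s c =>
    rw [dilate_monomial, Polynomial.coeff_monomial, MvPolynomial.homogeneousComponent_of_mem
      (MvPolynomial.isHomogeneous_monomial c rfl)]
    simp only [eq_comm]
  | add p q hp hq => rw [map_add, map_add, Polynomial.coeff_add, hp, hq]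

lemma mem_of_component_eq_zero {p : MvPolynomial τ ℂ} {e : ℕ}
    (h : ∀ m, m ≠ e → MvPolynomial.homogeneousComponent m p = 0) : p ∈ Hom' τ e := by
  refine fun s hs => ?_
  by_contra hne
  have h1 : Finsupp.degree s ≠ e := fun h => hne (by
    rw [← h, Finsupp.degree_eq_weight_one]; rfl)
  have h2 := congrArg (MvPolynomial.coeff s) (h _ h1)
  rw [MvPolynomial.coeff_homogeneousComponent, if_pos rfl] at h2
  exact hs h2

/-- Divisors of homogeneous polynomials are homogeneous. -/
lemma exists_mem_of_mul_mem {p q : MvPolynomial τ ℂ} {N : ℕ} (h : p * q ∈ Hom' τ N)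
    (h0 : p * q ≠ 0) : ∃ e, p ∈ Hom' τ e := by
  have hinj : Function.Injective (dilate τ) := by
    intro r s hrs
    refine MvPolynomial.ext _ _ fun t => ?_
    have h1 := congrArg (fun P => MvPolynomial.coeff t (Polynomial.coeff P t.degree)) hrs
    simpa only [coeff_dilate, MvPolynomial.coeff_homogeneousComponent, if_pos] using h1
  have hp : dilate τ p ≠ 0 := fun h => left_ne_zero_of_mul h0 (hinj (h.trans (map_zero _).symm))
  have hq : dilate τ q ≠ 0 := fun h => right_ne_zero_of_mul h0 (hinj (h.trans (map_zero _).symm))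
  have hpq : dilate τ p * dilate τ q = Polynomial.monomial N (p * q) := by
    rw [← map_mul]
    ext1 m
    rw [coeff_dilate, Polynomial.coeff_monomial, MvPolynomial.homogeneousComponent_of_mem h]
    simp only [eq_comm]
  have h1 := Polynomial.natDegree_mul hp hq
  have h2 := Polynomial.natTrailingDegree_mul hp hq
  rw [hpq, Polynomial.natDegree_monomial_eq _ h0] at h1
  rw [hpq, Polynomial.natTrailingDegree_monomial h0] at h2
  have h3 := Polynomial.natTrailingDegree_le_natDegree (dilate τ p)
  have h4 := Polynomial.natTrailingDegree_le_natDegree (dilate τ q)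
  refine ⟨(dilate τ p).natDegree, mem_of_component_eq_zero fun m hm => ?_⟩
  rw [← coeff_dilate]
  rcases hm.lt_or_gt with hlt | hlt
  · exact Polynomial.coeff_eq_zero_of_lt_natTrailingDegree (by omega)
  · exact Polynomial.coeff_eq_zero_of_natDegree_lt hlt

lemma mem_of_mul_mem {p q : MvPolynomial τ ℂ} {e N : ℕ} (hp : p ∈ Hom' τ e) (hp0 : p ≠ 0)
    (h : p * q ∈ Hom' τ N) : q ∈ Hom' τ (N - e) := by
  refine mem_of_component_eq_zero fun m hm => ?_
  have h1 := component_mul hp (m + e) (p := q)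
  rw [MvPolynomial.homogeneousComponent_of_mem h, if_neg (by omega), if_pos (Nat.le_add_left _ _),
    Nat.add_sub_cancel] at h1
  exact (mul_eq_zero.mp h1.symm).resolve_left hp0

/-- A family of homogeneous polynomials of the same degree, divided by its greatest common
divisor. -/
lemma exists_primitive {σ : Type} [Finite σ] {N : ℕ} {p : σ → MvPolynomial τ ℂ}
    (hp : ∀ a, p a ∈ Hom' τ N) (h0 : ∃ a, p a ≠ 0) :
    ∃ (m : ℕ) (γ : MvPolynomial τ ℂ) (G : σ → MvPolynomial τ ℂ), γ ≠ 0 ∧ (∀ a, p a = γ * G a) ∧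
      (∀ a, G a ∈ Hom' τ m) ∧ ∀ x y, (∀ a, x ∣ G a * y) → x ∣ y := by
  classical
  cases nonempty_fintype σ
  obtain ⟨a₀, ha₀⟩ := h0
  let _ : StrongNormalizationMonoid (MvPolynomial τ ℂ) :=
    UniqueFactorizationMonoid.strongNormalizationMonoid
  let _ : NormalizedGCDMonoid (MvPolynomial τ ℂ) :=
    UniqueFactorizationMonoid.toNormalizedGCDMonoid _
  obtain ⟨G, hG, h1⟩ := Finset.extract_gcd p (s := Finset.univ) ⟨a₀, Finset.mem_univ _⟩
  set γ := Finset.univ.gcd p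
  have e : ∀ a, p a = γ * G a := fun a => hG a (Finset.mem_univ _)
  have hne : γ * G a₀ ≠ 0 := e a₀ ▸ ha₀
  obtain ⟨k, hk⟩ := exists_mem_of_mul_mem (e a₀ ▸ hp a₀) hne
  refine ⟨N - k, γ, G, left_ne_zero_of_mul hne, e, fun a =>
    mem_of_mul_mem hk (left_ne_zero_of_mul hne) (e a ▸ hp a), fun x y h => ?_⟩
  have h2 : x ∣ Finset.univ.gcd fun a => G a * y := Finset.dvd_gcd fun a _ => h a
  have h3 := Finset.gcd_mul_right' (s := Finset.univ) (f := G) y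
  rw [h1, one_mul] at h3
  exact h2.trans h3.dvd

end homogeneousDivisors

/-! ### Morphisms from a projective space to a projective space -/

section isoProj

variable {σ τ : Type} {Y : Scheme.{0}} {f : Y ⟶ PP σ} {g : Y ⟶ PP τ}

/-- Fractions that agree on a nonempty open subset of projective space are equal. -/
lemma mul_eq_of_fr_eq [IsIso g] [Finite τ] [Nonempty τ] {n N M : ℕ} {h p q p' q' : MvPolynomial τ ℂ}
    (hh : h ∈ Hom' τ n) (h0 : h ≠ 0) (hp : p ∈ Hom' τ N) (hq : q ∈ Hom' τ N)
    (hp' : p' ∈ Hom' τ M) (hq' : q' ∈ Hom' τ M) (hU : g ⁻¹ᵁ DP h ≤ g ⁻¹ᵁ DP q)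
    (hU' : g ⁻¹ᵁ DP h ≤ g ⁻¹ᵁ DP q') (e : fr g hp hq hU = fr g hp' hq' hU') :
    p * q' = p' * q := by
  have m1 : p * q' ∈ Hom' τ (N + M) := mem_mul hp hq'
  have m2 : p' * q ∈ Hom' τ (N + M) := mem_cast (mem_mul hp' hq) (add_comm _ _)
  have m3 : q * q' ∈ Hom' τ (N + M) := mem_mul hq hq'
  have h1 : fr g (sub_mem m1 m2) m3 (le_DP_mul hU hU') = 0 := by
    rw [fr_sub m1 m2, sub_eq_zero]
    exact (fr_eq _ _ _ _ _ hU (by ring)).trans (e.trans (fr_eq _ _ _ _ _ _ (by ring)))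
  obtain ⟨K, hK⟩ := exists_pow_mul_mem_idealOf hh (sub_mem m1 m2) m3 (le_DP_mul hU hU') h1
  rw [idealOf_eq_bot, Ideal.mem_bot] at hK
  exact sub_eq_zero.mp ((mul_eq_zero.mp hK).resolve_left (pow_ne_zero _ h0))

/-- Near a point of the chart `X_a ≠ 0`, the functions `X_b / X_a` are fractions with the
same denominator. -/
lemma exists_local_rep [Finite σ] [IsClosedImmersion g] {a : σ} {x : Y} (hx : x ∈ chart f a) :
    ∃ (n : ℕ) (h : MvPolynomial τ ℂ) (hh : h ∈ Hom' τ n) (hU : g ⁻¹ᵁ DP h ≤ chart f a) (k : ℕ)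
      (q : σ → MvPolynomial τ ℂ) (hq : ∀ b, q b ∈ Hom' τ (k * n)), h ≠ 0 ∧ x ∈ g ⁻¹ᵁ DP h ∧
      ∀ b, res hU (ratio f a b) = fr g (hq b) (mem_pow hh k) (le_DP_pow le_rfl k) := by
  obtain ⟨n, h, hh, hxh, hU⟩ := exists_preimage_DP_le (g := g) hx
  -- multiplying `h` by a coordinate makes its degree positive
  obtain ⟨c, hc⟩ := exists_mem_chart g x
  have hle : g ⁻¹ᵁ DP (MvPolynomial.X c * h) ≤ g ⁻¹ᵁ DP h := by
    rw [DP, Proj.basicOpen_mul]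
    exact g.preimage_mono inf_le_right
  have hx' : x ∈ g ⁻¹ᵁ DP (MvPolynomial.X c * h) := by
    rw [DP, Proj.basicOpen_mul]
    exact ⟨hc, hxh⟩
  obtain ⟨k, hk⟩ := exists_uniform fun b => exists_fr_of_large (n := 1 + n) (by omega)
    (mem_mul (X_mem c) hh) rfl (res (hle.trans hU) (ratio f a b))
  choose q hq e using hk k le_rfl
  refine ⟨1 + n, _, mem_mul (X_mem c) hh, hle.trans hU, k, q, hq, ?_, hx', e⟩
  intro h0
  rw [h0, DP, Proj.basicOpen_zero] at hx'
  exact hx'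

lemma nonempty_of_isIso [IsIso g] [Nonempty τ] : Nonempty Y := by
  by_contra hY
  rw [not_nonempty_iff] at hY
  have h : ∀ {U : Y.Opens} (s t : Γ(Y, U)), s = t := fun s t =>
    fun_ext (ι := Empty) (U := Empty.elim) (fun x _ => (hY.false x).elim) (fun e => e.elim)
      fun e => e.elim
  exact one_ne_zero (eq_zero_of_polySec_eq_zero (g := g) one_mem' (TwSec.ext_coef fun _ _ _ _ => h _ _))

/-- If `Y` is a projective space, then the coordinates of any morphism `f` from `Y` to a projective
space are homogeneous polynomials. Near a point, the coordinates of `f` are homogeneous polynomials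
`p_b`; divided by their greatest common divisor, they give the polynomials `G_b`. Any other
local representation `q_b` is proportional to the `p_b`, and hence a multiple of the `G_b`, which
therefore describe `f` everywhere. -/
lemma exists_polynomials [IsIso g] [Finite σ] [Finite τ] [Nonempty τ] (f : Y ⟶ PP σ) :
    ∃ (m : ℕ) (G : σ → MvPolynomial τ ℂ) (hG : ∀ a, G a ∈ Hom' τ m)
      (hc : ∀ a, chart f a = g ⁻¹ᵁ DP (G a)),
      ∀ a b, ratio f a b = fr g (hG b) (hG a) (hc a).le := by
  obtain ⟨x₀⟩ := nonempty_of_isIso (g := g)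
  obtain ⟨a₀, hx₀⟩ := exists_mem_chart f x₀
  obtain ⟨n₀, h₀, hh₀, hU₀, k₀, p, hp, h₀0, -, hr₀⟩ := exists_local_rep (g := g) hx₀
  have hp0 : p a₀ ≠ 0 := by
    have h1 := hr₀ a₀
    rw [ratio, dehom_X_self, map_one, ← fr_self (mem_pow hh₀ k₀) (le_DP_pow le_rfl k₀)] at h1
    have h2 := mul_eq_of_fr_eq hh₀ h₀0 _ _ _ _ _ _ h1
    rw [mul_right_cancel₀ (pow_ne_zero _ h₀0) h2.symm]
    exact pow_ne_zero _ h₀0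
  obtain ⟨m, γ, G, hγ, hpG, hG, hprim⟩ := exists_primitive hp ⟨a₀, hp0⟩
  -- in terms of a local representation, `q_b = G_b r` and `h ^ k = G_a r`
  have key : ∀ {a : σ} {n : ℕ} {h : MvPolynomial τ ℂ} (hh : h ∈ Hom' τ n)
      (hU : g ⁻¹ᵁ DP h ≤ chart f a) {k : ℕ} {q : σ → MvPolynomial τ ℂ}
      (hq : ∀ b, q b ∈ Hom' τ (k * n)) (_ : h ≠ 0) (_ : ∀ b, res hU (ratio f a b) =
        fr g (hq b) (mem_pow hh k) (le_DP_pow le_rfl k)),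
      ∃ r, h ^ k = G a * r ∧ ∀ b, q b = G b * r := by
    intro a n h hh hU k q hq h0 hr
    have hD : g ⁻¹ᵁ DP (h₀ * h) = g ⁻¹ᵁ DP h₀ ⊓ g ⁻¹ᵁ DP h := by
      rw [DP, Proj.basicOpen_mul]
      rfl
    have hl := hD.le.trans inf_le_left
    have hl' := hD.le.trans inf_le_right
    have h1 : ∀ b, G b * h ^ k = G a * q b := by
      intro b
      have e := dehom_eq f a₀ a (X_mem b) (U := g ⁻¹ᵁ DP (h₀ * h)) (hl.trans hU₀) (hl'.trans hU)
      rw [pow_one] at e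
      have e1 := congrArg (res hl) (hr₀ b)
      have e2 := congrArg (res hl) (hr₀ a)
      have e3 := congrArg (res hl') (hr b)
      rw [res_res, res_fr] at e1 e2 e3
      have e4 := (e1.symm.trans (e.trans (congrArg₂ (· * ·) e2 e3))).trans
        (fr_mul _ _ _ _ _ _).symm
      have e5 := mul_eq_of_fr_eq (mem_mul hh₀ hh) (mul_ne_zero h₀0 h0) _ _ _ _ _ _ e4
      rw [hpG, hpG] at e5
      refine mul_left_cancel₀ (mul_ne_zero hγ (pow_ne_zero k₀ h₀0)) ?_
      linear_combination e5
    obtain ⟨r, hr⟩ := hprim (G a) (h ^ k) fun b => ⟨q b, h1 b⟩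
    have hG0 : G a ≠ 0 := fun h2 => pow_ne_zero k h0 (by rw [hr, h2, zero_mul])
    refine ⟨r, hr, fun b => mul_left_cancel₀ hG0 ?_⟩
    rw [← h1 b, hr]
    ring
  have hDP : ∀ r s : MvPolynomial τ ℂ, g ⁻¹ᵁ DP (r * s) = g ⁻¹ᵁ DP r ⊓ g ⁻¹ᵁ DP s := fun r s => by
    rw [DP, Proj.basicOpen_mul]
    rfl
  have hc : ∀ a, chart f a = g ⁻¹ᵁ DP (G a) := by
    refine fun a => le_antisymm (fun x hx => ?_) (fun x hx => ?_)
    · obtain ⟨n, h, hh, hU, k, q, hq, h0, hxh, hr⟩ := exists_local_rep (g := g) hx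
      obtain ⟨r, hr, -⟩ := key hh hU hq h0 hr
      have h1 : x ∈ g ⁻¹ᵁ DP (h ^ k) := g.preimage_mono (DP_le_pow h k) hxh
      rw [hr, hDP] at h1
      exact h1.1
    -- at a point of the chart `X_c ≠ 0` with `G a ≠ 0`, the function `X_a / X_c` is invertible
    · obtain ⟨c, hxc⟩ := exists_mem_chart f x
      obtain ⟨n, h, hh, hU, k, q, hq, h0, hxh, hr⟩ := exists_local_rep (g := g) hxc
      obtain ⟨r, hr1, hr2⟩ := key hh hU hq h0 hr
      have h1 : x ∈ g ⁻¹ᵁ DP (h ^ k) := g.preimage_mono (DP_le_pow h k) hxh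
      rw [hr1, hDP] at h1
      have h2 : x ∈ g ⁻¹ᵁ DP (q a) := by
        rw [hr2, hDP]
        exact ⟨hx, h1.2⟩
      have hV : g ⁻¹ᵁ DP h ⊓ g ⁻¹ᵁ DP (q a) ≤ g ⁻¹ᵁ DP h := inf_le_left
      have e := congrArg (res hV) (hr a)
      rw [res_res, res_fr] at e
      have hunit : IsUnit (res (hV.trans hU) (ratio f c a)) := by
        refine IsUnit.of_mul_eq_one (fr g (mem_pow hh k) (hq a) inf_le_right) ?_
        rw [e, ← fr_mul]
        refine (fr_eq _ _ _ _ _ _ ?_).trans (fr_self (mem_pow hh k) (hV.trans (le_DP_pow le_rfl k)))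
        ring
      have h3 := Y.basicOpen_of_isUnit hunit
      have h4 : x ∈ Y.basicOpen (res (hV.trans hU) (ratio f c a)) := h3.ge ⟨hxh, h2⟩
      have h5 : x ∈ Y.basicOpen (ratio f c a) := by
        rw [Scheme.basicOpen_res] at h4
        exact h4.2
      rw [ratio, basicOpen_dehom] at h5
      exact h5.2
  refine ⟨m, G, hG, hc, fun a b => ?_⟩
  have hloc : ∀ x : chart f a, ∃ V : Y.Opens, ∃ hV : V ≤ chart f a, x.1 ∈ V ∧
      res hV (ratio f a b) = res hV (fr g (hG b) (hG a) (hc a).le) := by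
    intro x
    obtain ⟨n, h, hh, hU, k, q, hq, h0, hxh, hr⟩ := exists_local_rep (g := g) x.2
    obtain ⟨r, hr1, hr2⟩ := key hh hU hq h0 hr
    refine ⟨_, hU, hxh, ?_⟩
    rw [hr, res_fr]
    refine fr_eq _ _ _ _ _ _ ?_
    rw [hr1, hr2]
    ring
  choose V hV hxV e using hloc
  exact fun_ext (fun x hx => Opens.mem_iSup.mpr ⟨⟨x, hx⟩, hxV _⟩) hV e

end isoProj


/-! ### Faithfulness for the projective plane -/

section depth

variable {τ : Type}

lemma reg3_X {a b c : τ} (hab : a ≠ b) (hac : a ≠ c) (hbc : b ≠ c) :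
    Reg3 (MvPolynomial.X a : MvPolynomial τ ℂ) (MvPolynomial.X b) (MvPolynomial.X c) := by
  refine ⟨reg2_X hab, fun u v w h => ?_⟩
  have himg : (MvPolynomial.X '' ({a, b} : Set τ) : Set (MvPolynomial τ ℂ)) =
      {MvPolynomial.X a, MvPolynomial.X b} := Set.image_pair _ _ _
  have h1 : MvPolynomial.X c * u ∈ Ideal.span (MvPolynomial.X '' ({a, b} : Set τ)) := by
    rw [himg, Ideal.mem_span_pair]
    exact ⟨v, w, by rw [h]; ring⟩
  have h2 : u ∈ Ideal.span (MvPolynomial.X '' ({a, b} : Set τ)) := by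
    rw [MvPolynomial.mem_ideal_span_X_image] at h1 ⊢
    intro m hm
    obtain ⟨e, he, hme⟩ := h1 (Finsupp.single c 1 + m) (by
      rw [MvPolynomial.mem_support_iff] at hm ⊢
      rwa [MvPolynomial.coeff_X_mul])
    refine ⟨e, he, ?_⟩
    have hce : c ≠ e := by
      rcases he with rfl | rfl
      · exact hac.symm
      · exact hbc.symm
    rwa [Finsupp.add_apply, Finsupp.single_eq_of_ne' hce, zero_add] at hme
  rw [himg, Ideal.mem_span_pair] at h2
  obtain ⟨v', w', h3⟩ := h2
  exact ⟨v', w', by rw [← h3]; ring⟩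

lemma depthThree_bot {a b c : τ} (hab : a ≠ b) (hac : a ≠ c) (hbc : b ≠ c) :
    DepthThree (⊥ : Ideal (MvPolynomial τ ℂ)) :=
  ⟨MvPolynomial τ ℂ, inferInstance, RingHom.id _, fun p => by simp,
    fun z => ⟨1, z, by simp, by simp⟩, MvPolynomial.X a, MvPolynomial.X b, MvPolynomial.X c,
    Ideal.subset_span ⟨a, rfl⟩, Ideal.subset_span ⟨b, rfl⟩, Ideal.subset_span ⟨c, rfl⟩,
    reg3_X hab hac hbc⟩

end depth

section isoProj

variable {σ τ : Type} {Y : Scheme.{0}} {f : Y ⟶ PP σ} {g : Y ⟶ PP τ}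

/-- On a projective space of positive dimension, no coordinate is nowhere zero. -/
lemma chart_ne_top [IsIso g] [Finite τ] {a b : τ} (hab : a ≠ b) : chart g a ≠ ⊤ := by
  intro h
  have : Nonempty τ := ⟨a⟩
  have hle : g ⁻¹ᵁ DP (MvPolynomial.X b) ≤ g ⁻¹ᵁ DP (MvPolynomial.X a) := le_top.trans h.ge
  obtain ⟨k, hk⟩ := exists_fr_of_large one_pos (X_mem b) rfl (fr g (X_mem b) (X_mem a) hle)
  obtain ⟨p, hp, e⟩ := hk k le_rfl
  have h1 := mul_eq_of_fr_eq (X_mem b) (MvPolynomial.X_ne_zero b) _ _ _ _ _ _ e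
  have h2 : (MvPolynomial.X a : MvPolynomial τ ℂ) ∣ MvPolynomial.X b ^ (k + 1) :=
    ⟨p, by rw [pow_succ', h1, mul_comm]⟩
  exact hab (by simpa using (MvPolynomial.X_prime (R := ℂ) (i := a)).dvd_of_dvd_pow h2)

/-- If `Y` is a projective space of positive dimension embedded so as to contain a line, then
this embedding is given by forms of positive degree. -/
lemma exists_model {d : ℕ} {Y : Scheme.{0}} {i : Y ⟶ PP (Fin (d + 1) ⊕ Fin 2)} {g : Y ⟶ PP τ}
    [IsIso g] [Finite τ] [Nonempty τ] {j : PP (Fin 2) ⟶ Y} (hj : j ≫ i = lineIncl d) :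
    ∃ (m : ℕ) (G : Fin (d + 1) ⊕ Fin 2 → MvPolynomial τ ℂ), Model i g m G := by
  obtain ⟨m, G, hG, hc, hr⟩ := exists_polynomials (g := g) i
  refine ⟨m, G, ?_, hG, hc, hr⟩
  rw [Nat.pos_iff_ne_zero]
  rintro rfl
  -- the coordinates would be constants, so that the charts would be empty or the whole space
  obtain ⟨x⟩ := nonempty_of_isIso (g := 𝟙 (PP (Fin 2)))
  obtain ⟨c, hx⟩ : ∃ c : Fin 2, x ∈ chart (lineIncl d) (Sum.inr c) :=
    Opens.mem_iSup.mp (iSup_chart_lineIncl trivial)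
  obtain ⟨b, hb⟩ := exists_ne c
  have h1 : chart (lineIncl d) (Sum.inr c) = chart (𝟙 (PP (Fin 2))) c :=
    congrArg DP (killZ_X_inr c)
  have h2 : chart (lineIncl d) (Sum.inr c) = j ⁻¹ᵁ chart i (Sum.inr c) := by
    rw [← hj]
    rfl
  refine chart_ne_top (g := 𝟙 (PP (Fin 2))) hb.symm (h1.symm.trans (h2.trans ?_))
  have h3 := MvPolynomial.totalDegree_eq_zero_iff_eq_C.mp
    (Nat.le_zero.mp (MvPolynomial.IsHomogeneous.totalDegree_le (hG (Sum.inr c))))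
  have h4 : DP (G (Sum.inr c)) = ⊤ := by
    by_cases h0 : MvPolynomial.coeff 0 (G (Sum.inr c)) = 0
    · rw [h2, hc, h3, h0, map_zero, DP, Proj.basicOpen_zero] at hx
      exact hx.elim
    · rw [eq_top_iff, ← Proj.basicOpen_one, ← map_one MvPolynomial.C, ← mul_inv_cancel₀ h0,
        map_mul, ← h3, Proj.basicOpen_mul]
      exact inf_le_left
  rw [hc, h4]
  rfl

end isoProj

section faithful

variable {d : ℕ} {Y : Scheme.{0}} {i : Y ⟶ PP (Fin (d + 1) ⊕ Fin 2)}
  [HasDerivedCategory.{w} Y.Modules] {j : PP (Fin 2) ⟶ Y} (hj : j ≫ i = lineIncl d)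

/-- If the cone over `Y` in some embedding has depth at least three at the vertex, then the
functor is faithful. -/
lemma Model.instantonFunctor_faithful {τ : Type} [Finite τ] {g : Y ⟶ PP τ} [IsClosedImmersion g]
    {m : ℕ} {G : Fin (d + 1) ⊕ Fin 2 → MvPolynomial τ ℂ} (M : Model i g m G)
    (h3 : DepthThree (idealOf g)) : (instantonFunctor j hj).Faithful :=
  PerverseInstanton.instantonFunctor_faithful (M.H0_neg_one_eq_zero h3.depthTwo) hj (M.extSplit h3)

lemma instantonFunctor_faithful_of_iso (e : Y ≅ PP (Fin 3)) : (instantonFunctor j hj).Faithful := by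
  obtain ⟨m, G, M⟩ := exists_model (g := e.hom) hj
  refine M.instantonFunctor_faithful hj ?_
  rw [idealOf_eq_bot]
  exact depthThree_bot (a := 0) (b := 1) (c := 2) (by decide) (by decide) (by decide)

end faithful


/-! ### Faithfulness for arithmetically Cohen–Macaulay schemes -/

section regularSequences

lemma Reg3.of_isWeaklyRegular {R : Type*} [CommRing R] {a b c : R} {l : List R}
    (h : RingTheory.Sequence.IsWeaklyRegular R (a :: b :: c :: l)) : Reg3 a b c := by
  have key : ∀ (s : List R) (r u : R), IsSMulRegular (R ⧸ (Ideal.ofList s • ⊤ : Submodule R R)) r →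
      r * u ∈ Ideal.ofList s → u ∈ Ideal.ofList s := by
    intro s r u h hu
    rw [isSMulRegular_quotient_iff_mem_of_smul_mem, smul_eq_mul, Ideal.mul_top] at h
    exact h u hu
  have h0 := fun u => key [] a u (h.regular_mod_prev 0 (by simp))
  have h1 := fun u => key [a] b u (h.regular_mod_prev 1 (by simp))
  have h2 := fun u => key [a, b] c u (h.regular_mod_prev 2 (by simp))
  simp only [Ideal.ofList_nil, Ideal.mem_bot, Ideal.ofList_singleton, Ideal.mem_span_singleton]
    at h0 h1
  have e : Ideal.ofList [a, b] = Ideal.span {a, b} := by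
    rw [Ideal.ofList_cons, Ideal.ofList_singleton, ← Ideal.span_union]
    rfl
  simp only [e, Ideal.mem_span_pair] at h2
  refine ⟨⟨h0, fun u v h => h1 u ⟨v, h⟩⟩, fun u v w h => ?_⟩
  obtain ⟨v', w', h3⟩ := h2 u ⟨v, w, by rw [h]; ring⟩
  exact ⟨v', w', by rw [← h3]; ring⟩

lemma exists_eq_cons_of_le_length {R : Type*} {rs : List R} (h : 3 ≤ rs.length) :
    ∃ a b c l, rs = a :: b :: c :: l := by
  match rs, h with
  | a :: b :: c :: l, _ => exact ⟨a, b, c, l, rfl⟩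

end regularSequences

section vertex

variable {τ : Type} {Y : Scheme.{0}} {g : Y ⟶ PP τ}

/-- The homogeneous prime ideal of a point of `Y`. -/
def primeOf (g : Y ⟶ PP τ) (y : Y) : Ideal (MvPolynomial τ ℂ) :=
  HomogeneousIdeal.toIdeal (ProjectiveSpectrum.asHomogeneousIdeal (g y))

instance (y : Y) : (primeOf g y).IsPrime := ProjectiveSpectrum.isPrime (g y)

lemma idealOf_le_primeOf (y : Y) : idealOf g ≤ primeOf g y := by
  rw [idealOf, Ideal.span_le]
  rintro p ⟨m, hp, h⟩
  by_contra hy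
  obtain ⟨a, ha⟩ := exists_mem_chart g y
  have h1 : y ∈ Y.basicOpen (dehom g a hp) := by
    rw [basicOpen_dehom]
    exact ⟨ha, hy⟩
  rw [(polySec_eq_zero_iff hp).mp h a, Scheme.basicOpen_zero] at h1
  exact h1

lemma primeOf_le_ker (y : Y) : primeOf g y ≤ RingHom.ker MvPolynomial.constantCoeff := by
  intro p hp
  have h1 := (ProjectiveSpectrum.asHomogeneousIdeal (g y)).isHomogeneous 0 hp
  have h2 : MvPolynomial.C (MvPolynomial.coeff 0 p) ∈ primeOf g y := by
    rw [← MvPolynomial.homogeneousComponent_zero]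
    exact (congrArg (· ∈ primeOf g y) (MvPolynomial.decomposition.decompose'_apply p 0)).mp h1
  by_contra h0
  exact Ideal.IsPrime.ne_top inferInstance (Ideal.eq_top_of_isUnit_mem _ h2
    ((IsUnit.mk0 _ h0).map MvPolynomial.C))

/-- The specialization order on `Y` is the inclusion of homogeneous prime ideals. -/
lemma primeOf_le_iff {y y' : Y} : primeOf g y' ≤ primeOf g y ↔ g y' ⤳ g y := by
  rw [specializes_iff_mem_closure]
  exact ProjectiveSpectrum.le_iff_mem_closure _ (g y') (g y)

variable (g) in
/-- The value at the vertex of the cone over `Y`. -/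
def vertexEval [Nonempty Y] : MvPolynomial τ ℂ ⧸ idealOf g →+* ℂ :=
  Ideal.Quotient.lift _ MvPolynomial.constantCoeff fun _ hp =>
    primeOf_le_ker (Classical.arbitrary Y) (idealOf_le_primeOf _ hp)

lemma vertexEval_mk [Nonempty Y] (p : MvPolynomial τ ℂ) :
    vertexEval g (Ideal.Quotient.mk _ p) = p.coeff 0 := rfl

variable (g) in
/-- The ideal of the vertex of the cone over `Y`. -/
def vertexIdeal [Nonempty Y] : Ideal (MvPolynomial τ ℂ ⧸ idealOf g) := RingHom.ker (vertexEval g)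

instance [Nonempty Y] : (vertexIdeal g).IsMaximal :=
  RingHom.ker_isMaximal_of_surjective _ fun c => ⟨Ideal.Quotient.mk _ (MvPolynomial.C c), by
    rw [vertexEval_mk, MvPolynomial.coeff_zero_C]⟩

lemma vertexIdeal_le [Nonempty Y] : vertexIdeal g ≤
    Ideal.span (Set.range fun c => Ideal.Quotient.mk (idealOf g) (MvPolynomial.X c)) := by
  intro z hz
  obtain ⟨p, rfl⟩ := Ideal.Quotient.mk_surjective z
  have h1 : p ∈ Ideal.span (MvPolynomial.X '' (Set.univ : Set τ)) := by
    rw [MvPolynomial.mem_ideal_span_X_image]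
    intro m hm
    by_contra! h
    have h0 : m = 0 := Finsupp.ext fun c => h c trivial
    rw [MvPolynomial.mem_support_iff, h0] at hm
    exact hm hz
  have h2 := Ideal.mem_map_of_mem (Ideal.Quotient.mk (idealOf g)) h1
  rw [Ideal.map_span, Set.image_univ, ← Set.range_comp] at h2
  exact h2

/-- The dimension of `Y` is at most that of its cone at the vertex: the homogeneous prime ideals
of the irreducible closed subsets of `Y` are contained in the ideal of the vertex. -/
lemma topologicalKrullDim_le [Nonempty Y] [IsClosedImmersion g] :
    topologicalKrullDim Y ≤ ringKrullDim (Localization.AtPrime (vertexIdeal g)) := by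
  let y : IrreducibleCloseds Y → Y := fun Z => Z.isIrreducible.genericPoint
  have hy : ∀ Z, IsGenericPoint (y Z) (Z : Set Y) := fun Z =>
    Z.isIrreducible.isGenericPoint_genericPoint Z.isClosed
  let q : Y → PrimeSpectrum (MvPolynomial τ ℂ ⧸ idealOf g) := fun z =>
    ⟨(primeOf g z).map (Ideal.Quotient.mk _), Ideal.map_isPrime_of_surjective
      Ideal.Quotient.mk_surjective (by rw [Ideal.mk_ker]; exact idealOf_le_primeOf z)⟩
  have hq : ∀ z p, Ideal.Quotient.mk (idealOf g) p ∈ (q z).asIdeal ↔ p ∈ primeOf g z := by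
    intro z p
    rw [← Ideal.mem_comap, Ideal.comap_map_of_surjective' _ Ideal.Quotient.mk_surjective,
      Ideal.mk_ker, sup_eq_left.mpr (idealOf_le_primeOf z)]
  have hqle : ∀ z z', q z' ≤ q z ↔ z' ⤳ z := by
    intro z z'
    rw [← g.isClosedEmbedding.isInducing.specializes_iff, ← primeOf_le_iff]
    refine ⟨fun h p hp => (hq z p).mp (h ((hq z' p).mpr hp)), fun h => ?_⟩
    exact Ideal.map_mono h
  let Φ : (IrreducibleCloseds Y)ᵒᵈ →
      Set.Iic (⟨vertexIdeal g, inferInstance⟩ : PrimeSpectrum (MvPolynomial τ ℂ ⧸ idealOf g)) :=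
    fun Z => ⟨q (y (OrderDual.ofDual Z)), by
      refine Ideal.map_le_of_le_comap fun p hp => ?_
      exact primeOf_le_ker _ hp⟩
  have hΦ : ∀ Z Z', Φ Z ≤ Φ Z' ↔ Z ≤ Z' := by
    intro Z Z'
    refine (hqle _ _).trans ?_
    rw [(hy _).specializes_iff_mem, (hy _).mem_closed_set_iff (OrderDual.ofDual Z).isClosed]
    rfl
  rw [topologicalKrullDim, ← Order.krullDim_orderDual, ringKrullDim,
    Order.krullDim_eq_of_orderIso (IsLocalization.AtPrime.primeSpectrumOrderIso
      (Localization.AtPrime (vertexIdeal g)) (vertexIdeal g))]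
  exact Order.krullDim_le_of_strictMono Φ (strictMono_of_le_iff_le fun Z Z' => (hΦ Z Z').symm)

/-- The ideal of `Y` is homogeneous, so it is closed under division by polynomials not vanishing
at the vertex. -/
lemma mem_idealOf_of_mul_mem {s p : MvPolynomial τ ℂ} (hs : s.coeff 0 ≠ 0)
    (h : s * p ∈ idealOf g) : p ∈ idealOf g := by
  rcases subsingleton_or_nontrivial (MvPolynomial τ ℂ ⧸ idealOf g) with hA | hA
  · exact Ideal.Quotient.eq_zero_iff_mem.mp (Subsingleton.elim _ _)
  let θ : MvPolynomial τ ℂ →+* Polynomial (MvPolynomial τ ℂ ⧸ idealOf g) :=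
    (Polynomial.mapRingHom (Ideal.Quotient.mk (idealOf g))).comp (dilate τ).toRingHom
  have hθ : ∀ r m, (θ r).coeff m =
      Ideal.Quotient.mk (idealOf g) (MvPolynomial.homogeneousComponent m r) := fun r m => by
    rw [← coeff_dilate]
    exact Polynomial.coeff_map _ _
  have h1 : θ s * θ p = 0 := by
    rw [← map_mul]
    ext1 m
    rw [hθ, Polynomial.coeff_zero, Ideal.Quotient.eq_zero_iff_mem]
    exact component_mem_idealOf h m
  have hu : IsUnit ((θ s).coeff 0) := by
    rw [hθ, MvPolynomial.homogeneousComponent_zero]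
    exact ((IsUnit.mk0 _ hs).map MvPolynomial.C).map (Ideal.Quotient.mk (idealOf g))
  have h2 : (θ s).trailingCoeff = (θ s).coeff 0 := by
    rw [Polynomial.trailingCoeff, Polynomial.natTrailingDegree_eq_zero_of_constantCoeff_ne_zero]
    exact hu.ne_zero
  have h3 : θ p = 0 := (mem_nonZeroDivisors_iff.mp
    (Polynomial.mem_nonZeroDivisors_of_trailingCoeff (h2 ▸ hu.mem_nonZeroDivisors))).1 _ h1
  rw [← MvPolynomial.sum_homogeneousComponent p]
  refine sum_mem fun m _ => ?_
  rw [← Ideal.Quotient.eq_zero_iff_mem, ← hθ, h3, Polynomial.coeff_zero]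

variable (g) in
/-- The homomorphism from polynomials to the local ring of the cone over `Y` at its vertex. -/
def coneHom [Nonempty Y] : MvPolynomial τ ℂ →+* Localization.AtPrime (vertexIdeal g) :=
  (algebraMap _ _).comp (Ideal.Quotient.mk (idealOf g))

lemma coneHom_eq_zero_iff [Nonempty Y] (p : MvPolynomial τ ℂ) :
    coneHom g p = 0 ↔ p ∈ idealOf g := by
  rw [← Ideal.Quotient.eq_zero_iff_mem]
  refine ⟨fun hp => ?_, fun hp => by rw [coneHom, RingHom.comp_apply, hp, map_zero]⟩
  rw [coneHom, RingHom.comp_apply,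
    IsLocalization.map_eq_zero_iff (vertexIdeal g).primeCompl] at hp
  obtain ⟨⟨s, hs⟩, h1⟩ := hp
  obtain ⟨s, rfl⟩ := Ideal.Quotient.mk_surjective s
  rw [← map_mul, Ideal.Quotient.eq_zero_iff_mem] at h1
  exact Ideal.Quotient.eq_zero_iff_mem.mpr (mem_idealOf_of_mul_mem hs h1)

lemma exists_coneHom_mul_eq [Nonempty Y] (z : Localization.AtPrime (vertexIdeal g)) :
    ∃ s u : MvPolynomial τ ℂ, s.coeff 0 ≠ 0 ∧ coneHom g s * z = coneHom g u := by
  obtain ⟨⟨u, ⟨s, hs⟩⟩, h1⟩ := IsLocalization.surj (vertexIdeal g).primeCompl z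
  obtain ⟨s, rfl⟩ := Ideal.Quotient.mk_surjective s
  obtain ⟨u, rfl⟩ := Ideal.Quotient.mk_surjective u
  exact ⟨s, u, hs, (mul_comm _ _).trans h1⟩

lemma maximalIdeal_le_span [Nonempty Y] :
    IsLocalRing.maximalIdeal (Localization.AtPrime (vertexIdeal g)) ≤
      Ideal.span (Set.range fun c => coneHom g (MvPolynomial.X c)) := by
  rw [← Localization.AtPrime.map_eq_maximalIdeal]
  refine (Ideal.map_mono vertexIdeal_le).trans ?_
  rw [Ideal.map_span, ← Set.range_comp]
  exact le_rfl

/-- The cone over an arithmetically Cohen–Macaulay scheme of dimension at least three has depth at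
least three at its vertex. -/
lemma depthThree_of_isACM [Nonempty Y] [IsClosedImmersion g] (h : IsACM g)
    (hdim : 3 ≤ topologicalKrullDim Y) : DepthThree (idealOf g) := by
  obtain ⟨rs, hmem, hreg, hlen⟩ := h.2 (vertexIdeal g)
  have h3 : (3 : WithBot ℕ∞) ≤ ((rs.length : ℕ) : WithBot ℕ∞) := by
    rw [hlen]
    exact hdim.trans topologicalKrullDim_le
  have h3' : 3 ≤ rs.length := by exact_mod_cast h3
  obtain ⟨a, b, c, l, rfl⟩ := exists_eq_cons_of_le_length h3'
  refine ⟨Localization.AtPrime (vertexIdeal g), inferInstance, coneHom g, coneHom_eq_zero_iff, exists_coneHom_mul_eq, a, b, c,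
    maximalIdeal_le_span (hmem a (by simp)), maximalIdeal_le_span (hmem b (by simp)),
    maximalIdeal_le_span (hmem c (by simp)), Reg3.of_isWeaklyRegular hreg.toIsWeaklyRegular⟩

end vertex

section faithful

lemma model_self {σ : Type} {Y : Scheme.{0}} (f : Y ⟶ PP σ) : Model f f 1 MvPolynomial.X where
  pos := one_pos
  mem a := X_mem a
  chart_eq a := rfl
  ratio_eq a b := (dehom_eq_fr a (X_mem b)).trans (fr_eq _ _ _ _ _ _ (by rw [pow_one]))

lemma instantonFunctor_faithful_of_isACM {d : ℕ} {Y : Scheme.{0}}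
    {i : Y ⟶ PP (Fin (d + 1) ⊕ Fin 2)} [IsClosedImmersion i] [HasDerivedCategory.{w} Y.Modules]
    {j : PP (Fin 2) ⟶ Y} (hj : j ≫ i = lineIncl d) (h : IsACM i)
    (hdim : 3 ≤ topologicalKrullDim Y) : (instantonFunctor j hj).Faithful := by
  have : Nonempty Y := (nonempty_of_isIso (g := 𝟙 (PP (Fin 2)))).map j
  exact (model_self i).instantonFunctor_faithful hj (depthThree_of_isACM h hdim)

end faithful

end PerverseInstanton

end

theorem theorem5p8 (d : ℕ) (Y : Scheme.{0}) (i : Y ⟶ PP (Fin (d + 1) ⊕ Fin 2))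
    [IsClosedImmersion i] (j : PP (Fin 2) ⟶ Y) (hj : j ≫ i = lineIncl d)
    [HasDerivedCategory.{w} Y.Modules] :
    ∃ F : ADHM i ⥤ (PI i j).FullSubcategory,
      F ⋙ (PI i j).ι = complexFunctor i ⋙ DerivedCategory.Q ∧
      (PicIsZ Y → LinNormal i → F.EssSurj) ∧
      (Nonempty (Y ≅ PP (Fin 3)) ∨ (IsACM i ∧ 3 ≤ topologicalKrullDim Y) → F.Faithful) := by
  refine ⟨instantonFunctor j hj, instantonFunctor_comp_ι j hj,
    fun _ hL => instantonFunctor_essSurj hL hj, ?_⟩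
  rintro (⟨⟨e⟩⟩ | ⟨h, hdim⟩)
  · exact instantonFunctor_faithful_of_iso hj e
  · exact instantonFunctor_faithful_of_isACM hj h hdim
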